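/- Let $d\ge 1$ and $m$ be integers and let $1<p<\infty$ with $m>d/p$. Write $\langle x\rangle=\sqrt{|x|^2+1}$, $r=|x|$, $\theta=x/|x|$. For $\delta\in\mathbb R$, let $H^{m,p}_\delta$ and $W^{m,p}_\delta$ be the spaces of real-valued functions $f$ on $\mathbb R^d$ with weak derivatives up to order $m$ and finite norm $$\|f\|_{H^{m,p}_\delta}=\sum_{|\alpha|\le m}\|\langle x\rangle^{\delta}D^\alpha f\|_{L^p},\qquad \|f\|_{W^{m,p}_\delta}=\sum_{|\alpha|\le m}\|\langle x\rangle^{\delta+|\alpha|}D^\alpha f\|_{L^p},$$ respectively, and let $H^{s,p}(S^{d-1})$ be the $L^p$-Sobolev space of integer order $s\ge 0$ on the unit sphere. Fix a smooth $\chi:\mathbb R\to\mathbb R$ with $\chi(t)=0$ for $t\le 1$ and $\chi(t)=1$ for $t\ge 2$, and a real $\gamma_0$ with $0<\gamma_0+d/p<1$. For an integer $N\ge 0$ put $\gamma_N=N+\gamma_0$, and let $N^*$ be the integer with $N-1+d/p<N^*\le N+d/p$. For integers $0\le n\le N$, the space $\mathcal A^{m,p}_{n,N}$ consists of the functions (modulo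 null sets) $$u(x)=\chi(r)\sum_{k=0}^{N}\frac{a_k(\theta)}{r^k}+f(x),\qquad a_k\in H^{m+1+N-k,p}(S^{d-1}),\quad f\in W^{m,p}_{\gamma_N},$$ with $a_k=0$ for $k<n$; its norm is $$\|u\|_{\mathcal A^{m,p}_{n,N}}=\sum_{k=0}^{N}\|a_k\|_{H^{m+1+N-k,p}(S^{d-1})}+\|f\|_{W^{m,p}_{\gamma_N}}.$$ The space $\mathbb A^{m,p}_{n,N}$ consists of the functions $$u(x)=\chi(r)\sum_{k=0}^{N^*}\frac{a_k(\theta)}{r^k}+f(x),\qquad a_k\in H^{m+1+N^*-k,p}(S^{d-1}),\quad f\in H^{m,p}_{N},$$ with $a_k=0$ for $k<n$; its norm is $$\|u\|_{\mathbb A^{m,p}_{n,N}}=\sum_{k=0}^{N^*}\|a_k\|_{H^{m+1+N^*-k,p}(S^{d-1})}+\|f\|_{H^{m,p}_N}.$$ (1) Let $0\le n_i\le N_i$ be integers for $i=1,2$, and let $n_0=n_1+n_2$ and $N_0=\min(N_1+n_2,N_2+n_1)$. There is a constant $C$, independent of $u$ and $v$, such that for all $u\in\mathbb A^{m,p}_{n_1,N_1}$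 and $v\in\mathbb A^{m,p}_{n_2,N_2}$ the pointwise product $uv$ lies in $\mathbb A^{m,p}_{n_0,N_0}$ and $$\|uv\|_{\mathbb A^{m,p}_{n_0,N_0}}\le C\,\|u\|_{\mathbb A^{m,p}_{n_1,N_1}}\|v\|_{\mathbb A^{m,p}_{n_2,N_2}}.$$ Likewise there is a constant $C$, independent of $u$ and $v$, such that for all $u\in\mathcal A^{m,p}_{n_1,N_1}$ and $v\in\mathcal A^{m,p}_{n_2,N_2}$ the product $uv$ lies in $\mathcal A^{m,p}_{n_0,N_0}$ and $$\|uv\|_{\mathcal A^{m,p}_{n_0,N_0}}\le C\,\|u\|_{\mathcal A^{m,p}_{n_1,N_1}}\|v\|_{\mathcal A^{m,p}_{n_2,N_2}}.$$ (2) For all integers $0\le n\le N$, the spaces $\mathbb A^{m,p}_{n,N}$ and $\mathcal A^{m,p}_{n,N}$ are Banach algebras under pointwise multiplication: they are vector spaces on which the above is a complete norm, they are closed under products, and $\|uv\|\le C\|u\|\|v\|$ with a constant $C>0$ independent of $u$ and $v$ (so that the equivalent norm $C\|\cdot\|$ is submultiplicative). -/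

import Mathlib

open MeasureTheory Filter Topology
open scoped ContDiff

noncomputable section

namespace AsymptoticSpaces

/-- Euclidean space `ℝ^d`. -/
abbrev E (d : ℕ) : Type := EuclideanSpace ℝ (Fin d)

/-- The unit sphere `S^{d-1}` of `ℝ^d`. -/
abbrev S (d : ℕ) : Type := Metric.sphere (0 : E d) 1

/-- The surface measure of `S^{d-1}` (for `d = 1`: the counting measure on two points). -/
abbrev σ (d : ℕ) : Measure (S d) := (volume : Measure (E d)).toSphere

/-- The classical partial derivative `∂φ/∂x_i`. -/
def pderiv {d : ℕ} (i : Fin d) (φ : E d → ℝ) : E d → ℝ :=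
  fun x => fderiv ℝ φ x (EuclideanSpace.single i 1)

/-- The classical derivative `D^α φ` for a multi-index `α`. -/
def multiDeriv {d : ℕ} (α : Fin d → ℕ) (φ : E d → ℝ) : E d → ℝ :=
  (List.finRange d).foldr (fun i ψ => (pderiv i)^[α i] ψ) φ

/-- `g` is the weak derivative `D^α f` on `ℝ^d`, where `|α| = ∑ i, α i`. -/
def IsWeakDeriv {d : ℕ} (α : Fin d → ℕ) (f g : E d → ℝ) : Prop :=
  LocallyIntegrable f volume ∧ LocallyIntegrable g volume ∧
    ∀ φ : E d → ℝ, ContDiff ℝ ∞ φ → HasCompactSupport φ →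
      ∫ x, f x * multiDeriv α φ x = (-1) ^ (∑ i, α i) * ∫ x, g x * φ x

open Classical in
/-- The weak derivative `D^α f` (unique up to null sets), and `0` if there is none. -/
def weakDeriv {d : ℕ} (α : Fin d → ℕ) (f : E d → ℝ) : E d → ℝ :=
  if h : ∃ g, IsWeakDeriv α f g then h.choose else 0

/-- `⟨x⟩ = √(|x|² + 1)`. -/
def japanese {d : ℕ} (x : E d) : ℝ := √(‖x‖ ^ 2 + 1)

/-- The weighted Sobolev space of functions with weak derivatives up to order `m` such that
`⟨x⟩^{e(|α|)} D^α f ∈ L^p` for all `|α| ≤ m`; here `e` gives the weight for each order. -/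
def MemWeightedSobolev {d : ℕ} (m : ℕ) (p : ℝ) (e : ℕ → ℝ) (f : E d → ℝ) : Prop :=
  ∀ α : Fin d → ℕ, ∑ i, α i ≤ m →
    (∃ g, IsWeakDeriv α f g) ∧
      MemLp (fun x => japanese x ^ e (∑ i, α i) * weakDeriv α f x) (ENNReal.ofReal p) volume

/-- The norm `∑_{|α| ≤ m} ‖⟨x⟩^{e(|α|)} D^α f‖_{L^p}`; the multi-indices are listed by order. -/
def weightedSobolevNorm {d : ℕ} (m : ℕ) (p : ℝ) (e : ℕ → ℝ) (f : E d → ℝ) : ENNReal :=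
  ∑ k ∈ Finset.range (m + 1), ∑ α ∈ Finset.piAntidiag (Finset.univ : Finset (Fin d)) k,
    eLpNorm (fun x => japanese x ^ e k * weakDeriv α f x) (ENNReal.ofReal p) volume

/-- The weights of `W_δ^{m,p}`: exponent `δ + |α|` for `D^α f`. -/
def expW (δ : ℝ) : ℕ → ℝ := fun k => δ + k

/-- The weights of `H_δ^{m,p}`: exponent `δ` for every derivative. -/
def expH (δ : ℝ) : ℕ → ℝ := fun _ => δ

/-- Index set of the coordinate planes, `i < j`. -/
abbrev Plane (d : ℕ) : Type := {q : Fin d × Fin d // q.1 < q.2}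

/-- The rotation field `L_{ij} φ = x_i ∂_j φ - x_j ∂_i φ`. It is tangent to the sphere, so its
values on the sphere depend only on `φ` on the sphere. The fields `L_{ij}` span every tangent
space of the sphere. -/
def rot {d : ℕ} (q : Plane d) (φ : E d → ℝ) : E d → ℝ :=
  fun x => x q.1.1 * pderiv q.1.2 φ x - x q.1.2 * pderiv q.1.1 φ x

/-- Iterated rotation fields: `rotWord [q₁, …, q_k] φ = L_{q_k} ⋯ L_{q₁} φ`. -/
def rotWord {d : ℕ} : List (Plane d) → (E d → ℝ) → E d → ℝ
  | [], φ => φ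
  | q :: w, φ => rotWord w (rot q φ)

/-- `b` is the weak derivative `L_{q₁} ⋯ L_{q_k} a` on the sphere, where `w = [q₁, …, q_k]`.
The `L_q` are divergence free on the sphere, so the formal adjoint of `L_{q₁} ⋯ L_{q_k}` is
`(-1)^k L_{q_k} ⋯ L_{q₁}`. Test functions on the sphere are restrictions of smooth functions. -/
def IsWeakRot {d : ℕ} (w : List (Plane d)) (a b : S d → ℝ) : Prop :=
  Integrable a (σ d) ∧ Integrable b (σ d) ∧
    ∀ φ : E d → ℝ, ContDiff ℝ ∞ φ →
      ∫ θ, a θ * rotWord w φ θ ∂σ d = (-1) ^ w.length * ∫ θ, b θ * φ θ ∂σ d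

open Classical in
/-- The weak derivative `L_{q₁} ⋯ L_{q_k} a`, and `0` if there is none. -/
def weakRot {d : ℕ} (w : List (Plane d)) (a : S d → ℝ) : S d → ℝ :=
  if h : ∃ b, IsWeakRot w a b then h.choose else 0

/-- The Sobolev space `H^{s,p}(S^{d-1})`: all weak derivatives of order at most `s` along the
fields `L_{ij}` (which span all tangential directions) lie in `L^p(S^{d-1})`. -/
def MemSphereSobolev {d : ℕ} (s : ℕ) (p : ℝ) (a : S d → ℝ) : Prop :=
  ∀ k ≤ s, ∀ w : Fin k → Plane d,
    (∃ b, IsWeakRot (List.ofFn w) a b) ∧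
      MemLp (weakRot (List.ofFn w) a) (ENNReal.ofReal p) (σ d)

/-- The norm of `H^{s,p}(S^{d-1})`. -/
def sphereSobolevNorm {d : ℕ} (s : ℕ) (p : ℝ) (a : S d → ℝ) : ENNReal :=
  ∑ k ∈ Finset.range (s + 1), ∑ w : Fin k → Plane d,
    eLpNorm (weakRot (List.ofFn w) a) (ENNReal.ofReal p) (σ d)

/-- `χ` is smooth, `χ = 0` on `(-∞, 1]` and `χ = 1` on `[2, ∞)`. -/
structure IsCutoff (χ : ℝ → ℝ) : Prop where
  smooth : ContDiff ℝ ∞ χ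
  eq_zero : ∀ t ≤ 1, χ t = 0
  eq_one : ∀ t, 2 ≤ t → χ t = 1

open Classical in
/-- `a(θ)` with `θ = x/|x|`, as a function of `x ≠ 0`; the value at `x = 0` is irrelevant. -/
def angular {d : ℕ} (a : S d → ℝ) (x : E d) : ℝ :=
  if h : x = 0 then 0
  else a ⟨‖x‖⁻¹ • x, by
    rw [mem_sphere_zero_iff_norm, norm_smul, norm_inv, norm_norm,
      inv_mul_cancel₀ (norm_ne_zero_iff.mpr h)]⟩

/-- The asymptotic function `χ(r) ∑_{k=0}^{K} a_k(θ) / r^k`. -/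
def asympFun {d : ℕ} (χ : ℝ → ℝ) (K : ℕ) (a : ℕ → S d → ℝ) (x : E d) : ℝ :=
  χ ‖x‖ * ∑ k ∈ Finset.range (K + 1), angular (a k) x / ‖x‖ ^ k

/-- `u = χ(r) ∑_{k=0}^{K} a_k(θ) / r^k + f` almost everywhere, with `a_k ∈ H^{m+1+K-k,p}(S^{d-1})`
for `0 ≤ k ≤ K` and remainder `f` in the weighted Sobolev space with weights `e`. -/
def IsExpansion {d : ℕ} (χ : ℝ → ℝ) (m : ℕ) (p : ℝ) (K : ℕ) (e : ℕ → ℝ)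
    (a : ℕ → S d → ℝ) (f : E d → ℝ) (u : E d →ₘ[volume] ℝ) : Prop :=
  (∀ k ≤ K, MemSphereSobolev (m + 1 + K - k) p (a k)) ∧ MemWeightedSobolev m p e f ∧
    ⇑u =ᵐ[volume] fun x => asympFun χ K a x + f x

/-- The functions (modulo null sets) having an expansion with `a_k = 0` for `k < n`. -/
def expansionSpace {d : ℕ} (χ : ℝ → ℝ) (m : ℕ) (p : ℝ) (n K : ℕ) (e : ℕ → ℝ) :
    Set (E d →ₘ[volume] ℝ) :=
  {u | ∃ a f, IsExpansion χ m p K e a f u ∧ ∀ k < n, a k =ᵐ[σ d] 0}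

/-- The norm `∑_{k=0}^{K} ‖a_k‖_{H^{m+1+K-k,p}(S^{d-1})} + ‖f‖`. In the spaces below an expansion
is unique up to null sets, so the infimum is over a single value; it is `⊤` if there is no
expansion. -/
def expansionNorm {d : ℕ} (χ : ℝ → ℝ) (m : ℕ) (p : ℝ) (K : ℕ) (e : ℕ → ℝ)
    (u : E d →ₘ[volume] ℝ) : ENNReal :=
  ⨅ (a : ℕ → S d → ℝ) (f : E d → ℝ) (_ : IsExpansion χ m p K e a f u),
    ∑ k ∈ Finset.range (K + 1), sphereSobolevNorm (m + 1 + K - k) p (a k) +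
      weightedSobolevNorm m p e f

/-- The space `𝒜_{n,N}^{m,p}(ℝ^d)`, with remainder space `W_{γ_N}^{m,p}`, `γ_N = N + γ₀`. -/
def calA (d : ℕ) (χ : ℝ → ℝ) (γ₀ : ℝ) (m : ℕ) (p : ℝ) (n N : ℕ) : Set (E d →ₘ[volume] ℝ) :=
  expansionSpace χ m p n N (expW (N + γ₀))

/-- The norm of `𝒜_N^{m,p}(ℝ^d)` and of its subspaces `𝒜_{n,N}^{m,p}(ℝ^d)`. -/
def calANorm (d : ℕ) (χ : ℝ → ℝ) (γ₀ : ℝ) (m : ℕ) (p : ℝ) (N : ℕ) :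
    (E d →ₘ[volume] ℝ) → ENNReal :=
  expansionNorm χ m p N (expW (N + γ₀))

/-- The integer `N*` with `N - 1 + d/p < N* ≤ N + d/p`. -/
def Nstar (d : ℕ) (p : ℝ) (N : ℕ) : ℕ := ⌊(N : ℝ) + d / p⌋₊

/-- The space `𝔸_{n,N}^{m,p}(ℝ^d)`, with asymptotics up to order `N*` and remainder space
`H_N^{m,p}`. -/
def bbA (d : ℕ) (χ : ℝ → ℝ) (m : ℕ) (p : ℝ) (n N : ℕ) : Set (E d →ₘ[volume] ℝ) :=
  expansionSpace χ m p n (Nstar d p N) (expH N)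

/-- The norm of `𝔸_N^{m,p}(ℝ^d)` and of its subspaces `𝔸_{n,N}^{m,p}(ℝ^d)`. -/
def bbANorm (d : ℕ) (χ : ℝ → ℝ) (m : ℕ) (p : ℝ) (N : ℕ) : (E d →ₘ[volume] ℝ) → ENNReal :=
  expansionNorm χ m p (Nstar d p N) (expH N)

/-- The set `A` of functions (modulo null sets), with `ν` as norm and with the pointwise operations,
is a Banach algebra: a linear space on which `ν` is a finite complete norm, closed under products,
with `ν (u v) ≤ C ν(u) ν(v)` for a constant `C`, which can be taken positive, so that the equivalent
norm `C ν` is submultiplicative. -/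
structure IsBanachAlgebra {d : ℕ} (A : Set (E d →ₘ[volume] ℝ))
    (ν : (E d →ₘ[volume] ℝ) → ENNReal) : Prop where
  zero_mem : 0 ∈ A
  add_mem : ∀ u ∈ A, ∀ v ∈ A, u + v ∈ A
  smul_mem : ∀ c : ℝ, ∀ u ∈ A, c • u ∈ A
  finite : ∀ u ∈ A, ν u < ⊤
  eq_zero : ∀ u ∈ A, ν u = 0 → u = 0
  norm_add_le : ∀ u ∈ A, ∀ v ∈ A, ν (u + v) ≤ ν u + ν v
  norm_smul : ∀ c : ℝ, ∀ u ∈ A, ν (c • u) = ENNReal.ofReal |c| * ν u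
  complete : ∀ U : ℕ → (E d →ₘ[volume] ℝ), (∀ i, U i ∈ A) →
    (∀ ε > 0, ∃ M, ∀ i ≥ M, ∀ j ≥ M, ν (U i - U j) < ε) →
      ∃ u ∈ A, Tendsto (fun i => ν (U i - u)) atTop (𝓝 0)
  mul_mem : ∀ u ∈ A, ∀ v ∈ A, u * v ∈ A
  norm_mul_le : ∃ C : NNReal, ∀ u ∈ A, ∀ v ∈ A, ν (u * v) ≤ C * ν u * ν v

end AsymptoticSpaces

end

open AsymptoticSpaces

/-! Write two elements as A + f and B + g, asymptotic part plus remainder. Their product is AB + Ag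
+ Bf + fg. The Cauchy product AB supplies the new coefficients up to the new order; the rest of AB,
that is, the higher orders and the terms carrying χ² - χ, decays fast enough to join the remainder.
So three facts are needed: Sobolev spaces on the sphere multiply, asymptotic functions multiply
remainders, and remainders multiply remainders.

All three come from one local fact, `exists_eLpNorm_mul_le_ballNorm`: on a ball, u with a
derivatives times v with b derivatives is in `L^p` once a + b ≥ m > d/p, with the natural dependence
on the radius. It rests on a first-order embedding on the unit ball
(`exists_eLpNorm_le_of_gradient`), iterated along the exponents `1/q_j = (1 - j/m)/p`. Each step
lowers the reciprocal exponent by `1/(pm)`, which is subcritical because d/p < m, so no endpoint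
inequality is required. Hölder, scaling and mollification finish the local statement and also give
the product rule for weak derivatives.

The local estimate is made global with balls of radius ρ(x) = ⟨x⟩^τ / 4, 0 ≤ τ ≤ 1. On such a ball
the weights are almost constant, and `L^p` averages of local norms against ρ^{-d} dx are comparable
to weighted norms. In `exists_recNorm_mul_le` one factor is controlled by a supremum over balls
(`unifNorm`), the other by an `L^p` average. The scale τ = 0 fits the spaces `H`, whose weights
ignore the order of the derivative, and τ = 1 fits the spaces `W`. Asymptotic functions always use τ
= 1, since each derivative of r^{-k} a(θ) gains one order of decay.

To treat r^{-k} a(θ), the partial derivatives are split into a radial part and rotations: a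
derivative of h(x) a(θ), with h a symbol vanishing on the unit ball, is a sum of symbols of one
order less times a or times rotation derivatives of a (`IsSym.wd_mul_angular`). An induction
(`exists_sym_bound`) then bounds such functions by the Sobolev norm of a on the sphere.
Multiplication on the sphere (`exists_sphereSobolevNorm_mul_le`) is itself deduced from ℝ^d by
spreading a and b over a shell.

Expansions are unique because r^{-k} with k ≤ K ≤ δ + d/p is not in the weighted `L^p` space near
infinity (`sphere_coeff_eq_zero`). Hence the norm is the sum of the component norms, and
completeness reduces to that of the Sobolev spaces involved. `exists_expansion_mul_le` assembles the
product under inequalities between weights; these are finally checked for the two families. -/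

noncomputable section
namespace AsymptoticSpaces

/-! ### Test functions and weak derivatives -/

variable {d : ℕ}

/-- Test functions: smooth functions of compact support. -/
structure IsTest (φ : E d → ℝ) : Prop where
  smooth : ContDiff ℝ ∞ φ
  compact : HasCompactSupport φ

lemma contDiff_pderiv {φ : E d → ℝ} (hφ : ContDiff ℝ ∞ φ) (i : Fin d) :
    ContDiff ℝ ∞ (pderiv i φ) :=
  (hφ.fderiv_right (m := ∞) (by simp)).clm_apply contDiff_const

lemma IsTest.pderiv {φ : E d → ℝ} (hφ : IsTest φ) (i : Fin d) : IsTest (pderiv i φ) :=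
  ⟨contDiff_pderiv hφ.smooth i, hφ.compact.fderiv_apply ℝ _⟩

lemma IsTest.mul_left {φ h : E d → ℝ} (hφ : IsTest φ) (hh : ContDiff ℝ ∞ h) :
    IsTest (fun x => h x * φ x) :=
  ⟨hh.mul hφ.smooth, hφ.compact.mul_left⟩

lemma pderiv_add {φ ψ : E d → ℝ} (hφ : ContDiff ℝ ∞ φ) (hψ : ContDiff ℝ ∞ ψ) (i : Fin d) (x : E d) :
    pderiv i (fun x => φ x + ψ x) x = pderiv i φ x + pderiv i ψ x := by
  simp only [pderiv]
  rw [fderiv_fun_add (hφ.differentiable (by simp) x) (hψ.differentiable (by simp) x)]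
  rfl

lemma pderiv_mul {φ ψ : E d → ℝ} (hφ : ContDiff ℝ ∞ φ) (hψ : ContDiff ℝ ∞ ψ) (i : Fin d) (x : E d) :
    pderiv i (fun x => φ x * ψ x) x = pderiv i φ x * ψ x + φ x * pderiv i ψ x := by
  simp only [pderiv]
  rw [fderiv_fun_mul (hφ.differentiable (by simp) x) (hψ.differentiable (by simp) x)]
  simp
  ring

lemma pderiv_comm {φ : E d → ℝ} (hφ : ContDiff ℝ ∞ φ) (i j : Fin d) :
    pderiv i (pderiv j φ) = pderiv j (pderiv i φ) := by
  have hD : Differentiable ℝ (fderiv ℝ φ) :=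
    (hφ.fderiv_right (m := ∞) (by simp)).differentiable (by simp)
  have key : ∀ (k l : Fin d) (x : E d), pderiv k (pderiv l φ) x =
      fderiv ℝ (fderiv ℝ φ) x (EuclideanSpace.single k 1) (EuclideanSpace.single l 1) := by
    intro k l x
    change fderiv ℝ (fun y => fderiv ℝ φ y (EuclideanSpace.single l 1)) x _ = _
    rw [fderiv_clm_apply (hD x) (differentiableAt_const _)]
    simp
  ext x
  rw [key, key]
  exact (hφ.contDiffAt.isSymmSndFDerivAt (by simp; exact WithTop.coe_le_coe.2 (le_top : (2 : ℕ∞) ≤ ⊤))).eq _ _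

lemma contDiff_iterate_pderiv {φ : E d → ℝ} (hφ : ContDiff ℝ ∞ φ) (i : Fin d) (n : ℕ) :
    ContDiff ℝ ∞ ((pderiv i)^[n] φ) := by
  induction n generalizing φ with
  | zero => simpa
  | succ n ih => simpa using ih (contDiff_pderiv hφ i)

lemma IsTest.iterate {φ : E d → ℝ} (hφ : IsTest φ) (i : Fin d) (n : ℕ) :
    IsTest ((AsymptoticSpaces.pderiv i)^[n] φ) := by
  induction n generalizing φ with
  | zero => simpa
  | succ n ih => simpa using ih (hφ.pderiv i)

lemma iterate_pderiv_comm {φ : E d → ℝ} (hφ : ContDiff ℝ ∞ φ) (i j : Fin d) (n : ℕ) :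
    (pderiv i)^[n] (pderiv j φ) = pderiv j ((pderiv i)^[n] φ) := by
  induction n generalizing φ with
  | zero => rfl
  | succ n ih =>
    rw [Function.iterate_succ_apply, Function.iterate_succ_apply, pderiv_comm hφ,
      ih (contDiff_pderiv hφ i)]

/-- The derivative along the coordinates in the list `l`, with multiplicities `α`. -/
def listDeriv (α : Fin d → ℕ) (l : List (Fin d)) (φ : E d → ℝ) : E d → ℝ :=
  l.foldr (fun i ψ => (pderiv i)^[α i] ψ) φ

lemma IsTest.listDeriv {φ : E d → ℝ} (hφ : IsTest φ) (α : Fin d → ℕ) (l : List (Fin d)) :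
    IsTest (listDeriv α l φ) := by
  induction l with
  | nil => exact hφ
  | cons i l ih => exact ih.iterate i _

lemma contDiff_listDeriv {φ : E d → ℝ} (hφ : ContDiff ℝ ∞ φ) (α : Fin d → ℕ)
    (l : List (Fin d)) : ContDiff ℝ ∞ (listDeriv α l φ) := by
  induction l with
  | nil => exact hφ
  | cons i l ih => exact contDiff_iterate_pderiv ih i _

lemma IsTest.multiDeriv {φ : E d → ℝ} (hφ : IsTest φ) (α : Fin d → ℕ) :
    IsTest (multiDeriv α φ) := hφ.listDeriv α _

/-- The list is arbitrary so that induction over it can run. Without repetitions the index `j` is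
met at most once, so raising its multiplicity yields a single extra derivative, which commutes to
the outside. -/
lemma listDeriv_add_single {φ : E d → ℝ} (hφ : ContDiff ℝ ∞ φ) (α : Fin d → ℕ) (j : Fin d)
    (l : List (Fin d)) (hl : l.Nodup) :
    listDeriv (α + Pi.single j 1) l φ =
      if j ∈ l then pderiv j (listDeriv α l φ) else listDeriv α l φ := by
  induction l with
  | nil => rfl
  | cons i l ih =>
    have h1 : ∀ (β : Fin d → ℕ) ψ, listDeriv β (i :: l) ψ = (pderiv i)^[β i] (listDeriv β l ψ) :=
      fun _ _ => rfl
    have hs := contDiff_listDeriv hφ α l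
    rw [h1, h1, ih hl.of_cons]
    have hi : i ∉ l := (List.nodup_cons.1 hl).1
    by_cases hij : j = i
    · subst hij
      simp [hi, Function.iterate_succ_apply, iterate_pderiv_comm hs]
    · have : (α + Pi.single j 1 : Fin d → ℕ) i = α i := by
        simp [Ne.symm hij]
      rw [this]
      by_cases hjl : j ∈ l
      · simp [hjl, iterate_pderiv_comm hs]
      · simp [hjl, hij]

lemma multiDeriv_add_single {φ : E d → ℝ} (hφ : ContDiff ℝ ∞ φ) (α : Fin d → ℕ) (j : Fin d) :
    multiDeriv (α + Pi.single j 1) φ = pderiv j (multiDeriv α φ) := by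
  have := listDeriv_add_single hφ α j (List.finRange d) (List.nodup_finRange d)
  rwa [if_pos (List.mem_finRange j)] at this

lemma multiDeriv_zero (φ : E d → ℝ) : multiDeriv 0 φ = φ := by
  unfold multiDeriv
  induction (List.finRange d) with
  | nil => rfl
  | cons i l ih => simp

lemma multiDeriv_single {φ : E d → ℝ} (hφ : ContDiff ℝ ∞ φ) (j : Fin d) :
    multiDeriv (Pi.single j 1) φ = pderiv j φ := by
  have := multiDeriv_add_single hφ 0 j
  rwa [zero_add, multiDeriv_zero] at this

lemma IsTest.integrable_mul {φ : E d → ℝ} (hφ : IsTest φ) {f : E d → ℝ}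
    (hf : LocallyIntegrable f volume) : Integrable (fun x => f x * φ x) volume := by
  simpa [mul_comm] using
    hf.integrable_smul_left_of_hasCompactSupport hφ.smooth.continuous hφ.compact

lemma isWeakDeriv_iff {α : Fin d → ℕ} {f g : E d → ℝ} : IsWeakDeriv α f g ↔
    LocallyIntegrable f volume ∧ LocallyIntegrable g volume ∧
    ∀ φ : E d → ℝ, IsTest φ →
      ∫ x, f x * multiDeriv α φ x = (-1) ^ (∑ i, α i) * ∫ x, g x * φ x :=
  ⟨fun h => ⟨h.1, h.2.1, fun φ hφ => h.2.2 φ hφ.1 hφ.2⟩,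
    fun h => ⟨h.1, h.2.1, fun φ h1 h2 => h.2.2 φ ⟨h1, h2⟩⟩⟩

/-- `g` is the weak partial derivative `∂_i f`. -/
abbrev WD (i : Fin d) (f g : E d → ℝ) : Prop := IsWeakDeriv (Pi.single i 1) f g

/-- The weak partial derivative `∂_i f`. -/
abbrev wd (i : Fin d) (f : E d → ℝ) : E d → ℝ := weakDeriv (Pi.single i 1) f

lemma wd_iff {i : Fin d} {f g : E d → ℝ} : WD i f g ↔
    LocallyIntegrable f volume ∧ LocallyIntegrable g volume ∧
    ∀ φ : E d → ℝ, IsTest φ → ∫ x, f x * pderiv i φ x = - ∫ x, g x * φ x := by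
  rw [WD, isWeakDeriv_iff]
  refine and_congr_right fun _ => and_congr_right fun _ => forall_congr' fun φ =>
    forall_congr' fun hφ => ?_
  rw [multiDeriv_single hφ.smooth, Finset.sum_pi_single']
  simp

lemma IsWeakDeriv.unique {α : Fin d → ℕ} {f g g' : E d → ℝ} (h : IsWeakDeriv α f g)
    (h' : IsWeakDeriv α f g') : g =ᵐ[volume] g' := by
  refine ae_eq_of_integral_contDiff_smul_eq h.2.1 h'.2.1 fun φ h1 h2 => ?_
  have e1 := h.2.2 φ h1 h2
  have e2 := h'.2.2 φ h1 h2
  rw [e1] at e2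
  have e3 : ((-1 : ℝ) ^ (∑ i, α i)) ≠ 0 := by simp
  simpa [mul_comm] using mul_left_cancel₀ e3 e2

lemma locallyIntegrable_congr {f f' : E d → ℝ} (h : f =ᵐ[volume] f')
    (hf : LocallyIntegrable f volume) : LocallyIntegrable f' volume := by
  intro x
  obtain ⟨s, hs, hs'⟩ := hf x
  exact ⟨s, hs, hs'.congr (ae_restrict_of_ae h)⟩

lemma IsWeakDeriv.congr {α : Fin d → ℕ} {f f' g g' : E d → ℝ} (h : IsWeakDeriv α f g)
    (hf : f =ᵐ[volume] f') (hg : g =ᵐ[volume] g') : IsWeakDeriv α f' g' := by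
  refine ⟨locallyIntegrable_congr hf h.1, locallyIntegrable_congr hg h.2.1, fun φ h1 h2 => ?_⟩
  have e1 : ∫ x, f' x * multiDeriv α φ x = ∫ x, f x * multiDeriv α φ x :=
    integral_congr_ae (hf.mono fun x hx => by simp only [hx])
  have e2 : ∫ x, g' x * φ x = ∫ x, g x * φ x :=
    integral_congr_ae (hg.mono fun x hx => by simp only [hx])
  rw [e1, e2, h.2.2 φ h1 h2]

lemma weakDeriv_spec {α : Fin d → ℕ} {f g : E d → ℝ} (h : IsWeakDeriv α f g) :
    IsWeakDeriv α f (weakDeriv α f) := by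
  have : ∃ g, IsWeakDeriv α f g := ⟨g, h⟩
  rw [weakDeriv, dif_pos this]
  exact this.choose_spec

lemma weakDeriv_ae_eq {α : Fin d → ℕ} {f g : E d → ℝ} (h : IsWeakDeriv α f g) :
    weakDeriv α f =ᵐ[volume] g := (weakDeriv_spec h).unique h

/-- This is an honest equality: `weakDeriv` is a choice that depends only on the predicate
`IsWeakDeriv α f`, and this predicate does not see null sets. -/
lemma weakDeriv_congr {α : Fin d → ℕ} {f f' : E d → ℝ} (h : f =ᵐ[volume] f') :
    weakDeriv α f = weakDeriv α f' := by
  have : IsWeakDeriv α f = IsWeakDeriv α f' := by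
    ext g
    exact ⟨fun hg => hg.congr h .rfl, fun hg => hg.congr h.symm .rfl⟩
  unfold weakDeriv
  rw [this]

lemma IsWeakDeriv.add {α : Fin d → ℕ} {f f' g g' : E d → ℝ} (h : IsWeakDeriv α f g)
    (h' : IsWeakDeriv α f' g') : IsWeakDeriv α (fun x => f x + f' x) (fun x => g x + g' x) := by
  rw [isWeakDeriv_iff] at *
  refine ⟨h.1.add h'.1, h.2.1.add h'.2.1, fun φ hφ => ?_⟩
  simp only [add_mul]
  rw [integral_add ((hφ.multiDeriv α).integrable_mul h.1) ((hφ.multiDeriv α).integrable_mul h'.1),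
    integral_add (hφ.integrable_mul h.2.1) (hφ.integrable_mul h'.2.1), h.2.2 φ hφ, h'.2.2 φ hφ]
  ring

lemma IsWeakDeriv.const_mul {α : Fin d → ℕ} {f g : E d → ℝ} (h : IsWeakDeriv α f g)
    (c : ℝ) : IsWeakDeriv α (fun x => c * f x) (fun x => c * g x) := by
  refine ⟨h.1.smul c, h.2.1.smul c, fun φ h1 h2 => ?_⟩
  simp only [mul_assoc, integral_const_mul, h.2.2 φ h1 h2]
  ring

lemma IsWeakDeriv.sub {α : Fin d → ℕ} {f f' g g' : E d → ℝ} (h : IsWeakDeriv α f g)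
    (h' : IsWeakDeriv α f' g') : IsWeakDeriv α (fun x => f x - f' x) (fun x => g x - g' x) := by
  have := h.add (h'.const_mul (-1))
  simpa [← sub_eq_add_neg] using this

lemma isWeakDeriv_zero_left {f : E d → ℝ} (h : LocallyIntegrable f volume) :
    IsWeakDeriv 0 f f := by
  refine ⟨h, h, fun φ h1 h2 => ?_⟩
  simp [multiDeriv_zero]

lemma isWeakDeriv_of_zero (α : Fin d → ℕ) : IsWeakDeriv α (fun _ => 0) (fun _ => 0) := by
  refine ⟨locallyIntegrable_const 0, locallyIntegrable_const 0, fun φ h1 h2 => ?_⟩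
  simp

/-- Together with `IsWeakDeriv.of_comp` this trades a derivative of order |α| + 1 for a first
derivative followed by one of order |α|, so that the weighted spaces can be studied by induction on
the order. -/
lemma IsWeakDeriv.comp {α : Fin d → ℕ} {i : Fin d} {f h g : E d → ℝ} (h1 : WD i f h)
    (h2 : IsWeakDeriv α h g) : IsWeakDeriv (α + Pi.single i 1) f g := by
  rw [wd_iff] at h1
  rw [isWeakDeriv_iff] at *
  refine ⟨h1.1, h2.2.1, fun φ hφ => ?_⟩
  rw [multiDeriv_add_single hφ.smooth, h1.2.2 _ (hφ.multiDeriv α), h2.2.2 φ hφ]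
  simp [Finset.sum_add_distrib, pow_succ]

lemma IsWeakDeriv.of_comp {α : Fin d → ℕ} {i : Fin d} {f h g : E d → ℝ} (h1 : WD i f h)
    (h2 : IsWeakDeriv (α + Pi.single i 1) f g) : IsWeakDeriv α h g := by
  rw [wd_iff] at h1
  rw [isWeakDeriv_iff] at *
  refine ⟨h1.2.1, h2.2.1, fun φ hφ => ?_⟩
  have := h2.2.2 φ hφ
  rw [multiDeriv_add_single hφ.smooth, h1.2.2 _ (hφ.multiDeriv α)] at this
  simp only [Finset.sum_add_distrib, pow_succ, Pi.add_apply, Finset.sum_pi_single',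
    Finset.mem_univ, if_true, mul_neg, mul_one, neg_mul] at this
  linarith

lemma weakDeriv_wd {α : Fin d → ℕ} {i : Fin d} {f h g : E d → ℝ} (h1 : WD i f h)
    (h2 : IsWeakDeriv (α + Pi.single i 1) f g) :
    weakDeriv α h =ᵐ[volume] weakDeriv (α + Pi.single i 1) f :=
  (weakDeriv_ae_eq (IsWeakDeriv.of_comp h1 h2)).trans (weakDeriv_ae_eq h2).symm

/-- Integration by parts for a smooth function. -/
lemma wd_of_contDiff {u : E d → ℝ} (hu : ContDiff ℝ ∞ u) (i : Fin d) : WD i u (pderiv i u) := by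
  rw [wd_iff]
  have hd := contDiff_pderiv hu i
  refine ⟨hu.continuous.locallyIntegrable, hd.continuous.locallyIntegrable, fun φ hφ => ?_⟩
  exact integral_mul_fderiv_eq_neg_fderiv_mul_of_integrable
    (hφ.integrable_mul hd.continuous.locallyIntegrable)
    ((hφ.pderiv i).integrable_mul hu.continuous.locallyIntegrable)
    (hφ.integrable_mul hu.continuous.locallyIntegrable)
    (fun x _ => hu.differentiable (by simp) x) (fun x _ => hφ.smooth.differentiable (by simp) x)

/-- The product rule with a smooth factor. -/
lemma WD.mul_smooth {u v w : E d → ℝ} {i : Fin d} (hu : ContDiff ℝ ∞ u) (hv : WD i v w) :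
    WD i (fun x => u x * v x) (fun x => pderiv i u x * v x + u x * w x) := by
  have hd := contDiff_pderiv hu i
  rw [wd_iff] at *
  have l1 : ∀ {g f : E d → ℝ}, Continuous g → LocallyIntegrable f volume →
      LocallyIntegrable (fun x => g x * f x) volume := by
    intro g f hg hf
    have := (locallyIntegrableOn_univ.2 hf).continuousOn_mul hg.continuousOn isOpen_univ.isLocallyClosed
    exact locallyIntegrableOn_univ.1 this
  refine ⟨l1 hu.continuous hv.1, (l1 hd.continuous hv.1).add (l1 hu.continuous hv.2.1),
    fun φ hφ => ?_⟩
  have ht := hφ.mul_left hu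
  have h1 := hv.2.2 _ ht
  have h2 : ∀ x, pderiv i (fun x => u x * φ x) x = pderiv i u x * φ x + u x * pderiv i φ x :=
    fun x => pderiv_mul hu hφ.smooth i x
  have i1 := (hφ.mul_left hd).integrable_mul hv.1
  have i2 := ((hφ.pderiv i).mul_left hu).integrable_mul hv.1
  have i3 := ht.integrable_mul hv.2.1
  have h3 : ∫ x, v x * pderiv i (fun x => u x * φ x) x =
      (∫ x, v x * (pderiv i u x * φ x)) + ∫ x, v x * (u x * pderiv i φ x) := by
    rw [← integral_add i1 i2]
    simp only [h2, mul_add]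
  have h4 : ∫ x, (pderiv i u x * v x + u x * w x) * φ x =
      (∫ x, v x * (pderiv i u x * φ x)) + ∫ x, w x * (u x * φ x) := by
    rw [← integral_add i1 i3]
    congr 1
    ext x
    ring
  have h5 : ∫ x, u x * v x * pderiv i φ x = ∫ x, v x * (u x * pderiv i φ x) := by
    congr 1
    ext x
    ring
  rw [h4, h5]
  linarith

/-! ### Weighted Sobolev spaces and their recursion in the order -/

section Weighted

lemma japanese_pos (x : E d) : 0 < japanese x := Real.sqrt_pos.2 (by positivity)

lemma one_le_japanese (x : E d) : 1 ≤ japanese x := by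
  rw [japanese, Real.one_le_sqrt]; nlinarith [sq_nonneg ‖x‖]

lemma norm_le_japanese (x : E d) : ‖x‖ ≤ japanese x := by
  refine Real.le_sqrt_of_sq_le (by linarith)

lemma japanese_le (x : E d) : japanese x ≤ 1 + ‖x‖ := by
  rw [japanese, Real.sqrt_le_left (by positivity)]
  nlinarith [norm_nonneg x]

lemma continuous_japanese : Continuous (japanese : E d → ℝ) := by
  unfold japanese; fun_prop

lemma continuous_japanese_rpow (s : ℝ) : Continuous (fun x : E d => japanese x ^ s) :=
  continuous_japanese.rpow_const fun x => Or.inl (japanese_pos x).ne'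

variable {p : ℝ}

/-- The weighted norm `‖⟨x⟩^s f‖_{L^p}`. -/
abbrev wnorm (p s : ℝ) (f : E d → ℝ) : ENNReal :=
  eLpNorm (fun x => japanese x ^ s * f x) (ENNReal.ofReal p) volume

abbrev WMem (p s : ℝ) (f : E d → ℝ) : Prop :=
  MemLp (fun x => japanese x ^ s * f x) (ENNReal.ofReal p) volume

/-- The weight is continuous and positive, so it can be divided out locally. -/
lemma WMem.locallyIntegrable (hp : 1 ≤ p) {s : ℝ} {f : E d → ℝ} (h : WMem p s f) :
    LocallyIntegrable f volume := by
  have h1 : LocallyIntegrable (fun x => japanese x ^ s * f x) volume :=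
    MemLp.locallyIntegrable h (by simpa using hp)
  have := (locallyIntegrableOn_univ.2 h1).continuousOn_mul
    (continuous_japanese_rpow (-s)).continuousOn isOpen_univ.isLocallyClosed
  refine (locallyIntegrableOn_univ.1 this).congr (.of_forall fun x => ?_)
  simp only [← mul_assoc]
  rw [← Real.rpow_add (japanese_pos x)]
  simp

lemma WMem.congr {s : ℝ} {f g : E d → ℝ} (h : WMem p s f) (hfg : f =ᵐ[volume] g) : WMem p s g :=
  MemLp.ae_eq (hfg.mono fun x hx => by simp only [hx]) h

lemma wnorm_congr {s : ℝ} {f g : E d → ℝ} (hfg : f =ᵐ[volume] g) : wnorm p s f = wnorm p s g :=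
  eLpNorm_congr_ae (hfg.mono fun x hx => by simp only [hx])

variable {m : ℕ} {e : ℕ → ℝ} {f g : E d → ℝ}

lemma MemWeightedSobolev.locallyIntegrable (h : MemWeightedSobolev m p e f) :
    LocallyIntegrable f volume := by
  obtain ⟨g, hg⟩ := (h 0 (by simp)).1
  exact hg.1

lemma MemWeightedSobolev.wMem (h : MemWeightedSobolev m p e f) : WMem p (e 0) f := by
  have := (h 0 (by simp)).2
  simp only [Pi.zero_apply, Finset.sum_const_zero] at this
  exact WMem.congr this (weakDeriv_ae_eq (isWeakDeriv_zero_left h.locallyIntegrable))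

lemma MemWeightedSobolev.congr (h : MemWeightedSobolev m p e f) (hfg : f =ᵐ[volume] g) :
    MemWeightedSobolev m p e g := by
  intro α hα
  obtain ⟨⟨a, ha⟩, h2⟩ := h α hα
  exact ⟨⟨a, ha.congr hfg .rfl⟩, by rwa [← weakDeriv_congr hfg]⟩

lemma weightedSobolevNorm_congr (hfg : f =ᵐ[volume] g) :
    weightedSobolevNorm m p e f = weightedSobolevNorm m p e g := by
  simp only [weightedSobolevNorm, weakDeriv_congr hfg]

lemma exists_eq_add_single {α : Fin d → ℕ} {k : ℕ} (h : ∑ i, α i = k + 1) :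
    ∃ (β : Fin d → ℕ) (i : Fin d), α = β + Pi.single i 1 ∧ ∑ j, β j = k := by
  have : ∃ i, α i ≠ 0 := by
    by_contra! hc
    simp [hc] at h
  obtain ⟨i, hi⟩ := this
  have hα : α = (α - Pi.single i 1) + Pi.single i 1 := by
    ext j
    by_cases hj : j = i
    · subst hj; simp; omega
    · simp [hj]
  refine ⟨α - Pi.single i 1, i, hα, ?_⟩
  rw [hα] at h
  simp only [Pi.add_apply, Finset.sum_add_distrib, Finset.sum_pi_single', Finset.mem_univ,
    if_true] at h
  simpa using h

lemma sum_add_single (β : Fin d → ℕ) (i : Fin d) :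
    ∑ j, (β + Pi.single i 1 : Fin d → ℕ) j = ∑ j, β j + 1 := by
  simp [Finset.sum_add_distrib]

lemma memWeightedSobolev_zero_iff (hp : 1 ≤ p) : MemWeightedSobolev 0 p e f ↔ WMem p (e 0) f := by
  refine ⟨fun h => h.wMem, fun h α hα => ?_⟩
  have h0 : α = 0 := by
    ext i
    have := (Finset.sum_eq_zero_iff.1 (Nat.le_zero.1 hα)) i (Finset.mem_univ i)
    simpa using this
  subst h0
  have hw := isWeakDeriv_zero_left (h.locallyIntegrable hp)
  refine ⟨⟨f, hw⟩, ?_⟩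
  simp only [Pi.zero_apply, Finset.sum_const_zero]
  exact WMem.congr h (weakDeriv_ae_eq hw).symm

/-- One derivative is peeled off and the weight sequence is shifted. Because the weights are an
arbitrary sequence, the same recursion serves `expH` and `expW`. -/
lemma memWeightedSobolev_succ_iff (hp : 1 ≤ p) : MemWeightedSobolev (m + 1) p e f ↔
    WMem p (e 0) f ∧ ∀ i, ∃ g, WD i f g ∧ MemWeightedSobolev m p (fun k => e (k + 1)) g := by
  constructor
  · intro h
    refine ⟨h.wMem, fun i => ?_⟩
    obtain ⟨⟨g, hg⟩, -⟩ := h (Pi.single i 1) (by simp)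
    refine ⟨g, hg, fun α hα => ?_⟩
    have hsum := sum_add_single α i
    obtain ⟨⟨g', hg'⟩, h2⟩ := h (α + Pi.single i 1) (by omega)
    refine ⟨⟨g', IsWeakDeriv.of_comp hg hg'⟩, ?_⟩
    rw [hsum] at h2
    exact WMem.congr h2 (weakDeriv_wd hg hg').symm
  · rintro ⟨h0, h1⟩ α hα
    rcases hk : ∑ i, α i with _ | k
    · have := (memWeightedSobolev_zero_iff (e := e) hp).2 h0 α hk.le
      rwa [hk] at this
    · obtain ⟨β, i, rfl, hβ⟩ := exists_eq_add_single hk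
      obtain ⟨g, hg, hg2⟩ := h1 i
      obtain ⟨⟨g', hg'⟩, h3⟩ := hg2 β (by omega)
      have := IsWeakDeriv.comp hg hg'
      refine ⟨⟨g', this⟩, ?_⟩
      rw [hβ] at h3
      exact WMem.congr h3 (weakDeriv_wd hg this)

lemma MemWeightedSobolev.deriv (hp : 1 ≤ p) (h : MemWeightedSobolev (m + 1) p e f) {i : Fin d}
    (hg : WD i f g) : MemWeightedSobolev m p (fun k => e (k + 1)) g := by
  obtain ⟨g', h1, h2⟩ := ((memWeightedSobolev_succ_iff hp).1 h).2 i
  exact h2.congr (h1.unique hg)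

lemma MemWeightedSobolev.wd (hp : 1 ≤ p) (h : MemWeightedSobolev (m + 1) p e f) (i : Fin d) :
    WD i f (wd i f) := by
  obtain ⟨g', h1, h2⟩ := ((memWeightedSobolev_succ_iff hp).1 h).2 i
  exact weakDeriv_spec h1

lemma MemWeightedSobolev.mono {m' : ℕ} (h : MemWeightedSobolev m p e f) (hm : m' ≤ m) :
    MemWeightedSobolev m' p e f := fun α hα => h α (hα.trans hm)

lemma weightedSobolevNorm_mono {m' : ℕ} (hm : m' ≤ m) :
    weightedSobolevNorm m' p e f ≤ weightedSobolevNorm m p e f :=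
  Finset.sum_le_sum_of_subset (Finset.range_mono (by omega))

lemma weightedSobolevNorm_zero (h : LocallyIntegrable f volume) :
    weightedSobolevNorm 0 p e f = wnorm p (e 0) f := by
  have h0 : Finset.piAntidiag (Finset.univ : Finset (Fin d)) 0 = {0} := by simp
  simp only [weightedSobolevNorm, zero_add, Finset.range_one, Finset.sum_singleton, h0]
  exact wnorm_congr (weakDeriv_ae_eq (isWeakDeriv_zero_left h))

lemma wnorm_le_weightedSobolevNorm (h : LocallyIntegrable f volume) :
    wnorm p (e 0) f ≤ weightedSobolevNorm m p e f := by
  rw [← weightedSobolevNorm_zero h]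
  exact weightedSobolevNorm_mono (Nat.zero_le m)

/-- Adding the index `i` embeds the multi-indices of order k injectively into those of order k + 1,
so one sum is part of the other. -/
lemma weightedSobolevNorm_deriv_le (hp : 1 ≤ p) (h : MemWeightedSobolev (m + 1) p e f) {i : Fin d}
    (hg : WD i f g) :
    weightedSobolevNorm m p (fun k => e (k + 1)) g ≤ weightedSobolevNorm (m + 1) p e f := by
  simp only [weightedSobolevNorm]
  rw [Finset.sum_range_succ' _ (m + 1)]
  refine le_trans (Finset.sum_le_sum fun k hk => ?_) le_self_add
  have hinj : Set.InjOn (fun α : Fin d → ℕ => α + Pi.single i 1)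
      (Finset.piAntidiag (Finset.univ : Finset (Fin d)) k) := fun a _ b _ hab => by simpa using hab
  have himg := Finset.sum_image (g := fun α : Fin d → ℕ => α + Pi.single i 1)
    (f := fun α => eLpNorm (fun x => japanese x ^ e (k + 1) * weakDeriv α f x)
      (ENNReal.ofReal p) volume) hinj
  refine le_trans (le_of_eq ?_) (himg.symm.le.trans (Finset.sum_le_sum_of_subset ?_))
  rotate_left
  · intro α hα
    simp only [Finset.mem_image, Finset.mem_piAntidiag] at hα ⊢
    obtain ⟨β, ⟨hβ, -⟩, rfl⟩ := hα
    exact ⟨(sum_add_single β i).trans (by rw [← hβ]), fun _ _ => Finset.mem_univ _⟩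
  · refine Finset.sum_congr rfl fun α hα => ?_
    simp only [Finset.mem_piAntidiag, Finset.mem_range] at hα hk
    obtain ⟨⟨g', hg'⟩, -⟩ := h (α + Pi.single i 1) (by
      have := sum_add_single α i; have h3 : ∑ j, α j = k := hα.1; omega)
    exact wnorm_congr (weakDeriv_wd hg hg')

lemma sum_biUnion_le' {ι κ : Type*} [DecidableEq κ] (s : Finset ι) (t : ι → Finset κ)
    (F : κ → ENNReal) : ∑ x ∈ s.biUnion t, F x ≤ ∑ i ∈ s, ∑ x ∈ t i, F x := by
  classical
  induction s using Finset.induction_on with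
  | empty => simp
  | insert a s ha ih =>
    rw [Finset.biUnion_insert, Finset.sum_insert ha]
    refine le_trans ?_ (add_le_add_right ih _)
    rw [← Finset.sum_union_inter]
    exact le_self_add

/-- Only an inequality is available: a multi-index of order k + 1 may arise from several pairs of a
multi-index and a coordinate, and the right side counts each of them. -/
lemma weightedSobolevNorm_succ_le (h : MemWeightedSobolev (m + 1) p e f)
    {D : Fin d → E d → ℝ} (hD : ∀ i, WD i f (D i)) :
    weightedSobolevNorm (m + 1) p e f ≤ wnorm p (e 0) f +
      ∑ i, weightedSobolevNorm m p (fun k => e (k + 1)) (D i) := by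
  have h0 := weightedSobolevNorm_zero (p := p) (e := e) h.locallyIntegrable
  simp only [weightedSobolevNorm] at h0 ⊢
  rw [Finset.sum_range_succ', add_comm]
  simp only [zero_add, Finset.range_one, Finset.sum_singleton] at h0
  rw [h0, Finset.sum_comm]
  gcongr with k hk
  calc ∑ α ∈ Finset.piAntidiag (Finset.univ : Finset (Fin d)) (k + 1),
        eLpNorm (fun x => japanese x ^ e (k + 1) * weakDeriv α f x) (ENNReal.ofReal p) volume
      ≤ ∑ α ∈ Finset.univ.biUnion (fun i : Fin d =>
          (Finset.piAntidiag (Finset.univ : Finset (Fin d)) k).image fun β => β + Pi.single i 1),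
        eLpNorm (fun x => japanese x ^ e (k + 1) * weakDeriv α f x) (ENNReal.ofReal p) volume := by
        refine Finset.sum_le_sum_of_subset fun α hα => ?_
        simp only [Finset.mem_piAntidiag, Finset.mem_biUnion, Finset.mem_image] at hα ⊢
        obtain ⟨β, i, rfl, hβ⟩ := exists_eq_add_single hα.1
        exact ⟨i, Finset.mem_univ _, β, ⟨hβ, fun _ _ => Finset.mem_univ _⟩, rfl⟩
    _ ≤ ∑ i, ∑ α ∈ (Finset.piAntidiag (Finset.univ : Finset (Fin d)) k).image
          (fun β => β + Pi.single i 1),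
        eLpNorm (fun x => japanese x ^ e (k + 1) * weakDeriv α f x) (ENNReal.ofReal p) volume :=
        sum_biUnion_le' _ _ _
    _ ≤ _ := by
        refine Finset.sum_le_sum fun i _ => ?_
        rw [Finset.sum_image fun a _ b _ hab => by simpa using hab]
        refine Finset.sum_le_sum fun α hα => ?_
        simp only [Finset.mem_piAntidiag, Finset.mem_range] at hα hk
        obtain ⟨⟨g', hg'⟩, -⟩ := h (α + Pi.single i 1) (by
          have := sum_add_single α i; have h3 : ∑ j, α j = k := hα.1; omega)
        exact (wnorm_congr (weakDeriv_wd (hD i) hg').symm).le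

end Weighted

end AsymptoticSpaces
end

/-! ### First-order Sobolev embedding on the unit ball -/

noncomputable section
namespace AsymptoticSpaces

variable {d : ℕ}

section Affine

lemma lintegral_comp_affine (F : E d → ENNReal) (hF : Measurable F) (x : E d) {t : ℝ}
    (ht : 0 < t) : ∫⁻ y, F (x + t • y) = ENNReal.ofReal t ^ (-(d : ℝ)) * ∫⁻ y, F y := by
  have h1 : ∫⁻ y, F (x + t • y) = ∫⁻ y, F (x + y) ∂(Measure.map (fun y => t • y) volume) := by
    rw [lintegral_map (f := fun y => F (x + y)) (hF.comp (measurable_const_add x))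
      (measurable_const_smul t)]
  rw [h1, Measure.map_addHaar_smul volume ht.ne', lintegral_smul_measure,
    lintegral_add_left_eq_self, smul_eq_mul]
  congr 1
  rw [finrank_euclideanSpace_fin, abs_of_pos (by positivity), ENNReal.ofReal_rpow_of_pos ht,
    Real.rpow_neg ht.le, Real.rpow_natCast]

lemma volume_ball_eq (x : E d) {r : ℝ} (hr : 0 < r) : volume (Metric.ball x r) =
    ENNReal.ofReal r ^ (d : ℝ) * volume (Metric.ball (0 : E d) 1) := by
  rw [Measure.addHaar_ball_of_pos _ _ hr, finrank_euclideanSpace_fin, ENNReal.rpow_natCast,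
    ENNReal.ofReal_pow hr.le]

lemma volume_unitBall_ne_zero : volume (Metric.ball (0 : E d) 1) ≠ 0 :=
  (Metric.measure_ball_pos _ _ one_pos).ne'

end Affine

section Riesz

/-- The averaged gradient `∫_0^1 t^{-d} ∫_{B ∩ B(x, 2 t)} g dw dt` on the unit ball `B`. -/
def ballPotential (g : E d → ENNReal) (x : E d) : ENNReal :=
  ∫⁻ t in Set.Ioc (0 : ℝ) 1, ∫⁻ w in Metric.ball (0 : E d) 1,
    ENNReal.ofReal t ^ (-(d : ℝ)) * (Metric.ball x (2 * t)).indicator g w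

lemma measurableSet_ballPair (x : E d) :
    MeasurableSet {z : ℝ × E d | z.2 ∈ Metric.ball x (2 * z.1)} := by
  simp only [Metric.mem_ball]
  exact measurableSet_lt (by fun_prop) (by fun_prop)

/-- Fundamental theorem of calculus on the segment from `x` to `y`; the factor 2 bounds its length.
-/
lemma norm_le_of_segment {u : E d → ℝ} (hu : ContDiff ℝ ∞ u) {x y : E d}
    (hx : x ∈ Metric.ball (0 : E d) 1) (hy : y ∈ Metric.ball (0 : E d) 1) :
    ‖u x‖ₑ ≤ ‖u y‖ₑ + ∫⁻ t in Set.Ioc (0 : ℝ) 1, 2 * ‖fderiv ℝ u (x + t • (y - x))‖ₑ := by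
  have hd : ∀ t ∈ Set.uIcc (0 : ℝ) 1, HasDerivAt (fun t : ℝ => u (x + t • (y - x)))
      (fderiv ℝ u (x + t • (y - x)) (y - x)) t := by
    intro t _
    have h1 : HasDerivAt (fun t : ℝ => x + t • (y - x)) (y - x) t := by
      simpa using ((hasDerivAt_id t).smul_const (y - x)).const_add x
    exact (hu.differentiable (by simp) _).hasFDerivAt.comp_hasDerivAt t h1
  have hc : Continuous fun t : ℝ => fderiv ℝ u (x + t • (y - x)) (y - x) := by
    have := hu.continuous_fderiv (by simp)
    fun_prop
  have h := intervalIntegral.integral_eq_sub_of_hasDerivAt hd (hc.intervalIntegrable _ _)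
  simp only [one_smul, zero_smul, add_zero, add_sub_cancel] at h
  have hux : u x = u y - ∫ t in (0 : ℝ)..1, fderiv ℝ u (x + t • (y - x)) (y - x) := by
    rw [h]; ring
  rw [hux]
  refine (enorm_sub_le).trans (add_le_add le_rfl ?_)
  rw [intervalIntegral.integral_of_le zero_le_one]
  refine (enorm_integral_le_lintegral_enorm _).trans (lintegral_mono fun t => ?_)
  refine (ContinuousLinearMap.le_opENorm _ _).trans ?_
  rw [mul_comm]
  gcongr
  rw [← ofReal_norm]
  refine (ENNReal.ofReal_le_ofReal (q := 2) ?_).trans (by simp)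
  rw [mem_ball_zero_iff] at hx hy
  linarith [norm_sub_le y x]

/-- The segment estimate is integrated over `y` in the ball. For fixed t the substitution w = x +
t(y - x) has Jacobian t^{-d}; by convexity w stays in the unit ball, and |w - x| < 2t. This is the
kernel of `ballPotential`. -/
lemma mul_enorm_le_ballPotential {u : E d → ℝ} (hu : ContDiff ℝ ∞ u) {x : E d}
    (hx : x ∈ Metric.ball (0 : E d) 1) :
    volume (Metric.ball (0 : E d) 1) * ‖u x‖ₑ ≤ (∫⁻ y in Metric.ball (0 : E d) 1, ‖u y‖ₑ) +
      2 * ballPotential (fun w => ‖fderiv ℝ u w‖ₑ) x := by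
  have hcf : Continuous (fderiv ℝ u) := hu.continuous_fderiv (by simp)
  have hm : Measurable fun w => ‖fderiv ℝ u w‖ₑ := hcf.enorm.measurable
  calc volume (Metric.ball (0 : E d) 1) * ‖u x‖ₑ
      = ∫⁻ y in Metric.ball (0 : E d) 1, ‖u x‖ₑ := by rw [setLIntegral_const, mul_comm]
    _ ≤ ∫⁻ y in Metric.ball (0 : E d) 1, (‖u y‖ₑ +
          ∫⁻ t in Set.Ioc (0 : ℝ) 1, 2 * ‖fderiv ℝ u (x + t • (y - x))‖ₑ) :=
        setLIntegral_mono' measurableSet_ball fun y hy => norm_le_of_segment hu hx hy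
    _ = (∫⁻ y in Metric.ball (0 : E d) 1, ‖u y‖ₑ) + ∫⁻ y in Metric.ball (0 : E d) 1,
          ∫⁻ t in Set.Ioc (0 : ℝ) 1, 2 * ‖fderiv ℝ u (x + t • (y - x))‖ₑ :=
        lintegral_add_left hu.continuous.enorm.measurable _
    _ = (∫⁻ y in Metric.ball (0 : E d) 1, ‖u y‖ₑ) + ∫⁻ t in Set.Ioc (0 : ℝ) 1,
          ∫⁻ y in Metric.ball (0 : E d) 1, 2 * ‖fderiv ℝ u (x + t • (y - x))‖ₑ := by
        rw [lintegral_lintegral_swap]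
        have : Continuous fun z : E d × ℝ => 2 * ‖fderiv ℝ u (x + z.2 • (z.1 - x))‖ₑ := by
          refine ENNReal.continuous_const_mul (by simp) |>.comp ?_
          fun_prop
        exact this.aemeasurable
    _ ≤ _ := by
        rw [ballPotential, ← lintegral_const_mul' _ _ (by simp)]
        refine add_le_add le_rfl (setLIntegral_mono' measurableSet_Ioc fun t ht => ?_)
        rw [lintegral_const_mul' _ _ (by simp)]
        refine mul_le_mul' le_rfl ?_
        set F : E d → ENNReal := (Metric.ball (0 : E d) 1).indicator
          ((Metric.ball x (2 * t)).indicator fun w => ‖fderiv ℝ u w‖ₑ) with hF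
        have hFm : Measurable F := (hm.indicator measurableSet_ball).indicator measurableSet_ball
        have h1 : ∫⁻ y in Metric.ball (0 : E d) 1, ‖fderiv ℝ u (x + t • (y - x))‖ₑ ≤
            ∫⁻ y, F ((x - t • x) + t • y) := by
          rw [← lintegral_indicator measurableSet_ball]
          refine lintegral_mono fun y => ?_
          by_cases hy : y ∈ Metric.ball (0 : E d) 1
          · have e : (x - t • x) + t • y = x + t • (y - x) := by rw [smul_sub]; abel
            have e2 : x + t • (y - x) ∈ Metric.ball (0 : E d) 1 :=
              (convex_ball (0 : E d) 1).add_smul_sub_mem hx hy ⟨ht.1.le, ht.2⟩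
            have e3 : x + t • (y - x) ∈ Metric.ball x (2 * t) := by
              rw [mem_ball_iff_norm, add_sub_cancel_left, norm_smul, Real.norm_of_nonneg ht.1.le]
              rw [mem_ball_zero_iff] at hx hy
              nlinarith [norm_sub_le y x, ht.1]
            rw [Set.indicator_of_mem hy, e, hF, Set.indicator_of_mem e2, Set.indicator_of_mem e3]
          · rw [Set.indicator_of_notMem hy]; exact zero_le
        refine h1.trans ?_
        rw [lintegral_comp_affine F hFm _ ht.1, hF, lintegral_indicator measurableSet_ball,
          ← lintegral_const_mul _ (hm.indicator measurableSet_ball)]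

lemma lintegral_rpow_Ioc_lt_top {ε : ℝ} (hε : 0 < ε) :
    ∫⁻ t in Set.Ioc (0 : ℝ) 1, ENNReal.ofReal t ^ (ε - 1) < ⊤ := by
  have h : IntegrableOn (fun t : ℝ => t ^ (ε - 1)) (Set.Ioc 0 1) := by
    have := intervalIntegral.intervalIntegrable_rpow' (a := 0) (b := 1) (r := ε - 1) (by linarith)
    rwa [intervalIntegrable_iff_integrableOn_Ioc_of_le zero_le_one] at this
  have h2 := h.lintegral_lt_top
  refine lt_of_eq_of_lt ?_ h2
  refine setLIntegral_congr_fun measurableSet_Ioc fun t ht => ?_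
  exact ENNReal.ofReal_rpow_of_pos ht.1

/-- The volume (2t)^d cancels t^{-d}. The value does not depend on the centre, so one constant
serves for integrals in either variable of the kernel. -/
lemma lintegral_volume_ball (ε : ℝ) (x : E d) : ∫⁻ t in Set.Ioc (0 : ℝ) 1,
    ENNReal.ofReal t ^ (ε - 1 - d) * volume (Metric.ball x (2 * t)) =
    (∫⁻ t in Set.Ioc (0 : ℝ) 1, ENNReal.ofReal t ^ (ε - 1)) *
      (ENNReal.ofReal 2 ^ (d : ℝ) * volume (Metric.ball (0 : E d) 1)) := by
  rw [← lintegral_mul_const']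
  · refine setLIntegral_congr_fun measurableSet_Ioc fun t ht => ?_
    have h0 : ENNReal.ofReal t ≠ 0 := by simpa using ht.1
    rw [volume_ball_eq x (by linarith [ht.1] : 0 < 2 * t), ENNReal.ofReal_mul zero_le_two,
      ENNReal.mul_rpow_of_nonneg _ _ (by positivity), ENNReal.rpow_sub _ _ h0 (by simp)]
    rw [div_eq_mul_inv]
    have h1 : (ENNReal.ofReal t ^ (d : ℝ))⁻¹ * ENNReal.ofReal t ^ (d : ℝ) = 1 :=
      ENNReal.inv_mul_cancel (by simp [ht.1]) (by simp)
    calc _ = ENNReal.ofReal t ^ (ε - 1) * (ENNReal.ofReal 2 ^ (d : ℝ) *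
          volume (Metric.ball (0 : E d) 1)) *
          ((ENNReal.ofReal t ^ (d : ℝ))⁻¹ * ENNReal.ofReal t ^ (d : ℝ)) := by ring
      _ = _ := by rw [h1, mul_one]
  · exact ENNReal.mul_ne_top (by simp) measure_ball_lt_top.ne

-- A Young-type inequality obtained from Hölder in the variables (t, w) with the three exponents s',
-- 1 - s and s - s', whose sum is 1. The factor `f0` carries the dependence on x and on g and is
-- integrated over x afterwards; `f1` is the kernel alone, with mass at most `K`; `f2` depends on g
-- alone and brings in `J`.
set_option maxHeartbeats 1000000 in
lemma exists_ballPotential_le {s s' ε : ℝ} (hs1 : s ≤ 1) (hs' : 0 ≤ s') (hss : s' < s)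
    (hε : ε = 1 - d * (s - s')) {J K : ENNReal} (hKt : K ≠ ⊤)
    (hJ : J = ∫⁻ t in Set.Ioc (0 : ℝ) 1, ENNReal.ofReal t ^ (ε - 1))
    (hrad : ∀ x : E d, ∫⁻ t in Set.Ioc (0 : ℝ) 1,
      ENNReal.ofReal t ^ (ε - 1 - d) * volume (Metric.ball x (2 * t)) = K)
    (g : E d → ENNReal) (hg : Measurable g) : ∃ F : E d → ENNReal, Measurable F ∧
      (∫⁻ x in Metric.ball (0 : E d) 1, F x ≤
        K * ∫⁻ w in Metric.ball (0 : E d) 1, g w ^ (1 / s)) ∧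
      ∀ x, ballPotential g x ≤ F x ^ s' *
        (K ^ (1 - s) * (J * ∫⁻ w in Metric.ball (0 : E d) 1, g w ^ (1 / s)) ^ (s - s')) := by
  have hs0 : 0 < s := by linarith
  set α : ℝ := ε - 1 - d with hα
  set B := Metric.ball (0 : E d) 1 with hB
  set μ := (volume.restrict (Set.Ioc (0 : ℝ) 1)).prod (volume.restrict B) with hμ
  set f0 : E d → ℝ × E d → ENNReal := fun x z => ENNReal.ofReal z.1 ^ α *
    {z : ℝ × E d | z.2 ∈ Metric.ball x (2 * z.1)}.indicator (fun z => g z.2 ^ (1 / s)) z with hf0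
  set f1 : E d → ℝ × E d → ENNReal := fun x z => ENNReal.ofReal z.1 ^ α *
    {z : ℝ × E d | z.2 ∈ Metric.ball x (2 * z.1)}.indicator 1 z with hf1
  set f2 : ℝ × E d → ENNReal := fun z => ENNReal.ofReal z.1 ^ (ε - 1) * g z.2 ^ (1 / s) with hf2
  have mτ : ∀ a : ℝ, Measurable fun z : ℝ × E d => ENNReal.ofReal z.1 ^ a := fun a => by fun_prop
  have mg : Measurable fun z : ℝ × E d => g z.2 ^ (1 / s) := by fun_prop
  have m0 : ∀ x, Measurable (f0 x) := fun x =>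
    (mτ α).mul (mg.indicator (measurableSet_ballPair x))
  have m1 : ∀ x, Measurable (f1 x) := fun x =>
    (mτ α).mul (measurable_one.indicator (measurableSet_ballPair x))
  have m2 : Measurable f2 := (mτ _).mul mg
  have m0' : Measurable fun y : E d × (ℝ × E d) => f0 y.1 y.2 := by
    have hs : MeasurableSet {y : E d × (ℝ × E d) | y.2.2 ∈ Metric.ball y.1 (2 * y.2.1)} := by
      simp only [Metric.mem_ball]
      exact measurableSet_lt (by fun_prop) (by fun_prop)
    have : (fun y : E d × (ℝ × E d) => f0 y.1 y.2) = fun y => ENNReal.ofReal y.2.1 ^ α *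
        {y : E d × (ℝ × E d) | y.2.2 ∈ Metric.ball y.1 (2 * y.2.1)}.indicator
          (fun y => g y.2.2 ^ (1 / s)) y := by
      ext y
      simp only [hf0, Set.indicator, Set.mem_ofPred_eq]
    rw [this]
    exact (by fun_prop : Measurable fun y : E d × (ℝ × E d) => ENNReal.ofReal y.2.1 ^ α).mul
      ((by fun_prop : Measurable fun y : E d × (ℝ × E d) => g y.2.2 ^ (1 / s)).indicator hs)
  refine ⟨fun x => ∫⁻ z, f0 x z ∂μ, m0'.lintegral_prod_right', ?_, fun x => ?_⟩
  · rw [lintegral_lintegral_swap m0'.aemeasurable]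
    have h1 : ∀ z : ℝ × E d, ∫⁻ x in B, f0 x z ≤
        ENNReal.ofReal z.1 ^ α * (volume (Metric.ball z.2 (2 * z.1)) * g z.2 ^ (1 / s)) := by
      intro z
      -- The relation |x - w| < 2t is symmetric, so for fixed (t, w) the integral over x is at most
      -- the volume of a ball about w.
      have : ∀ x, f0 x z = ENNReal.ofReal z.1 ^ α *
          (Metric.ball z.2 (2 * z.1)).indicator (fun _ => g z.2 ^ (1 / s)) x := by
        intro x
        simp only [hf0, Set.indicator, Set.mem_ofPred_eq, Metric.mem_ball, dist_comm]
      simp only [this]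
      rw [lintegral_const_mul _ (measurable_const.indicator measurableSet_ball),
        lintegral_indicator measurableSet_ball, setLIntegral_const, mul_comm (volume _)]
      gcongr
      exact Measure.restrict_le_self
    refine (lintegral_mono h1).trans ?_
    have mv : Measurable fun z : ℝ × E d => volume (Metric.ball z.2 (2 * z.1)) := by
      have : (fun z : ℝ × E d => volume (Metric.ball z.2 (2 * z.1))) =
          fun z => volume (Metric.ball (0 : E d) (2 * z.1)) := by
        ext z; exact Measure.addHaar_ball_center _ _ _
      rw [this]
      have hmono : Monotone fun r : ℝ => volume (Metric.ball (0 : E d) r) :=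
        fun a b hab => measure_mono (Metric.ball_subset_ball hab)
      exact hmono.measurable.comp (by fun_prop)
    rw [hμ, lintegral_prod_symm' (fun a : ℝ × E d => ENNReal.ofReal a.1 ^ α *
      (volume (Metric.ball a.2 (2 * a.1)) * g a.2 ^ (1 / s))) ((mτ α).mul (mv.mul mg)),
      ← lintegral_const_mul' _ _ hKt]
    refine lintegral_mono fun w => ?_
    simp only [← mul_assoc]
    rw [lintegral_mul_const]
    · rw [hrad w]
    · exact (by fun_prop : Measurable fun t : ℝ => ENNReal.ofReal t ^ α).mul
        ((Monotone.measurable fun a b hab => measure_mono (Metric.ball_subset_ball hab) :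
          Measurable fun r : ℝ => volume (Metric.ball w r)).comp (by fun_prop :
          Measurable fun t : ℝ => 2 * t))
  · have hb : ballPotential g x = ∫⁻ z, ENNReal.ofReal z.1 ^ (-(d : ℝ)) *
        {z : ℝ × E d | z.2 ∈ Metric.ball x (2 * z.1)}.indicator (fun z => g z.2) z ∂μ := by
      rw [hμ, lintegral_prod]
      · rfl
      · exact ((mτ _).mul ((hg.comp measurable_snd).indicator
          (measurableSet_ballPair x))).aemeasurable
    rw [hb]
    have hpos : ∀ᵐ z ∂μ, 0 < z.1 := by
      have : ∀ᵐ t ∂(volume.restrict (Set.Ioc (0 : ℝ) 1)), 0 < t :=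
        (ae_restrict_mem measurableSet_Ioc).mono fun t ht => ht.1
      exact Measure.quasiMeasurePreserving_fst.ae this
    have hold := ENNReal.lintegral_mul_prod_norm_pow_le (μ := μ) (Finset.univ : Finset (Fin 2))
      (g := f0 x) (f := ![f1 x, f2]) (m0 x).aemeasurable
      (by intro i _; fin_cases i; exacts [(m1 x).aemeasurable, m2.aemeasurable]) s'
      (p := ![1 - s, s - s']) (by simp) hs'
      (by intro i _; fin_cases i <;> simp <;> linarith)
    simp only [Fin.prod_univ_two, Matrix.cons_val_zero, Matrix.cons_val_one] at hold
    refine le_trans (lintegral_mono_ae ?_) (hold.trans ?_)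
    · filter_upwards [hpos] with z hz
      by_cases hzx : z ∈ {z : ℝ × E d | z.2 ∈ Metric.ball x (2 * z.1)}
      · simp only [hf0, hf1, hf2, Set.indicator_of_mem hzx, Pi.one_apply, mul_one]
        have h0 : ENNReal.ofReal z.1 ≠ 0 := by simpa using hz
        have ht : ENNReal.ofReal z.1 ≠ ⊤ := by simp
        rw [ENNReal.mul_rpow_of_nonneg _ _ hs', ENNReal.mul_rpow_of_nonneg _ _ (by linarith :
          0 ≤ s - s'), ← ENNReal.rpow_mul, ← ENNReal.rpow_mul, ← ENNReal.rpow_mul,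
          ← ENNReal.rpow_mul, ← ENNReal.rpow_mul]
        -- The powers of t add up to -d exactly because d(s - s') = 1 - ε.
        have e1 : ENNReal.ofReal z.1 ^ (-(d : ℝ)) = ENNReal.ofReal z.1 ^ (α * s') *
            ENNReal.ofReal z.1 ^ (α * (1 - s)) * ENNReal.ofReal z.1 ^ ((ε - 1) * (s - s')) := by
          rw [← ENNReal.rpow_add _ _ h0 ht, ← ENNReal.rpow_add _ _ h0 ht]
          congr 1
          rw [hα, hε]; ring
        have e2 : g z.2 = g z.2 ^ (1 / s * s') * g z.2 ^ (1 / s * (s - s')) := by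
          rw [← ENNReal.rpow_add_of_nonneg _ _ (by positivity)
            (mul_nonneg (by positivity) (by linarith)), ← mul_add]
          have : 1 / s * (s' + (s - s')) = 1 := by field_simp; ring
          rw [this, ENNReal.rpow_one]
        conv_lhs => rw [e1, e2]
        apply le_of_eq
        ring
      · simp only [Set.indicator_of_notMem hzx, mul_zero]; exact zero_le
    · refine mul_le_mul' le_rfl (mul_le_mul' (ENNReal.rpow_le_rpow ?_ (by linarith))
        (ENNReal.rpow_le_rpow ?_ (by linarith)))
      · rw [hμ, lintegral_prod _ (m1 x).aemeasurable, ← hrad x]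
        refine lintegral_mono fun t => ?_
        simp only [hf1]
        have : ∀ y, {z : ℝ × E d | z.2 ∈ Metric.ball x (2 * z.1)}.indicator
            (1 : ℝ × E d → ENNReal) (t, y) = (Metric.ball x (2 * t)).indicator 1 y := by
          intro y; simp [Set.indicator]
        simp only [this]
        rw [lintegral_const_mul _ (measurable_one.indicator measurableSet_ball),
          lintegral_indicator_one measurableSet_ball]
        gcongr
        exact Measure.restrict_le_self
      · rw [hμ, lintegral_prod _ m2.aemeasurable]
        simp only [hf2]
        rw [hJ, ← lintegral_mul_const]
        · refine lintegral_mono fun t => ?_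
          rw [lintegral_const_mul _ (by fun_prop)]
        · fun_prop

/-- Mapping properties of the potential between Lebesgue spaces on the unit ball. -/
lemma exists_eLpNorm_ballPotential_le (s s' : ℝ) (hs1 : s ≤ 1) (hs' : 0 ≤ s') (hss : s' < s)
    (hd : (d : ℝ) * (s - s') < 1) :
    ∃ C : NNReal, ∀ g : E d → ENNReal, Measurable g →
      eLpNorm (ballPotential g) (ENNReal.ofReal s')⁻¹ (volume.restrict (Metric.ball (0 : E d) 1)) ≤
        C * eLpNorm g (ENNReal.ofReal s)⁻¹ (volume.restrict (Metric.ball (0 : E d) 1)) := by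
  set B := Metric.ball (0 : E d) 1 with hB
  set ε : ℝ := 1 - d * (s - s') with hε
  have hε0 : 0 < ε := by linarith
  have hs0 : 0 < s := by linarith
  set J := ∫⁻ t in Set.Ioc (0 : ℝ) 1, ENNReal.ofReal t ^ (ε - 1) with hJ
  have hJt : J ≠ ⊤ := (lintegral_rpow_Ioc_lt_top hε0).ne
  have hVt : volume B ≠ ⊤ := measure_ball_lt_top.ne
  set K := J * (ENNReal.ofReal 2 ^ (d : ℝ) * volume B) with hK
  have hKt : K ≠ ⊤ := ENNReal.mul_ne_top hJt (ENNReal.mul_ne_top (by simp) hVt)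
  have hrad : ∀ x : E d, _ = K := lintegral_volume_ball ε
  have main := exists_ballPotential_le hs1 hs' hss hε hKt hJ hrad
  have hLs : ∀ g : E d → ENNReal, eLpNorm g (ENNReal.ofReal s)⁻¹ (volume.restrict B) =
      (∫⁻ w in B, g w ^ (1 / s)) ^ s := by
    intro g
    rw [eLpNorm_eq_lintegral_rpow_enorm_toReal (by simp) (by simpa using hs0)]
    simp [ENNReal.toReal_inv, ENNReal.toReal_ofReal hs0.le]
  set C0 : ENNReal := K ^ s' * (K ^ (1 - s) * J ^ (s - s')) with hC0
  have hC0t : C0 ≠ ⊤ := by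
    refine ENNReal.mul_ne_top ?_ (ENNReal.mul_ne_top ?_ ?_)
    · exact ENNReal.rpow_ne_top_of_nonneg hs' hKt
    · exact ENNReal.rpow_ne_top_of_nonneg (by linarith) hKt
    · exact ENNReal.rpow_ne_top_of_nonneg (by linarith) hJt
  refine ⟨C0.toNNReal, fun g hg => ?_⟩
  rw [ENNReal.coe_toNNReal hC0t, hLs]
  obtain ⟨F, hFm, hF1, hF2⟩ := main g hg
  set G := ∫⁻ w in B, g w ^ (1 / s) with hG
  have hGs : G ^ s = G ^ s' * G ^ (s - s') := by
    rw [← ENNReal.rpow_add_of_nonneg _ _ hs' (by linarith)]; congr 1; ring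
  -- For s' = 0 the target is `L^∞`: the factor `F x ^ s'` is 1 and the pointwise bound is already
  -- the claim.
  rcases hs'.eq_or_lt with h0 | h0
  · rw [← h0]
    simp only [ENNReal.ofReal_zero, ENNReal.inv_zero, eLpNorm_exponent_top]
    refine eLpNormEssSup_le_of_ae_enorm_bound (.of_forall fun x => ?_)
    rw [enorm_eq_self]
    refine (hF2 x).trans (le_of_eq ?_)
    rw [hC0, hGs, ← h0]
    simp only [ENNReal.rpow_zero, one_mul, sub_zero]
    rw [ENNReal.mul_rpow_of_nonneg _ _ hs0.le]
    ring
  · rw [eLpNorm_eq_lintegral_rpow_enorm_toReal (by simp) (by simpa using h0)]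
    simp only [enorm_eq_self, ENNReal.toReal_inv, ENNReal.toReal_ofReal h0.le, one_div, inv_inv]
    set c := K ^ (1 - s) * (J * G) ^ (s - s') with hc
    calc (∫⁻ x in B, ballPotential g x ^ s'⁻¹) ^ s'
        ≤ (∫⁻ x in B, (F x ^ s' * c) ^ s'⁻¹) ^ s' := by
          gcongr with x; exact hF2 x
      _ = (∫⁻ x in B, F x * c ^ s'⁻¹) ^ s' := by
          congr 1
          refine lintegral_congr fun x => ?_
          rw [ENNReal.mul_rpow_of_nonneg _ _ (by positivity), ← ENNReal.rpow_mul,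
            mul_inv_cancel₀ h0.ne', ENNReal.rpow_one]
      _ = (∫⁻ x in B, F x) ^ s' * c := by
          rw [lintegral_mul_const _ hFm, ENNReal.mul_rpow_of_nonneg _ _ hs', ← ENNReal.rpow_mul,
            inv_mul_cancel₀ h0.ne', ENNReal.rpow_one]
      _ ≤ (K * G) ^ s' * c := by gcongr
      _ = C0 * G ^ s := by
          rw [hc, hC0, hGs, ENNReal.mul_rpow_of_nonneg _ _ hs',
            ENNReal.mul_rpow_of_nonneg _ _ (by linarith : 0 ≤ s - s')]
          ring

lemma enorm_fderiv_le_sum (u : E d → ℝ) (w : E d) :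
    ‖fderiv ℝ u w‖ₑ ≤ ∑ i, ‖pderiv i u w‖ₑ := by
  have h : ‖fderiv ℝ u w‖ ≤ ∑ i, ‖pderiv i u w‖ := by
    refine ContinuousLinearMap.opNorm_le_bound _ (by positivity) fun v => ?_
    have hv : v = ∑ i, v i • EuclideanSpace.single i (1 : ℝ) := by
      have := (EuclideanSpace.basisFun (Fin d) ℝ).sum_repr v
      simpa using this.symm
    calc ‖fderiv ℝ u w v‖ = ‖∑ i, v i * pderiv i u w‖ := by
          conv_lhs => rw [hv]
          simp [pderiv]
      _ ≤ ∑ i, ‖v i * pderiv i u w‖ := norm_sum_le _ _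
      _ ≤ ∑ i, ‖pderiv i u w‖ * ‖v‖ := by
          refine Finset.sum_le_sum fun i _ => ?_
          rw [norm_mul, mul_comm]
          gcongr
          exact PiLp.norm_apply_le v i
      _ = _ := by rw [Finset.sum_mul]
  rw [← ofReal_norm]
  refine (ENNReal.ofReal_le_ofReal h).trans ?_
  rw [ENNReal.ofReal_sum_of_nonneg (fun i _ => norm_nonneg _)]
  simp [Real.enorm_eq_ofReal_abs]

/-- First-order Sobolev embedding on the unit ball. -/
lemma exists_eLpNorm_le_of_gradient (s s' : ℝ) (hs1 : s ≤ 1) (hs' : 0 ≤ s') (hss : s' < s)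
    (hd : (d : ℝ) * (s - s') < 1) :
    ∃ C : NNReal, ∀ u : E d → ℝ, ContDiff ℝ ∞ u →
      eLpNorm u (ENNReal.ofReal s')⁻¹ (volume.restrict (Metric.ball (0 : E d) 1)) ≤
        C * (eLpNorm u (ENNReal.ofReal s)⁻¹ (volume.restrict (Metric.ball (0 : E d) 1)) +
          ∑ i, eLpNorm (pderiv i u) (ENNReal.ofReal s)⁻¹
            (volume.restrict (Metric.ball (0 : E d) 1))) := by
  obtain ⟨C, hC⟩ := exists_eLpNorm_ballPotential_le (d := d) s s' hs1 hs' hss hd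
  set B := Metric.ball (0 : E d) 1 with hB
  set Q := (ENNReal.ofReal s)⁻¹ with hQ
  set Q' := (ENNReal.ofReal s')⁻¹ with hQ'
  have hQ1 : 1 ≤ Q := by
    rw [hQ, ENNReal.one_le_inv]
    simpa using hs1
  have hQ1' : 1 ≤ Q' := by
    rw [hQ', ENNReal.one_le_inv]
    simp; linarith
  set V := volume B with hV
  have hV0 : V ≠ 0 := volume_unitBall_ne_zero
  have hVt : V ≠ ⊤ := measure_ball_lt_top.ne
  set c1 : ENNReal := V ^ (1 / (1 : ENNReal).toReal - 1 / Q.toReal) with hc1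
  set c2 : ENNReal := eLpNorm (fun _ : E d => (1 : ℝ)) Q' (volume.restrict B) with hc2
  have hc1t : c1 ≠ ⊤ := ENNReal.rpow_ne_top_of_ne_zero hV0 hVt
  have hc2t : c2 ≠ ⊤ := by
    have : IsFiniteMeasure (volume.restrict B) := ⟨by simpa using measure_ball_lt_top⟩
    exact (memLp_const (1 : ℝ)).eLpNorm_lt_top.ne
  set D : ENNReal := V⁻¹ * (c1 * c2 + 2 * C) with hD
  have hDt : D ≠ ⊤ := ENNReal.mul_ne_top (ENNReal.inv_ne_top.2 hV0)
    (ENNReal.add_ne_top.2 ⟨ENNReal.mul_ne_top hc1t hc2t, ENNReal.mul_ne_top (by simp) (by simp)⟩)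
  refine ⟨D.toNNReal, fun u hu => ?_⟩
  rw [ENNReal.coe_toNNReal hDt]
  have hcf : Continuous (fderiv ℝ u) := hu.continuous_fderiv (by simp)
  have hm : Measurable fun w => ‖fderiv ℝ u w‖ₑ := hcf.enorm.measurable
  set A : ENNReal := ∫⁻ y in B, ‖u y‖ₑ with hA
  set g : E d → ENNReal := fun w => ‖fderiv ℝ u w‖ₑ with hg
  have hA1 : A ≤ eLpNorm u Q (volume.restrict B) * c1 := by
    have := eLpNorm_le_eLpNorm_mul_rpow_measure_univ (μ := volume.restrict B) hQ1
      hu.continuous.aestronglyMeasurable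
    rwa [eLpNorm_one_eq_lintegral_enorm, Measure.restrict_apply_univ] at this
  have hg1 : eLpNorm g Q (volume.restrict B) ≤ ∑ i, eLpNorm (pderiv i u) Q (volume.restrict B) := by
    have h1 : eLpNorm g Q (volume.restrict B) ≤
        eLpNorm (fun w => ∑ i, ‖pderiv i u w‖) Q (volume.restrict B) := by
      refine eLpNorm_mono_enorm fun w => ?_
      rw [hg, enorm_eq_self]
      refine (enorm_fderiv_le_sum u w).trans (le_of_eq ?_)
      rw [← ofReal_norm, Real.norm_of_nonneg (Finset.sum_nonneg fun i _ => norm_nonneg _),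
        ENNReal.ofReal_sum_of_nonneg (fun i _ => norm_nonneg _)]
      simp [Real.enorm_eq_ofReal_abs]
    refine h1.trans ?_
    have h2 := eLpNorm_sum_le (μ := volume.restrict B) (p := Q) (s := Finset.univ)
      (f := fun (i : Fin d) (w : E d) => ‖pderiv i u w‖)
      (fun i _ => (contDiff_pderiv hu i).continuous.norm.aestronglyMeasurable) hQ1
    have h3 : (fun w => ∑ i, ‖pderiv i u w‖) = ∑ i, fun w => ‖pderiv i u w‖ := by
      ext w; simp
    rw [h3]
    refine h2.trans (le_of_eq ?_)
    refine Finset.sum_congr rfl fun i _ => eLpNorm_norm _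
  have hT := hC g hm
  have hstep : eLpNorm u Q' (volume.restrict B) ≤
      eLpNorm (fun x => V⁻¹ * A + V⁻¹ * 2 * ballPotential g x) Q' (volume.restrict B) := by
    refine eLpNorm_mono_enorm_ae ?_
    filter_upwards [ae_restrict_mem measurableSet_ball] with x hx
    rw [enorm_eq_self]
    have := mul_enorm_le_ballPotential hu hx
    calc ‖u x‖ₑ = V⁻¹ * (V * ‖u x‖ₑ) := by
          rw [← mul_assoc, ENNReal.inv_mul_cancel hV0 hVt, one_mul]
      _ ≤ V⁻¹ * (A + 2 * ballPotential g x) := by gcongr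
      _ = _ := by ring
  have hmT : Measurable (ballPotential g) := by
    unfold ballPotential
    have hs : MeasurableSet {y : (E d × ℝ) × E d | y.2 ∈ Metric.ball y.1.1 (2 * y.1.2)} := by
      simp only [Metric.mem_ball]
      exact measurableSet_lt (by fun_prop) (by fun_prop)
    have h1 : Measurable fun y : (E d × ℝ) × E d => ENNReal.ofReal y.1.2 ^ (-(d : ℝ)) *
        {y : (E d × ℝ) × E d | y.2 ∈ Metric.ball y.1.1 (2 * y.1.2)}.indicator
          (fun y => g y.2) y :=
      (by fun_prop : Measurable fun y : (E d × ℝ) × E d => ENNReal.ofReal y.1.2 ^ (-(d : ℝ))).mul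
        ((hm.comp measurable_snd).indicator hs)
    have h2 := h1.lintegral_prod_right' (ν := volume.restrict B)
    have h3 := h2.lintegral_prod_right' (ν := volume.restrict (Set.Ioc (0 : ℝ) 1))
    exact h3
  refine hstep.trans ((eLpNorm_add_le aestronglyMeasurable_const
    (hmT.const_mul _).aestronglyMeasurable hQ1').trans ?_)
  have hconst : eLpNorm (fun _ : E d => V⁻¹ * A) Q' (volume.restrict B) ≤ V⁻¹ * A * c2 := by
    have h := eLpNorm_le_mul_eLpNorm_of_ae_le_mul'' (μ := volume.restrict B) Q' (c := V⁻¹ * A)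
      (f := fun _ : E d => V⁻¹ * A) (g := fun _ : E d => (1 : ℝ))
      (aestronglyMeasurable_const) (.of_forall fun x => by simp)
    exact h
  have hpot : eLpNorm (fun x => V⁻¹ * 2 * ballPotential g x) Q' (volume.restrict B) ≤
      V⁻¹ * 2 * eLpNorm (ballPotential g) Q' (volume.restrict B) :=
    eLpNorm_le_mul_eLpNorm_of_ae_le_mul'' Q' (hmT.aestronglyMeasurable)
      (.of_forall fun x => by simp)
  calc _ ≤ V⁻¹ * (eLpNorm u Q (volume.restrict B) * c1) * c2 + V⁻¹ * 2 * (C *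
        ∑ i, eLpNorm (pderiv i u) Q (volume.restrict B)) := by
        refine add_le_add (hconst.trans (by gcongr)) (hpot.trans ?_)
        gcongr
        exact hT.trans (by gcongr)
    _ = V⁻¹ * (c1 * c2) * eLpNorm u Q (volume.restrict B) + V⁻¹ * (2 * C) *
        ∑ i, eLpNorm (pderiv i u) Q (volume.restrict B) := by ring
    _ ≤ D * eLpNorm u Q (volume.restrict B) + D *
        ∑ i, eLpNorm (pderiv i u) Q (volume.restrict B) := by
        rw [hD]
        gcongr
        · exact le_self_add
        · exact le_add_self
    _ = _ := by rw [mul_add]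

end Riesz

end AsymptoticSpaces
end

/-! ### Sobolev multiplication on balls for smooth functions -/

noncomputable section
namespace AsymptoticSpaces

variable {d : ℕ}

section Smooth

/-- Local Sobolev norm of a smooth function on the ball `B(x,ρ)`, where each derivative carries a
factor `ρ`. -/
def smoothBallNorm (p : ℝ) (x : E d) (ρ : ℝ) : ℕ → (E d → ℝ) → ENNReal
  | 0, u => eLpNorm u (ENNReal.ofReal p) (volume.restrict (Metric.ball x ρ))
  | a + 1, u => eLpNorm u (ENNReal.ofReal p) (volume.restrict (Metric.ball x ρ)) +
      ENNReal.ofReal ρ * ∑ i, smoothBallNorm p x ρ a (pderiv i u)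

variable {p : ℝ}

lemma smoothBallNorm_le_succ (x : E d) (ρ : ℝ) (a : ℕ) (u : E d → ℝ) :
    smoothBallNorm p x ρ a u ≤ smoothBallNorm p x ρ (a + 1) u := by
  induction a generalizing u with
  | zero => exact le_self_add
  | succ a ih =>
    rw [smoothBallNorm, smoothBallNorm]
    gcongr
    exact ih _

lemma smoothBallNorm_mono (x : E d) (ρ : ℝ) {a b : ℕ} (hab : a ≤ b) (u : E d → ℝ) :
    smoothBallNorm p x ρ a u ≤ smoothBallNorm p x ρ b u :=
  monotone_nat_of_le_succ (f := fun a => smoothBallNorm p x ρ a u)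
    (fun a => smoothBallNorm_le_succ x ρ a u) hab

/-- Sobolev embedding on the unit ball along the exponents `1/q_j = (1 - j/m)/p`. -/
lemma exists_eLpNorm_le_smoothBallNorm (hp : 1 < p) {m : ℕ} (hm : (d : ℝ) / p < m) (j : ℕ)
    (hj : j ≤ m) : ∃ C : NNReal, ∀ u : E d → ℝ, ContDiff ℝ ∞ u →
      eLpNorm u (ENNReal.ofReal (1 / p * (1 - j / m)))⁻¹
        (volume.restrict (Metric.ball (0 : E d) 1)) ≤ C * smoothBallNorm p 0 1 j u := by
  have hp0 : 0 < p := by linarith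
  have hm0 : (0 : ℝ) < m := lt_of_le_of_lt (by positivity) hm
  induction j with
  | zero =>
    refine ⟨1, fun u _ => ?_⟩
    simp [smoothBallNorm, ENNReal.ofReal_inv_of_pos hp0]
  | succ j ih =>
    obtain ⟨C, hC⟩ := ih (by omega)
    have hjm : ((j + 1 : ℕ) : ℝ) ≤ m := by exact_mod_cast hj
    -- Consecutive reciprocal exponents differ by `1 / (p * m)`, so the condition d(s - s') < 1 of
    -- the first-order embedding is d/p < m at every step.
    have hdiff : 1 / p * (1 - (j : ℝ) / m) - 1 / p * (1 - ((j + 1 : ℕ) : ℝ) / m) = 1 / (p * m) := by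
      push_cast; field_simp; ring
    obtain ⟨C', hC'⟩ := exists_eLpNorm_le_of_gradient (d := d) (1 / p * (1 - j / m))
      (1 / p * (1 - (j + 1 : ℕ) / m))
      (by
        have h1 : 1 / p ≤ 1 := by rw [div_le_one hp0]; exact hp.le
        have h2 : 1 - (j : ℝ) / m ≤ 1 := by
          have : 0 ≤ (j : ℝ) / m := by positivity
          linarith
        have h3 : (j : ℝ) / m ≤ 1 := by
          rw [div_le_one hm0]; push_cast at hjm; linarith
        calc 1 / p * (1 - (j : ℝ) / m) ≤ 1 * 1 := by
              apply mul_le_mul h1 h2 (by linarith) (by norm_num)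
          _ = 1 := one_mul 1)
      (mul_nonneg (by positivity) (by
        have : ((j + 1 : ℕ) : ℝ) / m ≤ 1 := by rw [div_le_one hm0]; exact hjm
        linarith))
      (by
        have : 0 < 1 / (p * m) := by positivity
        linarith)
      (by
        rw [hdiff, mul_one_div, div_lt_one (by positivity)]
        rw [div_lt_iff₀ hp0] at hm
        linarith)
    refine ⟨C' * (C * 2), fun u hu => (hC' u hu).trans ?_⟩
    rw [ENNReal.coe_mul, mul_assoc]
    gcongr
    rw [ENNReal.coe_mul, mul_assoc]
    calc _ ≤ C * smoothBallNorm p 0 1 j u + ∑ i, C * smoothBallNorm p 0 1 j (pderiv i u) := by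
          gcongr with i
          · exact hC u hu
          · exact hC _ (contDiff_pderiv hu i)
      _ = C * (smoothBallNorm p 0 1 j u + ∑ i, smoothBallNorm p 0 1 j (pderiv i u)) := by
          rw [mul_add, Finset.mul_sum]
      _ ≤ _ := by
          gcongr (C : ENNReal) * ?_
          rw [ENNReal.coe_ofNat, two_mul]
          refine add_le_add (smoothBallNorm_le_succ _ _ _ _) ?_
          rw [smoothBallNorm, ENNReal.ofReal_one, one_mul]
          exact le_add_self

/-- Hölder with 1/q_j + 1/q_{m-j} = 1/p, where u spends `j = min a m` derivatives and v the
remaining m - j ≤ b. When j is 0 or m one of the exponents is infinite, which the embedding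
includes. -/
lemma exists_eLpNorm_mul_le_unitBall (hp : 1 < p) {m : ℕ} (hm : (d : ℝ) / p < m) {a b : ℕ}
    (hab : m ≤ a + b) : ∃ C : NNReal, ∀ u v : E d → ℝ, ContDiff ℝ ∞ u → ContDiff ℝ ∞ v →
      eLpNorm (fun x => u x * v x) (ENNReal.ofReal p)
        (volume.restrict (Metric.ball (0 : E d) 1)) ≤
        C * (smoothBallNorm p 0 1 a u * smoothBallNorm p 0 1 b v) := by
  have hp0 : 0 < p := by linarith
  have hm0 : (0 : ℝ) < m := lt_of_le_of_lt (by positivity) hm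
  set j := min a m with hj
  have hjm : (j : ℝ) ≤ m := by exact_mod_cast min_le_right a m
  obtain ⟨C, hC⟩ := exists_eLpNorm_le_smoothBallNorm (d := d) hp hm j (min_le_right _ _)
  obtain ⟨C', hC'⟩ := exists_eLpNorm_le_smoothBallNorm (d := d) hp hm (m - j) (Nat.sub_le _ _)
  refine ⟨C * C', fun u v hu hv => ?_⟩
  have hcast : ((m - j : ℕ) : ℝ) = m - j := Nat.cast_sub (min_le_right _ _)
  have hmj : 1 - ((m - j : ℕ) : ℝ) / m = j / m := by
    rw [hcast]; field_simp; ring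
  have h1 : 0 ≤ 1 - (j : ℝ) / m := by
    have : (j : ℝ) / m ≤ 1 := by rw [div_le_one hm0]; exact hjm
    linarith
  have : ENNReal.HolderTriple (ENNReal.ofReal (1 / p * (1 - j / m)))⁻¹
      (ENNReal.ofReal (1 / p * (1 - (m - j : ℕ) / m)))⁻¹ (ENNReal.ofReal p) := by
    constructor
    rw [inv_inv, inv_inv, hmj, ← ENNReal.ofReal_add (by positivity) (by positivity),
      ← ENNReal.ofReal_inv_of_pos hp0]
    congr 1
    field_simp; ring
  have h := eLpNorm_smul_le_mul_eLpNorm (μ := volume.restrict (Metric.ball (0 : E d) 1))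
    (p := (ENNReal.ofReal (1 / p * (1 - j / m)))⁻¹)
    (q := (ENNReal.ofReal (1 / p * (1 - (m - j : ℕ) / m)))⁻¹) (r := ENNReal.ofReal p)
    hv.continuous.aestronglyMeasurable hu.continuous.aestronglyMeasurable
  refine h.trans ((mul_le_mul' (hC u hu) (hC' v hv)).trans ?_)
  rw [ENNReal.coe_mul, mul_mul_mul_comm]
  gcongr
  · exact smoothBallNorm_mono _ _ (min_le_left _ _) _
  · exact smoothBallNorm_mono _ _ (by omega) _

lemma eLpNorm_comp_affine (hp : 0 < p) {F : E d → ℝ} (hF : Continuous F) (x : E d) {ρ : ℝ}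
    (hρ : 0 < ρ) : eLpNorm (fun y => F (x + ρ • y)) (ENNReal.ofReal p)
      (volume.restrict (Metric.ball (0 : E d) 1)) = ENNReal.ofReal ρ ^ (-((d : ℝ) / p)) *
        eLpNorm F (ENNReal.ofReal p) (volume.restrict (Metric.ball x ρ)) := by
  have hP : ENNReal.ofReal p ≠ 0 := by simpa using hp
  rw [eLpNorm_eq_lintegral_rpow_enorm_toReal hP (by simp),
    eLpNorm_eq_lintegral_rpow_enorm_toReal hP (by simp), ENNReal.toReal_ofReal hp.le]
  set G : E d → ENNReal := (Metric.ball x ρ).indicator fun y => ‖F y‖ₑ ^ p with hG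
  have hGm : Measurable G := (hF.enorm.measurable.pow_const p).indicator measurableSet_ball
  have h1 : ∫⁻ y in Metric.ball (0 : E d) 1, ‖F (x + ρ • y)‖ₑ ^ p = ∫⁻ y, G (x + ρ • y) := by
    rw [← lintegral_indicator measurableSet_ball]
    congr 1
    ext y
    have : y ∈ Metric.ball (0 : E d) 1 ↔ x + ρ • y ∈ Metric.ball x ρ := by
      rw [mem_ball_zero_iff, mem_ball_iff_norm, add_sub_cancel_left, norm_smul,
        Real.norm_of_nonneg hρ.le]
      constructor
      · intro h; nlinarith
      · intro h; nlinarith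
    by_cases hy : y ∈ Metric.ball (0 : E d) 1
    · rw [hG, Set.indicator_of_mem hy, Set.indicator_of_mem (this.1 hy)]
    · rw [hG, Set.indicator_of_notMem hy, Set.indicator_of_notMem fun h => hy (this.2 h)]
  rw [h1, lintegral_comp_affine G hGm x hρ, hG, lintegral_indicator measurableSet_ball,
    ENNReal.mul_rpow_of_nonneg _ _ (by positivity), ← ENNReal.rpow_mul]
  congr 2
  ring

lemma pderiv_comp_affine {u : E d → ℝ} (hu : ContDiff ℝ ∞ u) (x : E d) (ρ c : ℝ) (i : Fin d) :
    pderiv i (fun y => c * u (x + ρ • y)) = fun y => (c * ρ) * pderiv i u (x + ρ • y) := by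
  ext y
  simp only [pderiv]
  have h1 : HasFDerivAt (fun y : E d => x + ρ • y) (ρ • ContinuousLinearMap.id ℝ (E d)) y :=
    ((hasFDerivAt_id y).const_smul ρ).const_add x
  have h2 := (hu.differentiable (by simp) (x + ρ • y)).hasFDerivAt.comp y h1
  have h3 : HasFDerivAt (fun y => c * u (x + ρ • y)) _ y := h2.const_mul c
  rw [h3.fderiv]
  simp
  ring

/-- Since each derivative in `smoothBallNorm` carries a factor ρ, the whole norm scales like the
`L^p` norm. The scalar `c` is there to absorb the factors of ρ that differentiation produces during
the induction. -/
lemma smoothBallNorm_comp_affine (hp : 0 < p) (x : E d) {ρ : ℝ} (hρ : 0 < ρ) (a : ℕ)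
    {u : E d → ℝ} (hu : ContDiff ℝ ∞ u) {c : ℝ} (hc : 0 ≤ c) :
    smoothBallNorm p 0 1 a (fun y => c * u (x + ρ • y)) =
      ENNReal.ofReal c * (ENNReal.ofReal ρ ^ (-((d : ℝ) / p)) * smoothBallNorm p x ρ a u) := by
  have h0 : ∀ {v : E d → ℝ} {c : ℝ}, ContDiff ℝ ∞ v → 0 ≤ c →
      eLpNorm (fun y => c * v (x + ρ • y)) (ENNReal.ofReal p)
        (volume.restrict (Metric.ball (0 : E d) 1)) = ENNReal.ofReal c *
        (ENNReal.ofReal ρ ^ (-((d : ℝ) / p)) *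
          eLpNorm v (ENNReal.ofReal p) (volume.restrict (Metric.ball x ρ))) := by
    intro v c hv hc
    rw [← eLpNorm_comp_affine hp hv.continuous x hρ]
    have := eLpNorm_const_smul c (fun y => v (x + ρ • y)) (ENNReal.ofReal p)
      (volume.restrict (Metric.ball (0 : E d) 1))
    rw [Real.enorm_of_nonneg hc] at this
    exact this
  induction a generalizing u c with
  | zero => exact h0 hu hc
  | succ a ih =>
    rw [smoothBallNorm, smoothBallNorm, h0 hu hc]
    simp only [pderiv_comp_affine hu]
    simp only [fun i => ih (contDiff_pderiv hu i) (mul_nonneg hc hρ.le)]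
    rw [ENNReal.ofReal_one, one_mul, ← Finset.mul_sum, ← Finset.mul_sum, ENNReal.ofReal_mul hc]
    ring

/-- Sobolev multiplication on a ball, for smooth functions. -/
lemma exists_eLpNorm_mul_le_ball (hp : 1 < p) {m : ℕ} (hm : (d : ℝ) / p < m) {a b : ℕ}
    (hab : m ≤ a + b) : ∃ C : NNReal, ∀ (x : E d) (ρ : ℝ), 0 < ρ → ∀ u v : E d → ℝ,
      ContDiff ℝ ∞ u → ContDiff ℝ ∞ v →
      eLpNorm (fun x => u x * v x) (ENNReal.ofReal p) (volume.restrict (Metric.ball x ρ)) ≤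
        C * ENNReal.ofReal ρ ^ (-((d : ℝ) / p)) *
          (smoothBallNorm p x ρ a u * smoothBallNorm p x ρ b v) := by
  have hp0 : 0 < p := by linarith
  obtain ⟨C, hC⟩ := exists_eLpNorm_mul_le_unitBall (d := d) hp hm hab
  refine ⟨C, fun x ρ hρ u v hu hv => ?_⟩
  have haff : ContDiff ℝ ∞ fun y : E d => x + ρ • y := by fun_prop
  have h := hC _ _ (hu.comp haff) (hv.comp haff)
  have hu1 := smoothBallNorm_comp_affine hp0 x hρ a hu zero_le_one
  have hv1 := smoothBallNorm_comp_affine hp0 x hρ b hv zero_le_one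
  simp only [one_mul, ENNReal.ofReal_one] at hu1 hv1
  have huv := eLpNorm_comp_affine hp0 (hu.continuous.mul hv.continuous) x hρ
  change eLpNorm (fun y => u (x + ρ • y) * v (x + ρ • y)) _ _ ≤
    C * (smoothBallNorm p 0 1 a (fun y => u (x + ρ • y)) *
      smoothBallNorm p 0 1 b (fun y => v (x + ρ • y))) at h
  rw [hu1, hv1] at h
  change eLpNorm (fun y => u (x + ρ • y) * v (x + ρ • y)) _ _ = _ at huv
  rw [huv] at h
  set K := ENNReal.ofReal ρ ^ (-((d : ℝ) / p)) with hK
  have hK0 : K ≠ 0 := by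
    rw [hK, ne_eq, ENNReal.rpow_eq_zero_iff]
    simp [hρ.not_ge]
  have hKt : K ≠ ⊤ := ENNReal.rpow_ne_top_of_ne_zero (by simpa using hρ) (by simp)
  -- The scaling factor occurs once on the left and twice on the right; cancelling one copy leaves
  -- the factor ρ^{-d/p} of the statement.
  refine (ENNReal.mul_le_mul_iff_right hK0 hKt).1 (h.trans (le_of_eq ?_))
  ring

end Smooth

end AsymptoticSpaces
end

/-! ### Mollification and functions locally in `L^p` -/

noncomputable section
namespace AsymptoticSpaces

variable {d : ℕ}

section Mollify

/-- A bump function supported in the ball of radius `1/(k+1)`. -/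
def bump (d k : ℕ) : ContDiffBump (0 : E d) where
  rIn := 1 / (2 * ((k : ℝ) + 1))
  rOut := 1 / ((k : ℝ) + 1)
  rIn_pos := by positivity
  rIn_lt_rOut := by
    apply one_div_lt_one_div_of_lt (by positivity)
    have : (0 : ℝ) < (k : ℝ) + 1 := by positivity
    linarith

/-- The normalized bump function. -/
abbrev nbump (d k : ℕ) : E d → ℝ := (bump d k).normed volume

/-- Mollification of `u` at scale `1/(k+1)`. -/
def moll (k : ℕ) (u : E d → ℝ) : E d → ℝ :=
  convolution (nbump d k) u (ContinuousLinearMap.lsmul ℝ ℝ) volume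

lemma nbump_contDiff (k : ℕ) : ContDiff ℝ ∞ (nbump d k) := (bump d k).contDiff_normed

lemma nbump_compact (k : ℕ) : HasCompactSupport (nbump d k) := (bump d k).hasCompactSupport_normed

lemma moll_apply (k : ℕ) (u : E d → ℝ) (x : E d) : moll k u x = ∫ t, nbump d k t * u (x - t) := by
  simp [moll, convolution_def]

lemma moll_apply' (k : ℕ) (u : E d → ℝ) (x : E d) : moll k u x = ∫ y, nbump d k (x - y) * u y := by
  simp [moll, convolution_eq_swap]

lemma integrable_moll (k : ℕ) {u : E d → ℝ} (hu : LocallyIntegrable u volume) (x : E d) :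
    Integrable (fun t => nbump d k t * u (x - t)) volume := by
  have := (nbump_compact k).convolutionExists_left (ContinuousLinearMap.lsmul ℝ ℝ)
    (nbump_contDiff (d := d) k).continuous hu x
  simpa [ConvolutionExistsAt] using this

lemma moll_sub (k : ℕ) {u v : E d → ℝ} (hu : LocallyIntegrable u volume)
    (hv : LocallyIntegrable v volume) (x : E d) :
    moll k (fun x => u x - v x) x = moll k u x - moll k v x := by
  simp only [moll_apply, mul_sub]
  exact integral_sub (integrable_moll k hu x) (integrable_moll k hv x)

lemma contDiff_moll (k : ℕ) {u : E d → ℝ} (hu : LocallyIntegrable u volume) :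
    ContDiff ℝ ∞ (moll k u) :=
  (nbump_compact k).contDiff_convolution_left _ (nbump_contDiff k) hu

/-- The derivative first falls on the bump. As a function of y, `nbump d k (x - y)` is a test
function, and reflection changes the sign of its derivative, so the definition of the weak
derivative moves it onto u. -/
lemma pderiv_moll (k : ℕ) {u g : E d → ℝ} {i : Fin d} (h : WD i u g) :
    pderiv i (moll k u) = moll k g := by
  rw [wd_iff] at h
  ext x
  have h1 := (nbump_compact k).hasFDerivAt_convolution_left (ContinuousLinearMap.lsmul ℝ ℝ)
    ((nbump_contDiff (d := d) k).of_le (by simp)) h.1 x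
  have hint : Integrable (fun t => (ContinuousLinearMap.precompL (E d)
      (ContinuousLinearMap.lsmul ℝ ℝ)) (fderiv ℝ (nbump d k) t) (u (x - t))) volume :=
    ((nbump_compact k).fderiv (𝕜 := ℝ)).convolutionExists_left _
      ((nbump_contDiff (d := d) k).continuous_fderiv (by simp)) h.1 x
  have h2 : pderiv i (moll k u) x = ∫ t, pderiv i (nbump d k) t * u (x - t) := by
    rw [pderiv, moll, h1.fderiv, convolution_def, ContinuousLinearMap.integral_apply hint]
    simp [pderiv, ContinuousLinearMap.precompL_apply]
  rw [h2, moll_apply', ← integral_sub_left_eq_self _ volume x]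
  simp only [sub_sub_cancel]
  have ht : IsTest fun y => nbump d k (x - y) := by
    refine ⟨(nbump_contDiff k).comp (by fun_prop), ?_⟩
    exact (nbump_compact k).comp_homeomorph (Homeomorph.subLeft x)
  have h3 := h.2.2 _ ht
  have h4 : ∀ y, pderiv i (fun y => nbump d k (x - y)) y = - pderiv i (nbump d k) (x - y) := by
    intro y
    simp only [pderiv]
    have h5 : HasFDerivAt (fun y => nbump d k (x - y)) _ y :=
      ((nbump_contDiff (d := d) k).differentiable (by simp) (x - y)).hasFDerivAt.comp y
        ((hasFDerivAt_id y).const_sub x)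
    rw [h5.fderiv]
    simp
  simp only [h4, mul_neg, integral_neg, neg_inj] at h3
  calc ∫ y, pderiv i (nbump d k) (x - y) * u y = ∫ y, u y * pderiv i (nbump d k) (x - y) := by
        congr 1; ext y; ring
    _ = ∫ y, g y * nbump d k (x - y) := h3
    _ = _ := by congr 1; ext y; ring

variable {p : ℝ}

/-- Jensen's inequality for the probability density `nbump`, written as Hölder with weights 1/p and
1 - 1/p, followed by Tonelli and translation invariance. -/
lemma eLpNorm_moll_le (hp : 1 ≤ p) (k : ℕ) {f : E d → ℝ} (hf : AEStronglyMeasurable f volume) :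
    eLpNorm (moll k f) (ENNReal.ofReal p) volume ≤ eLpNorm f (ENNReal.ofReal p) volume := by
  have hp0 : 0 < p := by linarith
  wlog hfm : StronglyMeasurable f generalizing f
  · have h1 : moll k f = moll k (hf.mk f) :=
      convolution_congr _ (.refl _ _) hf.ae_eq_mk
    rw [h1, eLpNorm_congr_ae hf.ae_eq_mk]
    exact this hf.stronglyMeasurable_mk.aestronglyMeasurable hf.stronglyMeasurable_mk
  have hm : Measurable f := hfm.measurable
  have hP : ENNReal.ofReal p ≠ 0 := by simpa using hp0
  rw [eLpNorm_eq_lintegral_rpow_enorm_toReal hP (by simp),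
    eLpNorm_eq_lintegral_rpow_enorm_toReal hP (by simp), ENNReal.toReal_ofReal hp0.le]
  refine ENNReal.rpow_le_rpow ?_ (by positivity)
  set w : E d → ENNReal := fun t => ‖nbump d k t‖ₑ with hw
  have hwm : Measurable w := (nbump_contDiff k).continuous.enorm.measurable
  have hw1 : ∫⁻ t, w t = 1 := by
    have h1 := (bump d k).integral_normed (μ := (volume : Measure (E d)))
    have h2 := ofReal_integral_norm_eq_lintegral_enorm (bump d k).integrable_normed (μ := (volume : Measure (E d)))
    rw [hw, ← h2, ← ENNReal.ofReal_one, ← h1]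
    congr 2
    ext t
    exact Real.norm_of_nonneg ((bump d k).nonneg_normed t)
  have hm1 : ∀ x, Measurable fun t => ‖f (x - t)‖ₑ ^ p := fun x => by fun_prop
  have key : ∀ x, ‖moll k f x‖ₑ ^ p ≤ ∫⁻ t, w t * ‖f (x - t)‖ₑ ^ p := by
    intro x
    have h1 : ‖moll k f x‖ₑ ≤ ∫⁻ t, w t * ‖f (x - t)‖ₑ := by
      rw [moll_apply]
      refine (enorm_integral_le_lintegral_enorm _).trans (le_of_eq ?_)
      simp [hw, enorm_mul]
    have h2 := ENNReal.lintegral_mul_norm_pow_le (μ := (volume : Measure (E d)))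
      (f := fun t => w t * ‖f (x - t)‖ₑ ^ p) (g := w) (hwm.mul (hm1 x)).aemeasurable
      hwm.aemeasurable (p := 1 / p) (q := 1 - 1 / p) (by positivity)
      (by rw [sub_nonneg, div_le_one hp0]; exact hp) (by ring)
    rw [hw1, ENNReal.one_rpow, mul_one] at h2
    have h3 : ∀ t, w t * ‖f (x - t)‖ₑ =
        (w t * ‖f (x - t)‖ₑ ^ p) ^ (1 / p) * w t ^ (1 - 1 / p) := by
      intro t
      rw [ENNReal.mul_rpow_of_nonneg _ _ (by positivity), ← ENNReal.rpow_mul,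
        mul_one_div_cancel hp0.ne', ENNReal.rpow_one, mul_right_comm,
        ← ENNReal.rpow_add_of_nonneg _ _ (by positivity)
          (by rw [sub_nonneg, div_le_one hp0]; exact hp)]
      simp
    calc ‖moll k f x‖ₑ ^ p ≤ ((∫⁻ t, w t * ‖f (x - t)‖ₑ ^ p) ^ (1 / p)) ^ p := by
          gcongr
          refine h1.trans ?_
          simp only [h3]
          exact h2
      _ = _ := by rw [← ENNReal.rpow_mul, one_div_mul_cancel hp0.ne', ENNReal.rpow_one]
  calc ∫⁻ x, ‖moll k f x‖ₑ ^ p ≤ ∫⁻ x, ∫⁻ t, w t * ‖f (x - t)‖ₑ ^ p := lintegral_mono key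
    _ = ∫⁻ t, ∫⁻ x, w t * ‖f (x - t)‖ₑ ^ p := by
        rw [lintegral_lintegral_swap]
        exact ((hwm.comp measurable_snd).mul (by fun_prop)).aemeasurable
    _ = ∫⁻ t, w t * ∫⁻ x, ‖f x‖ₑ ^ p := by
        refine lintegral_congr fun t => ?_
        rw [lintegral_const_mul _ (by fun_prop), lintegral_sub_right_eq_self (fun x => ‖f x‖ₑ ^ p) t]
    _ = ∫⁻ x, ‖f x‖ₑ ^ p := by rw [lintegral_mul_const _ hwm, hw1, one_mul]

lemma rOut_bump_le (k : ℕ) : (bump d k).rOut ≤ 1 := by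
  change 1 / ((k : ℝ) + 1) ≤ 1
  rw [div_le_one (by positivity)]
  linarith [(Nat.cast_nonneg k : (0 : ℝ) ≤ k)]

lemma tendsto_rOut_bump : Tendsto (fun k => (bump d k).rOut) atTop (𝓝 0) :=
  tendsto_one_div_add_atTop_nhds_zero_nat

/-- All bumps are supported in the unit ball, so mollification is local at a scale independent of
`k`. -/
lemma moll_eq_of_eqOn (k : ℕ) {u v : E d → ℝ} {x : E d}
    (h : ∀ y ∈ Metric.ball x 1, u y = v y) : moll k u x = moll k v x := by
  simp only [moll_apply]
  congr 1
  ext t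
  by_cases ht : t ∈ Function.support (nbump d k)
  · rw [(bump d k).support_normed_eq, mem_ball_zero_iff] at ht
    rw [h]
    rw [mem_ball_iff_norm, sub_sub_cancel_left, norm_neg]
    exact ht.trans_le (rOut_bump_le k)
  · rw [Function.notMem_support.1 ht]; simp

/-- Uniform continuity gives uniform convergence, and all the differences live in the 1-thickening
of the support, a set of finite measure. -/
lemma tendsto_eLpNorm_moll_sub_of_continuous (hp : 1 ≤ p) {g : E d → ℝ} (hg : Continuous g)
    (hc : HasCompactSupport g) :
    Tendsto (fun k => eLpNorm (fun x => moll k g x - g x) (ENNReal.ofReal p) volume) atTop (𝓝 0) := by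
  have hp0 : 0 < p := by linarith
  set K := Metric.cthickening 1 (tsupport g) with hK
  have hKc : IsCompact K := hc.isCompact.cthickening
  have hVt : volume K ≠ ⊤ := hKc.measure_lt_top.ne
  have hsupp : ∀ k, Function.support (fun x => moll k g x - g x) ⊆ K := by
    intro k x hx
    by_contra hxK
    apply hx
    have h0 : ∀ y ∈ Metric.ball x 1, g y = 0 := by
      intro y hy
      by_contra hgy
      apply hxK
      refine Metric.mem_cthickening_of_dist_le x y 1 _ (subset_tsupport g hgy) ?_
      rw [dist_comm]; exact (Metric.mem_ball.1 hy).le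
    have h1 : moll k g x = moll k (fun _ => 0) x := moll_eq_of_eqOn k h0
    simp only
    rw [h1, h0 x (Metric.mem_ball_self one_pos), moll_apply]
    simp
  have huc := hc.uniformContinuous_of_continuous hg
  rw [ENNReal.tendsto_nhds_zero]
  intro ε hε
  -- uniform smallness on the compact set
  obtain ⟨δ, hδ, hδε⟩ : ∃ δ : ℝ, 0 < δ ∧
      volume K ^ (ENNReal.ofReal p).toReal⁻¹ * ENNReal.ofReal δ ≤ ε := by
    set c := volume K ^ (ENNReal.ofReal p).toReal⁻¹ with hc'
    have hct : c ≠ ⊤ := ENNReal.rpow_ne_top_of_nonneg (by positivity) hVt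
    have ht : Tendsto (fun δ : ℝ => c * ENNReal.ofReal δ) (𝓝[>] 0) (𝓝 (c * ENNReal.ofReal 0)) :=
      ENNReal.Tendsto.const_mul ((ENNReal.continuous_ofReal.tendsto 0).mono_left
        nhdsWithin_le_nhds) (Or.inr hct)
    rw [ENNReal.ofReal_zero, mul_zero] at ht
    have h1 := (ht.eventually_le_const hε).and self_mem_nhdsWithin
    obtain ⟨δ, h2, h3⟩ := h1.exists
    exact ⟨δ, h3, h2⟩
  obtain ⟨η, hη, hη2⟩ := Metric.uniformContinuous_iff.1 huc δ hδ
  filter_upwards [(tendsto_rOut_bump (d := d)).eventually (gt_mem_nhds hη)] with k hk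
  have hb : ∀ x, ‖moll k g x - g x‖ ≤ δ := by
    intro x
    rw [← dist_eq_norm]
    refine (bump d k).dist_normed_convolution_le hg.aestronglyMeasurable fun y hy => ?_
    exact (hη2 ((Metric.mem_ball.1 hy).trans hk)).le
  rw [← eLpNorm_restrict_eq_of_support_subset (hsupp k)]
  refine (eLpNorm_le_of_ae_bound (.of_forall hb)).trans ?_
  rwa [Measure.restrict_apply_univ]

lemma tendsto_eLpNorm_moll_sub (hp : 1 ≤ p) {f : E d → ℝ}
    (hf : MemLp f (ENNReal.ofReal p) volume) :
    Tendsto (fun k => eLpNorm (fun x => moll k f x - f x) (ENNReal.ofReal p) volume) atTop (𝓝 0) := by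
  have hP1 : 1 ≤ ENNReal.ofReal p := by simpa using hp
  rw [ENNReal.tendsto_nhds_zero]
  intro ε hε
  have hε3 : ε / 3 ≠ 0 := by
    rw [ENNReal.div_ne_zero]; exact ⟨hε.ne', by simp⟩
  obtain ⟨g, hgc, hfg, hg, hgm⟩ := hf.exists_hasCompactSupport_eLpNorm_sub_le (by simp) hε3
  filter_upwards [(ENNReal.tendsto_nhds_zero.1 (tendsto_eLpNorm_moll_sub_of_continuous hp hg hgc))
    (ε / 3) (pos_iff_ne_zero.2 hε3)] with k hk
  have hfl := hf.locallyIntegrable hP1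
  have hgl := hgm.locallyIntegrable hP1
  have hsub : AEStronglyMeasurable (fun x => f x - g x) volume := hf.1.sub hgm.1
  have hfgl := hfl.sub hgl
  have heq : (fun x => moll k f x - f x) = fun x => (moll k (fun x => f x - g x) x +
      (moll k g x - g x)) + (g x - f x) := by
    ext x
    rw [moll_sub k hfl hgl]; ring
  have m1 : AEStronglyMeasurable (moll k (fun x => f x - g x)) volume :=
    (contDiff_moll k hfgl).continuous.aestronglyMeasurable
  have m2 : AEStronglyMeasurable (fun x => moll k g x - g x) volume :=
    ((contDiff_moll k hgl).continuous.sub hg).aestronglyMeasurable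
  rw [heq]
  refine (eLpNorm_add_le (m1.add m2) (hgm.1.sub hf.1) hP1).trans ?_
  have h1 : eLpNorm (fun x => moll k (fun x => f x - g x) x + (moll k g x - g x))
      (ENNReal.ofReal p) volume ≤ ε / 3 + ε / 3 :=
    (eLpNorm_add_le m1 m2 hP1).trans
      (add_le_add ((eLpNorm_moll_le hp k hsub).trans hfg) hk)
  have h2 : eLpNorm (fun x => g x - f x) (ENNReal.ofReal p) volume ≤ ε / 3 := by
    have := eLpNorm_sub_comm g f (ENNReal.ofReal p) volume
    change eLpNorm (g - f) _ _ ≤ _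
    rwa [this]
  calc _ ≤ ε / 3 + ε / 3 + ε / 3 := add_le_add h1 h2
    _ = ε := ENNReal.add_thirds ε

/-- Functions that are locally in `L^p`. -/
def LocLp (p : ℝ) (u : E d → ℝ) : Prop :=
  ∀ R : ℝ, MemLp u (ENNReal.ofReal p) (volume.restrict (Metric.ball 0 R))

lemma LocLp.memLp {u : E d → ℝ} (h : LocLp p u) (x : E d) (ρ : ℝ) :
    MemLp u (ENNReal.ofReal p) (volume.restrict (Metric.ball x ρ)) :=
  (h (ρ + ‖x‖)).mono_measure (Measure.restrict_mono_set _ (Metric.ball_subset_ball' (by simp)))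

lemma LocLp.congr {u v : E d → ℝ} (h : LocLp p u) (huv : u =ᵐ[volume] v) : LocLp p v :=
  fun R => (h R).ae_eq (ae_restrict_of_ae huv)

lemma LocLp.locallyIntegrable (hp : 1 ≤ p) {u : E d → ℝ} (h : LocLp p u) :
    LocallyIntegrable u volume := by
  intro x
  refine ⟨Metric.ball x 1, Metric.ball_mem_nhds x one_pos, ?_⟩
  have : IsFiniteMeasure (volume.restrict (Metric.ball x 1)) := ⟨by simpa using measure_ball_lt_top⟩
  exact (h.memLp x 1).integrable (by simpa using hp)

lemma LocLp.sub {u v : E d → ℝ} (h : LocLp p u) (h' : LocLp p v) :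
    LocLp p (fun x => u x - v x) := fun R => (h R).sub (h' R)

lemma locLp_of_continuous {u : E d → ℝ} (h : Continuous u) : LocLp p u := by
  intro R
  have : IsFiniteMeasure (volume.restrict (Metric.ball (0 : E d) R)) :=
    ⟨by simpa using measure_ball_lt_top⟩
  obtain ⟨C, hC⟩ := (isCompact_closedBall (0 : E d) R).exists_bound_of_continuousOn h.continuousOn
  refine MemLp.of_bound h.aestronglyMeasurable C ?_
  filter_upwards [ae_restrict_mem measurableSet_ball] with x hx
  exact hC x (Metric.ball_subset_closedBall hx)

/-- By locality, cutting u off outside the ball of radius ρ + 1 changes nothing on the ball of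
radius ρ, and the cut-off function is globally in `L^p`. -/
lemma LocLp.tendsto_moll (hp : 1 ≤ p) {u : E d → ℝ} (h : LocLp p u) (x : E d) (ρ : ℝ) :
    Tendsto (fun k => eLpNorm (fun x => moll k u x - u x) (ENNReal.ofReal p)
      (volume.restrict (Metric.ball x ρ))) atTop (𝓝 0) := by
  set B := Metric.ball x (ρ + 1) with hB
  have h1 : MemLp (B.indicator u) (ENNReal.ofReal p) volume :=
    (memLp_indicator_iff_restrict measurableSet_ball).2 (h.memLp x (ρ + 1))
  have h2 := tendsto_eLpNorm_moll_sub hp h1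
  refine tendsto_of_tendsto_of_tendsto_of_le_of_le tendsto_const_nhds h2 (fun _ => zero_le)
    fun k => ?_
  calc eLpNorm (fun x => moll k u x - u x) (ENNReal.ofReal p) (volume.restrict (Metric.ball x ρ))
      = eLpNorm (fun x => moll k (B.indicator u) x - B.indicator u x) (ENNReal.ofReal p)
        (volume.restrict (Metric.ball x ρ)) := by
        refine eLpNorm_congr_ae ?_
        filter_upwards [ae_restrict_mem measurableSet_ball] with y hy
        have hsub : Metric.ball y 1 ⊆ B := Metric.ball_subset_ball' (by
          rw [Metric.mem_ball] at hy; linarith)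
        rw [Set.indicator_of_mem (hsub (Metric.mem_ball_self one_pos)),
          moll_eq_of_eqOn k fun z hz => (Set.indicator_of_mem (hsub hz) u).symm]
    _ ≤ _ := eLpNorm_mono_measure _ Measure.restrict_le_self

end Mollify

/-! ### Local Sobolev functions: multiplication and the product rule -/

section Local

variable {p : ℝ}

/-- Functions with weak derivatives up to order `a` that are locally in `L^p`. -/
def LocSobolev (p : ℝ) : ℕ → (E d → ℝ) → Prop
  | 0, u => LocLp p u
  | a + 1, u => LocLp p u ∧ ∀ i, ∃ g, WD i u g ∧ LocSobolev p a g

/-- Local Sobolev norm on the ball `B(x,ρ)`, where each derivative carries a factor `ρ`. -/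
def ballNorm (p : ℝ) (x : E d) (ρ : ℝ) : ℕ → (E d → ℝ) → ENNReal
  | 0, u => eLpNorm u (ENNReal.ofReal p) (volume.restrict (Metric.ball x ρ))
  | a + 1, u => eLpNorm u (ENNReal.ofReal p) (volume.restrict (Metric.ball x ρ)) +
      ENNReal.ofReal ρ * ∑ i, ballNorm p x ρ a (wd i u)

variable {a : ℕ} {u v g : E d → ℝ}

lemma LocSobolev.locLp (h : LocSobolev p a u) : LocLp p u := by
  cases a with
  | zero => exact h
  | succ a => exact h.1

lemma LocSobolev.congr (h : LocSobolev p a u) (huv : u =ᵐ[volume] v) : LocSobolev p a v := by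
  cases a with
  | zero => exact LocLp.congr h huv
  | succ a =>
    refine ⟨h.1.congr huv, fun i => ?_⟩
    obtain ⟨g, h1, h2⟩ := h.2 i
    exact ⟨g, h1.congr huv .rfl, h2⟩

lemma LocSobolev.deriv (h : LocSobolev p (a + 1) u) {i : Fin d} (hg : WD i u g) :
    LocSobolev p a g := by
  obtain ⟨g', h1, h2⟩ := h.2 i
  exact h2.congr (h1.unique hg)

lemma LocSobolev.wd (h : LocSobolev p (a + 1) u) (i : Fin d) : WD i u (wd i u) := by
  obtain ⟨g', h1, h2⟩ := h.2 i
  exact weakDeriv_spec h1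

lemma LocSobolev.of_succ (h : LocSobolev p (a + 1) u) : LocSobolev p a u := by
  induction a generalizing u with
  | zero => exact h.1
  | succ a ih =>
    refine ⟨h.1, fun i => ?_⟩
    obtain ⟨g, h1, h2⟩ := h.2 i
    exact ⟨g, h1, ih h2⟩

lemma LocSobolev.mono {b : ℕ} (h : LocSobolev p a u) (hb : b ≤ a) : LocSobolev p b u := by
  induction a with
  | zero => rwa [Nat.le_zero.1 hb]
  | succ a ih =>
    rcases hb.eq_or_lt with rfl | h'
    · exact h
    · exact ih h.of_succ (by omega)

lemma LocSobolev.sub (h : LocSobolev p a u) (h' : LocSobolev p a v) :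
    LocSobolev p a (fun x => u x - v x) := by
  induction a generalizing u v with
  | zero => exact LocLp.sub h h'
  | succ a ih =>
    refine ⟨h.1.sub h'.1, fun i => ?_⟩
    obtain ⟨g, h1, h2⟩ := h.2 i
    obtain ⟨g', h1', h2'⟩ := h'.2 i
    exact ⟨_, h1.sub h1', ih h2 h2'⟩

lemma locSobolev_of_contDiff (hu : ContDiff ℝ ∞ u) : LocSobolev p a u := by
  induction a generalizing u with
  | zero => exact locLp_of_continuous hu.continuous
  | succ a ih =>
    exact ⟨locLp_of_continuous hu.continuous, fun i =>
      ⟨_, wd_of_contDiff hu i, ih (contDiff_pderiv hu i)⟩⟩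

lemma MemWeightedSobolev.locSobolev (hp : 1 ≤ p) {e : ℕ → ℝ}
    (h : MemWeightedSobolev a p e u) : LocSobolev p a u := by
  have h0 : ∀ {s : ℝ} {f : E d → ℝ}, WMem p s f → LocLp p f := by
    intro s f hf R
    have hb : ∃ C : ℝ, ∀ x ∈ Metric.closedBall (0 : E d) R, ‖japanese x ^ (-s)‖ ≤ C :=
      (isCompact_closedBall (0 : E d) R).exists_bound_of_continuousOn
        (continuous_japanese_rpow (-s)).continuousOn
    obtain ⟨C, hC⟩ := hb
    have hm : AEStronglyMeasurable f volume := (hf.locallyIntegrable hp).aestronglyMeasurable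
    refine (MemLp.restrict (Metric.ball 0 R) hf).of_le_mul (c := C) hm.restrict ?_
    filter_upwards [ae_restrict_mem measurableSet_ball] with x hx
    have h1 := hC x (Metric.ball_subset_closedBall hx)
    have h2 : f x = japanese x ^ (-s) * (japanese x ^ s * f x) := by
      rw [← mul_assoc, ← Real.rpow_add (japanese_pos x)]; simp
    calc ‖f x‖ = ‖japanese x ^ (-s)‖ * ‖japanese x ^ s * f x‖ := by rw [← norm_mul, ← h2]
      _ ≤ _ := by gcongr
  induction a generalizing u e with
  | zero => exact h0 h.wMem
  | succ a ih =>
    rw [memWeightedSobolev_succ_iff hp] at h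
    refine ⟨h0 h.1, fun i => ?_⟩
    obtain ⟨g, h1, h2⟩ := h.2 i
    exact ⟨g, h1, ih h2⟩

lemma ballNorm_congr {x : E d} {ρ : ℝ} (huv : u =ᵐ[volume] v) :
    ballNorm p x ρ a u = ballNorm p x ρ a v := by
  cases a with
  | zero => exact eLpNorm_congr_ae (ae_restrict_of_ae huv)
  | succ a =>
    have : ∀ i, wd i u = wd i v := fun i => weakDeriv_congr huv
    simp only [ballNorm, this]
    rw [eLpNorm_congr_ae (ae_restrict_of_ae huv)]

lemma LocSobolev.ballNorm_lt_top (h : LocSobolev p a u) (x : E d) (ρ : ℝ) :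
    ballNorm p x ρ a u < ⊤ := by
  induction a generalizing u with
  | zero => exact (LocLp.memLp h x ρ).eLpNorm_lt_top
  | succ a ih =>
    refine ENNReal.add_lt_top.2 ⟨(h.1.memLp x ρ).eLpNorm_lt_top, ENNReal.mul_lt_top (by simp) ?_⟩
    exact ENNReal.sum_lt_top.2 fun i _ => ih (h.deriv (h.wd i))

lemma LocSobolev.ballNorm_le_add_sub (hp : 1 ≤ p) (h : LocSobolev p a u) (h' : LocSobolev p a v)
    (x : E d) (ρ : ℝ) :
    ballNorm p x ρ a u ≤ ballNorm p x ρ a v + ballNorm p x ρ a (fun y => u y - v y) := by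
  have hP1 : 1 ≤ ENNReal.ofReal p := by simpa using hp
  have h0 : ∀ {u v : E d → ℝ}, LocLp p u → LocLp p v →
      eLpNorm u (ENNReal.ofReal p) (volume.restrict (Metric.ball x ρ)) ≤
      eLpNorm v (ENNReal.ofReal p) (volume.restrict (Metric.ball x ρ)) +
      eLpNorm (fun y => u y - v y) (ENNReal.ofReal p) (volume.restrict (Metric.ball x ρ)) := by
    intro u v hu hv
    have : u = v + fun y => u y - v y := by ext y; simp
    conv_lhs => rw [this]
    exact eLpNorm_add_le (hv.memLp x ρ).1 ((hu.sub hv).memLp x ρ).1 hP1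
  induction a generalizing u v with
  | zero => exact h0 h h'
  | succ a ih =>
    rw [ballNorm, ballNorm, ballNorm]
    have h1 : ∀ i, ballNorm p x ρ a (AsymptoticSpaces.wd i u) ≤
        ballNorm p x ρ a (AsymptoticSpaces.wd i v) +
        ballNorm p x ρ a (AsymptoticSpaces.wd i fun y => u y - v y) := by
      intro i
      rw [ballNorm_congr (weakDeriv_ae_eq ((h.wd i).sub (h'.wd i)))]
      exact ih (h.deriv (h.wd i)) (h'.deriv (h'.wd i))
    calc _ ≤ (eLpNorm v (ENNReal.ofReal p) (volume.restrict (Metric.ball x ρ)) +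
          eLpNorm (fun y => u y - v y) (ENNReal.ofReal p) (volume.restrict (Metric.ball x ρ))) +
          ENNReal.ofReal ρ * ∑ i, (ballNorm p x ρ a (AsymptoticSpaces.wd i v) +
        ballNorm p x ρ a (AsymptoticSpaces.wd i fun y => u y - v y)) := by
          gcongr with i
          · exact h0 h.1 h'.1
          · exact h1 i
      _ = _ := by rw [Finset.sum_add_distrib]; ring

lemma ballNorm_eq_smoothBallNorm (hu : ContDiff ℝ ∞ u) (x : E d) (ρ : ℝ) :
    ballNorm p x ρ a u = smoothBallNorm p x ρ a u := by
  induction a generalizing u with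
  | zero => rfl
  | succ a ih =>
    rw [ballNorm, smoothBallNorm]
    congr 2
    refine Finset.sum_congr rfl fun i _ => ?_
    rw [← ih (contDiff_pderiv hu i)]
    exact ballNorm_congr (weakDeriv_ae_eq (wd_of_contDiff hu i))

lemma LocSobolev.tendsto_ballNorm_moll (hp : 1 ≤ p) (h : LocSobolev p a u) (x : E d) (ρ : ℝ) :
    Tendsto (fun k => ballNorm p x ρ a (fun y => moll k u y - u y)) atTop (𝓝 0) := by
  induction a generalizing u with
  | zero => exact LocLp.tendsto_moll hp h x ρ
  | succ a ih =>
    have h1 : ∀ k i, ballNorm p x ρ a (AsymptoticSpaces.wd i fun y => moll k u y - u y) =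
        ballNorm p x ρ a (fun y => moll k (AsymptoticSpaces.wd i u) y -
          AsymptoticSpaces.wd i u y) := by
      intro k i
      have h2 := (wd_of_contDiff (contDiff_moll k (h.1.locallyIntegrable hp)) i).sub (h.wd i)
      rw [pderiv_moll k (h.wd i)] at h2
      exact ballNorm_congr (weakDeriv_ae_eq h2)
    simp only [ballNorm, h1]
    have h3 : Tendsto (fun k => ∑ i, ballNorm p x ρ a (fun y => moll k (AsymptoticSpaces.wd i u) y -
          AsymptoticSpaces.wd i u y)) atTop (𝓝 (∑ i : Fin d, 0)) :=
      tendsto_finsetSum _ fun i _ => ih (h.deriv (h.wd i))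
    have h4 := ENNReal.Tendsto.const_mul (a := ENNReal.ofReal ρ) h3 (Or.inr (by simp))
    have h5 := (LocLp.tendsto_moll hp h.1 x ρ).add h4
    simpa using h5

/-- For the later limit passage, an upper bound on the mollified norms that converges to the norm of
u is enough. -/
lemma LocSobolev.tendsto_ballNorm_moll' (hp : 1 ≤ p) (h : LocSobolev p a u) (x : E d) (ρ : ℝ) :
    ∃ B : ℕ → ENNReal, Tendsto B atTop (𝓝 (ballNorm p x ρ a u)) ∧
      ∀ k, ballNorm p x ρ a (moll k u) ≤ B k := by
  refine ⟨fun k => ballNorm p x ρ a u + ballNorm p x ρ a (fun y => moll k u y - u y), ?_, fun k =>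
    LocSobolev.ballNorm_le_add_sub hp (locSobolev_of_contDiff
      (contDiff_moll k (h.locLp.locallyIntegrable hp))) h x ρ⟩
  simpa using tendsto_const_nhds.add (h.tendsto_ballNorm_moll hp x ρ)

/-- Sobolev multiplication on a ball. -/
lemma exists_eLpNorm_mul_le_ballNorm (hp : 1 < p) {m : ℕ} (hm : (d : ℝ) / p < m) {a b : ℕ}
    (hab : m ≤ a + b) : ∃ C : NNReal, ∀ (x : E d) (ρ : ℝ), 0 < ρ → ∀ u v : E d → ℝ,
      LocSobolev p a u → LocSobolev p b v →
      eLpNorm (fun x => u x * v x) (ENNReal.ofReal p) (volume.restrict (Metric.ball x ρ)) ≤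
        C * ENNReal.ofReal ρ ^ (-((d : ℝ) / p)) * (ballNorm p x ρ a u * ballNorm p x ρ b v) := by
  obtain ⟨C, hC⟩ := exists_eLpNorm_mul_le_ball (d := d) hp hm hab
  refine ⟨C, fun x ρ hρ u v hu hv => ?_⟩
  have hp1 := hp.le
  have hul := hu.locLp.locallyIntegrable hp1
  have hvl := hv.locLp.locallyIntegrable hp1
  have hr : Tendsto (fun k => (bump d k).rOut) atTop (𝓝 0) := tendsto_rOut_bump
  have hr2 : ∀ᶠ k in atTop, (bump d k).rOut ≤ 2 * (bump d k).rIn := by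
    refine .of_forall fun k => ?_
    change 1 / ((k : ℝ) + 1) ≤ 2 * (1 / (2 * ((k : ℝ) + 1)))
    apply le_of_eq
    field_simp
  have hua := ContDiffBump.ae_convolution_tendsto_right_of_locallyIntegrable (μ := volume) hr hr2 hul
  have hva := ContDiffBump.ae_convolution_tendsto_right_of_locallyIntegrable (μ := volume) hr hr2 hvl
  obtain ⟨Bu, hBu, hBu2⟩ := hu.tendsto_ballNorm_moll' hp1 x ρ
  obtain ⟨Bv, hBv, hBv2⟩ := hv.tendsto_ballNorm_moll' hp1 x ρ
  have hsm : ∀ k, ContDiff ℝ ∞ (moll k u) := fun k => contDiff_moll k hul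
  have hsm' : ∀ k, ContDiff ℝ ∞ (moll k v) := fun k => contDiff_moll k hvl
  -- The mollifications converge almost everywhere, hence so do their products, and Fatou transfers
  -- the smooth estimate without convergence of the products in `L^p`.
  have hfat := Lp.eLpNorm_lim_le_liminf_eLpNorm (μ := volume.restrict (Metric.ball x ρ))
    (p := ENNReal.ofReal p) (f := fun k y => moll k u y * moll k v y)
    (fun k => ((hsm k).continuous.mul (hsm' k).continuous).aestronglyMeasurable)
    (fun y => u y * v y) (ae_restrict_of_ae (by
      filter_upwards [hua, hva] with y h1 h2
      exact h1.mul h2))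
  refine hfat.trans ?_
  have hlim : Tendsto (fun k => C * ENNReal.ofReal ρ ^ (-((d : ℝ) / p)) * (Bu k * Bv k)) atTop
      (𝓝 (C * ENNReal.ofReal ρ ^ (-((d : ℝ) / p)) *
        (ballNorm p x ρ a u * ballNorm p x ρ b v))) := by
    refine ENNReal.Tendsto.const_mul (ENNReal.Tendsto.mul hBu (Or.inr
      (hv.ballNorm_lt_top x ρ).ne) hBv (Or.inr (hu.ballNorm_lt_top x ρ).ne)) (Or.inr ?_)
    exact ENNReal.mul_ne_top (by simp)
      (ENNReal.rpow_ne_top_of_ne_zero (by simpa using hρ) (by simp))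
  rw [← hlim.liminf_eq]
  refine liminf_le_liminf (.of_forall fun k => ?_)
  refine (hC x ρ hρ _ _ (hsm k) (hsm' k)).trans ?_
  rw [← ballNorm_eq_smoothBallNorm (hsm k), ← ballNorm_eq_smoothBallNorm (hsm' k)]
  gcongr
  · exact hBu2 k
  · exact hBv2 k

lemma LocSobolev.mul_locLp (hp : 1 < p) {m : ℕ} (hm : (d : ℝ) / p < m) {a b : ℕ}
    (hab : m ≤ a + b) (hu : LocSobolev p a u) (hv : LocSobolev p b v) :
    LocLp p (fun x => u x * v x) := by
  obtain ⟨C, hC⟩ := exists_eLpNorm_mul_le_ballNorm (d := d) hp hm hab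
  intro R
  rcases le_or_gt R 0 with hR | hR
  · rw [Metric.ball_eq_empty.2 hR]; simp
  refine ⟨(hu.locLp R).1.mul (hv.locLp R).1, (hC 0 R hR u v hu hv).trans_lt ?_⟩
  refine ENNReal.mul_lt_top (ENNReal.mul_lt_top (by simp) ?_) (ENNReal.mul_lt_top
    (hu.ballNorm_lt_top 0 R) (hv.ballNorm_lt_top 0 R))
  exact (ENNReal.rpow_ne_top_of_ne_zero (by simpa using hR) (by simp)).lt_top

/-- Local convergence of products of mollifications, tested against a test function. -/
lemma LocSobolev.tendsto_integral_moll_mul (hp : 1 < p) {m : ℕ} (hm : (d : ℝ) / p < m) {a b : ℕ}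
    (hab : m ≤ a + b) (hu : LocSobolev p a u) (hv : LocSobolev p b v) {φ : E d → ℝ}
    (hφ : IsTest φ) : Tendsto (fun k => ∫ x, moll k u x * v x * φ x) atTop
      (𝓝 (∫ x, u x * v x * φ x)) := by
  have hp1 := hp.le
  have hul := hu.locLp.locallyIntegrable hp1
  obtain ⟨C, hC⟩ := exists_eLpNorm_mul_le_ballNorm (d := d) hp hm hab
  obtain ⟨R, hR0, hR⟩ : ∃ R : ℝ, 0 < R ∧ tsupport φ ⊆ Metric.ball 0 R := by
    obtain ⟨R, hR⟩ := hφ.compact.isCompact.isBounded.subset_ball (0 : E d)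
    exact ⟨max R 1, by positivity, hR.trans (Metric.ball_subset_ball (le_max_left _ _))⟩
  set μ := volume.restrict (Metric.ball (0 : E d) R) with hμ
  have hfin : IsFiniteMeasure μ := ⟨by simpa [hμ] using measure_ball_lt_top⟩
  obtain ⟨M, hM⟩ : ∃ M : ℝ, ∀ x, ‖φ x‖ ≤ M :=
    hφ.compact.exists_bound_of_continuous hφ.smooth.continuous
  have hmk : ∀ k, LocSobolev p a (moll k u) := fun k => locSobolev_of_contDiff (contDiff_moll k hul)
  have hloc : LocLp p fun x => u x * v x := hu.mul_locLp hp hm hab hv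
  have hlock : ∀ k, LocLp p fun x => moll k u x * v x := fun k => (hmk k).mul_locLp hp hm hab hv
  refine tendsto_integral_of_L1 (fun x => u x * v x * φ x)
    (hφ.integrable_mul (hloc.locallyIntegrable hp1)).1
    (.of_forall fun k => hφ.integrable_mul ((hlock k).locallyIntegrable hp1)) ?_
  -- bound the `L^1` norm by the local `L^p` norm
  set c : ENNReal := ENNReal.ofReal M * μ Set.univ ^ (1 / (1 : ENNReal).toReal -
    1 / (ENNReal.ofReal p).toReal) with hc
  have hct : c ≠ ⊤ := by
    refine ENNReal.mul_ne_top (by simp) (ENNReal.rpow_ne_top_of_nonneg ?_ (measure_ne_top _ _))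
    rw [ENNReal.toReal_ofReal (by linarith), ENNReal.toReal_one, sub_nonneg]
    rw [div_le_div_iff₀ (by linarith) one_pos]; linarith
  have hbound : ∀ k, ∫⁻ x, ‖moll k u x * v x * φ x - u x * v x * φ x‖ₑ ≤
      c * (C * ENNReal.ofReal R ^ (-((d : ℝ) / p)) *
        (ballNorm p 0 R a (fun y => moll k u y - u y) * ballNorm p 0 R b v)) := by
    intro k
    have h1 : ∫⁻ x, ‖moll k u x * v x * φ x - u x * v x * φ x‖ₑ ≤
        ENNReal.ofReal M * ∫⁻ x, ‖(moll k u x - u x) * v x‖ₑ ∂μ := by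
      rw [← lintegral_const_mul' _ _ (by simp), hμ, ← lintegral_indicator measurableSet_ball]
      refine lintegral_mono fun x => ?_
      by_cases hx : x ∈ Metric.ball (0 : E d) R
      · rw [Set.indicator_of_mem hx, ← sub_mul, ← sub_mul, enorm_mul, mul_comm]
        gcongr
        rw [← ofReal_norm]
        exact ENNReal.ofReal_le_ofReal (hM x)
      · have : φ x = 0 := by
          by_contra h
          exact hx (hR (subset_tsupport φ h))
        simp [this]
    refine h1.trans ?_
    rw [hc, mul_assoc]
    gcongr
    rw [mul_comm]
    have hd := (hmk k).sub hu
    have h2 := eLpNorm_le_eLpNorm_mul_rpow_measure_univ (μ := μ) (p := 1) (q := ENNReal.ofReal p)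
      (by simpa using hp1) (f := fun x => (moll k u x - u x) * v x)
      ((hd.mul_locLp hp hm hab hv) R).1
    rw [eLpNorm_one_eq_lintegral_enorm] at h2
    refine h2.trans ?_
    gcongr
    exact hC 0 R hR0 _ _ hd hv
  refine tendsto_of_tendsto_of_tendsto_of_le_of_le tendsto_const_nhds ?_ (fun _ => zero_le) hbound
  have h6 : Tendsto (fun k => ballNorm p 0 R a (fun y => moll k u y - u y) * ballNorm p 0 R b v)
      atTop (𝓝 (0 * ballNorm p 0 R b v)) :=
    ENNReal.Tendsto.mul_const (hu.tendsto_ballNorm_moll hp1 0 R)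
      (Or.inr (hv.ballNorm_lt_top 0 R).ne)
  have h7 := ENNReal.Tendsto.const_mul (a := c) (ENNReal.Tendsto.const_mul
    (a := C * ENNReal.ofReal R ^ (-((d : ℝ) / p))) h6 (Or.inr (ENNReal.mul_ne_top (by simp)
      (ENNReal.rpow_ne_top_of_ne_zero (by simpa using hR0) (by simp))))) (Or.inr hct)
  simpa using h7

/-- The product rule for weak derivatives. -/
lemma LocSobolev.wd_mul (hp : 1 < p) {m : ℕ} (hm : (d : ℝ) / p < m) {a b : ℕ}
    (hab : m ≤ a + b + 1) (hu : LocSobolev p (a + 1) u) (hv : LocSobolev p (b + 1) v)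
    {i : Fin d} {u' v' : E d → ℝ} (hu' : WD i u u') (hv' : WD i v v') :
    WD i (fun x => u x * v x) (fun x => u' x * v x + u x * v' x) := by
  have hp1 := hp.le
  have hul := hu.locLp.locallyIntegrable hp1
  have hu1 := hu.deriv hu'
  have hv1 := hv.deriv hv'
  have l0 : LocLp p fun x => u x * v x := hu.mul_locLp hp hm (by omega) hv
  have l1 : LocLp p fun x => u' x * v x := hu1.mul_locLp hp hm (by omega) hv
  have l2 : LocLp p fun x => u x * v' x := hu.mul_locLp hp hm (by omega) hv1
  have i1 := l1.locallyIntegrable hp1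
  have i2 := l2.locallyIntegrable hp1
  rw [wd_iff]
  refine ⟨l0.locallyIntegrable hp1, i1.add i2, fun φ hφ => ?_⟩
  -- Only u is mollified, so the product rule with a smooth factor applies while v keeps its weak
  -- derivative. The limit then uses three products, and the worst of them, with one derivative
  -- already spent, needs just m ≤ a + b + 1.
  have e : ∀ k, ∫ x, moll k u x * v x * pderiv i φ x =
      -((∫ x, moll k u' x * v x * φ x) + ∫ x, moll k u x * v' x * φ x) := by
    intro k
    have h1 := (WD.mul_smooth (contDiff_moll k hul) hv')
    rw [pderiv_moll k hu'] at h1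
    have h2 := (wd_iff.1 h1).2.2 φ hφ
    rw [h2, ← integral_add]
    · simp only [add_mul]
    · exact hφ.integrable_mul (((locSobolev_of_contDiff (p := p) (a := a)
        (contDiff_moll k (hu1.locLp.locallyIntegrable hp1))).mul_locLp hp hm
          (by omega) hv).locallyIntegrable hp1)
    · exact hφ.integrable_mul (((locSobolev_of_contDiff (p := p) (a := a + 1)
        (contDiff_moll k hul)).mul_locLp hp hm (by omega) hv1).locallyIntegrable hp1)
  have t0 := hu.tendsto_integral_moll_mul hp hm (by omega) hv (hφ.pderiv i)
  have t1 := hu1.tendsto_integral_moll_mul hp hm (by omega) hv hφ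
  have t2 := hu.tendsto_integral_moll_mul hp hm (by omega) hv1 hφ
  simp only [e] at t0
  have := tendsto_nhds_unique t0 (t1.add t2).neg
  rw [this, ← integral_add (hφ.integrable_mul i1) (hφ.integrable_mul i2)]
  simp only [add_mul]

end Local

end AsymptoticSpaces
end

/-! ### Linear structure and the recursive form of the norm -/

noncomputable section
namespace AsymptoticSpaces
variable {d : ℕ}

section Linear

variable {p : ℝ} {m : ℕ} {e : ℕ → ℝ} {f g : E d → ℝ}

lemma MemWeightedSobolev.add (hf : MemWeightedSobolev m p e f) (hg : MemWeightedSobolev m p e g) :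
    MemWeightedSobolev m p e (fun x => f x + g x) := by
  intro α hα
  obtain ⟨⟨f', hf'⟩, hf2⟩ := hf α hα
  obtain ⟨⟨g', hg'⟩, hg2⟩ := hg α hα
  have h := (weakDeriv_spec hf').add (weakDeriv_spec hg')
  refine ⟨⟨_, h⟩, (hf2.add hg2).ae_eq ?_⟩
  filter_upwards [weakDeriv_ae_eq h] with x hx
  rw [hx]; simp [mul_add]

lemma MemWeightedSobolev.const_mul (hf : MemWeightedSobolev m p e f) (c : ℝ) :
    MemWeightedSobolev m p e (fun x => c * f x) := by
  intro α hα
  obtain ⟨⟨f', hf'⟩, hf2⟩ := hf α hα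
  have h := (weakDeriv_spec hf').const_mul c
  refine ⟨⟨_, h⟩, (hf2.const_mul c).ae_eq ?_⟩
  filter_upwards [weakDeriv_ae_eq h] with x hx
  rw [hx]; ring

lemma memWeightedSobolev_zero : MemWeightedSobolev m p e (fun _ : E d => 0) := by
  intro α hα
  have h := isWeakDeriv_of_zero α
  refine ⟨⟨_, h⟩, (MemLp.zero' (ε := ℝ)).ae_eq ?_⟩
  filter_upwards [weakDeriv_ae_eq h] with x hx
  rw [hx]; simp

lemma weightedSobolevNorm_fun_zero : weightedSobolevNorm m p e (fun _ : E d => 0) = 0 := by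
  refine Finset.sum_eq_zero fun k _ => Finset.sum_eq_zero fun α _ => ?_
  rw [← eLpNorm_zero (ε := ℝ) (p := ENNReal.ofReal p) (μ := (volume : Measure (E d)))]
  refine eLpNorm_congr_ae ?_
  filter_upwards [weakDeriv_ae_eq (isWeakDeriv_of_zero α)] with x hx
  rw [hx]; simp

lemma weightedSobolevNorm_add_le (hp : 1 ≤ p) (hf : MemWeightedSobolev m p e f)
    (hg : MemWeightedSobolev m p e g) :
    weightedSobolevNorm m p e (fun x => f x + g x) ≤
      weightedSobolevNorm m p e f + weightedSobolevNorm m p e g := by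
  simp only [weightedSobolevNorm, ← Finset.sum_add_distrib]
  refine Finset.sum_le_sum fun k hk => Finset.sum_le_sum fun α hα => ?_
  have hs : ∑ i, α i = k := (Finset.mem_piAntidiag.1 hα).1
  have hα' : ∑ i, α i ≤ m := by rw [hs]; exact Finset.mem_range_succ_iff.1 hk
  obtain ⟨⟨f', hf'⟩, hf2⟩ := hf α hα'
  obtain ⟨⟨g', hg'⟩, hg2⟩ := hg α hα'
  rw [hs] at hf2 hg2
  have h := (weakDeriv_spec hf').add (weakDeriv_spec hg')
  refine le_trans (le_of_eq ?_) (eLpNorm_add_le hf2.1 hg2.1 (by simpa using hp))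
  refine eLpNorm_congr_ae ?_
  filter_upwards [weakDeriv_ae_eq h] with x hx
  rw [hx]; simp [mul_add]

lemma weightedSobolevNorm_const_mul (hf : MemWeightedSobolev m p e f) (c : ℝ) :
    weightedSobolevNorm m p e (fun x => c * f x) =
      ENNReal.ofReal |c| * weightedSobolevNorm m p e f := by
  simp only [weightedSobolevNorm, Finset.mul_sum]
  refine Finset.sum_congr rfl fun k hk => Finset.sum_congr rfl fun α hα => ?_
  have hs : ∑ i, α i = k := (Finset.mem_piAntidiag.1 hα).1
  have hα' : ∑ i, α i ≤ m := by rw [hs]; exact Finset.mem_range_succ_iff.1 hk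
  obtain ⟨⟨f', hf'⟩, hf2⟩ := hf α hα'
  have h := (weakDeriv_spec hf').const_mul c
  rw [← Real.enorm_eq_ofReal_abs, ← eLpNorm_const_smul]
  refine eLpNorm_congr_ae ?_
  filter_upwards [weakDeriv_ae_eq h] with x hx
  rw [hx]; simp only [Pi.smul_apply, smul_eq_mul]; ring

lemma MemWeightedSobolev.norm_lt_top (hf : MemWeightedSobolev m p e f) :
    weightedSobolevNorm m p e f < ⊤ := by
  refine ENNReal.sum_lt_top.2 fun k hk => ENNReal.sum_lt_top.2 fun α hα => ?_
  have hs : ∑ i, α i = k := (Finset.mem_piAntidiag.1 hα).1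
  have h := (hf α (by rw [hs]; exact Finset.mem_range_succ_iff.1 hk)).2.2
  rwa [hs] at h

end Linear

section Recursive

variable {p : ℝ}

/-- The weighted Sobolev norm in recursive form. -/
def recNorm (p : ℝ) : ℕ → (ℕ → ℝ) → (E d → ℝ) → ENNReal
  | 0, e, f => wnorm p (e 0) f
  | a + 1, e, f => wnorm p (e 0) f + ∑ i, recNorm p a (fun k => e (k + 1)) (wd i f)

variable {a : ℕ} {e : ℕ → ℝ} {f g : E d → ℝ}

lemma recNorm_congr (hfg : f =ᵐ[volume] g) : recNorm p a e f = recNorm p a e g := by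
  cases a with
  | zero => exact wnorm_congr hfg
  | succ a =>
    simp only [recNorm, wnorm_congr hfg]
    congr 1
    refine Finset.sum_congr rfl fun i _ => ?_
    rw [wd, weakDeriv_congr hfg]

lemma recNorm_le_succ : recNorm p a e f ≤ recNorm p (a + 1) e f := by
  induction a generalizing e f with
  | zero => exact le_self_add
  | succ a ih =>
    rw [recNorm, recNorm]
    gcongr
    exact ih

lemma recNorm_mono {b : ℕ} (hab : a ≤ b) : recNorm p a e f ≤ recNorm p b e f :=
  monotone_nat_of_le_succ (f := fun k => recNorm p k e f) (fun _ => recNorm_le_succ) hab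

lemma weightedSobolevNorm_le_recNorm (hp : 1 ≤ p) (h : MemWeightedSobolev a p e f) :
    weightedSobolevNorm a p e f ≤ recNorm p a e f := by
  induction a generalizing e f with
  | zero => exact (weightedSobolevNorm_zero h.locallyIntegrable).le
  | succ a ih =>
    refine (weightedSobolevNorm_succ_le h fun i => h.wd hp i).trans ?_
    rw [recNorm]
    gcongr with i
    exact ih (h.deriv hp (h.wd hp i))

/-- The recursion counts ordered strings of derivatives separately, whence the combinatorial factor.
-/
lemma recNorm_le_weightedSobolevNorm (hp : 1 ≤ p) (h : MemWeightedSobolev a p e f) :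
    recNorm p a e f ≤ (d + 1) ^ a * weightedSobolevNorm a p e f := by
  induction a generalizing e f with
  | zero => simpa [recNorm] using (weightedSobolevNorm_zero h.locallyIntegrable).ge
  | succ a ih =>
    rw [recNorm]
    calc wnorm p (e 0) f + ∑ i, recNorm p a (fun k => e (k + 1)) (AsymptoticSpaces.wd i f)
        ≤ (d + 1) ^ a * weightedSobolevNorm (a + 1) p e f +
          ∑ _i : Fin d, (d + 1) ^ a * weightedSobolevNorm (a + 1) p e f := by
          gcongr with i
          · refine (wnorm_le_weightedSobolevNorm (m := a + 1) h.locallyIntegrable).trans ?_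
            exact le_mul_of_one_le_left' (one_le_pow₀ le_add_self)
          · refine (ih (h.deriv hp (h.wd hp i))).trans ?_
            gcongr
            exact weightedSobolevNorm_deriv_le hp h (h.wd hp i)
      _ = _ := by simp; ring

lemma MemWeightedSobolev.recNorm_lt_top (hp : 1 ≤ p) (h : MemWeightedSobolev a p e f) :
    recNorm p a e f < ⊤ :=
  (recNorm_le_weightedSobolevNorm hp h).trans_lt (ENNReal.mul_lt_top (by
    exact_mod_cast ENNReal.natCast_lt_top ((d + 1) ^ a)) h.norm_lt_top)

lemma recNorm_add_le (hp : 1 ≤ p) (hf : MemWeightedSobolev a p e f)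
    (hg : MemWeightedSobolev a p e g) :
    recNorm p a e (fun x => f x + g x) ≤ recNorm p a e f + recNorm p a e g := by
  have hP : 1 ≤ ENNReal.ofReal p := by simpa using hp
  have h0 : wnorm p (e 0) (fun x => f x + g x) ≤ wnorm p (e 0) f + wnorm p (e 0) g := by
    simp only [wnorm, mul_add]
    exact eLpNorm_add_le hf.wMem.1 hg.wMem.1 hP
  induction a generalizing e f g with
  | zero => exact h0
  | succ a ih =>
    simp only [recNorm]
    have h1 : ∀ i, recNorm p a (fun k => e (k + 1)) (AsymptoticSpaces.wd i fun x => f x + g x) ≤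
        recNorm p a (fun k => e (k + 1)) (AsymptoticSpaces.wd i f) +
          recNorm p a (fun k => e (k + 1)) (AsymptoticSpaces.wd i g) := by
      intro i
      have h2 := hf.deriv hp (hf.wd hp i)
      have h3 := hg.deriv hp (hg.wd hp i)
      rw [recNorm_congr (weakDeriv_ae_eq ((hf.wd hp i).add (hg.wd hp i)))]
      refine ih h2 h3 ?_
      simp only [wnorm, mul_add]
      exact eLpNorm_add_le h2.wMem.1 h3.wMem.1 hP
    calc _ ≤ wnorm p (e 0) f + wnorm p (e 0) g + ∑ i,
          (recNorm p a (fun k => e (k + 1)) (AsymptoticSpaces.wd i f) +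
          recNorm p a (fun k => e (k + 1)) (AsymptoticSpaces.wd i g)) := by
          gcongr; exact h1 _
      _ = _ := by rw [Finset.sum_add_distrib]; ring

end Recursive

/-! ### Averages over balls of radius ⟨x⟩^τ / 4 -/

section Averaging

/-- The radius `⟨x⟩^τ / 4`. -/
def rad (τ : ℝ) (x : E d) : ℝ := japanese x ^ τ / 4

lemma rad_pos (τ : ℝ) (x : E d) : 0 < rad τ x := by
  have := Real.rpow_pos_of_pos (japanese_pos x) τ
  unfold rad; positivity

/-- The differences of squares agree for the bracket and for the norm, whereas the sum of the
brackets is the larger one; hence the bracket is 1-Lipschitz. -/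
lemma abs_japanese_sub_le (x y : E d) : |japanese x - japanese y| ≤ ‖x - y‖ := by
  have h := abs_norm_sub_norm_le x y
  refine le_trans ?_ h
  have hx := japanese_pos x
  have hy := japanese_pos y
  have hx2 : japanese x ^ 2 = ‖x‖ ^ 2 + 1 := Real.sq_sqrt (by positivity)
  have hy2 : japanese y ^ 2 = ‖y‖ ^ 2 + 1 := Real.sq_sqrt (by positivity)
  have h1 : |japanese x - japanese y| * (japanese x + japanese y) =
      |‖x‖ - ‖y‖| * (‖x‖ + ‖y‖) := by
    have h3 := abs_of_pos (add_pos hx hy)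
    have h4 := abs_of_nonneg (by positivity : 0 ≤ ‖x‖ + ‖y‖)
    calc _ = |(japanese x - japanese y) * (japanese x + japanese y)| := by rw [abs_mul, h3]
      _ = |(‖x‖ - ‖y‖) * (‖x‖ + ‖y‖)| := by congr 1; nlinarith
      _ = _ := by rw [abs_mul, h4]
  have h2 : ‖x‖ + ‖y‖ ≤ japanese x + japanese y :=
    add_le_add (norm_le_japanese x) (norm_le_japanese y)
  by_contra! hc
  have h3 : |‖x‖ - ‖y‖| * (‖x‖ + ‖y‖) ≤ |‖x‖ - ‖y‖| * (japanese x + japanese y) := by gcongr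
  nlinarith [mul_lt_mul_of_pos_right hc (add_pos hx hy)]

lemma continuous_rad (τ : ℝ) : Continuous (rad τ : E d → ℝ) :=
  (continuous_japanese_rpow τ).div_const 4

lemma rad_le {τ : ℝ} (h1 : τ ≤ 1) (x : E d) : rad τ x ≤ japanese x / 4 := by
  have h := Real.rpow_le_rpow_of_exponent_le (one_le_japanese x) h1
  rw [Real.rpow_one] at h
  unfold rad; linarith

/-- For τ ≤ 1 the radius is at most ⟨x⟩ / 4, so the Lipschitz bound keeps the bracket within a
factor 2 on the whole ball. Consequently every power weight is constant there up to a factor. -/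
lemma japanese_comparable {τ : ℝ} (h1 : τ ≤ 1) {x y : E d} (h : y ∈ Metric.ball x (rad τ x)) :
    japanese x ≤ 2 * japanese y ∧ japanese y ≤ 2 * japanese x := by
  rw [Metric.mem_ball, dist_eq_norm] at h
  have h2 := abs_le.1 (abs_japanese_sub_le y x)
  have h3 := rad_le h1 x
  have := japanese_pos x
  constructor <;> linarith [h2.1, h2.2]

lemma rad_comparable {τ : ℝ} (h0 : 0 ≤ τ) (h1 : τ ≤ 1) {x y : E d}
    (hxy : japanese x ≤ 2 * japanese y) : rad τ x ≤ 2 * rad τ y := by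
  have h := Real.rpow_le_rpow (japanese_pos x).le hxy h0
  rw [Real.mul_rpow two_pos.le (japanese_pos y).le] at h
  have h2 : (2 : ℝ) ^ τ ≤ 2 := by
    simpa using Real.rpow_le_rpow_of_exponent_le one_le_two h1
  have h3 := Real.rpow_pos_of_pos (japanese_pos y) τ
  unfold rad
  nlinarith

lemma mem_ball_rad_of_mem_half {τ : ℝ} (h0 : 0 ≤ τ) (h1 : τ ≤ 1) {x y : E d}
    (h : x ∈ Metric.ball y (rad τ y / 2)) : y ∈ Metric.ball x (rad τ x) := by
  have hr := rad_pos τ y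
  have h2 : x ∈ Metric.ball y (rad τ y) := Metric.ball_subset_ball (by linarith) h
  have h3 := rad_comparable h0 h1 (japanese_comparable h1 h2).1
  rw [Metric.mem_ball] at h ⊢
  rw [dist_comm] at h
  linarith

lemma japanese_rpow_le_two_rpow (s : ℝ) {x y : E d} (h1 : japanese x ≤ 2 * japanese y)
    (h2 : japanese y ≤ 2 * japanese x) :
    japanese x ^ s ≤ 2 ^ |s| * japanese y ^ s := by
  have hx := japanese_pos x
  have hy := japanese_pos y
  rcases le_total 0 s with hs | hs
  · rw [abs_of_nonneg hs, ← Real.mul_rpow two_pos.le hy.le]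
    exact Real.rpow_le_rpow hx.le h1 hs
  · rw [abs_of_nonpos hs]
    have h3 := Real.rpow_le_rpow_of_nonpos hy h2 hs
    rw [Real.mul_rpow two_pos.le hx.le] at h3
    rw [Real.rpow_neg two_pos.le, inv_mul_eq_div, le_div_iff₀ (by positivity)]
    linarith

variable {τ : ℝ}

/-- The pairs `(x, y)` with `y ∈ B(x, ρ(x))`. -/
def ballRel (d : ℕ) (τ : ℝ) : Set (E d × E d) := {q | dist q.2 q.1 < rad τ q.1}

/-- The centres `x` with `y ∈ B(x, ρ(x))`. -/
def centres (τ : ℝ) (y : E d) : Set (E d) := {x | dist y x < rad τ x}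

lemma mem_centres {x y : E d} : x ∈ centres τ y ↔ y ∈ Metric.ball x (rad τ x) := Iff.rfl

lemma measurableSet_centres (τ : ℝ) (y : E d) : MeasurableSet (centres τ y) :=
  measurableSet_lt (by fun_prop) (continuous_rad τ).measurable

lemma ballRel_indicator (F : E d × E d → ENNReal) (x y : E d) : (ballRel d τ).indicator F (x, y) =
    (Metric.ball x (rad τ x)).indicator (fun y => F (x, y)) y := rfl

lemma ballRel_indicator' (F : E d × E d → ENNReal) (x y : E d) : (ballRel d τ).indicator F (x, y) =
    (centres τ y).indicator (fun x => F (x, y)) x := rfl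

lemma measurableSet_ballRel (d : ℕ) (τ : ℝ) : MeasurableSet (ballRel d τ) := by
  exact measurableSet_lt (by fun_prop) ((continuous_rad τ).measurable.comp measurable_fst)

lemma measurable_lintegral_ball (τ : ℝ) {F : E d → ENNReal} (hF : Measurable F) :
    Measurable fun x => ∫⁻ y in Metric.ball x (rad τ x), F y := by
  have h : Measurable ((ballRel d τ).indicator fun q => F q.2) :=
    (hF.comp measurable_snd).indicator (measurableSet_ballRel d τ)
  have h2 := h.lintegral_prod_right' (ν := volume)
  simp only [ballRel_indicator, lintegral_indicator measurableSet_ball] at h2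
  exact h2

/-- Exchange of integrals for averages over the balls `B(x, ρ(x))`. -/
lemma lintegral_lintegral_ball (τ : ℝ) {F w : E d → ENNReal} (hF : Measurable F)
    (hw : Measurable w) :
    ∫⁻ x, w x * ∫⁻ y in Metric.ball x (rad τ x), F y =
      ∫⁻ y, F y * ∫⁻ x in centres τ y, w x := by
  have h : Measurable ((ballRel d τ).indicator fun q => w q.1 * F q.2) :=
    ((hw.comp measurable_fst).mul (hF.comp measurable_snd)).indicator (measurableSet_ballRel d τ)
  have h2 : ∫⁻ x, ∫⁻ y, (ballRel d τ).indicator (fun q => w q.1 * F q.2) (x, y) =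
      ∫⁻ y, ∫⁻ x, (ballRel d τ).indicator (fun q => w q.1 * F q.2) (x, y) :=
    lintegral_lintegral_swap h.aemeasurable
  simp only [ballRel_indicator, lintegral_indicator measurableSet_ball,
    lintegral_const_mul _ hF] at h2
  rw [h2]
  refine lintegral_congr fun y => ?_
  rw [← lintegral_const_mul _ hw, ← lintegral_indicator (measurableSet_centres τ y)]
  refine lintegral_congr fun x => ?_
  rw [← ballRel_indicator (fun q => w q.1 * F q.2), ballRel_indicator']
  simp only [mul_comm]

/-- The density `ρ(x)^{-d}`. -/
def radDensity (τ : ℝ) (x : E d) : ENNReal := (ENNReal.ofReal (rad τ x))⁻¹ ^ d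

lemma measurable_radDensity (τ : ℝ) : Measurable (radDensity τ : E d → ENNReal) :=
  ((ENNReal.measurable_ofReal.comp (continuous_rad τ).measurable).inv).pow_const d

lemma radDensity_mul_volume (x : E d) (c : ℝ) (hc : 0 < c) :
    radDensity τ x * volume (Metric.ball x (c * rad τ x)) =
      ENNReal.ofReal c ^ d * volume (Metric.ball (0 : E d) 1) := by
  have hr := rad_pos τ x
  rw [Measure.addHaar_ball_of_pos _ _ (by positivity), finrank_euclideanSpace, Fintype.card_fin,
    ENNReal.ofReal_pow (by positivity), ENNReal.ofReal_mul hc.le, radDensity, mul_pow, ← mul_assoc]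
  congr 1
  rw [mul_comm (ENNReal.ofReal c ^ d), ← mul_assoc, ← mul_pow, ENNReal.inv_mul_cancel, one_pow,
    one_mul]
  · simpa using hr
  · simp

lemma radDensity_le {c : ℝ} (hc : 0 < c) {x y : E d} (h : rad τ y ≤ c * rad τ x) :
    radDensity τ x ≤ ENNReal.ofReal c ^ d * radDensity τ y := by
  have hy := rad_pos τ y
  have hx := rad_pos τ x
  rw [radDensity, radDensity, ← mul_pow]
  refine pow_le_pow_left' ?_ d
  rw [← ENNReal.ofReal_inv_of_pos hx, ← ENNReal.ofReal_inv_of_pos hy, ← ENNReal.ofReal_mul hc.le]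
  refine ENNReal.ofReal_le_ofReal ?_
  rw [inv_eq_one_div, div_le_iff₀ hx, mul_right_comm, ← div_eq_mul_inv, le_div_iff₀ hy]
  linarith

/-- After exchanging the integrals, y receives the weight ∫ ρ^{-d} over the centres whose ball
contains y. These centres lie in B(y, 2ρ(y)) and their radii are at least ρ(y)/2, so the weight is
bounded. -/
lemma exists_lintegral_average_le (d : ℕ) (h0 : 0 ≤ τ) (h1 : τ ≤ 1) : ∃ C : NNReal,
    ∀ F : E d → ENNReal, Measurable F →
      ∫⁻ x, radDensity τ x * ∫⁻ y in Metric.ball x (rad τ x), F y ≤ C * ∫⁻ y, F y := by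
  obtain ⟨B, hB⟩ : ∃ B : ENNReal, B = volume (Metric.ball (0 : E d) 1) := ⟨_, rfl⟩
  have hBt : B ≠ ⊤ := by rw [hB]; exact measure_ball_lt_top.ne
  obtain ⟨k, hk⟩ : ∃ k : ENNReal, k = ENNReal.ofReal 2 ^ d := ⟨_, rfl⟩
  have hkt : k ≠ ⊤ := by rw [hk]; exact ENNReal.pow_ne_top ENNReal.ofReal_ne_top
  obtain ⟨c, hc⟩ : ∃ c : ENNReal, c = k * (k * B) := ⟨_, rfl⟩
  have hct : c ≠ ⊤ := by rw [hc]; exact ENNReal.mul_ne_top hkt (ENNReal.mul_ne_top hkt hBt)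
  refine ⟨c.toNNReal, fun F hF => ?_⟩
  rw [lintegral_lintegral_ball τ hF (measurable_radDensity τ), ENNReal.coe_toNNReal hct,
    ← lintegral_const_mul _ hF]
  refine lintegral_mono fun y => ?_
  rw [mul_comm]
  gcongr
  calc ∫⁻ x in centres τ y, radDensity τ x
      ≤ ∫⁻ x in centres τ y, k * radDensity τ y := by
        refine setLIntegral_mono' (measurableSet_centres τ y) fun x hx => ?_
        rw [hk]
        exact radDensity_le two_pos (rad_comparable h0 h1 (japanese_comparable h1 (mem_centres.1 hx)).2)
    _ = k * (radDensity τ y * volume (centres τ y)) := by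
        rw [setLIntegral_const]; ring
    _ ≤ k * (radDensity τ y * volume (Metric.ball y (2 * rad τ y))) := by
        gcongr
        intro x hx
        have hx' := mem_centres.1 hx
        have h2 := rad_comparable h0 h1 (japanese_comparable h1 hx').1
        rw [Metric.mem_ball, dist_comm] at hx'
        exact Metric.mem_ball.2 (by linarith)
    _ = _ := by rw [radDensity_mul_volume y 2 two_pos, hc, hB, hk]

/-- Conversely, every x in B(y, ρ(y)/2) is a centre whose ball contains y, and its radius is at most
2ρ(y), so the weight received by y is bounded below. -/
lemma exists_le_lintegral_average (d : ℕ) (h0 : 0 ≤ τ) (h1 : τ ≤ 1) : ∃ C : NNReal,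
    ∀ F : E d → ENNReal, Measurable F →
      ∫⁻ y, F y ≤ C * ∫⁻ x, radDensity τ x * ∫⁻ y in Metric.ball x (rad τ x), F y := by
  obtain ⟨B, hB⟩ : ∃ B : ENNReal, B = volume (Metric.ball (0 : E d) 1) := ⟨_, rfl⟩
  have hBt : B ≠ ⊤ := by rw [hB]; exact measure_ball_lt_top.ne
  have hB0 : B ≠ 0 := by rw [hB]; exact volume_unitBall_ne_zero
  obtain ⟨b, hb⟩ : ∃ b : ENNReal, b = ENNReal.ofReal 2⁻¹ ^ d * B := ⟨_, rfl⟩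
  have hb0 : b ≠ 0 := by rw [hb]; exact mul_ne_zero (pow_ne_zero _ (by simp)) hB0
  have hbt : b ≠ ⊤ := by
    rw [hb]; exact ENNReal.mul_ne_top (ENNReal.pow_ne_top ENNReal.ofReal_ne_top) hBt
  obtain ⟨k, hk⟩ : ∃ k : ENNReal, k = ENNReal.ofReal 2 ^ d := ⟨_, rfl⟩
  have hkt : k ≠ ⊤ := by rw [hk]; exact ENNReal.pow_ne_top ENNReal.ofReal_ne_top
  obtain ⟨c, hc⟩ : ∃ c : ENNReal, c = k * b⁻¹ := ⟨_, rfl⟩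
  have hct : c ≠ ⊤ := by rw [hc]; exact ENNReal.mul_ne_top hkt (ENNReal.inv_ne_top.2 hb0)
  refine ⟨c.toNNReal, fun F hF => ?_⟩
  rw [lintegral_lintegral_ball τ hF (measurable_radDensity τ), ENNReal.coe_toNNReal hct]
  have hm : ∀ y : E d, 1 ≤ c * ∫⁻ x in centres τ y, radDensity τ x := by
    intro y
    have h2 : b ≤ k *
        ∫⁻ x in centres τ y, radDensity τ x := by
      rw [hb, hB, ← radDensity_mul_volume (τ := τ) y 2⁻¹ (by norm_num), ← lintegral_const_mul _
        (measurable_radDensity τ), ← setLIntegral_const]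
      refine (setLIntegral_mono' measurableSet_ball fun x hx => ?_).trans
        (lintegral_mono_set fun x hx => ?_)
      · rw [hk]
        refine radDensity_le two_pos (rad_comparable h0 h1 (japanese_comparable h1 ?_).2)
        refine Metric.ball_subset_ball ?_ hx
        have := rad_pos τ y
        linarith
      · refine mem_centres.2 (mem_ball_rad_of_mem_half h0 h1 ?_)
        convert hx using 2
        ring
    rw [hc, mul_right_comm, ← div_eq_mul_inv, ENNReal.le_div_iff_mul_le (Or.inl hb0) (Or.inl hbt),
      one_mul]
    exact h2
  have hmeas : Measurable fun y => F y * ∫⁻ x in centres τ y,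
      radDensity τ x := by
    refine hF.mul ?_
    have h : Measurable ((ballRel d τ).indicator fun q => radDensity τ q.1) :=
      ((measurable_radDensity τ).comp measurable_fst).indicator (measurableSet_ballRel d τ)
    have h2 := h.lintegral_prod_left' (μ := volume)
    simp only [ballRel_indicator', lintegral_indicator (measurableSet_centres τ _)] at h2
    exact h2
  rw [← lintegral_const_mul _ hmeas]
  refine lintegral_mono fun y => ?_
  calc F y = F y * 1 := (mul_one _).symm
    _ ≤ F y * (c * ∫⁻ x in centres τ y, radDensity τ x) := by
        gcongr; exact hm y
    _ = _ := by ring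

end Averaging

end AsymptoticSpaces
end

/-! ### From products on balls to weighted products -/

noncomputable section
namespace AsymptoticSpaces
variable {d : ℕ} {p τ : ℝ} {a b : ℕ} {u v : E d → ℝ}

/-- The measure `ρ(x)^{-d} dx`. -/
def radMeasure (d : ℕ) (τ : ℝ) : Measure (E d) := volume.withDensity (radDensity τ)

lemma eLpNorm_radMeasure (hp : 0 < p) {g : E d → ENNReal} (hg : Measurable g) :
    eLpNorm g (ENNReal.ofReal p) (radMeasure d τ) =
      (∫⁻ x, radDensity τ x * g x ^ p) ^ (1 / p) := by
  rw [eLpNorm_eq_lintegral_rpow_enorm_toReal (by simpa using hp) (by simp),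
    ENNReal.toReal_ofReal hp.le, radMeasure,
    lintegral_withDensity_eq_lintegral_mul _ (measurable_radDensity τ) (by fun_prop)]
  rfl

lemma eLpNorm_ennreal_const_mul (hp : 0 < p) {μ : Measure (E d)} {c : ENNReal} (hc : c ≠ ⊤)
    (g : E d → ENNReal) : eLpNorm (fun x => c * g x) (ENNReal.ofReal p) μ =
      c * eLpNorm g (ENNReal.ofReal p) μ := by
  rw [eLpNorm_eq_lintegral_rpow_enorm_toReal (by simpa using hp) (by simp),
    eLpNorm_eq_lintegral_rpow_enorm_toReal (by simpa using hp) (by simp),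
    ENNReal.toReal_ofReal hp.le]
  simp only [enorm_eq_self, ENNReal.mul_rpow_of_nonneg _ _ hp.le]
  rw [lintegral_const_mul' _ _ (ENNReal.rpow_ne_top_of_nonneg hp.le hc),
    ENNReal.mul_rpow_of_nonneg _ _ (by positivity), ← ENNReal.rpow_mul]
  rw [mul_one_div_cancel hp.ne', ENNReal.rpow_one]

lemma eLpNorm_ball_eq (hp : 0 < p) (v : E d → ℝ) (x : E d) (ρ : ℝ) :
    eLpNorm v (ENNReal.ofReal p) (volume.restrict (Metric.ball x ρ)) =
      (∫⁻ y in Metric.ball x ρ, ‖v y‖ₑ ^ p) ^ (1 / p) := by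
  rw [eLpNorm_eq_lintegral_rpow_enorm_toReal (by simpa using hp) (by simp),
    ENNReal.toReal_ofReal hp.le]

lemma measurable_eLpNorm_ball (hp : 0 < p) (hv : AEStronglyMeasurable v volume) :
    Measurable fun x => eLpNorm v (ENNReal.ofReal p) (volume.restrict (Metric.ball x (rad τ x))) := by
  have h : ∀ x, eLpNorm v (ENNReal.ofReal p) (volume.restrict (Metric.ball x (rad τ x))) =
      (∫⁻ y in Metric.ball x (rad τ x), ‖hv.mk v y‖ₑ ^ p) ^ (1 / p) := fun x => by
    rw [eLpNorm_congr_ae (ae_restrict_of_ae hv.ae_eq_mk), eLpNorm_ball_eq hp]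
  simp only [h]
  exact (measurable_lintegral_ball τ
    (hv.stronglyMeasurable_mk.measurable.enorm.pow_const p)).pow_const _

lemma LocSobolev.measurable_ballNorm (hp : 1 ≤ p) (hv : LocSobolev p a v) :
    Measurable fun x => ballNorm p x (rad τ x) a v := by
  have hp0 : 0 < p := by linarith
  have h0 := measurable_eLpNorm_ball (τ := τ) hp0
    (hv.locLp.locallyIntegrable hp).aestronglyMeasurable
  induction a generalizing v with
  | zero => exact h0
  | succ a ih =>
    refine h0.add ((ENNReal.measurable_ofReal.comp (continuous_rad τ).measurable).mul
      (Finset.measurable_fun_sum _ fun i _ => ?_))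
    have h1 := hv.deriv (hv.wd i)
    exact ih h1 (measurable_eLpNorm_ball hp0
      (h1.locLp.locallyIntegrable hp).aestronglyMeasurable)

/-- The `L^p` average, with weight `⟨x⟩^t`, of the local norms on `B(x, ρ(x))`. -/
def avgNorm (p τ : ℝ) (a : ℕ) (t : ℝ) (v : E d → ℝ) : ENNReal :=
  eLpNorm (fun x => ENNReal.ofReal (japanese x ^ t) * ballNorm p x (rad τ x) a v)
    (ENNReal.ofReal p) (radMeasure d τ)

lemma measurable_ofReal_japanese (t : ℝ) :
    Measurable fun x : E d => ENNReal.ofReal (japanese x ^ t) :=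
  ENNReal.measurable_ofReal.comp (continuous_japanese_rpow t).measurable

lemma wnorm_ball_le (h1 : τ ≤ 1) (t : ℝ) (v : E d → ℝ) (x : E d) :
    ENNReal.ofReal (japanese x ^ t) *
        eLpNorm v (ENNReal.ofReal p) (volume.restrict (Metric.ball x (rad τ x))) ≤
      ENNReal.ofReal (2 ^ |t|) * eLpNorm (fun y => japanese y ^ t * v y) (ENNReal.ofReal p)
        (volume.restrict (Metric.ball x (rad τ x))) := by
  have hx := Real.rpow_pos_of_pos (japanese_pos x) t
  rw [← abs_of_pos hx, ← Real.enorm_eq_ofReal_abs, ← eLpNorm_const_smul]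
  refine eLpNorm_le_mul_eLpNorm_of_ae_le_mul ?_ _
  filter_upwards [ae_restrict_mem measurableSet_ball] with y hy
  have h := japanese_comparable h1 hy
  have h2 := japanese_rpow_le_two_rpow t h.1 h.2
  have hy' := Real.rpow_pos_of_pos (japanese_pos y) t
  rw [Pi.smul_apply, smul_eq_mul, norm_mul, norm_mul, ← mul_assoc]
  gcongr
  rwa [Real.norm_of_nonneg hx.le, Real.norm_of_nonneg hy'.le]

lemma ball_wnorm_le (h1 : τ ≤ 1) (t : ℝ) (v : E d → ℝ) (x : E d) :
    eLpNorm (fun y => japanese y ^ t * v y) (ENNReal.ofReal p)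
        (volume.restrict (Metric.ball x (rad τ x))) ≤
      ENNReal.ofReal (2 ^ |t|) * (ENNReal.ofReal (japanese x ^ t) *
        eLpNorm v (ENNReal.ofReal p) (volume.restrict (Metric.ball x (rad τ x)))) := by
  have hx := Real.rpow_pos_of_pos (japanese_pos x) t
  rw [← mul_assoc, ← ENNReal.ofReal_mul (by positivity)]
  refine eLpNorm_le_mul_eLpNorm_of_ae_le_mul ?_ _
  filter_upwards [ae_restrict_mem measurableSet_ball] with y hy
  have h := japanese_comparable h1 hy
  have h2 := japanese_rpow_le_two_rpow t h.2 h.1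
  have hy' := Real.rpow_pos_of_pos (japanese_pos y) t
  rw [norm_mul, Real.norm_of_nonneg hy'.le]
  gcongr

lemma exists_ball_average_eq (hp : 1 ≤ p) {w : E d → ℝ} (hw : AEStronglyMeasurable w volume) :
    ∃ F : E d → ENNReal, Measurable F ∧
      eLpNorm (fun x => eLpNorm w (ENNReal.ofReal p) (volume.restrict (Metric.ball x (rad τ x))))
        (ENNReal.ofReal p) (radMeasure d τ) =
        (∫⁻ x, radDensity τ x * ∫⁻ y in Metric.ball x (rad τ x), F y) ^ (1 / p) ∧
      eLpNorm w (ENNReal.ofReal p) volume = (∫⁻ y, F y) ^ (1 / p) := by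
  have hp0 : 0 < p := by linarith
  refine ⟨fun y => ‖hw.mk w y‖ₑ ^ p, hw.stronglyMeasurable_mk.measurable.enorm.pow_const p, ?_, ?_⟩
  · rw [eLpNorm_radMeasure hp0 (measurable_eLpNorm_ball hp0 hw)]
    congr 1
    refine lintegral_congr fun x => ?_
    rw [eLpNorm_congr_ae (ae_restrict_of_ae hw.ae_eq_mk), eLpNorm_ball_eq hp0, ← ENNReal.rpow_mul,
      one_div_mul_cancel hp0.ne', ENNReal.rpow_one]
  · rw [eLpNorm_congr_ae hw.ae_eq_mk,
      eLpNorm_eq_lintegral_rpow_enorm_toReal (by simpa using hp0) (by simp),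
      ENNReal.toReal_ofReal hp0.le]

lemma wnorm_mono {s t : ℝ} (hst : s ≤ t) (f : E d → ℝ) : wnorm p s f ≤ wnorm p t f := by
  refine eLpNorm_mono fun x => ?_
  rw [norm_mul, norm_mul]
  gcongr
  rw [Real.norm_of_nonneg (Real.rpow_nonneg (japanese_pos x).le _),
    Real.norm_of_nonneg (Real.rpow_nonneg (japanese_pos x).le _)]
  exact Real.rpow_le_rpow_of_exponent_le (one_le_japanese x) hst

/-- With `exists_wnorm_le_avgNorm` this makes the averaged norm of order zero equivalent to the
weighted `L^p` norm: the weight moves inside the ball at the cost of a constant, and the averaging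
lemmas apply to the p-th power. -/
lemma exists_avgNorm_zero_le (d : ℕ) (hp : 1 ≤ p) (h0 : 0 ≤ τ) (h1 : τ ≤ 1) (t : ℝ) :
    ∃ C : NNReal, ∀ v : E d → ℝ, AEStronglyMeasurable v volume →
      avgNorm p τ 0 t v ≤ C * wnorm p t v := by
  obtain ⟨C, hC⟩ := exists_lintegral_average_le d h0 h1
  have hp0 : 0 < p := by linarith
  refine ⟨(2 ^ |t| : ℝ).toNNReal * C ^ (1 / p), fun v hv => ?_⟩
  have hw : AEStronglyMeasurable (fun y => japanese y ^ t * v y) volume :=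
    (continuous_japanese_rpow t).aestronglyMeasurable.mul hv
  obtain ⟨F, hF, hF1, hF2⟩ := exists_ball_average_eq (τ := τ) hp hw
  calc avgNorm p τ 0 t v ≤ eLpNorm (fun x => ENNReal.ofReal (2 ^ |t|) *
        eLpNorm (fun y => japanese y ^ t * v y) (ENNReal.ofReal p)
          (volume.restrict (Metric.ball x (rad τ x)))) (ENNReal.ofReal p) (radMeasure d τ) := by
        refine eLpNorm_mono_enorm fun x => ?_
        rw [enorm_eq_self, enorm_eq_self]
        exact wnorm_ball_le h1 t v x
    _ ≤ ENNReal.ofReal (2 ^ |t|) * (C * ∫⁻ y, F y) ^ (1 / p) := by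
        rw [eLpNorm_ennreal_const_mul hp0 (by simp), hF1]
        gcongr
        exact hC F hF
    _ = _ := by
        rw [ENNReal.mul_rpow_of_nonneg _ _ (by positivity), ← hF2, ENNReal.coe_mul,
          ENNReal.coe_rpow_of_nonneg _ (by positivity), mul_assoc]
        rfl

lemma exists_wnorm_le_avgNorm (d : ℕ) (hp : 1 ≤ p) (h0 : 0 ≤ τ) (h1 : τ ≤ 1) (t : ℝ) :
    ∃ C : NNReal, ∀ v : E d → ℝ, AEStronglyMeasurable v volume →
      wnorm p t v ≤ C * avgNorm p τ 0 t v := by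
  obtain ⟨C, hC⟩ := exists_le_lintegral_average d h0 h1
  have hp0 : 0 < p := by linarith
  refine ⟨C ^ (1 / p) * (2 ^ |t| : ℝ).toNNReal, fun v hv => ?_⟩
  have hw : AEStronglyMeasurable (fun y => japanese y ^ t * v y) volume :=
    (continuous_japanese_rpow t).aestronglyMeasurable.mul hv
  obtain ⟨F, hF, hF1, hF2⟩ := exists_ball_average_eq (τ := τ) hp hw
  calc wnorm p t v = (∫⁻ y, F y) ^ (1 / p) := hF2
    _ ≤ (C * ∫⁻ x, radDensity τ x * ∫⁻ y in Metric.ball x (rad τ x), F y) ^ (1 / p) := by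
        gcongr; exact hC F hF
    _ = (C : ENNReal) ^ (1 / p) * eLpNorm (fun x => eLpNorm (fun y => japanese y ^ t * v y)
          (ENNReal.ofReal p) (volume.restrict (Metric.ball x (rad τ x))))
          (ENNReal.ofReal p) (radMeasure d τ) := by
        rw [ENNReal.mul_rpow_of_nonneg _ _ (by positivity), hF1]
    _ ≤ (C : ENNReal) ^ (1 / p) * (ENNReal.ofReal (2 ^ |t|) * avgNorm p τ 0 t v) := by
        rw [avgNorm, ← eLpNorm_ennreal_const_mul hp0 (c := ENNReal.ofReal (2 ^ |t|)) (by simp)]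
        refine mul_le_mul_right ?_ _
        refine eLpNorm_mono_enorm fun x => ?_
        rw [enorm_eq_self, enorm_eq_self]
        exact ball_wnorm_le h1 t v x
    _ = _ := by
        rw [ENNReal.coe_mul, ENNReal.coe_rpow_of_nonneg _ (by positivity), mul_assoc]
        rfl

lemma ofReal_rpow_mul_rad_le (t : ℝ) (x : E d) :
    ENNReal.ofReal (japanese x ^ t) * ENNReal.ofReal (rad τ x) ≤
      ENNReal.ofReal (japanese x ^ (t + τ)) := by
  have h1 := Real.rpow_pos_of_pos (japanese_pos x) t
  have h2 := Real.rpow_pos_of_pos (japanese_pos x) τ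
  rw [← ENNReal.ofReal_mul h1.le, Real.rpow_add (japanese_pos x)]
  refine ENNReal.ofReal_le_ofReal (mul_le_mul_of_nonneg_left ?_ h1.le)
  unfold rad; linarith

/-- Each derivative in the local norm comes with a radius, at most ⟨x⟩^τ, so β derivatives require
the weight t + τβ. Larger weights are harmless because ⟨x⟩ ≥ 1. -/
lemma exists_avgNorm_le (d : ℕ) (hp : 1 ≤ p) (h0 : 0 ≤ τ) (h1 : τ ≤ 1) (b : ℕ) (t : ℝ) (e : ℕ → ℝ)
    (he : ∀ β ≤ b, t + τ * β ≤ e β) :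
    ∃ C : NNReal, ∀ v : E d → ℝ, MemWeightedSobolev b p e v →
      avgNorm p τ b t v ≤ C * recNorm p b e v := by
  have hP : 1 ≤ ENNReal.ofReal p := by simpa using hp
  induction b generalizing t e with
  | zero =>
    obtain ⟨C, hC⟩ := exists_avgNorm_zero_le d hp h0 h1 t
    refine ⟨C, fun v hv => (hC v hv.locallyIntegrable.aestronglyMeasurable).trans ?_⟩
    gcongr
    exact wnorm_mono (by simpa using he 0 le_rfl) v
  | succ b ih =>
    obtain ⟨C, hC⟩ := exists_avgNorm_zero_le d hp h0 h1 t
    obtain ⟨C', hC'⟩ := ih (t + τ) (fun k => e (k + 1)) fun β hβ => by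
      have := he (β + 1) (by omega)
      push_cast at this ⊢
      linarith
    refine ⟨C + C', fun v hv => ?_⟩
    have hL := hv.locSobolev hp
    set B : Fin d → E d → ENNReal := fun i x =>
      ENNReal.ofReal (japanese x ^ (t + τ)) * ballNorm p x (rad τ x) b (wd i v) with hB
    have hBm : ∀ i, Measurable (B i) := fun i =>
      (measurable_ofReal_japanese _).mul ((hL.deriv (hL.wd i)).measurable_ballNorm hp)
    have hm0 : Measurable fun x => ENNReal.ofReal (japanese x ^ t) *
        ballNorm p x (rad τ x) 0 v :=
      (measurable_ofReal_japanese _).mul ((hL.mono zero_le).measurable_ballNorm hp)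
    have h2 : avgNorm p τ (b + 1) t v ≤ avgNorm p τ 0 t v + ∑ i, avgNorm p τ b (t + τ) (wd i v) := by
      calc avgNorm p τ (b + 1) t v ≤ eLpNorm ((fun x => ENNReal.ofReal (japanese x ^ t) *
            ballNorm p x (rad τ x) 0 v) + ∑ i, B i) (ENNReal.ofReal p) (radMeasure d τ) := by
            refine eLpNorm_mono_enorm fun x => ?_
            simp only [enorm_eq_self, Pi.add_apply, Finset.sum_apply, ballNorm, mul_add, hB]
            rw [← mul_assoc, Finset.mul_sum]
            gcongr with i
            exact ofReal_rpow_mul_rad_le t x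
        _ ≤ avgNorm p τ 0 t v + eLpNorm (∑ i, B i) (ENNReal.ofReal p) (radMeasure d τ) :=
            eLpNorm_add_le hm0.aestronglyMeasurable
              (Finset.aestronglyMeasurable_sum _ fun i _ => (hBm i).aestronglyMeasurable) hP
        _ ≤ _ := by
            gcongr
            exact eLpNorm_sum_le (fun i _ => (hBm i).aestronglyMeasurable) hP
    refine h2.trans ?_
    have h3 : ∀ i, avgNorm p τ b (t + τ) (wd i v) ≤
        C' * recNorm p b (fun k => e (k + 1)) (wd i v) := fun i => hC' _ (hv.deriv hp (hv.wd hp i))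
    have h4 : avgNorm p τ 0 t v ≤ C * wnorm p (e 0) v :=
      (hC v hv.locallyIntegrable.aestronglyMeasurable).trans
        (by gcongr; exact wnorm_mono (by simpa using he 0 zero_le) v)
    calc _ ≤ C * wnorm p (e 0) v + ∑ i, C' * recNorm p b (fun k => e (k + 1)) (wd i v) := by
          gcongr with i; exact h3 i
      _ ≤ (C + C') * wnorm p (e 0) v +
          (C + C') * ∑ i, recNorm p b (fun k => e (k + 1)) (wd i v) := by
          rw [← Finset.mul_sum]
          gcongr
          · exact le_self_add
          · exact le_add_self
      _ = _ := by rw [recNorm, ENNReal.coe_add, mul_add]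

/-- Uniform local norm: `sup_x ⟨x⟩^s ρ(x)^{-d/p} ‖u‖_{B(x, ρ(x))}`. -/
def unifNorm (p τ : ℝ) (a : ℕ) (s : ℝ) (u : E d → ℝ) : ENNReal :=
  ⨆ x, ENNReal.ofReal (japanese x ^ s) * ENNReal.ofReal (rad τ x) ^ (-((d : ℝ) / p)) *
    ballNorm p x (rad τ x) a u

/-- The radius that accompanies a derivative is turned into τ additional orders of weight; the
factor 4 undoes the division in `rad`. -/
lemma unifNorm_deriv_le (s : ℝ) (i : Fin d) (u : E d → ℝ) :
    unifNorm p τ a (s + τ) (wd i u) ≤ 4 * unifNorm p τ (a + 1) s u := by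
  refine iSup_le fun x => ?_
  have h2 : ENNReal.ofReal (japanese x ^ (s + τ)) =
      4 * (ENNReal.ofReal (japanese x ^ s) * ENNReal.ofReal (rad τ x)) := by
    rw [← ENNReal.ofReal_mul (Real.rpow_pos_of_pos (japanese_pos x) s).le,
      show (4 : ENNReal) = ENNReal.ofReal 4 by simp, ← ENNReal.ofReal_mul (by norm_num),
      Real.rpow_add (japanese_pos x)]
    congr 1; unfold rad; ring
  calc _ = 4 * (ENNReal.ofReal (japanese x ^ s) * ENNReal.ofReal (rad τ x) ^ (-((d : ℝ) / p)) *
        (ENNReal.ofReal (rad τ x) * ballNorm p x (rad τ x) a (wd i u))) := by rw [h2]; ring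
    _ ≤ 4 * (ENNReal.ofReal (japanese x ^ s) * ENNReal.ofReal (rad τ x) ^ (-((d : ℝ) / p)) *
        ballNorm p x (rad τ x) (a + 1) u) := by
        gcongr
        rw [ballNorm]
        refine le_add_left ?_
        gcongr
        exact Finset.single_le_sum (f := fun i => ballNorm p x (rad τ x) a (wd i u))
          (fun _ _ => zero_le) (Finset.mem_univ i)
    _ ≤ _ := by
        gcongr
        exact le_iSup (fun x => ENNReal.ofReal (japanese x ^ s) *
          ENNReal.ofReal (rad τ x) ^ (-((d : ℝ) / p)) * ballNorm p x (rad τ x) (a + 1) u) x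

lemma unifNorm_congr {s : ℝ} (h : u =ᵐ[volume] v) : unifNorm p τ a s u = unifNorm p τ a s v := by
  simp only [unifNorm, ballNorm_congr h]

lemma rad_rpow_neg_eq (c : ℝ) (x : E d) : ENNReal.ofReal (rad τ x) ^ (-c) =
    ENNReal.ofReal (4 ^ c) * ENNReal.ofReal (japanese x ^ (-(τ * c))) := by
  have h2 := Real.rpow_pos_of_pos (japanese_pos x) τ
  rw [← ENNReal.ofReal_mul (by positivity), ENNReal.ofReal_rpow_of_pos (rad_pos τ x)]
  congr 1
  rw [rad, Real.div_rpow h2.le (by norm_num), ← Real.rpow_mul (japanese_pos x).le,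
    Real.rpow_neg (by norm_num : (0:ℝ) ≤ 4), div_inv_eq_mul, mul_comm, mul_neg]

lemma unifNorm_zero_le (h1 : τ ≤ 1) (s : ℝ) (u : E d → ℝ) :
    unifNorm p τ 0 s u ≤ ENNReal.ofReal (4 ^ ((d : ℝ) / p) * 2 ^ |s - τ * (d / p)|) *
      wnorm p (s - τ * (d / p)) u := by
  refine iSup_le fun x => ?_
  have hx := japanese_pos x
  calc _ = ENNReal.ofReal (4 ^ ((d : ℝ) / p)) * (ENNReal.ofReal (japanese x ^ (s - τ * (d / p))) *
        ballNorm p x (rad τ x) 0 u) := by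
        rw [rad_rpow_neg_eq, sub_eq_add_neg, Real.rpow_add hx,
          ENNReal.ofReal_mul (Real.rpow_pos_of_pos hx s).le]
        ring
    _ ≤ ENNReal.ofReal (4 ^ ((d : ℝ) / p)) * (ENNReal.ofReal (2 ^ |s - τ * (d / p)|) *
        wnorm p (s - τ * (d / p)) u) := by
        refine mul_le_mul_right ((wnorm_ball_le h1 _ u x).trans ?_) _
        refine mul_le_mul_right ?_ _
        exact eLpNorm_mono_measure _ Measure.restrict_le_self
    _ = _ := by rw [ENNReal.ofReal_mul (by positivity), mul_assoc]

lemma unifNorm_succ_le (s : ℝ) (u : E d → ℝ) : unifNorm p τ (a + 1) s u ≤ unifNorm p τ 0 s u +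
    ∑ i, unifNorm p τ a (s + τ) (wd i u) := by
  refine iSup_le fun x => ?_
  rw [ballNorm, mul_add]
  refine add_le_add (le_iSup (fun x => ENNReal.ofReal (japanese x ^ s) *
      ENNReal.ofReal (rad τ x) ^ (-((d : ℝ) / p)) * ballNorm p x (rad τ x) 0 u) x) ?_
  rw [Finset.mul_sum, Finset.mul_sum]
  refine Finset.sum_le_sum fun i _ => ?_
  refine le_trans ?_ (le_iSup (fun x => ENNReal.ofReal (japanese x ^ (s + τ)) *
      ENNReal.ofReal (rad τ x) ^ (-((d : ℝ) / p)) * ballNorm p x (rad τ x) a (wd i u)) x)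
  calc _ = ENNReal.ofReal (japanese x ^ s) * ENNReal.ofReal (rad τ x) *
        ENNReal.ofReal (rad τ x) ^ (-((d : ℝ) / p)) * ballNorm p x (rad τ x) a (wd i u) := by
        ring
    _ ≤ _ := by gcongr; exact ofReal_rpow_mul_rad_le s x

/-- Local norms are bounded by global ones, and the normalisation ρ^{-d/p} is of size ⟨x⟩^{-τd/p}.
Hence the uniform norm tolerates τd/p more decay than the integral weights provide. -/
lemma exists_unifNorm_le (d : ℕ) (hp : 1 ≤ p) (h1 : τ ≤ 1) (a : ℕ) (s : ℝ) (e : ℕ → ℝ)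
    (he : ∀ β ≤ a, s + τ * β - τ * (d / p) ≤ e β) :
    ∃ C : NNReal, ∀ u : E d → ℝ, MemWeightedSobolev a p e u →
      unifNorm p τ a s u ≤ C * recNorm p a e u := by
  induction a generalizing s e with
  | zero =>
    refine ⟨Real.toNNReal (4 ^ ((d : ℝ) / p) * 2 ^ |s - τ * (d / p)|), fun u hu => ?_⟩
    refine (unifNorm_zero_le h1 s u).trans ?_
    rw [recNorm]
    exact mul_le_mul_right (wnorm_mono (by simpa using he 0 le_rfl) u) _
  | succ a ih =>
    obtain ⟨C', hC'⟩ := ih (s + τ) (fun k => e (k + 1)) fun β hβ => by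
      have := he (β + 1) (by omega)
      push_cast at this ⊢
      linarith
    set C : NNReal := Real.toNNReal (4 ^ ((d : ℝ) / p) * 2 ^ |s - τ * (d / p)|) with hC
    refine ⟨C + C', fun u hu => ?_⟩
    have h3 : unifNorm p τ 0 s u ≤ C * wnorm p (e 0) u :=
      (unifNorm_zero_le h1 s u).trans
        (mul_le_mul_right (wnorm_mono (by simpa using he 0 zero_le) u) _)
    have h4 := unifNorm_succ_le (p := p) (τ := τ) (a := a) s u
    calc _ ≤ C * wnorm p (e 0) u + ∑ i, C' * recNorm p a (fun k => e (k + 1)) (wd i u) := by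
          refine h4.trans ?_
          gcongr with i
          exact hC' _ (hu.deriv hp (hu.wd hp i))
      _ ≤ (C + C') * wnorm p (e 0) u +
          (C + C') * ∑ i, recNorm p a (fun k => e (k + 1)) (wd i u) := by
          rw [← Finset.mul_sum]
          gcongr
          · exact le_self_add
          · exact le_add_self
      _ = _ := by rw [recNorm, ENNReal.coe_add, mul_add]

/-- The zeroth order estimate for products with one uniformly locally bounded factor. -/
lemma exists_wnorm_mul_le (hp : 1 < p) {m : ℕ} (hm : (d : ℝ) / p < m) (h0 : 0 ≤ τ) (h1 : τ ≤ 1)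
    (hab : m ≤ a + b) (s t : ℝ) (e : ℕ → ℝ) (he : ∀ β ≤ m - a, t - s + τ * β ≤ e β) :
    ∃ C : NNReal, ∀ u v : E d → ℝ, LocSobolev p a u → unifNorm p τ a s u < ⊤ →
      MemWeightedSobolev b p e v →
      wnorm p t (fun x => u x * v x) ≤ C * (unifNorm p τ a s u * recNorm p b e v) := by
  -- Only the m - a derivatives of v that multiplication requires are used (none if a ≥ m), so the
  -- weights of v matter only up to that order.
  obtain ⟨C, hC⟩ := exists_eLpNorm_mul_le_ballNorm (d := d) hp hm (a := a) (b := m - a) (by omega)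
  obtain ⟨C1, hC1⟩ := exists_wnorm_le_avgNorm d hp.le h0 h1 t
  obtain ⟨C2, hC2⟩ := exists_avgNorm_le d hp.le h0 h1 (m - a) (t - s) e he
  have hp0 : 0 < p := by linarith
  refine ⟨C1 * (C * C2), fun u v hu hM hv => ?_⟩
  have hb : m - a ≤ b := by omega
  have hv' := hv.mono hb
  set M := unifNorm p τ a s u with hMdef
  -- The weight splits as ⟨x⟩^s ⟨x⟩^{t-s}. The first factor, with ρ^{-d/p} and the local norm of u,
  -- is bounded by the supremum; the second stays with v in the `L^p` average.
  have hkey : avgNorm p τ 0 t (fun x => u x * v x) ≤ C * M * avgNorm p τ (m - a) (t - s) v := by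
    rw [avgNorm, avgNorm, ← eLpNorm_ennreal_const_mul hp0 (ENNReal.mul_ne_top (by simp) hM.ne)]
    refine eLpNorm_mono_enorm fun x => ?_
    rw [enorm_eq_self, enorm_eq_self, ballNorm]
    have hx := japanese_pos x
    calc _ ≤ ENNReal.ofReal (japanese x ^ t) * (C * ENNReal.ofReal (rad τ x) ^ (-((d : ℝ) / p)) *
          (ballNorm p x (rad τ x) a u * ballNorm p x (rad τ x) (m - a) v)) := by
          gcongr
          exact hC x _ (rad_pos τ x) u v hu (hv'.locSobolev hp.le)
      _ = C * (ENNReal.ofReal (japanese x ^ s) * ENNReal.ofReal (rad τ x) ^ (-((d : ℝ) / p)) *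
          ballNorm p x (rad τ x) a u) * (ENNReal.ofReal (japanese x ^ (t - s)) *
            ballNorm p x (rad τ x) (m - a) v) := by
          rw [show t = s + (t - s) by ring, Real.rpow_add hx,
            ENNReal.ofReal_mul (Real.rpow_pos_of_pos hx s).le, show s + (t - s) - s = t - s by ring]
          ring
      _ ≤ _ := by
          gcongr
          exact le_iSup (fun x => ENNReal.ofReal (japanese x ^ s) *
            ENNReal.ofReal (rad τ x) ^ (-((d : ℝ) / p)) * ballNorm p x (rad τ x) a u) x
  have hmeas : AEStronglyMeasurable (fun x => u x * v x) volume :=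
    (hu.locLp.locallyIntegrable hp.le).aestronglyMeasurable.mul
      hv.locallyIntegrable.aestronglyMeasurable
  calc _ ≤ C1 * (C * M * (C2 * recNorm p (m - a) e v)) := by
        refine (hC1 _ hmeas).trans ?_
        gcongr
        refine hkey.trans ?_
        gcongr
        exact hC2 v hv'
    _ ≤ C1 * (C * M * (C2 * recNorm p b e v)) := by
        gcongr
        exact recNorm_mono hb
    _ = _ := by push_cast; ring

/-- Products in weighted Sobolev spaces, with one uniformly locally bounded factor. -/
theorem exists_recNorm_mul_le (hp : 1 < p) {m : ℕ} (hm : (d : ℝ) / p < m) (h0 : 0 ≤ τ) (h1 : τ ≤ 1)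
    (n a b : ℕ) (hna : n ≤ a) (hnb : n ≤ b) (hab : m + n ≤ a + b) (s : ℝ) (e₀ e : ℕ → ℝ)
    (he : ∀ j l β : ℕ, j + l ≤ n → β ≤ m - (a - j) →
      e₀ (j + l) - (s + τ * j) + τ * β ≤ e (l + β)) :
    ∃ C : NNReal, ∀ u v : E d → ℝ, LocSobolev p a u → unifNorm p τ a s u < ⊤ →
      MemWeightedSobolev b p e v →
      MemWeightedSobolev n p e₀ (fun x => u x * v x) ∧
      recNorm p n e₀ (fun x => u x * v x) ≤ C * (unifNorm p τ a s u * recNorm p b e v) := by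
  -- In `he`, the numbers j and l count the derivatives that fall on u and on v, and β counts the
  -- extra derivatives of v spent on multiplication when u has only a - j left.
  induction n generalizing a b s e₀ e with
  | zero =>
    obtain ⟨C, hC⟩ := exists_wnorm_mul_le hp hm h0 h1 (a := a) (b := b) (by omega) s (e₀ 0) e
      fun β hβ => by simpa using he 0 0 β le_rfl (by simpa using hβ)
    refine ⟨C, fun u v hu hM hv => ?_⟩
    have h := hC u v hu hM hv
    refine ⟨(memWeightedSobolev_zero_iff hp.le).2 ⟨?_, h.trans_lt ?_⟩, h⟩
    · exact (continuous_japanese_rpow _).aestronglyMeasurable.mul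
        ((hu.locLp.locallyIntegrable hp.le).aestronglyMeasurable.mul
          hv.locallyIntegrable.aestronglyMeasurable)
    · exact ENNReal.mul_lt_top (by simp) (ENNReal.mul_lt_top hM (hv.recNorm_lt_top hp.le))
  | succ n ih =>
    obtain ⟨a, rfl⟩ : ∃ a', a = a' + 1 := ⟨a - 1, by omega⟩
    obtain ⟨b, rfl⟩ : ∃ b', b = b' + 1 := ⟨b - 1, by omega⟩
    obtain ⟨C, hC⟩ := exists_wnorm_mul_le hp hm h0 h1 (a := a + 1) (b := b + 1) (by omega) s (e₀ 0) e
      fun β hβ => by simpa using he 0 0 β zero_le (by simpa using hβ)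
    -- A derivative on u lowers a and raises its decay by τ; a derivative on v lowers b and shifts
    -- the weights of v.
    obtain ⟨C1, hC1⟩ := ih a (b + 1) (by omega) (by omega) (by omega) (s + τ) (fun k => e₀ (k + 1)) e
      fun j l β hj hβ => by
        have := he (j + 1) l β (by omega) (by omega)
        rw [show j + 1 + l = j + l + 1 by ring] at this
        push_cast at this
        linarith
    obtain ⟨C2, hC2⟩ := ih (a + 1) b (by omega) (by omega) (by omega) s (fun k => e₀ (k + 1))
      (fun k => e (k + 1)) fun j l β hj hβ => by
        have := he j (l + 1) β (by omega) (by omega)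
        rwa [show l + 1 + β = l + β + 1 by ring] at this
    refine ⟨C + d * (C1 * 4 + C2), fun u v hu hM hv => ?_⟩
    set R := unifNorm p τ (a + 1) s u * recNorm p (b + 1) e v with hR
    have h := hC u v hu hM hv
    have hvL := hv.locSobolev hp.le
    have hwd : ∀ i, WD i (fun x => u x * v x) (fun x => wd i u x * v x + u x * wd i v x) :=
      fun i => hu.wd_mul hp hm (by omega) hvL (hu.wd i) (hvL.wd i)
    have hM' : ∀ i, unifNorm p τ a (s + τ) (wd i u) < ⊤ := fun i =>
      (unifNorm_deriv_le s i u).trans_lt (ENNReal.mul_lt_top (by simp) hM)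
    have hA := fun i => hC1 (wd i u) v (hu.deriv (hu.wd i)) (hM' i) hv
    have hB := fun i => hC2 u (wd i v) hu hM (hv.deriv hp.le (hv.wd hp.le i))
    have hRt : R < ⊤ := ENNReal.mul_lt_top hM (hv.recNorm_lt_top hp.le)
    have hmem : MemWeightedSobolev (n + 1) p e₀ fun x => u x * v x := by
      refine (memWeightedSobolev_succ_iff hp.le).2 ⟨⟨?_, h.trans_lt ?_⟩, fun i =>
        ⟨_, hwd i, (hA i).1.add (hB i).1⟩⟩
      · exact (continuous_japanese_rpow _).aestronglyMeasurable.mul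
          ((hu.locLp.locallyIntegrable hp.le).aestronglyMeasurable.mul
            hv.locallyIntegrable.aestronglyMeasurable)
      · exact ENNReal.mul_lt_top (by simp) hRt
    refine ⟨hmem, ?_⟩
    rw [recNorm]
    have hD : ∀ i, recNorm p n (fun k => e₀ (k + 1)) (wd i fun x => u x * v x) ≤
        (C1 * 4 + C2) * R := by
      intro i
      rw [recNorm_congr (weakDeriv_ae_eq (hwd i))]
      refine (recNorm_add_le hp.le (hA i).1 (hB i).1).trans ?_
      rw [add_mul]
      refine add_le_add ((hA i).2.trans ?_) ((hB i).2.trans ?_)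
      · rw [hR, mul_assoc, ← mul_assoc 4]
        gcongr
        exact unifNorm_deriv_le s i u
      · rw [hR]
        gcongr
        rw [recNorm]
        refine le_add_left ?_
        exact Finset.single_le_sum (f := fun i => recNorm p b (fun k => e (k + 1)) (wd i v))
          (fun _ _ => zero_le) (Finset.mem_univ i)
    calc _ ≤ C * R + ∑ _i : Fin d, (C1 * 4 + C2) * R := by gcongr with i; exact hD i
      _ = _ := by simp; ring

end AsymptoticSpaces
end

/-! ### Polar coordinates and functions of the angle -/

noncomputable section
namespace AsymptoticSpaces
variable {d : ℕ}

/-- The measure `r^{d-1} dr` on `(0, ∞)`. -/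
def radialMeasure (d : ℕ) : Measure ℝ :=
  (volume.restrict (Set.Ioi 0)).withDensity fun r => ENNReal.ofReal (r ^ (d - 1))

lemma map_volumeIoiPow (d : ℕ) :
    (Measure.volumeIoiPow (d - 1)).map Subtype.val = radialMeasure d := by
  have hm : Measurable fun r : ℝ => ENNReal.ofReal (r ^ (d - 1)) := by fun_prop
  refine Measure.ext_of_lintegral _ fun f hf => ?_
  rw [lintegral_map hf measurable_subtype_coe, Measure.volumeIoiPow, radialMeasure,
    lintegral_withDensity_eq_lintegral_mul (f := fun a : Set.Ioi (0 : ℝ) =>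
      ENNReal.ofReal (a.1 ^ (d - 1))) (g := fun a => f a.1) _
      (hm.comp measurable_subtype_coe) (hf.comp measurable_subtype_coe), lintegral_withDensity_eq_lintegral_mul _ hm hf,
    ← lintegral_subtype_comap measurableSet_Ioi]
  rfl

instance : SFinite (radialMeasure d) := by unfold radialMeasure; infer_instance

lemma ae_radial_pos : ∀ᵐ r ∂radialMeasure d, 0 < r :=
  (withDensity_absolutelyContinuous _ _).ae_le (ae_restrict_mem measurableSet_Ioi)

lemma lintegral_radial {f : ℝ → ENNReal} (hf : Measurable f) :
    ∫⁻ r, f r ∂radialMeasure d = ∫⁻ r in Set.Ioi 0, ENNReal.ofReal (r ^ (d - 1)) * f r := by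
  rw [radialMeasure, lintegral_withDensity_eq_lintegral_mul _ (by fun_prop) hf]
  rfl

lemma integral_radial (f : ℝ → ℝ) :
    ∫ r, f r ∂radialMeasure d = ∫ r in Set.Ioi 0, r ^ (d - 1) * f r := by
  rw [radialMeasure, integral_withDensity_eq_integral_toReal_smul (by fun_prop) (by simp)]
  refine setIntegral_congr_fun measurableSet_Ioi fun r hr => ?_
  simp [ENNReal.toReal_ofReal (pow_nonneg (le_of_lt hr) _)]

lemma radialMeasure_Iio_lt_top (R : ℝ) : radialMeasure d (Set.Iio R) < ⊤ := by
  rw [radialMeasure, withDensity_apply _ measurableSet_Iio, Measure.restrict_restrict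
    measurableSet_Iio]
  refine (setLIntegral_mono' (g := fun _ => ENNReal.ofReal (R ^ (d - 1)))
    (measurableSet_Iio.inter measurableSet_Ioi) fun r hr => ?_).trans_lt ?_
  · exact ENNReal.ofReal_le_ofReal (pow_le_pow_left₀ (le_of_lt hr.2) (le_of_lt hr.1) _)
  · rw [setLIntegral_const]
    refine ENNReal.mul_lt_top (by simp) ?_
    rw [Set.Iio_inter_Ioi]; simp

lemma sphere_smul_ne_zero (θ : S d) {r : ℝ} (hr : 0 < r) : r • (θ : E d) ≠ 0 :=
  smul_ne_zero hr.ne' (ne_zero_of_mem_unit_sphere θ)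

lemma norm_sphere_smul (θ : S d) {r : ℝ} (hr : 0 < r) : ‖r • (θ : E d)‖ = r := by
  rw [norm_smul, norm_eq_of_mem_sphere, mul_one, Real.norm_of_nonneg hr.le]

lemma ae_polar_pos : ∀ᵐ z ∂(σ d).prod (radialMeasure d), 0 < z.2 :=
  Measure.quasiMeasurePreserving_snd.ae ae_radial_pos

variable [NeZero d]

instance : Nontrivial (E d) :=
  ⟨⟨EuclideanSpace.single 0 1, 0, fun h => by
    have := congrArg (fun v : E d => v 0) h
    simp at this⟩⟩

instance : Nonempty (S d) := (NormedSpace.sphere_nonempty.2 zero_le_one).to_subtype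

/-- Polar coordinates. -/
lemma measurePreserving_polar : MeasurePreserving (fun z : S d × ℝ => z.2 • (z.1 : E d))
    ((σ d).prod (radialMeasure d)) volume := by
  have hcont : Continuous fun z : S d × ℝ => z.2 • (z.1 : E d) := by fun_prop
  refine ⟨hcont.measurable, ?_⟩
  have h1 := (volume : Measure (E d)).measurePreserving_homeomorphUnitSphereProd
  rw [finrank_euclideanSpace_fin] at h1
  have h2 := h1.symm (homeomorphUnitSphereProd (E d)).toMeasurableEquiv
  rw [← map_volumeIoiPow]
  have h3 : (σ d).prod ((Measure.volumeIoiPow (d - 1)).map Subtype.val) =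
      ((σ d).prod (Measure.volumeIoiPow (d - 1))).map (Prod.map id Subtype.val) := by
    rw [← Measure.map_prod_map _ _ measurable_id measurable_subtype_coe, Measure.map_id]
  rw [h3, Measure.map_map hcont.measurable (measurable_id.prodMap measurable_subtype_coe)]
  have h4 : (fun z : S d × ℝ => z.2 • (z.1 : E d)) ∘ Prod.map id Subtype.val =
      Subtype.val ∘ (homeomorphUnitSphereProd (E d)).symm := by
    ext z; simp
  rw [h4, ← Measure.map_map measurable_subtype_coe
    (homeomorphUnitSphereProd (E d)).symm.measurable]
  have h5 : Measure.map (homeomorphUnitSphereProd (E d)).symm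
      ((σ d).prod (Measure.volumeIoiPow (d - 1))) = (volume : Measure (E d)).comap (↑) := h2.map_eq
  -- The homeomorphism covers only the complement of the origin, which has full measure.
  rw [h5, map_comap_subtype_coe (measurableSet_singleton _).compl,
    Measure.restrict_eq_self_of_ae_mem (s := {(0 : E d)}ᶜ) (Measure.ae_ne volume (0 : E d))]

open Classical in
/-- The direction `x / |x|` of `x ≠ 0`. -/
def dir (x : E d) : S d :=
  if h : x = 0 then Classical.arbitrary _ else ⟨‖x‖⁻¹ • x, by
    rw [mem_sphere_zero_iff_norm, norm_smul, norm_inv, norm_norm,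
      inv_mul_cancel₀ (norm_ne_zero_iff.mpr h)]⟩

lemma angular_eq (a : S d → ℝ) {x : E d} (hx : x ≠ 0) : angular a x = a (dir x) := by
  simp [angular, dir, hx]

lemma dir_smul (θ : S d) {r : ℝ} (hr : 0 < r) : dir (r • (θ : E d)) = θ := by
  rw [dir, dif_neg (sphere_smul_ne_zero θ hr)]
  ext1
  simp only [norm_sphere_smul θ hr, smul_smul, inv_mul_cancel₀ hr.ne', one_smul]

lemma angular_smul (a : S d → ℝ) (θ : S d) {r : ℝ} (hr : 0 < r) :
    angular a (r • (θ : E d)) = a θ := by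
  rw [angular_eq a (sphere_smul_ne_zero θ hr), dir_smul θ hr]

lemma measurable_dir : Measurable (dir : E d → S d) := by
  classical
  rw [← (MeasurableEmbedding.subtype_coe
    (Metric.isClosed_sphere (x := (0 : E d)) (ε := 1)).measurableSet).measurable_comp_iff]
  have h : Subtype.val ∘ (dir : E d → S d) = fun x : E d =>
      if x ∈ ({0} : Set (E d)) then ((Classical.arbitrary (S d) : S d) : E d) else ‖x‖⁻¹ • x := by
    funext x
    by_cases hx : x = 0 <;> simp [dir, hx]
  rw [h]
  exact Measurable.ite (measurableSet_singleton _) measurable_const (by fun_prop)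

/-- Null sets of directions have null cones, so `angular` respects almost everywhere equality and
measurability. -/
lemma quasiMeasurePreserving_dir : Measure.QuasiMeasurePreserving (dir : E d → S d) volume (σ d) := by
  refine ⟨measurable_dir, ?_⟩
  rw [← (measurePreserving_polar (d := d)).map_eq, Measure.map_map measurable_dir
    measurePreserving_polar.measurable]
  have h : dir ∘ (fun z : S d × ℝ => z.2 • (z.1 : E d)) =ᵐ[(σ d).prod (radialMeasure d)] Prod.fst := by
    filter_upwards [ae_polar_pos] with z hz
    exact dir_smul z.1 hz
  rw [Measure.map_congr h]
  exact Measure.quasiMeasurePreserving_fst.absolutelyContinuous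

lemma angular_ae_eq (a : S d → ℝ) : angular a =ᵐ[volume] a ∘ dir := by
  filter_upwards [Measure.ae_ne volume (0 : E d)] with x hx
  exact angular_eq a hx

lemma angular_congr {a b : S d → ℝ} (h : a =ᵐ[σ d] b) : angular a =ᵐ[volume] angular b :=
  (angular_ae_eq a).trans ((quasiMeasurePreserving_dir.ae_eq_comp h).trans (angular_ae_eq b).symm)

lemma aestronglyMeasurable_angular {a : S d → ℝ} (h : AEStronglyMeasurable a (σ d)) :
    AEStronglyMeasurable (angular a) volume :=
  (h.comp_quasiMeasurePreserving quasiMeasurePreserving_dir).congr (angular_ae_eq a).symm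

/-- Integration of products of radial and angular functions. -/
lemma lintegral_radial_mul_angular {F : ℝ → ENNReal} (hF : Measurable F) {G : S d → ENNReal}
    (hG : AEMeasurable G (σ d)) :
    ∫⁻ x : E d, F ‖x‖ * G (dir x) = (∫⁻ r, F r ∂radialMeasure d) * ∫⁻ θ, G θ ∂σ d := by
  have hm : AEMeasurable (fun x : E d => F ‖x‖ * G (dir x)) volume :=
    (hF.comp measurable_norm).aemeasurable.mul
      (hG.comp_quasiMeasurePreserving quasiMeasurePreserving_dir)
  rw [← measurePreserving_polar.map_eq] at hm ⊢
  rw [lintegral_map' hm measurePreserving_polar.aemeasurable]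
  have h : (fun z : S d × ℝ => F ‖z.2 • (z.1 : E d)‖ * G (dir (z.2 • (z.1 : E d))))
      =ᵐ[(σ d).prod (radialMeasure d)] fun z => G z.1 * F z.2 := by
    filter_upwards [ae_polar_pos] with z hz
    rw [norm_sphere_smul z.1 hz, dir_smul z.1 hz, mul_comm]
  rw [lintegral_congr_ae h, lintegral_prod_mul hG hF.aemeasurable, mul_comm]

lemma integral_polar {f : E d → ℝ} (hf : Integrable f volume) :
    ∫ x, f x = ∫ r, ∫ θ, f (r • (θ : E d)) ∂σ d ∂radialMeasure d := by
  have h1 : Integrable (fun z : S d × ℝ => f (z.2 • (z.1 : E d))) ((σ d).prod (radialMeasure d)) :=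
    (measurePreserving_polar.integrable_comp hf.aestronglyMeasurable).2 hf
  rw [← integral_prod_symm _ h1]
  conv_lhs => rw [← (measurePreserving_polar (d := d)).map_eq]
  rw [integral_map measurePreserving_polar.aemeasurable]
  rw [measurePreserving_polar.map_eq]
  exact hf.aestronglyMeasurable

lemma integral_polar' {f : E d → ℝ} (hf : Integrable f volume) :
    ∫ x, f x = ∫ θ, ∫ r, f (r • (θ : E d)) ∂radialMeasure d ∂σ d := by
  have h1 : Integrable (fun z : S d × ℝ => f (z.2 • (z.1 : E d))) ((σ d).prod (radialMeasure d)) :=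
    (measurePreserving_polar.integrable_comp hf.aestronglyMeasurable).2 hf
  rw [← integral_prod _ h1]
  conv_lhs => rw [← (measurePreserving_polar (d := d)).map_eq]
  rw [integral_map measurePreserving_polar.aemeasurable]
  rw [measurePreserving_polar.map_eq]
  exact hf.aestronglyMeasurable

lemma locallyIntegrable_angular {a : S d → ℝ} (h : Integrable a (σ d)) :
    LocallyIntegrable (angular a) volume := by
  have hm := aestronglyMeasurable_angular h.aestronglyMeasurable
  rw [locallyIntegrable_iff]
  intro K hK
  obtain ⟨R, hR⟩ := hK.isBounded.subset_ball (0 : E d)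
  refine IntegrableOn.mono_set ?_ hR
  refine ⟨hm.restrict, ?_⟩
  rw [HasFiniteIntegral, ← lintegral_indicator measurableSet_ball]
  have h1 := lintegral_radial_mul_angular (F := (Set.Iio R).indicator 1)
    (measurable_one.indicator measurableSet_Iio) h.aestronglyMeasurable.enorm
  calc _ = ∫⁻ x : E d, (Set.Iio R).indicator 1 ‖x‖ * ‖a (dir x)‖ₑ := by
        refine lintegral_congr_ae ?_
        filter_upwards [angular_ae_eq a] with x hx
        by_cases hxR : ‖x‖ < R
        · rw [Set.indicator_of_mem (by simpa using hxR), Set.indicator_of_mem (by simpa using hxR), hx]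
          simp
        · rw [Set.indicator_of_notMem (by simpa using hxR),
            Set.indicator_of_notMem (by simpa using hxR)]
          simp
    _ < ⊤ := by
        rw [h1, lintegral_indicator_one measurableSet_Iio]
        exact ENNReal.mul_lt_top (radialMeasure_Iio_lt_top R) h.2

lemma radialMeasure_Iio_pos : radialMeasure d (Set.Iio 1) ≠ 0 := by
  have h1 := lintegral_radial_mul_angular (d := d) (F := (Set.Iio 1).indicator 1)
    (measurable_one.indicator measurableSet_Iio) (G := fun _ => 1) aemeasurable_const
  intro h0
  rw [lintegral_indicator_one measurableSet_Iio, h0, zero_mul] at h1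
  refine (volume_unitBall_ne_zero (d := d)) ?_
  rw [← lintegral_indicator_one measurableSet_ball, ← h1]
  refine lintegral_congr fun x => ?_
  rw [mul_one]
  by_cases hx : ‖x‖ < 1
  · rw [Set.indicator_of_mem (by simpa using hx), Set.indicator_of_mem (by simpa using hx)]; rfl
  · rw [Set.indicator_of_notMem (by simpa using hx), Set.indicator_of_notMem (by simpa using hx)]

/-- A measurable set of directions whose cone is null is null. -/
lemma ae_of_ae_dir {P : S d → Prop} (h : ∀ᵐ x : E d, P (dir x)) : ∀ᵐ θ ∂σ d, P θ := by
  have h1 : ∀ᵐ z ∂(σ d).prod (radialMeasure d), P z.1 := by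
    have := measurePreserving_polar.quasiMeasurePreserving.ae h
    filter_upwards [this, ae_polar_pos] with z hz hz2
    rwa [dir_smul z.1 hz2] at hz
  have h2 := Measure.ae_ae_of_ae_prod h1
  filter_upwards [h2] with θ hθ
  by_contra hP
  have h3 : radialMeasure d = 0 := by
    rw [← ae_eq_bot]
    exact eventually_false_iff_eq_bot.1 (hθ.mono fun _ hr => hP hr)
  exact radialMeasure_Iio_pos (d := d) (by rw [h3]; simp)

/-- The fundamental lemma on ℝ^d is applied to the extension of c constant along rays: in polar
coordinates each sphere of radius r sees a dilated test function, so the integrals vanish. A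
function of the angle that is null on ℝ^d is null on the sphere. -/
lemma ae_eq_zero_of_integral_sphere {c : S d → ℝ} (hc : Integrable c (σ d))
    (h : ∀ φ : E d → ℝ, ContDiff ℝ ∞ φ → ∫ θ, c θ * φ θ ∂σ d = 0) : c =ᵐ[σ d] 0 := by
  have hl := locallyIntegrable_angular hc
  have h1 : ∀ᵐ x, angular c x = 0 := by
    refine ae_eq_zero_of_integral_contDiff_smul_eq_zero hl fun g hg hgc => ?_
    have hint : Integrable (fun x => g x * angular c x) volume := by
      simpa only [mul_comm] using IsTest.integrable_mul ⟨hg, hgc⟩ hl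
    simp only [smul_eq_mul]
    rw [integral_polar hint]
    have h3 : ∀ᵐ r ∂radialMeasure d,
        ∫ θ, g (r • (θ : E d)) * angular c (r • (θ : E d)) ∂σ d = 0 := by
      filter_upwards [ae_radial_pos] with r hr
      rw [← h (fun x => g (r • x)) (hg.comp (contDiff_const_smul r))]
      refine integral_congr_ae (.of_forall fun θ => ?_)
      simp only [angular_smul c θ hr]
      ring
    rw [integral_congr_ae h3]
    simp
  refine ae_of_ae_dir (P := fun θ => c θ = (0 : S d → ℝ) θ) ?_
  filter_upwards [h1, angular_ae_eq c] with x hx hx2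
  exact hx2.symm.trans hx

end AsymptoticSpaces
end

/-! ### Rotation fields and Sobolev spaces on the sphere -/

noncomputable section
namespace AsymptoticSpaces
variable {d : ℕ}

lemma contDiff_coord (i : Fin d) : ContDiff ℝ ∞ fun x : E d => x i :=
  (EuclideanSpace.proj (𝕜 := ℝ) i).contDiff

lemma contDiff_rot {φ : E d → ℝ} (hφ : ContDiff ℝ ∞ φ) (q : Plane d) : ContDiff ℝ ∞ (rot q φ) :=
  ((contDiff_coord _).mul (contDiff_pderiv hφ _)).sub
    ((contDiff_coord _).mul (contDiff_pderiv hφ _))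

lemma contDiff_rotWord {φ : E d → ℝ} (hφ : ContDiff ℝ ∞ φ) (w : List (Plane d)) :
    ContDiff ℝ ∞ (rotWord w φ) := by
  induction w generalizing φ with
  | nil => exact hφ
  | cons q w ih => exact ih (contDiff_rot hφ q)

lemma rotWord_append_singleton (w : List (Plane d)) (q : Plane d) (φ : E d → ℝ) :
    rotWord (w ++ [q]) φ = rot q (rotWord w φ) := by
  induction w generalizing φ with
  | nil => rfl
  | cons r w ih => exact ih _

lemma integrable_sphere_mul {a : S d → ℝ} (ha : Integrable a (σ d)) {φ : E d → ℝ}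
    (hφ : Continuous φ) : Integrable (fun θ : S d => a θ * φ θ) (σ d) := by
  have hc : Continuous fun θ : S d => φ θ := hφ.comp continuous_subtype_val
  obtain ⟨M, hM⟩ := isCompact_univ.exists_bound_of_continuousOn hc.continuousOn
  exact ha.mul_bdd hc.aestronglyMeasurable (.of_forall fun θ => hM θ (Set.mem_univ _))

lemma IsWeakRot.add {w : List (Plane d)} {a a' b b' : S d → ℝ} (h : IsWeakRot w a b)
    (h' : IsWeakRot w a' b') : IsWeakRot w (fun θ => a θ + a' θ) (fun θ => b θ + b' θ) := by
  refine ⟨h.1.add h'.1, h.2.1.add h'.2.1, fun φ hφ => ?_⟩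
  have hr := (contDiff_rotWord hφ w).continuous
  simp only [add_mul]
  rw [integral_add (integrable_sphere_mul h.1 hr) (integrable_sphere_mul h'.1 hr),
    integral_add (integrable_sphere_mul h.2.1 hφ.continuous)
      (integrable_sphere_mul h'.2.1 hφ.continuous), h.2.2 φ hφ, h'.2.2 φ hφ]
  ring

lemma IsWeakRot.const_mul {w : List (Plane d)} {a b : S d → ℝ} (h : IsWeakRot w a b) (c : ℝ) :
    IsWeakRot w (fun θ => c * a θ) (fun θ => c * b θ) := by
  refine ⟨h.1.const_mul c, h.2.1.const_mul c, fun φ hφ => ?_⟩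
  simp only [mul_assoc, integral_const_mul, h.2.2 φ hφ]
  ring

lemma IsWeakRot.congr {w : List (Plane d)} {a a' b b' : S d → ℝ} (h : IsWeakRot w a b)
    (ha : a =ᵐ[σ d] a') (hb : b =ᵐ[σ d] b') : IsWeakRot w a' b' := by
  refine ⟨h.1.congr ha, h.2.1.congr hb, fun φ hφ => ?_⟩
  have h1 : ∫ θ, a' θ * rotWord w φ θ ∂σ d = ∫ θ, a θ * rotWord w φ θ ∂σ d :=
    integral_congr_ae (by filter_upwards [ha] with θ hθ; rw [hθ])
  have h2 : ∫ θ, b' θ * φ θ ∂σ d = ∫ θ, b θ * φ θ ∂σ d :=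
    integral_congr_ae (by filter_upwards [hb] with θ hθ; rw [hθ])
  rw [h1, h2, h.2.2 φ hφ]

lemma isWeakRot_nil {a : S d → ℝ} (h : Integrable a (σ d)) : IsWeakRot [] a a :=
  ⟨h, h, fun φ _ => by simp [rotWord]⟩

lemma isWeakRot_zero (w : List (Plane d)) : IsWeakRot w (fun _ => 0) (fun _ => 0) :=
  ⟨integrable_zero _ _ _, integrable_zero _ _ _, fun φ _ => by simp⟩

/-- In `rotWord (w ++ [q]) φ` the field `q` acts last on the test function, so by duality it is the
first to act on a. Words are therefore peeled from their end. -/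
lemma isWeakRot_append_iff {w : List (Plane d)} {q : Plane d} {a b c : S d → ℝ}
    (h : IsWeakRot [q] a b) : IsWeakRot (w ++ [q]) a c ↔ IsWeakRot w b c := by
  have key : ∀ φ : E d → ℝ, ContDiff ℝ ∞ φ →
      ∫ θ, a θ * rotWord (w ++ [q]) φ θ ∂σ d = - ∫ θ, b θ * rotWord w φ θ ∂σ d := fun φ hφ => by
    rw [rotWord_append_singleton]
    have := h.2.2 _ (contDiff_rotWord hφ w)
    simpa [rotWord] using this
  constructor
  · rintro ⟨h1, h2, h3⟩
    refine ⟨h.2.1, h2, fun φ hφ => ?_⟩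
    have := h3 φ hφ
    rw [key φ hφ] at this
    rw [← neg_neg (∫ θ, b θ * rotWord w φ θ ∂σ d), this]
    simp [pow_succ]
  · rintro ⟨h1, h2, h3⟩
    refine ⟨h.1, h2, fun φ hφ => ?_⟩
    rw [key φ hφ, h3 φ hφ]
    simp [pow_succ]

variable [NeZero d]

lemma IsWeakRot.unique {w : List (Plane d)} {a b b' : S d → ℝ} (h : IsWeakRot w a b)
    (h' : IsWeakRot w a b') : b =ᵐ[σ d] b' := by
  have h1 := ae_eq_zero_of_integral_sphere (h.2.1.sub h'.2.1) fun φ hφ => by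
    simp only [Pi.sub_apply, sub_mul]
    rw [integral_sub (integrable_sphere_mul h.2.1 hφ.continuous)
      (integrable_sphere_mul h'.2.1 hφ.continuous)]
    have h2 := (h.2.2 φ hφ).symm.trans (h'.2.2 φ hφ)
    rw [sub_eq_zero]
    exact mul_left_cancel₀ (pow_ne_zero _ (by norm_num)) h2
  filter_upwards [h1] with θ hθ
  exact sub_eq_zero.1 hθ

lemma weakRot_spec {w : List (Plane d)} {a b : S d → ℝ} (h : IsWeakRot w a b) :
    IsWeakRot w a (weakRot w a) := by
  have h' : ∃ b, IsWeakRot w a b := ⟨b, h⟩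
  rw [weakRot, dif_pos h']
  exact h'.choose_spec

lemma weakRot_ae_eq {w : List (Plane d)} {a b : S d → ℝ} (h : IsWeakRot w a b) :
    weakRot w a =ᵐ[σ d] b := (weakRot_spec h).unique h

lemma weakRot_congr {w : List (Plane d)} {a a' : S d → ℝ} (h : a =ᵐ[σ d] a') :
    weakRot w a = weakRot w a' := by
  have : IsWeakRot w a = IsWeakRot w a' := by
    ext b
    exact ⟨fun h1 => h1.congr h .rfl, fun h1 => h1.congr h.symm .rfl⟩
  unfold weakRot
  rw [this]

section Sobolev

variable {p : ℝ} {s : ℕ} {a b : S d → ℝ}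

lemma MemSphereSobolev.integrable (h : MemSphereSobolev s p a) : Integrable a (σ d) :=
  (h 0 zero_le Fin.elim0).1.choose_spec.1

lemma MemSphereSobolev.memLp (h : MemSphereSobolev s p a) : MemLp a (ENNReal.ofReal p) (σ d) := by
  have h1 := (h 0 zero_le Fin.elim0).2
  rw [List.ofFn_zero] at h1
  exact (memLp_congr_ae (weakRot_ae_eq (isWeakRot_nil h.integrable))).1 h1

lemma MemSphereSobolev.congr (h : MemSphereSobolev s p a) (hab : a =ᵐ[σ d] b) :
    MemSphereSobolev s p b := fun k hk w => by
  obtain ⟨⟨c, hc⟩, h2⟩ := h k hk w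
  exact ⟨⟨c, hc.congr hab .rfl⟩, weakRot_congr hab ▸ h2⟩

lemma sphereSobolevNorm_congr (hab : a =ᵐ[σ d] b) :
    sphereSobolevNorm s p a = sphereSobolevNorm s p b := by
  simp only [sphereSobolevNorm, weakRot_congr hab]

lemma MemSphereSobolev.mono {s' : ℕ} (h : MemSphereSobolev s p a) (hs : s' ≤ s) :
    MemSphereSobolev s' p a := fun k hk w => h k (hk.trans hs) w

lemma sphereSobolevNorm_mono {s' : ℕ} (hs : s' ≤ s) :
    sphereSobolevNorm s' p a ≤ sphereSobolevNorm s p a :=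
  Finset.sum_le_sum_of_subset (Finset.range_mono (by omega))

lemma memLp_sphere_integrable (hp : 1 ≤ p) (h : MemLp a (ENNReal.ofReal p) (σ d)) :
    Integrable a (σ d) := h.integrable (by simpa using hp)

lemma memSphereSobolev_zero_iff (hp : 1 ≤ p) :
    MemSphereSobolev 0 p a ↔ MemLp a (ENNReal.ofReal p) (σ d) := by
  refine ⟨fun h => h.memLp, fun h k hk w => ?_⟩
  obtain rfl : k = 0 := by omega
  have h1 := isWeakRot_nil (memLp_sphere_integrable hp h)
  rw [List.ofFn_zero]
  exact ⟨⟨_, h1⟩, (memLp_congr_ae (weakRot_ae_eq h1)).2 h⟩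

lemma ofFn_snoc {k : ℕ} (w : Fin k → Plane d) (q : Plane d) :
    List.ofFn (Fin.snoc (α := fun _ => Plane d) w q) = List.ofFn w ++ [q] := by
  rw [List.ofFn_succ']
  simp

lemma memSphereSobolev_succ_iff (hp : 1 ≤ p) : MemSphereSobolev (s + 1) p a ↔
    MemLp a (ENNReal.ofReal p) (σ d) ∧
      ∀ q, ∃ b, IsWeakRot [q] a b ∧ MemSphereSobolev s p b := by
  constructor
  · intro h
    refine ⟨h.memLp, fun q => ?_⟩
    obtain ⟨⟨b, hb⟩, -⟩ := h 1 (by omega) fun _ => q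
    simp only [List.ofFn_succ, List.ofFn_zero] at hb
    refine ⟨b, hb, fun k hk w => ?_⟩
    obtain ⟨⟨c, hc⟩, h2⟩ := h (k + 1) (by omega) (Fin.snoc (α := fun _ => Plane d) w q)
    rw [ofFn_snoc] at hc h2
    have hc' := (isWeakRot_append_iff hb).1 hc
    exact ⟨⟨c, hc'⟩, (memLp_congr_ae ((weakRot_ae_eq hc').trans (weakRot_ae_eq hc).symm)).2 h2⟩
  · rintro ⟨h0, h1⟩ k hk w
    cases k with
    | zero =>
      have h1 := isWeakRot_nil (memLp_sphere_integrable hp h0)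
      rw [List.ofFn_zero]
      exact ⟨⟨_, h1⟩, (memLp_congr_ae (weakRot_ae_eq h1)).2 h0⟩
    | succ k =>
      rw [← Fin.snoc_init_self w, ofFn_snoc]
      obtain ⟨b, hb, hb2⟩ := h1 (w (Fin.last k))
      obtain ⟨⟨c, hc⟩, h2⟩ := hb2 k (by omega) (Fin.init w)
      have hc' := (isWeakRot_append_iff hb).2 hc
      exact ⟨⟨c, hc'⟩, (memLp_congr_ae ((weakRot_ae_eq hc').trans (weakRot_ae_eq hc).symm)).2 h2⟩

lemma MemSphereSobolev.deriv (hp : 1 ≤ p) (h : MemSphereSobolev (s + 1) p a) {q : Plane d}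
    (hb : IsWeakRot [q] a b) : MemSphereSobolev s p b := by
  obtain ⟨c, hc, hc2⟩ := ((memSphereSobolev_succ_iff hp).1 h).2 q
  exact hc2.congr (hc.unique hb)

lemma MemSphereSobolev.rot (hp : 1 ≤ p) (h : MemSphereSobolev (s + 1) p a) (q : Plane d) :
    IsWeakRot [q] a (weakRot [q] a) := by
  obtain ⟨c, hc, hc2⟩ := ((memSphereSobolev_succ_iff hp).1 h).2 q
  exact weakRot_spec hc

lemma sphereSobolevNorm_zero (h : Integrable a (σ d)) :
    sphereSobolevNorm 0 p a = eLpNorm a (ENNReal.ofReal p) (σ d) := by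
  simp [sphereSobolevNorm, eLpNorm_congr_ae (weakRot_ae_eq (isWeakRot_nil h))]

/-- A nonempty word is uniquely a shorter word and a last letter, so, unlike for multi-indices, the
recursion is an equality. -/
lemma sphereSobolevNorm_succ (hp : 1 ≤ p) (h : MemSphereSobolev (s + 1) p a) :
    sphereSobolevNorm (s + 1) p a = eLpNorm a (ENNReal.ofReal p) (σ d) +
      ∑ q, sphereSobolevNorm s p (weakRot [q] a) := by
  rw [sphereSobolevNorm, Finset.sum_range_succ', add_comm]
  congr 1
  · simp [eLpNorm_congr_ae (weakRot_ae_eq (isWeakRot_nil h.integrable))]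
  · simp only [sphereSobolevNorm]
    rw [Finset.sum_comm]
    refine Finset.sum_congr rfl fun k hk => ?_
    rw [← (Fin.snocEquiv fun _ => Plane d).sum_comp, Fintype.sum_prod_type]
    refine Finset.sum_congr rfl fun q _ => Finset.sum_congr rfl fun w _ => ?_
    refine eLpNorm_congr_ae ?_
    have hq := h.rot hp q
    obtain ⟨⟨c, hc⟩, -⟩ := h.deriv hp hq k (Finset.mem_range_succ_iff.1 hk) w
    have hc' := (isWeakRot_append_iff hq).2 hc
    have h3 : List.ofFn ((Fin.snocEquiv fun _ => Plane d) (q, w)) = List.ofFn w ++ [q] :=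
      ofFn_snoc w q
    rw [h3]
    exact (weakRot_ae_eq hc').trans (weakRot_ae_eq hc).symm

lemma eLpNorm_le_sphereSobolevNorm (h : Integrable a (σ d)) :
    eLpNorm a (ENNReal.ofReal p) (σ d) ≤ sphereSobolevNorm s p a := by
  rw [← sphereSobolevNorm_zero h]
  exact sphereSobolevNorm_mono zero_le

lemma sphereSobolevNorm_rot_le (hp : 1 ≤ p) (h : MemSphereSobolev (s + 1) p a) {q : Plane d}
    (hb : IsWeakRot [q] a b) : sphereSobolevNorm s p b ≤ sphereSobolevNorm (s + 1) p a := by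
  rw [sphereSobolevNorm_succ hp h, ← sphereSobolevNorm_congr (weakRot_ae_eq hb)]
  refine le_add_left ?_
  exact Finset.single_le_sum (f := fun q => sphereSobolevNorm s p (weakRot [q] a))
    (fun _ _ => zero_le) (Finset.mem_univ q)

lemma MemSphereSobolev.add (ha : MemSphereSobolev s p a) (hb : MemSphereSobolev s p b) :
    MemSphereSobolev s p (fun θ => a θ + b θ) := fun k hk w => by
  obtain ⟨⟨_, h1⟩, h2⟩ := ha k hk w
  obtain ⟨⟨_, h3⟩, h4⟩ := hb k hk w
  have h5 := (weakRot_spec h1).add (weakRot_spec h3)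
  exact ⟨⟨_, h5⟩, (memLp_congr_ae (weakRot_ae_eq h5)).2 (h2.add h4)⟩

lemma MemSphereSobolev.const_mul (ha : MemSphereSobolev s p a) (c : ℝ) :
    MemSphereSobolev s p (fun θ => c * a θ) := fun k hk w => by
  obtain ⟨⟨_, h1⟩, h2⟩ := ha k hk w
  have h5 := (weakRot_spec h1).const_mul c
  exact ⟨⟨_, h5⟩, (memLp_congr_ae (weakRot_ae_eq h5)).2 (h2.const_mul c)⟩

lemma memSphereSobolev_fun_zero : MemSphereSobolev s p (fun _ : S d => (0 : ℝ)) := fun _ _ _ =>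
  ⟨⟨_, isWeakRot_zero _⟩, (memLp_congr_ae (weakRot_ae_eq (isWeakRot_zero _))).2 MemLp.zero'⟩

lemma sphereSobolevNorm_fun_zero : sphereSobolevNorm s p (fun _ : S d => (0 : ℝ)) = 0 := by
  refine Finset.sum_eq_zero fun k _ => Finset.sum_eq_zero fun w _ => ?_
  rw [eLpNorm_congr_ae (weakRot_ae_eq (isWeakRot_zero _))]
  exact eLpNorm_zero'

lemma sphereSobolevNorm_add_le (hp : 1 ≤ p) (ha : MemSphereSobolev s p a)
    (hb : MemSphereSobolev s p b) : sphereSobolevNorm s p (fun θ => a θ + b θ) ≤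
      sphereSobolevNorm s p a + sphereSobolevNorm s p b := by
  simp only [sphereSobolevNorm, ← Finset.sum_add_distrib]
  refine Finset.sum_le_sum fun k hk => Finset.sum_le_sum fun w _ => ?_
  obtain ⟨⟨_, h1⟩, h2⟩ := ha k (Finset.mem_range_succ_iff.1 hk) w
  obtain ⟨⟨_, h3⟩, h4⟩ := hb k (Finset.mem_range_succ_iff.1 hk) w
  have h5 := (weakRot_spec h1).add (weakRot_spec h3)
  rw [eLpNorm_congr_ae (weakRot_ae_eq h5)]
  exact eLpNorm_add_le h2.1 h4.1 (by simpa using hp)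

lemma sphereSobolevNorm_const_mul (ha : MemSphereSobolev s p a) (c : ℝ) :
    sphereSobolevNorm s p (fun θ => c * a θ) = ENNReal.ofReal |c| * sphereSobolevNorm s p a := by
  simp only [sphereSobolevNorm, Finset.mul_sum]
  refine Finset.sum_congr rfl fun k hk => Finset.sum_congr rfl fun w _ => ?_
  obtain ⟨⟨_, h1⟩, h2⟩ := ha k (Finset.mem_range_succ_iff.1 hk) w
  have h5 := (weakRot_spec h1).const_mul c
  rw [eLpNorm_congr_ae (weakRot_ae_eq h5), ← Real.enorm_eq_ofReal_abs, ← eLpNorm_const_smul]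
  rfl

lemma MemSphereSobolev.norm_lt_top (ha : MemSphereSobolev s p a) :
    sphereSobolevNorm s p a < ⊤ :=
  ENNReal.sum_lt_top.2 fun k hk => ENNReal.sum_lt_top.2 fun w _ =>
    (ha k (Finset.mem_range_succ_iff.1 hk) w).2.2

lemma ae_eq_zero_of_sphereSobolevNorm (hp : 1 ≤ p) (ha : MemSphereSobolev s p a)
    (h : sphereSobolevNorm s p a = 0) : a =ᵐ[σ d] 0 := by
  have h1 := (eLpNorm_le_sphereSobolevNorm (p := p) (s := s) ha.integrable).trans h.le
  exact (eLpNorm_eq_zero_iff ha.memLp.1 (by simpa using by linarith)).1 (le_antisymm h1 zero_le)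

end Sobolev

end AsymptoticSpaces
end

/-! ### Radial symbols -/

noncomputable section
namespace AsymptoticSpaces
variable {d : ℕ}

section Symbols

/-- Smooth functions on the line, vanishing on `(-∞, 1]` and eventually constant. -/
structure IsRadial (ψ : ℝ → ℝ) : Prop where
  smooth : ContDiff ℝ ∞ ψ
  eq_zero : ∀ t ≤ 1, ψ t = 0
  const : ∃ R c : ℝ, ∀ t, R ≤ t → ψ t = c

lemma IsCutoff.isRadial {χ : ℝ → ℝ} (h : IsCutoff χ) : IsRadial χ :=
  ⟨h.smooth, h.eq_zero, 2, 1, h.eq_one⟩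

lemma IsRadial.mul {ψ φ : ℝ → ℝ} (hψ : IsRadial ψ) (hφ : IsRadial φ) :
    IsRadial fun t => ψ t * φ t := by
  obtain ⟨R, c, h⟩ := hψ.const
  obtain ⟨R', c', h'⟩ := hφ.const
  refine ⟨hψ.smooth.mul hφ.smooth, fun t ht => by simp [hψ.eq_zero t ht], max R R', c * c', ?_⟩
  intro t ht
  rw [h t ((le_max_left _ _).trans ht), h' t ((le_max_right _ _).trans ht)]

lemma IsRadial.bounded {ψ : ℝ → ℝ} (hψ : IsRadial ψ) : ∃ M, 0 ≤ M ∧ ∀ t, |ψ t| ≤ M := by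
  obtain ⟨R, c, h⟩ := hψ.const
  obtain ⟨M, hM⟩ := (isCompact_Icc (a := 1) (b := R)).exists_bound_of_continuousOn
    hψ.smooth.continuous.continuousOn
  refine ⟨max (max M 0) |c|, by positivity, fun t => ?_⟩
  rcases le_total t 1 with h1 | h1
  · rw [hψ.eq_zero t h1]; simp
  · rcases le_total R t with h2 | h2
    · rw [h t h2]; exact le_max_right _ _
    · exact (hM t ⟨h1, h2⟩).trans ((le_max_left _ _).trans (le_max_left _ _))

/-- The radial function obtained by differentiating `ψ(r) r^{-k}`. -/
lemma IsRadial.euler {ψ : ℝ → ℝ} (hψ : IsRadial ψ) (k : ℕ) :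
    IsRadial fun t => t * deriv ψ t - k * ψ t := by
  obtain ⟨R, c, h⟩ := hψ.const
  have hd : ContDiff ℝ ∞ (deriv ψ) := ((contDiff_infty_iff_deriv).1 hψ.smooth).2
  refine ⟨(contDiff_id.mul hd).sub (contDiff_const.mul hψ.smooth), fun t ht => ?_, R + 1, -(k * c),
    fun t ht => ?_⟩
  · have h1 : deriv ψ t = 0 := by
      have hcont := hd.continuous
      have hev : ∀ s < 1, deriv ψ s = 0 := fun s hs => by
        have : ψ =ᶠ[𝓝 s] fun _ => 0 := by
          filter_upwards [Iio_mem_nhds hs] with y hy using hψ.eq_zero y (le_of_lt hy)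
        rw [this.deriv_eq, deriv_const]
      have hcl : IsClosed {s | deriv ψ s = 0} := isClosed_eq hcont continuous_const
      have : Set.Iic (1 : ℝ) ⊆ {s | deriv ψ s = 0} := by
        rw [← closure_Iio]
        exact closure_minimal hev hcl
      exact this ht
    rw [h1, hψ.eq_zero t ht]; simp
  · have : ψ =ᶠ[𝓝 t] fun _ => c := by
      filter_upwards [Ioi_mem_nhds (by linarith : R < t)] with y hy using h y (le_of_lt hy)
    rw [this.deriv_eq, deriv_const, h t (by linarith)]; ring

/-- Smooth functions vanishing on the unit ball that behave like symbols of order `s`. -/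
inductive IsSym : ℤ → (E d → ℝ) → Prop
  | radial {ψ : ℝ → ℝ} (hψ : IsRadial ψ) (k : ℕ) : IsSym (-k) fun x => ψ ‖x‖ * (‖x‖ ^ k)⁻¹
  | coord {s : ℤ} {h : E d → ℝ} (hh : IsSym s h) (j : Fin d) : IsSym (s + 1) fun x => x j * h x
  | add {s : ℤ} {h g : E d → ℝ} (hh : IsSym s h) (hg : IsSym s g) : IsSym s fun x => h x + g x

variable {s : ℤ} {h : E d → ℝ}

lemma IsSym.eq_zero (hh : IsSym s h) {x : E d} (hx : ‖x‖ ≤ 1) : h x = 0 := by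
  induction hh with
  | radial hψ k => simp [hψ.eq_zero _ hx]
  | coord _ j ih => simp [ih]
  | add _ _ ih1 ih2 => simp [ih1, ih2]

lemma contDiff_radial {ψ : ℝ → ℝ} (hψ : IsRadial ψ) (k : ℕ) :
    ContDiff ℝ ∞ fun x : E d => ψ ‖x‖ * (‖x‖ ^ k)⁻¹ := by
  rw [contDiff_iff_contDiffAt]
  intro x
  by_cases hx : x = 0
  · refine (contDiffAt_const (c := (0 : ℝ))).congr_of_eventuallyEq ?_
    filter_upwards [Metric.ball_mem_nhds x one_pos] with y hy
    have : ‖y‖ ≤ 1 := by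
      rw [hx, mem_ball_zero_iff] at hy; exact hy.le
    simp [hψ.eq_zero _ this]
  · have hn : ContDiffAt ℝ ∞ (fun x : E d => ‖x‖) x := contDiffAt_norm ℝ hx
    exact (hψ.smooth.contDiffAt.comp x hn).mul ((hn.pow k).inv (pow_ne_zero _ (norm_ne_zero_iff.2 hx)))

lemma IsSym.contDiff (hh : IsSym s h) : ContDiff ℝ ∞ h := by
  induction hh with
  | radial hψ k => exact contDiff_radial hψ k
  | coord _ j ih => exact (contDiff_coord j).mul ih
  | add _ _ ih1 ih2 => exact ih1.add ih2

lemma hasFDerivAt_norm_of_ne {x : E d} (hx : x ≠ 0) :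
    HasFDerivAt (fun x : E d => ‖x‖) ((‖x‖⁻¹ : ℝ) • innerSL ℝ x) x := by
  have h1 : HasFDerivAt (fun x : E d => ‖x‖ ^ 2) (2 • innerSL ℝ x) x :=
    (hasStrictFDerivAt_norm_sq x).hasFDerivAt
  have hx0 : ‖x‖ ^ 2 ≠ 0 := pow_ne_zero _ (norm_ne_zero_iff.2 hx)
  have h2 := h1.sqrt hx0
  simp only [Real.sqrt_sq (norm_nonneg _)] at h2
  refine h2.congr_fderiv ?_
  have := norm_ne_zero_iff.2 hx
  ext y
  simp only [smul_apply, nsmul_eq_mul, smul_eq_mul]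
  push_cast
  field_simp

/-- The Euler-type expression on the right is again an `IsRadial` profile, so differentiation stays
within the class of symbols. The origin is treated apart, since the function vanishes near it. -/
lemma pderiv_radial {ψ : ℝ → ℝ} (hψ : IsRadial ψ) (k : ℕ) (i : Fin d) :
    pderiv i (fun x : E d => ψ ‖x‖ * (‖x‖ ^ k)⁻¹) =
      fun x => x i * ((‖x‖ * deriv ψ ‖x‖ - k * ψ ‖x‖) * (‖x‖ ^ (k + 2))⁻¹) := by
  funext x
  by_cases hx : x = 0
  · have : (fun x : E d => ψ ‖x‖ * (‖x‖ ^ k)⁻¹) =ᶠ[𝓝 x] fun _ => 0 := by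
      filter_upwards [Metric.ball_mem_nhds x one_pos] with y hy
      have : ‖y‖ ≤ 1 := by
        rw [hx, mem_ball_zero_iff] at hy; exact hy.le
      simp [hψ.eq_zero _ this]
    rw [pderiv, this.fderiv_eq]
    simp [hx]
  · have hr : ‖x‖ ≠ 0 := norm_ne_zero_iff.2 hx
    have hn := hasFDerivAt_norm_of_ne hx
    have h1 : HasDerivAt ψ (deriv ψ ‖x‖) ‖x‖ :=
      (hψ.smooth.differentiable (by simp) _).hasDerivAt
    have h2 : HasDerivAt (fun t : ℝ => ψ t * (t ^ k)⁻¹)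
        (deriv ψ ‖x‖ * (‖x‖ ^ k)⁻¹ + ψ ‖x‖ * (-(k * ‖x‖ ^ (k - 1)) / (‖x‖ ^ k) ^ 2)) ‖x‖ :=
      h1.mul ((hasDerivAt_pow k _).inv (pow_ne_zero _ hr))
    have h3 := h2.comp_hasFDerivAt x hn
    have h4 : (fun x : E d => ψ ‖x‖ * (‖x‖ ^ k)⁻¹) = (fun t : ℝ => ψ t * (t ^ k)⁻¹) ∘ fun x => ‖x‖ :=
      rfl
    rw [pderiv, h4, h3.fderiv]
    have h5 : (inner ℝ x (EuclideanSpace.single i (1 : ℝ)) : ℝ) = x i := by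
      rw [EuclideanSpace.inner_single_right]; simp
    simp only [smul_apply, innerSL_apply_apply, h5, smul_eq_mul]
    cases k with
    | zero => simp; field_simp
    | succ k =>
      simp only [Nat.add_sub_cancel]
      field_simp
      ring

lemma IsSym.cast {s' : ℤ} (hh : IsSym s h) (hs : s = s') : IsSym s' h := hs ▸ hh

lemma IsSym.pderiv (hh : IsSym s h) (i : Fin d) : IsSym (s - 1) (pderiv i h) := by
  induction hh with
  | radial hψ k =>
    rw [pderiv_radial hψ]
    exact ((IsSym.radial (hψ.euler k) (k + 2)).coord i).cast (by push_cast; ring)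
  | @coord s h hh j ih =>
    have h1 : AsymptoticSpaces.pderiv i (fun x : E d => x j * h x) =
        fun x => (if i = j then h x else 0) + x j * AsymptoticSpaces.pderiv i h x := by
      funext x
      rw [pderiv_mul (contDiff_coord j) hh.contDiff]
      congr 1
      have : AsymptoticSpaces.pderiv i (fun x : E d => x j) x = if i = j then 1 else 0 := by
        have h2 : fderiv ℝ (fun x : E d => x j) x = EuclideanSpace.proj (𝕜 := ℝ) j :=
          (EuclideanSpace.proj (𝕜 := ℝ) j).fderiv
        rw [AsymptoticSpaces.pderiv, h2]
        simp [eq_comm]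
      rw [this]; split_ifs <;> simp
    rw [h1]
    by_cases hij : i = j
    · simp only [hij, if_true]
      exact (hh.cast (by ring)).add ((hij ▸ ih.coord j).cast (by ring))
    · simp only [hij, if_false, zero_add]
      exact (ih.coord j).cast (by ring)
  | @add s h g hh hg ih1 ih2 =>
    have h1 : AsymptoticSpaces.pderiv i (fun x : E d => h x + g x) =
        fun x => AsymptoticSpaces.pderiv i h x + AsymptoticSpaces.pderiv i g x :=
      funext fun x => pderiv_add hh.contDiff hg.contDiff i x
    rw [h1]
    exact ih1.add ih2

lemma IsSym.div_sq (hh : IsSym s h) : IsSym (s - 2) fun x => h x * (‖x‖ ^ 2)⁻¹ := by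
  induction hh with
  | radial hψ k =>
    convert (IsSym.radial hψ (k + 2)).cast (s' := -k - 2) (by push_cast; ring) using 2 with x
    rw [pow_add, mul_inv]; ring
  | @coord s h hh j ih =>
    convert (ih.coord j).cast (s' := s + 1 - 2) (by ring) using 2 with x
    ring
  | @add s h g hh hg ih1 ih2 =>
    convert ih1.add ih2 using 2 with x
    ring

lemma japanese_le_two_mul {x : E d} (hx : 1 ≤ ‖x‖) : japanese x ≤ 2 * ‖x‖ :=
  (japanese_le x).trans (by linarith)

/-- Symbols vanish on the unit ball, and outside it the norm and the bracket are comparable. -/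
lemma IsSym.bound (hh : IsSym s h) : ∃ C, 0 ≤ C ∧ ∀ x, |h x| ≤ C * japanese x ^ s := by
  induction hh with
  | @radial ψ hψ k =>
    obtain ⟨M, hM, hM2⟩ := hψ.bounded
    refine ⟨M * 2 ^ k, by positivity, fun x => ?_⟩
    have hj := japanese_pos x
    rcases le_total ‖x‖ 1 with h1 | h1
    · simp only [hψ.eq_zero _ h1, zero_mul, abs_zero]; positivity
    · rw [abs_mul, zpow_neg, zpow_natCast, abs_of_nonneg (by positivity : 0 ≤ (‖x‖ ^ k)⁻¹), mul_assoc]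
      gcongr
      · exact hM2 _
      · rw [← div_eq_mul_inv, ← div_pow, ← inv_pow]
        gcongr
        rw [inv_le_iff_one_le_mul₀ (by linarith), div_mul_eq_mul_div, le_div_iff₀ hj, one_mul]
        exact japanese_le_two_mul h1
  | @coord s h hh j ih =>
    obtain ⟨C, hC, hC2⟩ := ih
    refine ⟨C, hC, fun x => ?_⟩
    have hj := japanese_pos x
    have hxj : |x j| ≤ japanese x := by
      rw [← Real.norm_eq_abs]
      exact (PiLp.norm_apply_le x j).trans (norm_le_japanese x)
    rw [abs_mul, zpow_add_one₀ hj.ne']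
    calc |x j| * |h x| ≤ japanese x * (C * japanese x ^ s) := by gcongr; exact hC2 x
      _ = _ := by ring
  | @add s h g hh hg ih1 ih2 =>
    obtain ⟨C, hC, hC2⟩ := ih1
    obtain ⟨C', hC', hC2'⟩ := ih2
    refine ⟨C + C', by positivity, fun x => (abs_add_le _ _).trans ?_⟩
    rw [add_mul]
    exact add_le_add (hC2 x) (hC2' x)

end Symbols

/-! ### Weak derivatives of h(x) a(θ) -/

section Derivative

variable [NeZero d]

lemma integrable_angular_mul {a : S d → ℝ} (ha : Integrable a (σ d)) {Ψ : E d → ℝ} (hΨ : IsTest Ψ) :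
    Integrable (fun x => angular a x * Ψ x) volume :=
  hΨ.integrable_mul (locallyIntegrable_angular ha)

/-- Radial divergences integrate to zero against functions of the angle. -/
lemma integral_angular_mul_euler {a : S d → ℝ} (ha : Integrable a (σ d)) {Ψ : E d → ℝ}
    (hΨ : IsTest Ψ) : ∫ x, angular a x * (d * Ψ x + fderiv ℝ Ψ x x) = 0 := by
  have hD : IsTest fun x => d * Ψ x + fderiv ℝ Ψ x x := by
    have h1 : ContDiff ℝ ∞ fun x => fderiv ℝ Ψ x x :=
      (hΨ.smooth.fderiv_right (m := ∞) (by simp)).clm_apply contDiff_id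
    refine ⟨(contDiff_const.mul hΨ.smooth).add h1, ?_⟩
    refine HasCompactSupport.add hΨ.compact.mul_left ?_
    refine (hΨ.compact.fderiv ℝ).mono' fun x hx => ?_
    refine subset_tsupport _ fun h => hx ?_
    simp only [h, zero_apply]
  rw [integral_polar' (integrable_angular_mul ha hD)]
  have h0 : ∀ θ : S d, ∫ r, angular a (r • (θ : E d)) * (d * Ψ (r • (θ : E d)) +
      fderiv ℝ Ψ (r • (θ : E d)) (r • (θ : E d))) ∂radialMeasure d = 0 := by
    intro θ
    have hd : 0 < d := Nat.pos_of_ne_zero (NeZero.ne d)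
    have hcomp : ContDiff ℝ ∞ fun r : ℝ => r ^ d * Ψ (r • (θ : E d)) :=
      (contDiff_id.pow d).mul (hΨ.smooth.comp (contDiff_id.smul contDiff_const))
    -- With the polar density, the integrand is the radial derivative of r^d Ψ. Its integral over a
    -- ray is a boundary term, zero at the origin because d ≥ 1 and at infinity by compact support.
    have hderiv : ∀ r : ℝ, HasDerivAt (fun r : ℝ => r ^ d * Ψ (r • (θ : E d)))
        (r ^ (d - 1) * (d * Ψ (r • (θ : E d)) + fderiv ℝ Ψ (r • (θ : E d)) (r • (θ : E d)))) r := by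
      intro r
      have h1 : HasDerivAt (fun r : ℝ => r • (θ : E d)) (θ : E d) r := by
        simpa using (hasDerivAt_id r).smul_const (θ : E d)
      have h2 := (hΨ.smooth.differentiable (by simp) (r • (θ : E d))).hasFDerivAt.comp_hasDerivAt r h1
      refine ((hasDerivAt_pow d r).mul h2).congr_deriv ?_
      rw [map_smul, smul_eq_mul]
      obtain ⟨k, rfl⟩ : ∃ k, d = k + 1 := ⟨d - 1, by omega⟩
      simp only [Nat.add_sub_cancel, Function.comp]
      ring
    have hsupp : HasCompactSupport fun r : ℝ => r ^ d * Ψ (r • (θ : E d)) := by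
      obtain ⟨R, hR⟩ := hΨ.compact.isCompact.isBounded.subset_closedBall (0 : E d)
      refine HasCompactSupport.intro (isCompact_Icc (a := -R) (b := R)) fun r hr => ?_
      have : Ψ (r • (θ : E d)) = 0 := by
        by_contra hne
        have h1 := hR (subset_tsupport Ψ hne)
        rw [mem_closedBall_zero_iff, norm_smul, norm_eq_of_mem_sphere, mul_one, Real.norm_eq_abs,
          abs_le] at h1
        exact hr h1
      rw [this, mul_zero]
    have hI : Integrable (fun r : ℝ => r ^ (d - 1) * (d * Ψ (r • (θ : E d)) +
        fderiv ℝ Ψ (r • (θ : E d)) (r • (θ : E d)))) volume := by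
      have h1 : (fun r : ℝ => r ^ (d - 1) * (d * Ψ (r • (θ : E d)) +
        fderiv ℝ Ψ (r • (θ : E d)) (r • (θ : E d)))) = deriv fun r : ℝ => r ^ d * Ψ (r • (θ : E d)) :=
        funext fun r => (hderiv r).deriv.symm
      rw [h1]
      exact (hcomp.continuous_deriv (by simp)).integrable_of_hasCompactSupport hsupp.deriv
    have h2 := integral_Ioi_of_hasDerivAt_of_tendsto' (a := 0) (fun r _ => hderiv r)
      hI.integrableOn (m := 0) (hsupp.is_zero_at_infty.mono_left atTop_le_cocompact)
    rw [integral_radial]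
    calc _ = a θ * ∫ r in Set.Ioi (0 : ℝ), r ^ (d - 1) * (d * Ψ (r • (θ : E d)) +
          fderiv ℝ Ψ (r • (θ : E d)) (r • (θ : E d))) := by
          rw [← integral_const_mul]
          refine setIntegral_congr_fun measurableSet_Ioi fun r hr => ?_
          simp only [angular_smul a θ hr]
          ring
      _ = 0 := by rw [h2]; simp [hd.ne']
  simp only [h0, integral_zero]

lemma pderiv_dilate {Ψ : E d → ℝ} (hΨ : ContDiff ℝ ∞ Ψ) (r : ℝ) (i : Fin d) (x : E d) :
    pderiv i (fun y => Ψ (r • y)) x = r * pderiv i Ψ (r • x) := by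
  have h1 : HasFDerivAt (fun y : E d => r • y) (r • ContinuousLinearMap.id ℝ (E d)) x :=
    (hasFDerivAt_id x).const_smul r
  have h2 := (hΨ.differentiable (by simp) (r • x)).hasFDerivAt.comp x h1
  have h3 : (fun y => Ψ (r • y)) = Ψ ∘ fun y => r • y := rfl
  rw [pderiv, h3, h2.fderiv]
  simp [pderiv]

lemma rot_dilate {Ψ : E d → ℝ} (hΨ : ContDiff ℝ ∞ Ψ) (r : ℝ) (q : Plane d) (x : E d) :
    rot q (fun y => Ψ (r • y)) x = rot q Ψ (r • x) := by
  simp only [rot, pderiv_dilate hΨ, PiLp.smul_apply, smul_eq_mul]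
  ring

lemma IsTest.rot {Ψ : E d → ℝ} (hΨ : IsTest Ψ) (q : Plane d) : IsTest (rot q Ψ) := by
  refine ⟨contDiff_rot hΨ.smooth q, ?_⟩
  have h1 := ((hΨ.pderiv q.1.2).mul_left (contDiff_coord q.1.1)).compact
  have h2 := ((hΨ.pderiv q.1.1).mul_left (contDiff_coord q.1.2)).compact
  exact h1.sub h2

/-- Weak rotations of functions of the angle, tested on `ℝ^d`. -/
lemma integral_angular_mul_rot {a b : S d → ℝ} {q : Plane d} (h : IsWeakRot [q] a b) {Ψ : E d → ℝ}
    (hΨ : IsTest Ψ) : ∫ x, angular a x * rot q Ψ x = - ∫ x, angular b x * Ψ x := by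
  rw [integral_polar (integrable_angular_mul h.1 (hΨ.rot q)),
    integral_polar (integrable_angular_mul h.2.1 hΨ), ← integral_neg]
  refine integral_congr_ae ?_
  filter_upwards [ae_radial_pos] with r hr
  have h1 := h.2.2 (fun x => Ψ (r • x)) (hΨ.smooth.comp (contDiff_const_smul r))
  simp only [rotWord, rot_dilate hΨ.smooth, List.length_singleton, pow_one, neg_one_mul] at h1
  simp only [angular_smul _ _ hr]
  exact h1

/-- The weak derivative of `a` along `x_j ∂_i - x_i ∂_j`. -/
def sgnRot (j i : Fin d) (a : S d → ℝ) : S d → ℝ :=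
  if h : j < i then weakRot [⟨(j, i), h⟩] a
  else if h : i < j then fun θ => -1 * weakRot [⟨(i, j), h⟩] a θ
  else fun _ => 0

lemma integral_angular_mul_sgnRot {a : S d → ℝ} (ha : ∀ q, IsWeakRot [q] a (weakRot [q] a))
    {Ψ : E d → ℝ} (hΨ : IsTest Ψ) (j i : Fin d) :
    ∫ x, angular a x * (x j * pderiv i Ψ x - x i * pderiv j Ψ x) =
      - ∫ x, angular (sgnRot j i a) x * Ψ x := by
  rcases lt_trichotomy j i with h | rfl | h
  · rw [sgnRot, dif_pos h]
    exact integral_angular_mul_rot (ha ⟨(j, i), h⟩) hΨ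
  · have h0 : ∀ x : E d, angular (fun _ => (0 : ℝ)) x = 0 := fun x => by
      unfold angular; split_ifs <;> rfl
    simp [sgnRot, h0]
  · rw [sgnRot, dif_neg h.not_gt, dif_pos h]
    have h1 := integral_angular_mul_rot (ha ⟨(i, j), h⟩) hΨ
    have h2 : ∀ x : E d, angular (fun θ => -1 * weakRot [⟨(i, j), h⟩] a θ) x =
        - angular (weakRot [⟨(i, j), h⟩] a) x := fun x => by
      unfold angular; split_ifs <;> simp
    simp only [h2, neg_mul (angular _ _), integral_neg, neg_neg]
    rw [← neg_eq_iff_eq_neg.2 h1, ← integral_neg]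
    refine integral_congr_ae (.of_forall fun x => ?_)
    simp only [rot]; ring

lemma integrable_sgnRot {a : S d → ℝ} (ha : ∀ q, IsWeakRot [q] a (weakRot [q] a)) (j i : Fin d) :
    Integrable (sgnRot j i a) (σ d) := by
  unfold sgnRot
  split_ifs with h h
  · exact (ha _).2.1
  · exact (ha _).2.1.const_mul _
  · exact integrable_zero _ _ _

lemma pderiv_coord (i j : Fin d) (x : E d) :
    pderiv i (fun x : E d => x j) x = if i = j then 1 else 0 := by
  have h2 : fderiv ℝ (fun x : E d => x j) x = EuclideanSpace.proj (𝕜 := ℝ) j :=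
    (EuclideanSpace.proj (𝕜 := ℝ) j).fderiv
  rw [pderiv, h2]
  simp [eq_comm]

lemma fderiv_self_eq_sum (g : E d → ℝ) (x : E d) : fderiv ℝ g x x = ∑ j, x j * pderiv j g x := by
  have hx : x = ∑ j, x j • EuclideanSpace.single j (1 : ℝ) := by
    ext k; simp [Finset.sum_apply, Pi.single_apply]
  conv_lhs => rw [hx, map_sum]
  simp only [map_smul, smul_eq_mul]
  rw [← hx]
  rfl

/-- Decomposition of `∂_i` into a radial and rotational part. -/
lemma pderiv_sq_mul {g : E d → ℝ} (hg : ContDiff ℝ ∞ g) (i : Fin d) (x : E d) :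
    pderiv i (fun y => ‖y‖ ^ 2 * g y) x =
      (d * (x i * g x) + fderiv ℝ (fun y => y i * g y) x x) +
      ∑ j, (x j * pderiv i (fun y => y j * g y) x - x i * pderiv j (fun y => y j * g y) x) := by
  have hsq : ContDiff ℝ ∞ fun y : E d => ‖y‖ ^ 2 := contDiff_norm_sq ℝ
  have h1 : pderiv i (fun y : E d => ‖y‖ ^ 2) x = 2 * x i := by
    have : HasFDerivAt (fun x : E d => ‖x‖ ^ 2) (2 • innerSL ℝ x) x :=
      (hasStrictFDerivAt_norm_sq x).hasFDerivAt
    rw [pderiv, this.fderiv]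
    simp [EuclideanSpace.inner_single_right]
  have h2 : ∑ j, x j * x j = ‖x‖ ^ 2 := by
    rw [EuclideanSpace.norm_sq_eq]
    simp [sq]
  -- The identity behind this is |x|² ∂_i = x_i (x·∇) + ∑_j x_j (x_j ∂_i - x_i ∂_j). Moving the
  -- coordinates inside the derivatives gives the zeroth-order terms, so that each summand fits
  -- `integral_angular_mul_euler` or `integral_angular_mul_sgnRot`.
  rw [pderiv_mul hsq hg, h1, fderiv_self_eq_sum]
  simp only [pderiv_mul (contDiff_coord _) hg, pderiv_coord]
  have e1 : ∑ j, x j * ((if j = i then 1 else 0) * g x + x i * pderiv j g x) =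
      x i * g x + x i * ∑ j, x j * pderiv j g x := by
    simp only [mul_add, Finset.sum_add_distrib, Finset.mul_sum]
    congr 1
    · simp
    · exact Finset.sum_congr rfl fun j _ => by ring
  have e2 : ∑ j, (x j * ((if i = j then 1 else 0) * g x + x j * pderiv i g x) -
        x i * ((if True then 1 else 0) * g x + x j * pderiv j g x)) =
      x i * g x + ‖x‖ ^ 2 * pderiv i g x - (d * (x i * g x) + x i * ∑ j, x j * pderiv j g x) := by
    rw [Finset.sum_sub_distrib]
    congr 1
    · simp only [mul_add, Finset.sum_add_distrib, ← h2, Finset.sum_mul]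
      congr 1
      · simp
      · exact Finset.sum_congr rfl fun j _ => by ring
    · simp only [mul_add, Finset.sum_add_distrib, Finset.mul_sum]
      congr 1
      simp
  rw [e1, e2]
  ring

lemma locallyIntegrable_mul_angular {a : S d → ℝ} (ha : Integrable a (σ d)) {h : E d → ℝ}
    (hh : Continuous h) : LocallyIntegrable (fun x => h x * angular a x) volume := by
  have := (locallyIntegrable_angular ha).continuous_mul hh
  exact this

/-- Weak derivatives of `h(x) a(θ)`. -/
lemma IsSym.wd_mul_angular {s : ℤ} {h : E d → ℝ} (hh : IsSym s h) {a : S d → ℝ}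
    (hai : Integrable a (σ d)) (ha : ∀ q, IsWeakRot [q] a (weakRot [q] a)) (i : Fin d) :
    WD i (fun x => h x * angular a x) (fun x => AsymptoticSpaces.pderiv i h x * angular a x +
      ∑ j, (x j * (h x * (‖x‖ ^ 2)⁻¹)) * angular (sgnRot j i a) x) := by
  have hc := hh.contDiff
  have hc1 : ∀ j : Fin d, IsSym (s - 2 + 1) fun x => x j * (h x * (‖x‖ ^ 2)⁻¹) :=
    fun j => hh.div_sq.coord j
  have hl1 := locallyIntegrable_mul_angular hai (hh.pderiv i).contDiff.continuous
  have hl2 := fun j => locallyIntegrable_mul_angular (integrable_sgnRot ha j i)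
    (hc1 j).contDiff.continuous
  rw [wd_iff]
  refine ⟨locallyIntegrable_mul_angular hai hc.continuous, hl1.add
    (locallyIntegrable_finsetSum _ fun j _ => hl2 j), fun φ hφ => ?_⟩
  -- Dividing by |x|² is harmless because h vanishes near the origin; thus h φ = |x|² g with g a
  -- test function, as the decomposition requires.
  set g : E d → ℝ := fun x => (h x * (‖x‖ ^ 2)⁻¹) * φ x with hg
  have hgt : IsTest g := hφ.mul_left hh.div_sq.contDiff
  have hgx : ∀ j : Fin d, IsTest fun x => x j * g x := fun j => hgt.mul_left (contDiff_coord j)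
  have hsq : (fun x => ‖x‖ ^ 2 * g x) = fun x => h x * φ x := by
    funext x
    by_cases hx : ‖x‖ = 0
    · rw [hh.eq_zero (by rw [hx]; exact zero_le_one)]; simp [hx]
    · simp only [hg]; field_simp
  have e1 : ∀ x, angular a x * AsymptoticSpaces.pderiv i (fun y => h y * φ y) x =
      angular a x * (d * (x i * g x) + fderiv ℝ (fun y => y i * g y) x x) +
      ∑ j, angular a x * (x j * AsymptoticSpaces.pderiv i (fun y => y j * g y) x -
        x i * AsymptoticSpaces.pderiv j (fun y => y j * g y) x) := by
    intro x
    rw [← hsq, pderiv_sq_mul hgt.smooth, mul_add, Finset.mul_sum]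
  have hT : IsTest fun y => h y * φ y := hφ.mul_left hc
  have hTj : ∀ j, IsTest fun x => x j * AsymptoticSpaces.pderiv i (fun y => y j * g y) x -
        x i * AsymptoticSpaces.pderiv j (fun y => y j * g y) x := fun j =>
    ⟨(((hgx j).pderiv i).mul_left (contDiff_coord j)).smooth.sub
      (((hgx j).pderiv j).mul_left (contDiff_coord i)).smooth,
      (((hgx j).pderiv i).mul_left (contDiff_coord j)).compact.sub
      (((hgx j).pderiv j).mul_left (contDiff_coord i)).compact⟩
  have hint := fun j => integrable_angular_mul hai (hTj j)
  have e2 : ∫ x, angular a x * AsymptoticSpaces.pderiv i (fun y => h y * φ y) x =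
      - ∑ j, ∫ x, angular (sgnRot j i a) x * (x j * g x) := by
    have hI0 : Integrable (fun x => angular a x * (d * (x i * g x) +
        fderiv ℝ (fun y => y i * g y) x x)) volume := by
      have := (integrable_angular_mul hai (hT.pderiv i)).sub
        (integrable_finsetSum Finset.univ fun j _ => hint j)
      refine this.congr (.of_forall fun x => ?_)
      simp only [Pi.sub_apply, e1]
      ring
    simp only [e1]
    rw [integral_add hI0 (integrable_finsetSum _ fun j _ => hint j), integral_finsetSum _
      fun j _ => hint j, integral_angular_mul_euler hai (hgx i), zero_add, ← Finset.sum_neg_distrib]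
    exact Finset.sum_congr rfl fun j _ => integral_angular_mul_sgnRot ha (hgx j) j i
  have hJ := fun j => integrable_angular_mul (integrable_sgnRot ha j i) (hgx j)
  have e3 : ∫ x, (AsymptoticSpaces.pderiv i h x * angular a x +
      ∑ j, (x j * (h x * (‖x‖ ^ 2)⁻¹)) * angular (sgnRot j i a) x) * φ x =
      (∫ x, angular a x * (AsymptoticSpaces.pderiv i h x * φ x)) +
      ∑ j, ∫ x, angular (sgnRot j i a) x * (x j * g x) := by
    rw [← integral_finsetSum _ fun j _ => hJ j, ← integral_add
      (integrable_angular_mul hai (hφ.mul_left (hh.pderiv i).contDiff))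
      (integrable_finsetSum _ fun j _ => hJ j)]
    refine integral_congr_ae (.of_forall fun x => ?_)
    simp only [add_mul, Finset.sum_mul, hg]
    congr 1
    · ring
    · exact Finset.sum_congr rfl fun j _ => by ring
  have e4 : ∫ x, h x * angular a x * AsymptoticSpaces.pderiv i φ x =
      (∫ x, angular a x * AsymptoticSpaces.pderiv i (fun y => h y * φ y) x) -
      ∫ x, angular a x * (AsymptoticSpaces.pderiv i h x * φ x) := by
    rw [← integral_sub (integrable_angular_mul hai (hT.pderiv i))
      (integrable_angular_mul hai (hφ.mul_left (hh.pderiv i).contDiff))]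
    refine integral_congr_ae (.of_forall fun x => ?_)
    simp only [pderiv_mul hc hφ.smooth]
    ring
  rw [e4, e2, e3]
  ring

end Derivative

end AsymptoticSpaces
end

/-! ### Norm estimates for h(x) a(θ) -/

noncomputable section
namespace AsymptoticSpaces
variable {d : ℕ} {p : ℝ}

section Sums

variable {a : ℕ} {τ s : ℝ} {u v : E d → ℝ}

lemma LocSobolev.add (hu : LocSobolev p a u) (hv : LocSobolev p a v) :
    LocSobolev p a (fun x => u x + v x) := by
  have h := hu.sub ((locSobolev_of_contDiff (contDiff_const (c := (0 : ℝ)))).sub hv)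
  exact h.congr (.of_forall fun x => by ring)

lemma unifNorm_add_le (hp : 1 ≤ p) (hu : LocSobolev p a u) (hv : LocSobolev p a v) :
    unifNorm p τ a s (fun x => u x + v x) ≤ unifNorm p τ a s u + unifNorm p τ a s v := by
  refine iSup_le fun x => ?_
  have h := (hu.add hv).ballNorm_le_add_sub hp hu x (rad τ x)
  rw [ballNorm_congr (u := fun y => u y + v y - u y) (v := v)
    (.of_forall fun y => by ring)] at h
  calc _ ≤ ENNReal.ofReal (japanese x ^ s) * ENNReal.ofReal (rad τ x) ^ (-((d : ℝ) / p)) *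
        (ballNorm p x (rad τ x) a u + ballNorm p x (rad τ x) a v) := by gcongr
    _ ≤ _ := by
        rw [mul_add]
        exact add_le_add
          (le_iSup (fun x => ENNReal.ofReal (japanese x ^ s) *
            ENNReal.ofReal (rad τ x) ^ (-((d : ℝ) / p)) * ballNorm p x (rad τ x) a u) x)
          (le_iSup (fun x => ENNReal.ofReal (japanese x ^ s) *
            ENNReal.ofReal (rad τ x) ^ (-((d : ℝ) / p)) * ballNorm p x (rad τ x) a v) x)

end Sums

variable [NeZero d]

section Induction

variable {a : S d → ℝ} {m : ℕ}

lemma MemSphereSobolev.sgnRot (hp : 1 ≤ p) (h : MemSphereSobolev (m + 1) p a) (j i : Fin d) :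
    MemSphereSobolev m p (sgnRot j i a) ∧
      sphereSobolevNorm m p (AsymptoticSpaces.sgnRot j i a) ≤ sphereSobolevNorm (m + 1) p a := by
  unfold AsymptoticSpaces.sgnRot
  split_ifs with h1 h1
  · exact ⟨h.deriv hp (h.rot hp _), sphereSobolevNorm_rot_le hp h (h.rot hp _)⟩
  · have h2 := h.deriv hp (h.rot hp ⟨(i, j), h1⟩)
    refine ⟨h2.const_mul _, ?_⟩
    rw [sphereSobolevNorm_const_mul h2]
    simpa using sphereSobolevNorm_rot_le hp h (h.rot hp ⟨(i, j), h1⟩)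
  · exact ⟨memSphereSobolev_fun_zero, by rw [sphereSobolevNorm_fun_zero]; exact zero_le⟩

/-- Induction principle for estimates of `h(x) a(θ)`, where `P m l u K` stands for a bound by `K`
of `m` derivatives of `u`, with a gain of `l` orders of decay. -/
theorem exists_sym_bound (hp : 1 ≤ p) (P : ℕ → ℕ → (E d → ℝ) → ENNReal → Prop) (M : ℕ) (s₀ : ℤ)
    (hadd : ∀ m l u v K K', P m l u K → P m l v K' → P m l (fun x => u x + v x) (K + K'))
    (mono : ∀ m l u K K', K ≤ K' → P m l u K → P m l u K')
    (zero : ∀ m l, P m l (fun _ => 0) 0)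
    (base : ∀ l ≤ M, ∀ h, IsSym (s₀ - l) h → ∃ C : NNReal, ∀ a : S d → ℝ,
      MemLp a (ENNReal.ofReal p) (σ d) →
      P 0 l (fun x => h x * angular a x) (C * eLpNorm a (ENNReal.ofReal p) (σ d)))
    (succ : ∀ m l u (g : Fin d → E d → ℝ) K (K' : Fin d → ENNReal), P 0 l u K → (∀ i, WD i u (g i)) → (∀ i, P m (l + 1) (g i) (K' i)) →
      P (m + 1) l u (K + ∑ i, K' i))
    (m l : ℕ) (hml : m + l ≤ M) (h : E d → ℝ) (hh : IsSym (s₀ - l) h) :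
    ∃ C : NNReal, ∀ a : S d → ℝ, MemSphereSobolev m p a →
      P m l (fun x => h x * angular a x) (C * sphereSobolevNorm m p a) := by
  induction m generalizing l h with
  | zero =>
    obtain ⟨C, hC⟩ := base l (by omega) h hh
    exact ⟨C, fun a ha => by rw [sphereSobolevNorm_zero ha.integrable]; exact hC a ha.memLp⟩
  | succ m ih =>
    obtain ⟨C, hC⟩ := base l (by omega) h hh
    -- A derivative produces symbols of one order less, multiplying a or its rotations; `l` records
    -- the orders gained so far. The symbols do not involve a, and hence neither do the constants.
    choose C1 hC1 using fun i : Fin d => ih (l + 1) (by omega) (pderiv i h)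
      ((hh.pderiv i).cast (by push_cast; ring))
    choose C2 hC2 using fun j : Fin d => ih (l + 1) (by omega) (fun x => x j * (h x * (‖x‖ ^ 2)⁻¹))
      ((hh.div_sq.coord j).cast (by push_cast; ring))
    refine ⟨C + ∑ i, (C1 i + ∑ j, C2 j), fun a ha => ?_⟩
    have hsum : ∀ (i : Fin d) (t : Finset (Fin d)), P m (l + 1)
        (fun x => ∑ j ∈ t, (x j * (h x * (‖x‖ ^ 2)⁻¹)) * angular (AsymptoticSpaces.sgnRot j i a) x)
        (∑ j ∈ t, C2 j * sphereSobolevNorm (m + 1) p a) := by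
      intro i t
      induction t using Finset.induction_on with
      | empty => simpa using zero m (l + 1)
      | insert j t hj iht =>
        simp only [Finset.sum_insert hj]
        refine hadd _ _ _ _ _ _ (mono _ _ _ _ _ ?_ (hC2 j _ (ha.sgnRot hp j i).1)) iht
        gcongr
        exact (ha.sgnRot hp j i).2
    have hfirst : ∀ i, P m (l + 1) (fun x => pderiv i h x * angular a x)
        (C1 i * sphereSobolevNorm (m + 1) p a) := fun i =>
      mono _ _ _ _ _ (by gcongr; exact sphereSobolevNorm_mono (by omega)) (hC1 i a (ha.mono (by omega)))
    refine mono _ _ _ _ _ (le_of_eq ?_) (succ m l _ _ (C * sphereSobolevNorm (m + 1) p a) _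
      (mono _ _ _ _ _ (by gcongr; exact eLpNorm_le_sphereSobolevNorm ha.integrable) (hC a ha.memLp))
      (fun i => hh.wd_mul_angular ha.integrable (ha.rot hp) i)
      (fun i => hadd _ _ _ _ _ _ (hfirst i) (hsum i Finset.univ)))
    push_cast
    simp only [add_mul, Finset.sum_mul]

end Induction

section Base

lemma radialMeasure_Iio_le (R : ℝ) : radialMeasure d (Set.Iio R) ≤ ENNReal.ofReal R ^ d := by
  rw [radialMeasure, withDensity_apply _ measurableSet_Iio, Measure.restrict_restrict
    measurableSet_Iio]
  refine (setLIntegral_mono' (g := fun _ => ENNReal.ofReal R ^ (d - 1))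
    (measurableSet_Iio.inter measurableSet_Ioi) fun r hr => ?_).trans ?_
  · rw [← ENNReal.ofReal_pow (le_of_lt (hr.2.trans hr.1))]
    exact ENNReal.ofReal_le_ofReal (pow_le_pow_left₀ (le_of_lt hr.2) (le_of_lt hr.1) _)
  · rw [setLIntegral_const, Set.Iio_inter_Ioi, Real.volume_Ioo, sub_zero, ← pow_succ,
      Nat.sub_add_cancel (Nat.pos_of_ne_zero (NeZero.ne d))]

lemma eLpNorm_angular_ball_le (hp : 0 < p) {a : S d → ℝ} (ha : AEStronglyMeasurable a (σ d)) (R : ℝ) :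
    eLpNorm (angular a) (ENNReal.ofReal p) (volume.restrict (Metric.ball 0 R)) ≤
      ENNReal.ofReal R ^ ((d : ℝ) / p) * eLpNorm a (ENNReal.ofReal p) (σ d) := by
  rw [eLpNorm_ball_eq hp, eLpNorm_eq_lintegral_rpow_enorm_toReal (by simpa using hp) (by simp),
    ENNReal.toReal_ofReal hp.le, div_eq_mul_one_div (d : ℝ) p, ENNReal.rpow_mul,
    ← ENNReal.mul_rpow_of_nonneg _ _ (by positivity)]
  refine ENNReal.rpow_le_rpow ?_ (by positivity)
  have h1 := lintegral_radial_mul_angular (F := (Set.Iio R).indicator 1)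
    (measurable_one.indicator measurableSet_Iio) (ha.enorm.pow_const p)
  calc _ = ∫⁻ x : E d, (Set.Iio R).indicator 1 ‖x‖ * ‖a (dir x)‖ₑ ^ p := by
        rw [← lintegral_indicator measurableSet_ball]
        refine lintegral_congr_ae ?_
        filter_upwards [angular_ae_eq a] with x hx
        by_cases hxR : ‖x‖ < R
        · rw [Set.indicator_of_mem (by simpa using hxR), Set.indicator_of_mem (by simpa using hxR), hx]
          simp
        · rw [Set.indicator_of_notMem (by simpa using hxR),
            Set.indicator_of_notMem (by simpa using hxR)]
          simp
    _ ≤ _ := by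
        rw [h1, lintegral_indicator_one measurableSet_Iio, ENNReal.rpow_natCast]
        gcongr
        exact radialMeasure_Iio_le R

/-- The ball of radius ⟨x⟩ / 4 about x lies in the ball of radius 2⟨x⟩ about the origin, where a
function of the angle has `L^p` norm at most (2⟨x⟩)^{d/p} times that of a. Against ρ^{-d/p} this
leaves the constant 8^{d/p}, and the size of the symbol cancels the weight. -/
lemma exists_unifNorm_zero_sym_le (hp : 1 ≤ p) {s : ℤ} {h : E d → ℝ} (hh : IsSym s h) :
    ∃ C : NNReal, ∀ a : S d → ℝ, MemLp a (ENNReal.ofReal p) (σ d) →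
      LocSobolev p 0 (fun x => h x * angular a x) ∧
      unifNorm p 1 0 (-(s : ℝ)) (fun x => h x * angular a x) ≤
        C * eLpNorm a (ENNReal.ofReal p) (σ d) := by
  obtain ⟨C, hC, hb⟩ := hh.bound
  have hp0 : 0 < p := by linarith
  have hbd : ∀ (a : S d → ℝ), MemLp a (ENNReal.ofReal p) (σ d) → ∀ x : E d,
      eLpNorm (fun y => h y * angular a y) (ENNReal.ofReal p)
        (volume.restrict (Metric.ball x (rad 1 x))) ≤
      ENNReal.ofReal (C * (2 ^ |(s : ℝ)| * japanese x ^ (s : ℝ))) *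
        (ENNReal.ofReal (2 * japanese x) ^ ((d : ℝ) / p) * eLpNorm a (ENNReal.ofReal p) (σ d)) := by
    intro a ha x
    refine (eLpNorm_le_mul_eLpNorm_of_ae_le_mul (g := angular a)
      (c := C * (2 ^ |(s : ℝ)| * japanese x ^ (s : ℝ))) ?_ _).trans ?_
    · filter_upwards [ae_restrict_mem measurableSet_ball] with y hy
      have hcomp := japanese_comparable le_rfl hy
      have h2 := japanese_rpow_le_two_rpow (s : ℝ) hcomp.2 hcomp.1
      rw [norm_mul]
      gcongr
      rw [Real.norm_eq_abs]
      refine (hb y).trans ?_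
      rw [← Real.rpow_intCast]
      gcongr
    · gcongr
      refine (eLpNorm_mono_measure _ (Measure.restrict_mono ?_ le_rfl)).trans
        (eLpNorm_angular_ball_le hp0 ha.1 _)
      intro y hy
      have hcomp := japanese_comparable le_rfl hy
      rw [mem_ball_zero_iff]
      have h1 : ‖y‖ < japanese y := by
        refine Real.lt_sqrt_of_sq_lt ?_
        linarith
      linarith [hcomp.2]
  refine ⟨Real.toNNReal (C * 2 ^ |(s : ℝ)| * 8 ^ ((d : ℝ) / p)), fun a ha => ⟨?_, ?_⟩⟩
  · intro R
    have hm : AEStronglyMeasurable (fun x => h x * angular a x) volume :=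
      hh.contDiff.continuous.aestronglyMeasurable.mul (aestronglyMeasurable_angular ha.1)
    refine ⟨hm.restrict, ?_⟩
    obtain ⟨M, hM⟩ := (isCompact_closedBall (0 : E d) R).exists_bound_of_continuousOn
      hh.contDiff.continuous.continuousOn
    refine (eLpNorm_le_mul_eLpNorm_of_ae_le_mul (g := angular a) (c := M) ?_ _).trans_lt ?_
    · filter_upwards [ae_restrict_mem measurableSet_ball] with y hy
      rw [norm_mul]
      gcongr
      exact hM y (Metric.ball_subset_closedBall hy)
    · exact ENNReal.mul_lt_top (by simp) ((eLpNorm_angular_ball_le hp0 ha.1 R).trans_lt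
        (ENNReal.mul_lt_top (ENNReal.rpow_lt_top_of_nonneg (by positivity) (by simp)) ha.2))
  · refine iSup_le fun x => ?_
    have hx := japanese_pos x
    have hr : rad 1 x = japanese x / 4 := by rw [rad, Real.rpow_one]
    rw [ballNorm]
    refine (mul_le_mul_right (hbd a ha x) _).trans (le_of_eq ?_)
    rw [← mul_assoc, ← mul_assoc]
    congr 1
    rw [ENNReal.ofReal_rpow_of_pos (rad_pos _ _), ENNReal.ofReal_rpow_of_pos (by positivity), hr,
      ← ENNReal.ofReal_mul (by positivity), ← ENNReal.ofReal_mul (by positivity),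
      ← ENNReal.ofReal_mul (by positivity)]
    change _ = ENNReal.ofReal _
    congr 1
    have e1 : japanese x ^ (-(s : ℝ)) * japanese x ^ (s : ℝ) = 1 := by
      rw [← Real.rpow_add hx]; simp
    have e2 : (japanese x / 4) ^ (-((d : ℝ) / p)) * (2 * japanese x) ^ ((d : ℝ) / p) =
        8 ^ ((d : ℝ) / p) := by
      rw [Real.rpow_neg (by positivity), inv_mul_eq_div, ← Real.div_rpow (by positivity)
        (by positivity)]
      congr 1
      field_simp
      norm_num
    calc _ = (japanese x ^ (-(s : ℝ)) * japanese x ^ (s : ℝ)) * ((japanese x / 4) ^ (-((d : ℝ) / p)) *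
          (2 * japanese x) ^ ((d : ℝ) / p)) * (C * 2 ^ |(s : ℝ)|) := by ring
      _ = _ := by rw [e1, e2]; ring

/-- Finiteness of the radial integrals for decaying weights. -/
lemma lintegral_radial_rpow_lt_top {t : ℝ} (ht : t + d < 0) :
    ∫⁻ r, (Set.Ioi 1).indicator (fun r => ENNReal.ofReal (r ^ t)) r ∂radialMeasure d < ⊤ := by
  have hm : Measurable ((Set.Ioi (1 : ℝ)).indicator fun r : ℝ => ENNReal.ofReal (r ^ t)) :=
    (by fun_prop : Measurable fun r : ℝ => ENNReal.ofReal (r ^ t)).indicator measurableSet_Ioi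
  rw [lintegral_radial hm]
  have hI : IntegrableOn (fun r : ℝ => r ^ (t + (d - 1))) (Set.Ioi 1) volume :=
    integrableOn_Ioi_rpow_of_lt (by linarith) one_pos
  refine lt_of_le_of_lt ?_ hI.2
  rw [← lintegral_indicator measurableSet_Ioi, ← lintegral_indicator measurableSet_Ioi]
  refine lintegral_mono fun r => ?_
  by_cases hr : r ∈ Set.Ioi (1 : ℝ)
  · have hr0 : (0 : ℝ) < r := one_pos.trans hr
    rw [Set.indicator_of_mem (show r ∈ Set.Ioi (0:ℝ) from hr0), Set.indicator_of_mem hr,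
      Set.indicator_of_mem hr, ← ENNReal.ofReal_mul (by positivity), Real.enorm_eq_ofReal_abs,
      abs_of_pos (Real.rpow_pos_of_pos hr0 _), Real.rpow_add hr0, mul_comm]
    have hd : ((d : ℝ) - 1) = ((d - 1 : ℕ) : ℝ) := by
      rw [Nat.cast_sub (Nat.pos_of_ne_zero (NeZero.ne d))]; simp
    rw [hd, Real.rpow_natCast]
  · rw [Set.indicator_of_notMem hr]
    refine le_trans (le_of_eq ?_) zero_le
    by_cases h0 : r ∈ Set.Ioi (0 : ℝ)
    · rw [Set.indicator_of_mem h0, Set.indicator_of_notMem hr, mul_zero]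
    · rw [Set.indicator_of_notMem h0]

/-- The hypothesis `ht` is integrability of r^{(t+s)p + d - 1} at infinity; there is no condition at
the origin, where symbols vanish. -/
lemma exists_wnorm_sym_le (hp : 1 ≤ p) {s : ℤ} {h : E d → ℝ} (hh : IsSym s h) {t : ℝ}
    (ht : (t + s) * p + d < 0) :
    ∃ C : NNReal, ∀ a : S d → ℝ, MemLp a (ENNReal.ofReal p) (σ d) →
      WMem p t (fun x => h x * angular a x) ∧
      wnorm p t (fun x => h x * angular a x) ≤ C * eLpNorm a (ENNReal.ofReal p) (σ d) := by
  obtain ⟨C, hC, hb⟩ := hh.bound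
  have hp0 : 0 < p := by linarith
  set c : ℝ := C * 2 ^ |t + s| with hc
  have hc0 : 0 ≤ c := by positivity
  set I : ENNReal := ∫⁻ r, (Set.Ioi 1).indicator (fun r => ENNReal.ofReal (r ^ ((t + s) * p))) r
    ∂radialMeasure d with hI
  have hIt : I ^ (1 / p) < ⊤ :=
    ENNReal.rpow_lt_top_of_nonneg (by positivity) (lintegral_radial_rpow_lt_top ht).ne
  have hpt : ∀ (a : S d → ℝ) (x : E d), ‖japanese x ^ t * (h x * angular a x)‖ₑ ^ p ≤
      ENNReal.ofReal c ^ p * ((Set.Ioi 1).indicator (fun r => ENNReal.ofReal (r ^ ((t + s) * p))) ‖x‖ *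
        ‖angular a x‖ₑ ^ p) := by
    intro a x
    by_cases hx : ‖x‖ ≤ 1
    · rw [hh.eq_zero hx]; simp [hp0]
    push Not at hx
    have hx0 : 0 < ‖x‖ := by linarith
    have hj := japanese_pos x
    rw [Set.indicator_of_mem (show ‖x‖ ∈ Set.Ioi (1:ℝ) from hx), Real.rpow_mul hx0.le,
      ← ENNReal.ofReal_rpow_of_pos (by positivity), ← ENNReal.mul_rpow_of_nonneg _ _ hp0.le,
      ← ENNReal.mul_rpow_of_nonneg _ _ hp0.le]
    refine ENNReal.rpow_le_rpow ?_ hp0.le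
    rw [← mul_assoc, ← mul_assoc, enorm_mul]
    gcongr
    rw [← ENNReal.ofReal_mul hc0, Real.enorm_eq_ofReal_abs]
    refine ENNReal.ofReal_le_ofReal ?_
    rw [abs_mul, abs_of_pos (Real.rpow_pos_of_pos hj t)]
    have h2 : japanese x ^ (t + s) ≤ 2 ^ |t + s| * ‖x‖ ^ (t + s) := by
      rcases le_total 0 (t + s) with h0 | h0
      · rw [abs_of_nonneg h0, ← Real.mul_rpow two_pos.le hx0.le]
        exact Real.rpow_le_rpow hj.le (japanese_le_two_mul hx.le) h0
      · refine (Real.rpow_le_rpow_of_nonpos hx0 (norm_le_japanese x) h0).trans ?_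
        refine le_mul_of_one_le_left (by positivity) ?_
        exact Real.one_le_rpow one_le_two (abs_nonneg _)
    calc japanese x ^ t * |h x| ≤ japanese x ^ t * (C * japanese x ^ s) := by
          gcongr; exact hb x
      _ = C * japanese x ^ (t + s) := by rw [Real.rpow_add hj, Real.rpow_intCast]; ring
      _ ≤ C * (2 ^ |t + s| * ‖x‖ ^ (t + s)) := by gcongr
      _ = _ := by rw [hc]; ring
  have hle : ∀ a : S d → ℝ, MemLp a (ENNReal.ofReal p) (σ d) →
      wnorm p t (fun x => h x * angular a x) ≤
        (ENNReal.ofReal c * I ^ (1 / p)) * eLpNorm a (ENNReal.ofReal p) (σ d) := by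
    intro a ha
    have hm : Measurable ((Set.Ioi (1 : ℝ)).indicator fun r : ℝ =>
        ENNReal.ofReal (r ^ ((t + s) * p))) :=
      (by fun_prop : Measurable fun r : ℝ => ENNReal.ofReal (r ^ ((t + s) * p))).indicator
        measurableSet_Ioi
    have h1 := lintegral_radial_mul_angular hm (ha.1.enorm.pow_const p)
    rw [wnorm, eLpNorm_eq_lintegral_rpow_enorm_toReal (by simpa using hp0) (by simp),
      eLpNorm_eq_lintegral_rpow_enorm_toReal (by simpa using hp0) (by simp),
      ENNReal.toReal_ofReal hp0.le]
    calc _ ≤ (∫⁻ x : E d, ENNReal.ofReal c ^ p * ((Set.Ioi 1).indicator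
          (fun r => ENNReal.ofReal (r ^ ((t + s) * p))) ‖x‖ * ‖a (dir x)‖ₑ ^ p)) ^ (1 / p) := by
          refine ENNReal.rpow_le_rpow (lintegral_mono_ae ?_) (by positivity)
          filter_upwards [angular_ae_eq a] with x hx
          have := hpt a x
          rwa [hx] at this ⊢
      _ = _ := by
          rw [lintegral_const_mul' _ _ (ENNReal.rpow_ne_top_of_nonneg hp0.le (by simp)), h1,
            ENNReal.mul_rpow_of_nonneg _ _ (by positivity),
            ENNReal.mul_rpow_of_nonneg _ _ (by positivity), ← ENNReal.rpow_mul,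
            mul_one_div_cancel hp0.ne', ENNReal.rpow_one, mul_assoc]
  have hct : ENNReal.ofReal c * I ^ (1 / p) < ⊤ := ENNReal.mul_lt_top (by simp) hIt
  refine ⟨(ENNReal.ofReal c * I ^ (1 / p)).toNNReal, fun a ha => ?_⟩
  have h3 := hle a ha
  rw [ENNReal.coe_toNNReal hct.ne]
  refine ⟨⟨?_, h3.trans_lt (ENNReal.mul_lt_top hct ha.2)⟩, h3⟩
  exact (continuous_japanese_rpow t).aestronglyMeasurable.mul
    (hh.contDiff.continuous.aestronglyMeasurable.mul (aestronglyMeasurable_angular ha.1))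

end Base

section Main

lemma unifNorm_fun_zero {τ s : ℝ} (m : ℕ) : unifNorm p τ m s (fun _ : E d => 0) = 0 := by
  have h0 : ∀ (m : ℕ) (x : E d) (ρ : ℝ), ballNorm p x ρ m (fun _ : E d => 0) = 0 := by
    intro m x ρ
    induction m with
    | zero => exact eLpNorm_zero'
    | succ m ih =>
      have : ∀ i : Fin d, ballNorm p x ρ m (wd i fun _ : E d => 0) = 0 := fun i => by
        rw [ballNorm_congr (weakDeriv_ae_eq (isWeakDeriv_of_zero _)), ih]
      simp [ballNorm, this]
  simp [unifNorm, h0]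

/-- `h(x) a(θ)` is uniformly locally in the Sobolev space at scale `⟨x⟩`. -/
theorem IsSym.exists_unifNorm_le (hp : 1 ≤ p) (m : ℕ) {s : ℤ} {h : E d → ℝ} (hh : IsSym s h) :
    ∃ C : NNReal, ∀ a : S d → ℝ, MemSphereSobolev m p a →
      LocSobolev p m (fun x => h x * angular a x) ∧
      unifNorm p 1 m (-(s : ℝ)) (fun x => h x * angular a x) ≤ C * sphereSobolevNorm m p a := by
  obtain ⟨C, hC⟩ := exists_sym_bound hp (fun m l u K => LocSobolev p m u ∧
      unifNorm p 1 m (-(s : ℝ) + l) u ≤ K) m s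
    (fun m l u v K K' h1 h2 => ⟨h1.1.add h2.1,
      (unifNorm_add_le hp h1.1 h2.1).trans (add_le_add h1.2 h2.2)⟩)
    (fun m l u K K' hK h1 => ⟨h1.1, h1.2.trans hK⟩)
    (fun m l => ⟨locSobolev_of_contDiff contDiff_const, (unifNorm_fun_zero m).le⟩)
    (fun l _ h hh => by
      obtain ⟨C, hC⟩ := exists_unifNorm_zero_sym_le hp hh
      refine ⟨C, fun a ha => ⟨(hC a ha).1, ?_⟩⟩
      have := (hC a ha).2
      rwa [show (-((s - l : ℤ) : ℝ)) = -(s : ℝ) + l by push_cast; ring] at this)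
    (fun m l u g K K' h1 hg h2 => by
      refine ⟨⟨h1.1, fun i => ⟨g i, hg i, (h2 i).1⟩⟩, (unifNorm_succ_le _ u).trans ?_⟩
      refine add_le_add h1.2 (Finset.sum_le_sum fun i _ => ?_)
      rw [unifNorm_congr (weakDeriv_ae_eq (hg i))]
      have := (h2 i).2
      rwa [show (-(s : ℝ) + ((l + 1 : ℕ) : ℝ)) = -(s : ℝ) + l + 1 by push_cast; ring] at this)
    m 0 (by omega) h (hh.cast (by simp))
  exact ⟨C, fun a ha => by simpa using hC a ha⟩

/-- `h(x) a(θ)` belongs to weighted Sobolev spaces when the decay is sufficient. -/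
theorem IsSym.exists_recNorm_le (hp : 1 ≤ p) (m : ℕ) {s : ℤ} {h : E d → ℝ} (hh : IsSym s h)
    (e : ℕ → ℝ) (he : ∀ j ≤ m, (e j + s - j) * p + d < 0) :
    ∃ C : NNReal, ∀ a : S d → ℝ, MemSphereSobolev m p a →
      MemWeightedSobolev m p e (fun x => h x * angular a x) ∧
      recNorm p m e (fun x => h x * angular a x) ≤ C * sphereSobolevNorm m p a := by
  obtain ⟨C, hC⟩ := exists_sym_bound hp (fun m l u K => MemWeightedSobolev m p (fun k => e (k + l)) u ∧
      recNorm p m (fun k => e (k + l)) u ≤ K) m s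
    (fun m l u v K K' h1 h2 => ⟨h1.1.add h2.1,
      (recNorm_add_le hp h1.1 h2.1).trans (add_le_add h1.2 h2.2)⟩)
    (fun m l u K K' hK h1 => ⟨h1.1, h1.2.trans hK⟩)
    (fun m l => ⟨memWeightedSobolev_zero, (recNorm_le_weightedSobolevNorm hp
      memWeightedSobolev_zero).trans (by rw [weightedSobolevNorm_fun_zero, mul_zero])⟩)
    (fun l hl h hh => by
      obtain ⟨C, hC⟩ := exists_wnorm_sym_le hp hh (t := e l) (by
        have := he l hl
        push_cast
        rwa [← add_sub_assoc])
      refine ⟨C, fun a ha => ⟨(memWeightedSobolev_zero_iff hp).2 ?_, ?_⟩⟩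
      · simpa using (hC a ha).1
      · simpa [recNorm] using (hC a ha).2)
    (fun m l u g K K' h1 hg h2 => by
      have e1 : (fun k => e (k + 1 + l)) = fun k => e (k + (l + 1)) := by
        funext k; congr 1; ring
      refine ⟨(memWeightedSobolev_succ_iff hp).2 ⟨h1.1.wMem, fun i => ⟨g i, hg i, ?_⟩⟩, ?_⟩
      · rw [e1]; exact (h2 i).1
      · rw [recNorm]
        refine add_le_add h1.2 (Finset.sum_le_sum fun i _ => ?_)
        rw [recNorm_congr (weakDeriv_ae_eq (hg i)), e1]
        exact (h2 i).2)
    m 0 (by omega) h (hh.cast (by simp))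
  exact ⟨C, fun a ha => by simpa using hC a ha⟩

end Main

end AsymptoticSpaces
end

/-! ### Multiplication on the sphere -/

noncomputable section
namespace AsymptoticSpaces
variable {d : ℕ} {p : ℝ}

/-- A concrete cutoff keeps the statements about the sphere independent of `χ`. -/
lemma isCutoff_smoothTransition : IsCutoff fun t => Real.smoothTransition (t - 1) where
  smooth := Real.smoothTransition.contDiff.comp (contDiff_id.sub contDiff_const)
  eq_zero t ht := Real.smoothTransition.zero_of_nonpos (by linarith)
  eq_one t ht := Real.smoothTransition.one_of_one_le (by linarith)

lemma one_le_radialMeasure_Ico {R : ℝ} (hR : 1 ≤ R) : 1 ≤ radialMeasure d (Set.Ico R (R + 1)) := by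
  rw [radialMeasure, withDensity_apply _ measurableSet_Ico, Measure.restrict_restrict
    measurableSet_Ico]
  have h1 : Set.Ico R (R + 1) ∩ Set.Ioi 0 = Set.Ico R (R + 1) :=
    Set.inter_eq_left.2 fun r hr => (lt_of_lt_of_le one_pos hR).trans_le hr.1
  rw [h1]
  calc (1 : ENNReal) = ∫⁻ _r in Set.Ico R (R + 1), 1 := by simp
    _ ≤ _ := by
        refine setLIntegral_mono' measurableSet_Ico fun r hr => ?_
        rw [← ENNReal.ofReal_one]
        exact ENNReal.ofReal_le_ofReal (one_le_pow₀ (hR.trans hr.1))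

lemma angular_mul (a b : S d → ℝ) (x : E d) :
    angular (fun θ => a θ * b θ) x = angular a x * angular b x := by
  unfold angular; split_ifs <;> simp

lemma angular_add (a b : S d → ℝ) (x : E d) :
    angular (fun θ => a θ + b θ) x = angular a x + angular b x := by
  unfold angular; split_ifs <;> simp

variable [NeZero d]

/-- Sobolev multiplication on the sphere, zeroth order. -/
lemma exists_eLpNorm_sphere_mul_le (hp : 1 < p) {m : ℕ} (hm : (d : ℝ) / p < m) {α β : ℕ}
    (hab : m ≤ α + β) : ∃ C : NNReal, ∀ a b : S d → ℝ, MemSphereSobolev α p a →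
      MemSphereSobolev β p b → eLpNorm (fun θ => a θ * b θ) (ENNReal.ofReal p) (σ d) ≤
        C * (sphereSobolevNorm α p a * sphereSobolevNorm β p b) := by
  have hp0 : 0 < p := by linarith
  set ψ : ℝ → ℝ := fun t => Real.smoothTransition (t - 1) with hψ
  have hψr : IsRadial ψ := isCutoff_smoothTransition.isRadial
  -- Multiplication on ℝ^d is applied to ψ(r) r^{-k} a(θ) and ψ(r) r^{-k} b(θ). The first has
  -- uniform decay k; with k = d + 1 the second lies in the space with weights j - k that the
  -- unweighted estimate of the product calls for.
  set k : ℕ := d + 1 with hk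
  set h : E d → ℝ := fun x => ψ ‖x‖ * (‖x‖ ^ k)⁻¹ with hh
  have hs : IsSym (-k) h := IsSym.radial hψr k
  obtain ⟨C1, hC1⟩ := hs.exists_unifNorm_le hp.le α
  obtain ⟨C2, hC2⟩ := hs.exists_recNorm_le hp.le β (fun j => 0 - k + j) fun j _ => by
    have hkr : (k : ℝ) = d + 1 := by simp [hk]
    have hd0 : (0 : ℝ) ≤ d := Nat.cast_nonneg d
    have e1 : (0 - (k : ℝ) + j + ((-k : ℤ) : ℝ) - j) * p = -(2 * (d + 1) * p) := by
      rw [← hkr]; push_cast; ring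
    rw [e1]
    nlinarith
  obtain ⟨C3, hC3⟩ := exists_wnorm_mul_le hp hm zero_le_one le_rfl hab (k : ℝ) 0
    (fun j => 0 - k + j) fun j _ => by simp
  -- On the shell 2 ≤ r < 3 the cutoff is 1 and removing the two factors r^{-k} costs at most 9^k;
  -- the shell has radial measure at least 1, so its contribution controls the norm of ab on the
  -- sphere.
  refine ⟨9 ^ k * (C3 * (C1 * C2)), fun a b ha hb => ?_⟩
  obtain ⟨hu1, hu2⟩ := hC1 a ha
  obtain ⟨hv1, hv2⟩ := hC2 b hb
  rw [Int.cast_neg, neg_neg, Int.cast_natCast] at hu2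
  have h3 := hC3 _ _ hu1 (hu2.trans_lt (ENNReal.mul_lt_top (by simp) ha.norm_lt_top)) hv1
  have hmab : AEStronglyMeasurable (fun θ => a θ * b θ) (σ d) :=
    ha.integrable.aestronglyMeasurable.mul hb.integrable.aestronglyMeasurable
  have hlow : eLpNorm (fun θ => a θ * b θ) (ENNReal.ofReal p) (σ d) ≤
      9 ^ k * wnorm p 0 (fun x => (h x * angular a x) * (h x * angular b x)) := by
    have hc : (9 : ENNReal) ^ k ≠ ⊤ := by simp
    rw [wnorm, eLpNorm_eq_lintegral_rpow_enorm_toReal (by simpa using hp0) (by simp),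
      eLpNorm_eq_lintegral_rpow_enorm_toReal (by simpa using hp0) (by simp),
      ENNReal.toReal_ofReal hp0.le]
    have h1 := lintegral_radial_mul_angular (F := (Set.Ico (2 : ℝ) (2 + 1)).indicator 1)
      (measurable_one.indicator measurableSet_Ico) (hmab.enorm.pow_const p)
    rw [lintegral_indicator_one measurableSet_Ico] at h1
    calc _ ≤ (∫⁻ x : E d, (Set.Ico (2 : ℝ) (2 + 1)).indicator 1 ‖x‖ *
          ‖a (dir x) * b (dir x)‖ₑ ^ p) ^ (1 / p) := by
          refine ENNReal.rpow_le_rpow ?_ (by positivity)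
          rw [h1]
          exact le_mul_of_one_le_left' (one_le_radialMeasure_Ico one_le_two)
      _ ≤ (∫⁻ x : E d, (9 ^ k) ^ p * ‖japanese x ^ (0 : ℝ) * ((h x * angular a x) *
          (h x * angular b x))‖ₑ ^ p) ^ (1 / p) := by
          refine ENNReal.rpow_le_rpow (lintegral_mono_ae ?_) (by positivity)
          filter_upwards [angular_ae_eq a, angular_ae_eq b] with x hxa hxb
          by_cases hx : ‖x‖ ∈ Set.Ico (2 : ℝ) (2 + 1)
          · rw [Set.indicator_of_mem hx, Pi.one_apply, one_mul, ← ENNReal.mul_rpow_of_nonneg _ _ hp0.le]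
            refine ENNReal.rpow_le_rpow ?_ hp0.le
            have hx0 : 0 < ‖x‖ := two_pos.trans_le hx.1
            have hψ1 : ψ ‖x‖ = 1 := isCutoff_smoothTransition.eq_one _ hx.1
            rw [Real.rpow_zero, one_mul, show (9 : ENNReal) ^ k = ‖(9 : ℝ) ^ k‖ₑ by
              rw [Real.enorm_eq_ofReal_abs, abs_of_pos (by positivity),
                ENNReal.ofReal_pow (by norm_num)]; simp, ← enorm_mul,
              Real.enorm_eq_ofReal_abs, Real.enorm_eq_ofReal_abs]
            refine ENNReal.ofReal_le_ofReal ?_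
            have e1 : (9 : ℝ) ^ k * (h x * angular a x * (h x * angular b x)) =
                ((3 / ‖x‖) ^ k) ^ 2 * (a (dir x) * b (dir x)) := by
              rw [hxa, hxb, hh]
              simp only [hψ1, Function.comp, one_mul]
              rw [show (9 : ℝ) = 3 ^ 2 by norm_num, ← pow_mul, mul_comm 2 k, pow_mul, div_pow]
              field_simp
            rw [e1, abs_mul (((3 / ‖x‖) ^ k) ^ 2)]
            refine le_mul_of_one_le_left (abs_nonneg _) ?_
            rw [abs_of_nonneg (by positivity)]
            refine one_le_pow₀ (one_le_pow₀ ?_)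
            rw [one_le_div hx0]
            linarith [hx.2]
          · rw [Set.indicator_of_notMem hx, zero_mul]; exact zero_le
      _ = _ := by
          rw [lintegral_const_mul' _ _ (ENNReal.rpow_ne_top_of_nonneg hp0.le hc),
            ENNReal.mul_rpow_of_nonneg _ _ (by positivity), ← ENNReal.rpow_mul,
            mul_one_div_cancel hp0.ne', ENNReal.rpow_one]
  calc _ ≤ 9 ^ k * (C3 * ((C1 * sphereSobolevNorm α p a) * (C2 * sphereSobolevNorm β p b))) := by
        refine hlow.trans ?_
        gcongr
        refine h3.trans ?_
        gcongr
    _ = _ := by push_cast; ring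

section ProductRule

lemma rot_mul {φ ψ : E d → ℝ} (hφ : ContDiff ℝ ∞ φ) (hψ : ContDiff ℝ ∞ ψ) (q : Plane d) (x : E d) :
    rot q (fun x => φ x * ψ x) x = rot q φ x * ψ x + φ x * rot q ψ x := by
  simp only [rot, pderiv_mul hφ hψ]; ring

lemma rot_radial {ψ : ℝ → ℝ} (hψ : IsRadial ψ) (k : ℕ) (q : Plane d) (x : E d) :
    rot q (fun x => ψ ‖x‖ * (‖x‖ ^ k)⁻¹) x = 0 := by
  simp only [rot, pderiv_radial hψ]; ring

/-- Weak rotations in terms of weak derivatives on `ℝ^d`. -/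
lemma WD.integral_mul_rot {f f₁ f₂ : E d → ℝ} {q : Plane d} (h1 : WD q.1.1 f f₁)
    (h2 : WD q.1.2 f f₂) {Φ : E d → ℝ} (hΦ : IsTest Φ) :
    ∫ x, f x * rot q Φ x = - ∫ x, (x q.1.1 * f₂ x - x q.1.2 * f₁ x) * Φ x := by
  have hne : q.1.1 ≠ q.1.2 := ne_of_lt q.2
  have hl := (wd_iff.1 h1).1
  have t1 := hΦ.mul_left (contDiff_coord q.1.1)
  have t2 := hΦ.mul_left (contDiff_coord q.1.2)
  have e1 := (wd_iff.1 h2).2.2 _ t1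
  have e2 := (wd_iff.1 h1).2.2 _ t2
  calc _ = (∫ x, f x * pderiv q.1.2 (fun y => y q.1.1 * Φ y) x) -
        ∫ x, f x * pderiv q.1.1 (fun y => y q.1.2 * Φ y) x := by
        rw [← integral_sub ((t1.pderiv _).integrable_mul hl) ((t2.pderiv _).integrable_mul hl)]
        refine integral_congr_ae (.of_forall fun x => ?_)
        simp only [pderiv_mul (contDiff_coord _) hΦ.smooth, pderiv_coord, hne, hne.symm, if_false,
          rot]
        ring
    _ = - ((∫ x, f₂ x * (x q.1.1 * Φ x)) - ∫ x, f₁ x * (x q.1.2 * Φ x)) := by rw [e1, e2]; ring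
    _ = _ := by
        rw [← integral_sub (t1.integrable_mul (wd_iff.1 h2).2.1)
          (t2.integrable_mul (wd_iff.1 h1).2.1)]
        congr 1
        refine integral_congr_ae (.of_forall fun x => ?_)
        simp only
        ring

/-- Rotations annihilate radial functions, so the radial factor can be absorbed into the test
function. -/
lemma integral_radial_mul_angular_mul_rot {ψ : ℝ → ℝ} (hψ : IsRadial ψ) {a b : S d → ℝ} {q : Plane d}
    (h : IsWeakRot [q] a b) {Φ : E d → ℝ} (hΦ : IsTest Φ) :
    ∫ x, ψ ‖x‖ * (‖x‖ ^ 0)⁻¹ * angular a x * rot q Φ x =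
      - ∫ x, ψ ‖x‖ * (‖x‖ ^ 0)⁻¹ * angular b x * Φ x := by
  have hc := contDiff_radial (d := d) hψ 0
  have h1 := integral_angular_mul_rot h (hΦ.mul_left hc)
  calc _ = ∫ x, angular a x * rot q (fun x => ψ ‖x‖ * (‖x‖ ^ 0)⁻¹ * Φ x) x := by
        refine integral_congr_ae (.of_forall fun x => ?_)
        simp only [rot_mul hc hΦ.smooth, rot_radial hψ]
        ring
    _ = _ := by
        rw [h1]; congr 1
        refine integral_congr_ae (.of_forall fun x => ?_)
        simp only
        ring

/-- The rotation derivative of `ψ(r) a(θ)`. -/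
lemma rot_radial_mul_angular_ae_eq {ψ : ℝ → ℝ} (hψ : IsRadial ψ) {a b : S d → ℝ} {q : Plane d}
    (h : IsWeakRot [q] a b) {f₁ f₂ : E d → ℝ}
    (h1 : WD q.1.1 (fun x => ψ ‖x‖ * (‖x‖ ^ 0)⁻¹ * angular a x) f₁)
    (h2 : WD q.1.2 (fun x => ψ ‖x‖ * (‖x‖ ^ 0)⁻¹ * angular a x) f₂) :
    (fun x => x q.1.1 * f₂ x - x q.1.2 * f₁ x) =ᵐ[volume]
      fun x => ψ ‖x‖ * (‖x‖ ^ 0)⁻¹ * angular b x := by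
  have hl : ∀ (i : Fin d) (f : E d → ℝ), LocallyIntegrable f volume →
      LocallyIntegrable (fun x => x i * f x) volume := fun i f hf =>
    hf.continuous_mul (contDiff_coord i).continuous
  refine ae_eq_of_integral_contDiff_smul_eq
    ((hl _ _ (wd_iff.1 h2).2.1).sub (hl _ _ (wd_iff.1 h1).2.1))
    (locallyIntegrable_mul_angular h.2.1 (contDiff_radial hψ 0).continuous) fun Φ hΦ hΦc => ?_
  have e1 := WD.integral_mul_rot h1 h2 ⟨hΦ, hΦc⟩
  have e2 := integral_radial_mul_angular_mul_rot hψ h ⟨hΦ, hΦc⟩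
  simp only [smul_eq_mul, mul_comm (Φ _)]
  exact neg_inj.1 (e1.symm.trans e2)

/-- The tangent vector `x_i e_j - x_j e_i`. -/
def rotVec (q : Plane d) (x : E d) : E d :=
  x q.1.1 • EuclideanSpace.single q.1.2 (1 : ℝ) - x q.1.2 • EuclideanSpace.single q.1.1 (1 : ℝ)

lemma rot_eq_fderiv (q : Plane d) (φ : E d → ℝ) (x : E d) :
    rot q φ x = fderiv ℝ φ x (rotVec q x) := by
  simp [rot, pderiv, rotVec]

lemma inner_rotVec (q : Plane d) (x : E d) : inner ℝ x (rotVec q x) = 0 := by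
  simp only [rotVec, inner_sub_right, inner_smul_right, EuclideanSpace.inner_single_right]
  simp
  ring

/-- A function of the angle times a radial bump, as a test function. -/
def conicTest (η : ContDiffBump (4 : ℝ)) (φ : E d → ℝ) (x : E d) : ℝ := η ‖x‖ * φ (‖x‖⁻¹ • x)

variable {η : ContDiffBump (4 : ℝ)}

lemma bump_eq_zero_of_le (hη : η.rOut ≤ 2) {r : ℝ} (hr : r ≤ 2) : η r = 0 := by
  refine η.zero_of_le_dist ?_
  rw [Real.dist_eq, abs_of_neg (by linarith)]
  linarith

lemma bump_eq_zero_of_ge (hη : η.rOut ≤ 2) {r : ℝ} (hr : 6 ≤ r) : η r = 0 := by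
  refine η.zero_of_le_dist ?_
  rw [Real.dist_eq, abs_of_pos (by linarith)]
  linarith

lemma conicTest_eventually_zero (hη : η.rOut ≤ 2) (φ : E d → ℝ) :
    conicTest η φ =ᶠ[𝓝 0] fun _ => 0 := by
  filter_upwards [Metric.ball_mem_nhds (0 : E d) one_pos] with y hy
  rw [mem_ball_zero_iff] at hy
  have : η ‖y‖ = 0 := bump_eq_zero_of_le hη (by linarith)
  simp [conicTest, this]

lemma contDiffAt_inv_norm_smul {x : E d} (hx : x ≠ 0) :
    ContDiffAt ℝ ∞ (fun x : E d => ‖x‖⁻¹ • x) x :=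
  ((contDiffAt_norm ℝ hx).inv (norm_ne_zero_iff.2 hx)).smul contDiffAt_id

lemma isTest_conicTest (hη : η.rOut ≤ 2) {φ : E d → ℝ} (hφ : ContDiff ℝ ∞ φ) :
    IsTest (conicTest η φ) := by
  constructor
  · rw [contDiff_iff_contDiffAt]
    intro x
    by_cases hx : x = 0
    · exact (contDiffAt_const (c := (0 : ℝ))).congr_of_eventuallyEq
        (hx ▸ conicTest_eventually_zero hη φ)
    · exact (η.contDiff.contDiffAt.comp x (contDiffAt_norm ℝ hx)).mul
        (hφ.contDiffAt.comp x (contDiffAt_inv_norm_smul hx))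
  · refine HasCompactSupport.intro (isCompact_closedBall (0 : E d) 6) fun x hx => ?_
    rw [mem_closedBall_zero_iff, not_le] at hx
    have : η ‖x‖ = 0 := bump_eq_zero_of_ge hη hx.le
    simp [conicTest, this]

/-- The vector `rotVec q x` is orthogonal to x, so neither the radial bump nor the factor 1/|x| is
differentiated, and it depends linearly on x. -/
lemma rot_conicTest (hη : η.rOut ≤ 2) {φ : E d → ℝ} (hφ : ContDiff ℝ ∞ φ) (q : Plane d) (x : E d) :
    rot q (conicTest η φ) x = η ‖x‖ * rot q φ (‖x‖⁻¹ • x) := by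
  by_cases hx : x = 0
  · rw [rot_eq_fderiv, hx, (conicTest_eventually_zero hη φ).fderiv_eq]
    simp [rot]
  have hr : ‖x‖ ≠ 0 := norm_ne_zero_iff.2 hx
  have hn := hasFDerivAt_norm_of_ne hx
  have h1 : HasFDerivAt (fun x : E d => η ‖x‖) _ x :=
    (η.contDiff (n := 1) |>.differentiable (by simp) ‖x‖).hasFDerivAt.comp x hn
  have h2 : HasFDerivAt (fun x : E d => ‖x‖⁻¹) _ x :=
    ((hasDerivAt_inv hr).hasFDerivAt).comp x hn
  have h3 := h2.smul (hasFDerivAt_id x)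
  have h4 : HasFDerivAt (fun x : E d => φ (‖x‖⁻¹ • x)) _ x :=
    HasFDerivAt.comp x (hφ.differentiable (by simp) (‖x‖⁻¹ • x)).hasFDerivAt h3
  have h5 := h1.mul h4
  have hi := inner_rotVec q x
  have e : rotVec q (‖x‖⁻¹ • x) = ‖x‖⁻¹ • rotVec q x := by
    simp only [rotVec, PiLp.smul_apply, smul_sub, smul_smul, smul_eq_mul]
  rw [rot_eq_fderiv, rot_eq_fderiv, e]
  have h6 : fderiv ℝ (conicTest η φ) x = _ := h5.fderiv
  rw [h6]
  simp [hi]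

lemma integral_conic {F : ℝ → ℝ} {G : S d → ℝ}
    (hint : Integrable (fun x : E d => F ‖x‖ * G (dir x)) volume) :
    ∫ x : E d, F ‖x‖ * G (dir x) = (∫ r, F r ∂radialMeasure d) * ∫ θ, G θ ∂σ d := by
  rw [integral_polar hint, ← integral_mul_const]
  refine integral_congr_ae ?_
  filter_upwards [ae_radial_pos] with r hr
  simp only [norm_sphere_smul _ hr, dir_smul _ hr]
  rw [integral_const_mul]

/-- The common radial factor of both sides in `isWeakRot_of_integral` can be cancelled. -/
lemma integral_bump_pos (hη : η.rOut ≤ 2) : 0 < ∫ r, η r ∂radialMeasure d := by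
  have hc : Continuous fun r => η r := η.contDiff.continuous (n := 0)
  have hint : Integrable (fun r => η r) (radialMeasure d) := by
    refine Integrable.mono' (g := (Set.Iio (6 : ℝ)).indicator fun _ => 1) ?_
      hc.aestronglyMeasurable ?_
    · rw [integrable_indicator_iff measurableSet_Iio]
      exact integrableOn_const (radialMeasure_Iio_lt_top 6).ne
    · refine .of_forall fun r => ?_
      by_cases hr : r ∈ Set.Iio (6 : ℝ)
      · rw [Set.indicator_of_mem hr, Real.norm_of_nonneg η.nonneg]
        exact η.le_one
      · rw [Set.indicator_of_notMem hr, bump_eq_zero_of_ge hη (not_lt.1 hr), norm_zero]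
  rw [integral_pos_iff_support_of_nonneg (fun r => η.nonneg) hint]
  have hη0 := η.rOut_pos
  have hU : IsOpen (Metric.ball (4 : ℝ) η.rOut) := Metric.isOpen_ball
  have h4 : Metric.ball (4 : ℝ) η.rOut ⊆ Function.support fun r => η r := fun r hr =>
    (η.pos_of_mem_ball hr).ne'
  refine lt_of_lt_of_le ?_ (measure_mono h4)
  refine lt_of_lt_of_le ?_ (measure_mono (μ := radialMeasure d) (s := Set.Ioo 4 (4 + η.rOut)) ?_)
  · rw [radialMeasure, withDensity_apply _ measurableSet_Ioo, Measure.restrict_restrict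
      measurableSet_Ioo]
    have h1 : Set.Ioo 4 (4 + η.rOut) ∩ Set.Ioi 0 = Set.Ioo 4 (4 + η.rOut) :=
      Set.inter_eq_left.2 fun r hr => (four_pos.trans hr.1 : (0 : ℝ) < r)
    rw [h1]
    calc (0 : ENNReal) < ∫⁻ _r in Set.Ioo 4 (4 + η.rOut), 1 := by simpa using hη0
      _ ≤ _ := by
          refine setLIntegral_mono' measurableSet_Ioo fun r hr => ?_
          rw [← ENNReal.ofReal_one]
          exact ENNReal.ofReal_le_ofReal (one_le_pow₀ (by linarith [hr.1]))
  · intro r hr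
    rw [Metric.mem_ball, Real.dist_eq, abs_of_pos (by linarith [hr.1])]
    linarith [hr.2]

/-- Weak rotations on the sphere from weak rotations on `ℝ^d`. -/
lemma isWeakRot_of_integral {ψ : ℝ → ℝ} (hψ2 : ∀ t, 2 ≤ t → ψ t = 1) {a b : S d → ℝ} {q : Plane d}
    (ha : Integrable a (σ d)) (hb : Integrable b (σ d))
    (h : ∀ Φ : E d → ℝ, IsTest Φ → ∫ x, ψ ‖x‖ * angular a x * rot q Φ x =
      - ∫ x, ψ ‖x‖ * angular b x * Φ x) : IsWeakRot [q] a b := by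
  refine ⟨ha, hb, fun φ hφ => ?_⟩
  -- This bump lives in 2 ≤ r ≤ 6, where ψ equals 1.
  obtain ⟨η, hη⟩ : ∃ η : ContDiffBump (4 : ℝ), η.rOut = 2 := ⟨⟨1, 2, one_pos, one_lt_two⟩, rfl⟩
  have hη2 := hη.le
  have hT := isTest_conicTest hη2 hφ
  have h1 := h _ hT
  have key : ∀ (c : S d → ℝ) (g Ψ : E d → ℝ), IsTest Ψ → (∀ x, Ψ x = η ‖x‖ * g (‖x‖⁻¹ • x)) →
      Integrable c (σ d) → ∫ x, ψ ‖x‖ * angular c x * Ψ x =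
        (∫ r, η r ∂radialMeasure d) * ∫ θ, c θ * g θ ∂σ d := by
    intro c g Ψ hΨ hg hc
    have e : ∀ x, x ≠ 0 → angular c x * Ψ x = η ‖x‖ * ((fun θ : S d => c θ * g θ) (dir x)) := by
      intro x hx
      have h2 : ((dir x : S d) : E d) = ‖x‖⁻¹ • x := by rw [dir, dif_neg hx]
      simp only [angular_eq c hx, hg, h2]
      ring
    have e' : (fun x => angular c x * Ψ x) =ᵐ[volume]
        fun x => η ‖x‖ * ((fun θ : S d => c θ * g θ) (dir x)) := by
      filter_upwards [Measure.ae_ne volume (0 : E d)] with x hx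
      exact e x hx
    have hi := integral_conic (F := fun r => η r) (G := fun θ : S d => c θ * g θ)
      ((integrable_angular_mul hc hΨ).congr e')
    refine Eq.trans ?_ hi
    refine integral_congr_ae ?_
    filter_upwards [e'] with x hx
    refine Eq.trans ?_ hx
    by_cases h2 : 2 ≤ ‖x‖
    · rw [hψ2 _ h2, one_mul]
    · rw [hg, bump_eq_zero_of_le hη2 (by linarith)]; simp
  rw [key a (rot q φ) _ (hT.rot q) (rot_conicTest hη2 hφ q) ha,
    key b φ _ hT (fun x => rfl) hb] at h1
  have hpos := integral_bump_pos (d := d) hη2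
  have h2 : ∫ θ, a θ * rot q φ θ ∂σ d = - ∫ θ, b θ * φ θ ∂σ d := by
    rw [← mul_neg] at h1
    exact mul_left_cancel₀ hpos.ne' h1
  simpa [rotWord] using h2

/-- The product rule on the sphere. -/
lemma MemSphereSobolev.isWeakRot_mul (hp : 1 < p) {m : ℕ} (hm : (d : ℝ) / p < m) {α β : ℕ}
    (hab : m ≤ α + β + 1) {a b a' b' : S d → ℝ} (ha : MemSphereSobolev (α + 1) p a)
    (hb : MemSphereSobolev (β + 1) p b) {q : Plane d} (ha' : IsWeakRot [q] a a')
    (hb' : IsWeakRot [q] b b') :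
    IsWeakRot [q] (fun θ => a θ * b θ) (fun θ => a' θ * b θ + a θ * b' θ) := by
  have hint : ∀ {γ δ : ℕ} {f g : S d → ℝ}, m ≤ γ + δ → MemSphereSobolev γ p f →
      MemSphereSobolev δ p g → Integrable (fun θ => f θ * g θ) (σ d) := by
    intro γ δ f g hγ hf hg
    obtain ⟨C, hC⟩ := exists_eLpNorm_sphere_mul_le hp hm hγ
    refine memLp_sphere_integrable hp.le ⟨hf.integrable.aestronglyMeasurable.mul
      hg.integrable.aestronglyMeasurable, (hC f g hf hg).trans_lt ?_⟩
    exact ENNReal.mul_lt_top (by simp) (ENNReal.mul_lt_top hf.norm_lt_top hg.norm_lt_top)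
  have hda := ha.deriv hp.le ha'
  have hdb := hb.deriv hp.le hb'
  have i0 := hint (by omega) ha hb
  have i1 := hint (by omega) hda hb
  have i2 := hint (by omega) ha hdb
  set ψ : ℝ → ℝ := fun t => Real.smoothTransition (t - 1) with hψ
  have hψr : IsRadial ψ := isCutoff_smoothTransition.isRadial
  -- The trivial power of the norm is kept so that the function literally has the shape of
  -- `IsSym.radial`.
  have hs : IsSym (-(0 : ℕ)) (fun x : E d => ψ ‖x‖ * (‖x‖ ^ 0)⁻¹) := IsSym.radial hψr 0
  obtain ⟨C1, hC1⟩ := hs.exists_unifNorm_le hp.le (α + 1)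
  obtain ⟨C2, hC2⟩ := hs.exists_unifNorm_le hp.le (β + 1)
  have hU := (hC1 a ha).1
  have hV := (hC2 b hb).1
  have hmul := fun i => hU.wd_mul hp hm hab hV (hU.wd i) (hV.wd i)
  -- Both localised factors carry ψ, so their product carries ψ², which is still 1 from radius 2 on.
  refine isWeakRot_of_integral (ψ := fun t => ψ t * ψ t)
    (fun t ht => by rw [show ψ t = 1 from isCutoff_smoothTransition.eq_one t ht, mul_one])
    i0 (i1.add i2) fun Φ hΦ => ?_
  have e1 := WD.integral_mul_rot (hmul q.1.1) (hmul q.1.2) hΦ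
  have r1 := rot_radial_mul_angular_ae_eq hψr ha' (hU.wd q.1.1) (hU.wd q.1.2)
  have r2 := rot_radial_mul_angular_ae_eq hψr hb' (hV.wd q.1.1) (hV.wd q.1.2)
  calc _ = ∫ x, ψ ‖x‖ * (‖x‖ ^ 0)⁻¹ * angular a x * (ψ ‖x‖ * (‖x‖ ^ 0)⁻¹ * angular b x) *
        AsymptoticSpaces.rot q Φ x := by
        refine integral_congr_ae (.of_forall fun x => ?_)
        simp only [angular_mul, pow_zero, inv_one]
        ring
    _ = _ := by
        rw [e1]
        congr 1
        refine integral_congr_ae ?_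
        filter_upwards [r1, r2] with x h1 h2
        simp only [angular_add, angular_mul]
        have h3 : ψ ‖x‖ * (‖x‖ ^ 0)⁻¹ = ψ ‖x‖ := by simp
        rw [h3] at h1 h2 ⊢
        linear_combination (ψ ‖x‖ * angular b x * Φ x) * h1 + (ψ ‖x‖ * angular a x * Φ x) * h2

end ProductRule

/-- Products in Sobolev spaces on the sphere. -/
theorem exists_sphereSobolevNorm_mul_le (hp : 1 < p) {m : ℕ} (hm : (d : ℝ) / p < m) (n α β : ℕ)
    (hα : n ≤ α) (hβ : n ≤ β) (hab : m + n ≤ α + β) :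
    ∃ C : NNReal, ∀ a b : S d → ℝ, MemSphereSobolev α p a → MemSphereSobolev β p b →
      MemSphereSobolev n p (fun θ => a θ * b θ) ∧ sphereSobolevNorm n p (fun θ => a θ * b θ) ≤
        C * (sphereSobolevNorm α p a * sphereSobolevNorm β p b) := by
  have hL : ∀ {α β : ℕ}, m ≤ α + β → ∀ {a b : S d → ℝ}, MemSphereSobolev α p a →
      MemSphereSobolev β p b → MemLp (fun θ => a θ * b θ) (ENNReal.ofReal p) (σ d) := by
    intro α β h a b ha hb
    obtain ⟨C, hC⟩ := exists_eLpNorm_sphere_mul_le hp hm h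
    exact ⟨ha.integrable.aestronglyMeasurable.mul hb.integrable.aestronglyMeasurable,
      (hC a b ha hb).trans_lt (ENNReal.mul_lt_top (by simp)
        (ENNReal.mul_lt_top ha.norm_lt_top hb.norm_lt_top))⟩
  induction n generalizing α β with
  | zero =>
    obtain ⟨C, hC⟩ := exists_eLpNorm_sphere_mul_le hp hm (α := α) (β := β) (by omega)
    refine ⟨C, fun a b ha hb => ?_⟩
    have h1 := hL (by omega) ha hb
    refine ⟨(memSphereSobolev_zero_iff hp.le).2 h1, ?_⟩
    rw [sphereSobolevNorm_zero (memLp_sphere_integrable hp.le h1)]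
    exact hC a b ha hb
  | succ n ih =>
    obtain ⟨α, rfl⟩ : ∃ a', α = a' + 1 := ⟨α - 1, by omega⟩
    obtain ⟨β, rfl⟩ : ∃ b', β = b' + 1 := ⟨β - 1, by omega⟩
    obtain ⟨C, hC⟩ := exists_eLpNorm_sphere_mul_le hp hm (α := α + 1) (β := β + 1) (by omega)
    obtain ⟨C1, hC1⟩ := ih α (β + 1) (by omega) (by omega) (by omega)
    obtain ⟨C2, hC2⟩ := ih (α + 1) β (by omega) (by omega) (by omega)
    refine ⟨C + Fintype.card (Plane d) * (C1 + C2), fun a b ha hb => ?_⟩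
    have h1 := hL (by omega) ha hb
    have hrot := fun q => ha.isWeakRot_mul hp hm (by omega) hb (ha.rot hp.le q) (hb.rot hp.le q)
    have hA := fun q => hC1 _ b (ha.deriv hp.le (ha.rot hp.le q)) hb
    have hB := fun q => hC2 a _ ha (hb.deriv hp.le (hb.rot hp.le q))
    have hmem : MemSphereSobolev (n + 1) p fun θ => a θ * b θ :=
      (memSphereSobolev_succ_iff hp.le).2 ⟨h1, fun q => ⟨_, hrot q, (hA q).1.add (hB q).1⟩⟩
    refine ⟨hmem, ?_⟩
    set N := sphereSobolevNorm (α + 1) p a * sphereSobolevNorm (β + 1) p b with hN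
    have hq : ∀ q, sphereSobolevNorm n p (weakRot [q] fun θ => a θ * b θ) ≤ (C1 + C2) * N := by
      intro q
      rw [sphereSobolevNorm_congr (weakRot_ae_eq (hrot q))]
      refine (sphereSobolevNorm_add_le hp.le (hA q).1 (hB q).1).trans ?_
      rw [add_mul]
      refine add_le_add ((hA q).2.trans ?_) ((hB q).2.trans ?_)
      · rw [hN]; gcongr; exact sphereSobolevNorm_rot_le hp.le ha (ha.rot hp.le q)
      · rw [hN]; gcongr; exact sphereSobolevNorm_rot_le hp.le hb (hb.rot hp.le q)
    rw [sphereSobolevNorm_succ hp.le hmem]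
    calc _ ≤ C * N + ∑ _q : Plane d, (C1 + C2) * N := by
          gcongr with q
          · exact hC a b ha hb
          · exact hq q
      _ = _ := by
          rw [Finset.sum_const, Finset.card_univ, nsmul_eq_mul]
          push_cast; ring

end AsymptoticSpaces
end

/-! ### Asymptotic functions in weighted `L^p` have no coefficients -/

noncomputable section
namespace AsymptoticSpaces
variable {d : ℕ} {p : ℝ}

lemma two_rpow_mul_rpow_le (s : ℝ) {r j : ℝ} (hr : 0 < r) (h1 : r ≤ j) (h2 : j ≤ 2 * r) :
    2 ^ (-|s|) * r ^ s ≤ j ^ s := by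
  have hj : 0 < j := hr.trans_le h1
  rcases le_total 0 s with h | h
  · refine le_trans ?_ (Real.rpow_le_rpow hr.le h1 h)
    refine mul_le_of_le_one_left (by positivity) ?_
    exact Real.rpow_le_one_of_one_le_of_nonpos one_le_two (by simp)
  · rw [abs_of_nonpos h, neg_neg, ← Real.mul_rpow zero_le_two hr.le]
    exact Real.rpow_le_rpow_of_nonpos hj h2 h

/-- A sum of homogeneous radial functions of degree at least `-s - d/p` which is weighted `L^p`
vanishes. -/
lemma radial_coeff_eq_zero (hp : 0 < p) [NeZero d] {K : ℕ} {s : ℝ} (hK : (K : ℝ) ≤ s + d / p)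
    {c : ℕ → ℝ} {J : ℝ → ℝ} (hJ : ∀ r, 2 ≤ r → r ≤ J r ∧ J r ≤ 2 * r)
    (h : IntegrableAtFilter
      (fun r => r ^ (d - 1) * ‖J r ^ s * ∑ k ∈ Finset.range (K + 1), c k / r ^ k‖ ^ p)
      atTop volume) : ∀ k ≤ K, c k = 0 := by
  intro k
  induction k using Nat.strong_induction_on with
  | _ k ih =>
  intro hk
  by_contra hc
  -- Multiplication by r^k isolates the first coefficient not yet known to vanish: the earlier ones
  -- are zero by induction and the later terms tend to zero.
  have hlim : Tendsto (fun r : ℝ => ∑ l ∈ Finset.range (K + 1), c l * (r ^ k / r ^ l)) atTop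
      (𝓝 (∑ l ∈ Finset.range (K + 1), if l = k then c k else 0)) := by
    refine tendsto_finsetSum _ fun l hl => ?_
    have hlK : l ≤ K := Nat.lt_succ_iff.1 (Finset.mem_range.1 hl)
    rcases lt_trichotomy l k with h1 | rfl | h1
    · simp [ih l h1 hlK, h1.ne]
    · rw [if_pos rfl]
      refine tendsto_const_nhds.congr' ?_
      filter_upwards [eventually_gt_atTop 0] with r hr
      rw [div_self (by positivity), mul_one]
    · rw [if_neg h1.ne']
      have := (tendsto_pow_div_pow_atTop_zero (𝕜 := ℝ) h1).const_mul (c l)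
      simpa using this
  rw [Finset.sum_ite_eq' , if_pos (Finset.mem_range.2 (Nat.lt_succ_iff.2 hk))] at hlim
  have hev : ∀ᶠ r in atTop, |c k| / 2 < |∑ l ∈ Finset.range (K + 1), c l * (r ^ k / r ^ l)| :=
    hlim.abs.eventually_const_lt (by have := abs_pos.2 hc; linarith)
  set A : ℝ := (2 ^ (-|s|) * (|c k| / 2)) ^ p with hA
  have hA0 : 0 < A := by
    have := abs_pos.2 hc
    positivity
  -- If `c k` were nonzero, the integrand would grow at least like r^{(s-k)p + d - 1}, with exponent
  -- at least -1 because k ≤ K ≤ s + d/p; but r^{-1} is not integrable at infinity.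
  have hO : (fun r : ℝ => r ^ (-1 : ℝ)) =O[atTop] fun r =>
      r ^ (d - 1) * ‖J r ^ s * ∑ k ∈ Finset.range (K + 1), c k / r ^ k‖ ^ p := by
    refine Asymptotics.IsBigO.of_bound A⁻¹ ?_
    filter_upwards [hev, eventually_ge_atTop 2] with r hr1 hr
    have hr0 : 0 < r := by linarith
    have hJr := two_rpow_mul_rpow_le s hr0 (hJ r hr).1 (hJ r hr).2
    have e1 : ∑ l ∈ Finset.range (K + 1), c l * (r ^ k / r ^ l) =
        r ^ k * ∑ l ∈ Finset.range (K + 1), c l / r ^ l := by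
      rw [Finset.mul_sum]
      exact Finset.sum_congr rfl fun l _ => by ring
    obtain ⟨Q, hQ⟩ : ∃ Q, Q = ∑ l ∈ Finset.range (K + 1), c l / r ^ l := ⟨_, rfl⟩
    rw [e1, ← hQ, abs_mul, abs_of_pos (pow_pos hr0 k)] at hr1
    rw [← hQ, Real.norm_of_nonneg (by positivity), Real.norm_of_nonneg (by positivity),
      Real.norm_eq_abs, abs_mul, abs_of_nonneg (Real.rpow_nonneg (by linarith [(hJ r hr).1]) s)]
    rw [inv_mul_eq_div, le_div_iff₀ hA0]
    have e2 : r ^ (-1 : ℝ) * A ≤ r ^ (d - 1) * ((2 ^ (-|s|) * r ^ s) * (|c k| / 2 / r ^ k)) ^ p := by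
      have e3 : (2 : ℝ) ^ (-|s|) * r ^ s * (|c k| / 2 / r ^ k) =
          (2 ^ (-|s|) * (|c k| / 2)) * r ^ (s - k) := by
        rw [Real.rpow_sub hr0, Real.rpow_natCast]
        ring
      rw [e3, Real.mul_rpow (by positivity) (by positivity), ← Real.rpow_mul hr0.le, ← hA]
      rw [mul_left_comm, mul_comm _ A]
      refine mul_le_mul_of_nonneg_left ?_ hA0.le
      rw [← Real.rpow_natCast, ← Real.rpow_add hr0]
      refine Real.rpow_le_rpow_of_exponent_le (by linarith) ?_
      have hd1 : 1 ≤ d := Nat.one_le_iff_ne_zero.2 (NeZero.ne d)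
      rw [Nat.cast_sub hd1, Nat.cast_one]
      have hkK : (k : ℝ) ≤ K := by exact_mod_cast hk
      have : 0 ≤ (s + d / p - k) * p := mul_nonneg (by linarith) hp.le
      have e4 : (s + d / p - k) * p = (s - k) * p + d := by field_simp; ring
      linarith
    refine e2.trans ?_
    refine mul_le_mul_of_nonneg_left (Real.rpow_le_rpow (by positivity) ?_ hp.le) (by positivity)
    refine mul_le_mul hJr ?_ (by positivity) (Real.rpow_nonneg (by linarith [(hJ r hr).1]) s)
    rw [div_le_iff₀ (by positivity), mul_comm]
    exact hr1.le
  have hi := hO.integrableAtFilter ?_ h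
  · rw [integrableAtFilter_rpow_atTop_iff] at hi
    exact lt_irrefl _ hi
  · exact ⟨Set.univ, univ_mem, by fun_prop⟩

variable [NeZero d]

lemma aestronglyMeasurable_asympFun {χ : ℝ → ℝ} (hχ : Continuous χ) {K : ℕ} {c : ℕ → S d → ℝ}
    (hc : ∀ k ≤ K, Integrable (c k) (σ d)) :
    AEStronglyMeasurable (asympFun χ K c) volume := by
  unfold asympFun
  refine (hχ.comp continuous_norm).aestronglyMeasurable.mul ?_
  refine Finset.aestronglyMeasurable_fun_sum _ fun k hk => ?_
  have h1 := aestronglyMeasurable_angular (hc k (Nat.lt_succ_iff.1 (Finset.mem_range.1 hk))).1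
  simp only [div_eq_mul_inv]
  exact h1.mul (measurable_norm.pow_const k).inv.aestronglyMeasurable

/-- Fubini in polar coordinates gives integrability along almost every ray, and
`radial_coeff_eq_zero` applies on each of them. -/
lemma sphere_coeff_eq_zero (hp : 1 ≤ p) {χ : ℝ → ℝ} (hχ : IsCutoff χ) {K : ℕ} {s : ℝ}
    (hK : (K : ℝ) ≤ s + d / p) {c : ℕ → S d → ℝ} (h : WMem p s (asympFun χ K c)) :
    ∀ k ≤ K, c k =ᵐ[σ d] 0 := by
  have hp0 : 0 < p := by linarith
  have h1 : Integrable (fun x : E d => ‖japanese x ^ s * asympFun χ K c x‖ ^ p) volume := by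
    have := MemLp.integrable_norm_rpow h (by simpa using hp0) (by simp)
    rwa [ENNReal.toReal_ofReal hp0.le] at this
  have h2 := (measurePreserving_polar.integrable_comp h1.aestronglyMeasurable).2 h1
  have h3 := h2.prod_right_ae
  intro k hk
  filter_upwards [h3] with θ hθ
  refine radial_coeff_eq_zero (J := fun r => √(r ^ 2 + 1)) (c := fun k => c k θ) hp0 hK ?_ ?_ k hk
  · intro r hr
    exact ⟨Real.le_sqrt_of_sq_le (by linarith), by
      rw [Real.sqrt_le_left (by linarith)]; nlinarith⟩
  · rw [radialMeasure, integrable_withDensity_iff_integrable_smul' (by fun_prop)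
      (.of_forall fun r => by simp)] at hθ
    refine ⟨Set.Ici 2, Ici_mem_atTop 2, ?_⟩
    have h4 := IntegrableOn.mono_set (s := Set.Ici 2) hθ fun r (hr : r ∈ Set.Ici 2) =>
      Set.mem_Ioi.2 (two_pos.trans_le (Set.mem_Ici.1 hr))
    refine h4.congr_fun (fun r hr => ?_) measurableSet_Ici
    have hr2 : 2 ≤ r := Set.mem_Ici.1 hr
    have hr0 : 0 < r := by linarith
    simp only [Function.comp, asympFun, japanese, norm_sphere_smul θ hr0, angular_smul _ θ hr0,
      hχ.eq_one r hr2, one_mul, smul_eq_mul, ENNReal.toReal_ofReal (pow_nonneg hr0.le _)]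

end AsymptoticSpaces
end

/-! ### Expansions and their uniqueness -/

noncomputable section
namespace AsymptoticSpaces
variable {d : ℕ} {p : ℝ} {m n K : ℕ} {e : ℕ → ℝ} {χ : ℝ → ℝ} {a b : ℕ → S d → ℝ} {f g : E d → ℝ}
  {u v : E d →ₘ[volume] ℝ}

lemma angular_const_mul (c : ℝ) (a : S d → ℝ) (x : E d) :
    angular (fun θ => c * a θ) x = c * angular a x := by
  unfold angular; split_ifs <;> simp

lemma angular_fun_zero (x : E d) : angular (fun _ => 0) x = 0 := by
  unfold angular; split_ifs <;> simp

lemma angular_sum {ι : Type*} (t : Finset ι) (A : ι → S d → ℝ) (x : E d) :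
    angular (fun θ => ∑ i ∈ t, A i θ) x = ∑ i ∈ t, angular (A i) x := by
  unfold angular; split_ifs <;> simp

lemma asympFun_add (a b : ℕ → S d → ℝ) (x : E d) :
    asympFun χ K (fun k θ => a k θ + b k θ) x = asympFun χ K a x + asympFun χ K b x := by
  simp only [asympFun, angular_add, add_div, Finset.sum_add_distrib, mul_add]

lemma asympFun_const_mul (c : ℝ) (a : ℕ → S d → ℝ) (x : E d) :
    asympFun χ K (fun k θ => c * a k θ) x = c * asympFun χ K a x := by
  simp only [asympFun, angular_const_mul, mul_div_assoc, ← Finset.mul_sum]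
  ring

lemma asympFun_zero (x : E d) : asympFun χ K (fun _ _ => 0) x = 0 := by
  simp [asympFun, angular_fun_zero]

variable [NeZero d]

/-- The norm of an expansion with coefficients `a` and remainder `f`. -/
def expansionSum (m : ℕ) (p : ℝ) (K : ℕ) (e : ℕ → ℝ) (a : ℕ → S d → ℝ) (f : E d → ℝ) : ENNReal :=
  ∑ k ∈ Finset.range (K + 1), sphereSobolevNorm (m + 1 + K - k) p (a k) +
    weightedSobolevNorm m p e f

lemma sphereSobolevNorm_le_expansionSum {k : ℕ} (hk : k ≤ K) :
    sphereSobolevNorm (m + 1 + K - k) p (a k) ≤ expansionSum m p K e a f :=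
  (Finset.single_le_sum (f := fun k => sphereSobolevNorm (m + 1 + K - k) p (a k))
    (fun _ _ => zero_le) (Finset.mem_range.2 (by omega))).trans le_self_add

lemma weightedSobolevNorm_le_expansionSum :
    weightedSobolevNorm m p e f ≤ expansionSum m p K e a f := le_add_self

lemma IsExpansion.zero : IsExpansion χ m p K e (fun _ _ => 0) (fun _ : E d => 0) 0 := by
  refine ⟨fun k _ => memSphereSobolev_fun_zero, memWeightedSobolev_zero, ?_⟩
  filter_upwards [AEEqFun.coeFn_zero (α := E d) (β := ℝ) (μ := volume)] with x hx
  simp [hx, asympFun_zero]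

lemma IsExpansion.const_mul (h : IsExpansion χ m p K e a f u) (c : ℝ) :
    IsExpansion χ m p K e (fun k θ => c * a k θ) (fun x => c * f x) (c • u) := by
  refine ⟨fun k hk => (h.1 k hk).const_mul c, h.2.1.const_mul c, ?_⟩
  filter_upwards [AEEqFun.coeFn_smul c u, h.2.2] with x hx hu
  rw [hx, Pi.smul_apply, hu, asympFun_const_mul, smul_eq_mul, mul_add]

lemma expansionSum_const_mul (h : IsExpansion χ m p K e a f u) (c : ℝ) :
    expansionSum m p K e (fun k θ => c * a k θ) (fun x => c * f x) =
      ENNReal.ofReal |c| * expansionSum m p K e a f := by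
  rw [expansionSum, expansionSum, weightedSobolevNorm_const_mul h.2.1, mul_add, Finset.mul_sum]
  congr 1
  exact Finset.sum_congr rfl fun k hk => sphereSobolevNorm_const_mul
    (h.1 k (Nat.lt_succ_iff.1 (Finset.mem_range.1 hk))) c

lemma asympFun_congr (h : ∀ k ≤ K, a k =ᵐ[σ d] b k) :
    asympFun χ K a =ᵐ[volume] asympFun χ K b := by
  have h1 : ∀ᵐ x : E d, ∀ k ∈ Finset.range (K + 1), angular (a k) x = angular (b k) x :=
    (Finset.eventually_all _).2 fun k hk =>
      angular_congr (h k (Nat.lt_succ_iff.1 (Finset.mem_range.1 hk)))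
  filter_upwards [h1] with x hx
  rw [asympFun, asympFun, Finset.sum_congr rfl fun k hk => by rw [hx k hk]]

lemma IsExpansion.congr (h : IsExpansion χ m p K e a f u) (hab : ∀ k ≤ K, a k =ᵐ[σ d] b k)
    (hfg : f =ᵐ[volume] g) : IsExpansion χ m p K e b g u := by
  refine ⟨fun k hk => (h.1 k hk).congr (hab k hk), h.2.1.congr hfg, ?_⟩
  filter_upwards [h.2.2, asympFun_congr (χ := χ) hab, hfg] with x h1 h2 h3
  rw [h1, h2, h3]

lemma expansionSum_congr (hab : ∀ k ≤ K, a k =ᵐ[σ d] b k) (hfg : f =ᵐ[volume] g) :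
    expansionSum m p K e a f = expansionSum m p K e b g := by
  rw [expansionSum, expansionSum, weightedSobolevNorm_congr hfg]
  congr 1
  exact Finset.sum_congr rfl fun k hk => sphereSobolevNorm_congr
    (hab k (Nat.lt_succ_iff.1 (Finset.mem_range.1 hk)))

lemma IsExpansion.add (h : IsExpansion χ m p K e a f u) (h' : IsExpansion χ m p K e b g v) :
    IsExpansion χ m p K e (fun k θ => a k θ + b k θ) (fun x => f x + g x) (u + v) := by
  refine ⟨fun k hk => (h.1 k hk).add (h'.1 k hk), h.2.1.add h'.2.1, ?_⟩
  filter_upwards [AEEqFun.coeFn_add u v, h.2.2, h'.2.2] with x hx hu hv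
  rw [hx, Pi.add_apply, hu, hv, asympFun_add]
  ring

lemma IsExpansion.sub (h : IsExpansion χ m p K e a f u) (h' : IsExpansion χ m p K e b g v) :
    IsExpansion χ m p K e (fun k θ => a k θ - b k θ) (fun x => f x - g x) (u - v) := by
  have := h.add (h'.const_mul (-1))
  simpa only [neg_one_mul, ← sub_eq_add_neg, neg_smul, one_smul] using this

lemma expansionSum_add_le (hp : 1 ≤ p) (h : IsExpansion χ m p K e a f u)
    (h' : IsExpansion χ m p K e b g v) :
    expansionSum m p K e (fun k θ => a k θ + b k θ) (fun x => f x + g x) ≤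
      expansionSum m p K e a f + expansionSum m p K e b g := by
  rw [expansionSum, expansionSum, expansionSum, add_add_add_comm, ← Finset.sum_add_distrib]
  refine add_le_add (Finset.sum_le_sum fun k hk => ?_) (weightedSobolevNorm_add_le hp h.2.1 h'.2.1)
  have hk' := Nat.lt_succ_iff.1 (Finset.mem_range.1 hk)
  exact sphereSobolevNorm_add_le hp (h.1 k hk') (h'.1 k hk')

lemma IsExpansion.sum_lt_top (h : IsExpansion χ m p K e a f u) :
    expansionSum m p K e a f < ⊤ :=
  ENNReal.add_lt_top.2 ⟨ENNReal.sum_lt_top.2 fun k hk =>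
    (h.1 k (Nat.lt_succ_iff.1 (Finset.mem_range.1 hk))).norm_lt_top, h.2.1.norm_lt_top⟩

/-- Coefficients that vanish almost everywhere, and those beyond `K`, are replaced by literal zeros,
so that the algebra of coefficient sequences takes place pointwise. -/
lemma exists_isExpansion_of_mem (hu : u ∈ expansionSpace χ m p n K e) :
    ∃ a f, IsExpansion χ m p K e a f u ∧ (∀ k < n, a k = fun _ => 0) ∧
      ∀ k, K < k → a k = fun _ => 0 := by
  obtain ⟨a, f, h, ha⟩ := hu
  refine ⟨fun k => if k < n ∨ K < k then fun _ => 0 else a k, f, h.congr (fun k hk => ?_) .rfl,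
    fun k hk => if_pos (Or.inl hk), fun k hk => if_pos (Or.inr hk)⟩
  split_ifs with h1
  · exact ha k (by omega)
  · rfl

/-- Uniqueness of expansions. -/
lemma IsExpansion.unique (hp : 1 ≤ p) (hχ : IsCutoff χ) (hK : (K : ℝ) ≤ e 0 + d / p)
    (h : IsExpansion χ m p K e a f u) (h' : IsExpansion χ m p K e b g u) :
    (∀ k ≤ K, a k =ᵐ[σ d] b k) ∧ f =ᵐ[volume] g := by
  have h1 := h.sub h'
  rw [sub_self] at h1
  have h2 : asympFun χ K (fun k θ => a k θ - b k θ) =ᵐ[volume] fun x => -(f x - g x) := by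
    filter_upwards [h1.2.2, AEEqFun.coeFn_zero (α := E d) (β := ℝ) (μ := volume)] with x h3 h4
    rw [h4, Pi.zero_apply] at h3
    linarith
  have h3 : WMem p (e 0) (asympFun χ K (fun k θ => a k θ - b k θ)) := by
    refine WMem.congr ?_ h2.symm
    have := (h1.2.1.const_mul (-1)).wMem
    simpa only [neg_one_mul] using this
  have h4 := sphere_coeff_eq_zero hp hχ hK h3
  have h5 : ∀ k ≤ K, a k =ᵐ[σ d] b k := fun k hk => (h4 k hk).mono fun θ hθ => sub_eq_zero.1 hθ
  refine ⟨h5, ?_⟩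
  filter_upwards [h.2.2, h'.2.2, asympFun_congr (χ := χ) h5] with x h6 h7 h8
  rw [h6, h8] at h7
  exact add_left_cancel h7

/-- Uniqueness turns the infimum into a single value, so norms can be computed from any expansion at
hand. -/
lemma IsExpansion.norm_eq (hp : 1 ≤ p) (hχ : IsCutoff χ) (hK : (K : ℝ) ≤ e 0 + d / p)
    (h : IsExpansion χ m p K e a f u) :
    expansionNorm χ m p K e u = expansionSum m p K e a f := by
  refine le_antisymm (iInf_le_of_le a (iInf_le_of_le f (iInf_le _ h))) ?_
  refine le_iInf fun b => le_iInf fun g => le_iInf fun h' => ?_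
  obtain ⟨h1, h2⟩ := h.unique hp hχ hK h'
  exact (expansionSum_congr h1 h2).le

end AsymptoticSpaces
end

/-! ### Completeness of the Sobolev spaces -/

noncomputable section
namespace AsymptoticSpaces

section Lp
variable {α : Type*} [MeasurableSpace α] {μ : Measure α} {P Q : ENNReal}

/-- A double sequence of distances tends to `0`. -/
def IsCauchyDist (D : ℕ → ℕ → ENNReal) : Prop :=
  ∀ ε > 0, ∃ M, ∀ i ≥ M, ∀ j ≥ M, D i j < ε

lemma IsCauchyDist.of_le {D D' : ℕ → ℕ → ENNReal} (h : IsCauchyDist D) (hD : ∀ i j, D' i j ≤ D i j) :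
    IsCauchyDist D' := fun ε hε => by
  obtain ⟨M, hM⟩ := h ε hε
  exact ⟨M, fun i hi j hj => (hD i j).trans_lt (hM i hi j hj)⟩

lemma exists_tendsto_eLpNorm (hP : 1 ≤ P) {F : ℕ → α → ℝ} (hF : ∀ i, MemLp (F i) P μ)
    (hC : IsCauchyDist fun i j => eLpNorm (fun x => F i x - F j x) P μ) :
    ∃ G, MemLp G P μ ∧ Tendsto (fun i => eLpNorm (fun x => F i x - G x) P μ) atTop (𝓝 0) := by
  have : Fact (1 ≤ P) := ⟨hP⟩
  have h1 : CauchySeq fun i => (hF i).toLp (F i) := by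
    rw [EMetric.cauchySeq_iff]
    intro ε hε
    obtain ⟨M, hM⟩ := hC ε hε
    refine ⟨M, fun i hi j hj => ?_⟩
    rw [Lp.edist_toLp_toLp]
    exact hM i hi j hj
  obtain ⟨L, hL⟩ := cauchySeq_tendsto_of_complete h1
  refine ⟨L, Lp.memLp L, ?_⟩
  rw [tendsto_iff_edist_tendsto_0] at hL
  refine hL.congr fun i => ?_
  conv_lhs => rw [← Lp.toLp_coeFn L (Lp.memLp L), Lp.edist_toLp_toLp]
  rfl

lemma tendsto_integral_mul [ENNReal.HolderConjugate P Q] {F : ℕ → α → ℝ} {G ψ : α → ℝ}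
    (hF : ∀ i, MemLp (F i) P μ) (hG : MemLp G P μ) (hψ : MemLp ψ Q μ)
    (h : Tendsto (fun i => eLpNorm (fun x => F i x - G x) P μ) atTop (𝓝 0)) :
    Tendsto (fun i => ∫ x, F i x * ψ x ∂μ) atTop (𝓝 (∫ x, G x * ψ x ∂μ)) := by
  have hi : ∀ {f : α → ℝ}, MemLp f P μ → Integrable (fun x => f x * ψ x) μ := fun hf =>
    hf.integrable_mul hψ
  refine tendsto_integral_of_L1' _ (hi hG).1 (.of_forall fun i => hi (hF i)) ?_
  have h1 := ENNReal.Tendsto.mul_const (b := eLpNorm ψ Q μ) h (Or.inr hψ.eLpNorm_ne_top)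
  rw [zero_mul] at h1
  refine tendsto_of_tendsto_of_tendsto_of_le_of_le tendsto_const_nhds h1 (fun _ => zero_le)
    fun i => ?_
  have e : (fun x => F i x * ψ x) - (fun x => G x * ψ x) = (fun x => F i x - G x) • ψ := by
    ext x; simp [sub_mul]
  dsimp only
  rw [e]
  exact eLpNorm_smul_le_mul_eLpNorm hψ.1 ((hF i).1.sub hG.1)

end Lp

variable {d : ℕ} {p : ℝ}

lemma eLpNorm_weakDeriv_le {m : ℕ} {e : ℕ → ℝ} {f : E d → ℝ} {α : Fin d → ℕ} (hα : ∑ i, α i ≤ m) :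
    eLpNorm (fun x => japanese x ^ e (∑ i, α i) * weakDeriv α f x) (ENNReal.ofReal p) volume ≤
      weightedSobolevNorm m p e f := by
  refine le_trans ?_ (Finset.single_le_sum (f := fun k => ∑ α ∈ Finset.piAntidiag
    (Finset.univ : Finset (Fin d)) k, eLpNorm (fun x => japanese x ^ e k * weakDeriv α f x)
      (ENNReal.ofReal p) volume) (fun _ _ => zero_le) (Finset.mem_range.2 (Nat.lt_succ_iff.2 hα)))
  exact Finset.single_le_sum (f := fun β => eLpNorm (fun x => japanese x ^ e (∑ i, α i) *
    weakDeriv β f x) (ENNReal.ofReal p) volume) (fun _ _ => zero_le)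
    (Finset.mem_piAntidiag.2 ⟨rfl, fun i _ => Finset.mem_univ i⟩)

/-- Completeness of the weighted Sobolev spaces. -/
theorem exists_tendsto_weightedSobolevNorm (hp : 1 < p) {m : ℕ} {e : ℕ → ℝ} {F : ℕ → E d → ℝ}
    (hF : ∀ i, MemWeightedSobolev m p e (F i))
    (hC : IsCauchyDist fun i j => weightedSobolevNorm m p e (fun x => F i x - F j x)) :
    ∃ f, MemWeightedSobolev m p e f ∧
      Tendsto (fun i => weightedSobolevNorm m p e (fun x => F i x - f x)) atTop (𝓝 0) := by
  have hP : 1 ≤ ENNReal.ofReal p := by simpa using hp.le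
  have hpq := Real.HolderConjugate.conjExponent hp
  have := hpq.ennrealOfReal
  have hJ : ∀ (s : ℝ) (x : E d), japanese x ^ s * japanese x ^ (-s) = 1 := fun s x => by
    rw [← Real.rpow_add (japanese_pos x), add_neg_cancel, Real.rpow_zero]
  -- Each weighted derivative has an `L^p` limit. Convergence against test functions is recorded as
  -- well: it carries integration by parts to the limit, which identifies the limits as weak
  -- derivatives of the limit of order zero.
  have h1 : ∀ α : Fin d → ℕ, ∑ i, α i ≤ m → ∃ g, WMem p (e (∑ i, α i)) g ∧
      Tendsto (fun i => wnorm p (e (∑ i, α i)) fun x => weakDeriv α (F i) x - g x) atTop (𝓝 0) ∧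
      ∀ φ, IsTest φ → Tendsto (fun i => ∫ x, weakDeriv α (F i) x * φ x) atTop
        (𝓝 (∫ x, g x * φ x)) := by
    intro α hα
    obtain ⟨G, hG, hlim⟩ := exists_tendsto_eLpNorm hP (fun i => (hF i α hα).2)
      (hC.of_le fun i j => by
        obtain ⟨⟨gi, hgi⟩, -⟩ := hF i α hα
        obtain ⟨⟨gj, hgj⟩, -⟩ := hF j α hα
        have h2 := weakDeriv_ae_eq ((weakDeriv_spec hgi).sub (weakDeriv_spec hgj))
        refine le_trans (le_of_eq (eLpNorm_congr_ae ?_)) (eLpNorm_weakDeriv_le hα)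
        filter_upwards [h2] with x hx
        rw [hx, mul_sub])
    have e1 : (fun x => japanese x ^ e (∑ i, α i) * (japanese x ^ (-e (∑ i, α i)) * G x)) = G := by
      ext x
      rw [← mul_assoc, hJ, one_mul]
    refine ⟨fun x => japanese x ^ (-e (∑ i, α i)) * G x, ?_, ?_, fun φ hφ => ?_⟩
    · rw [WMem, e1]; exact hG
    · refine hlim.congr fun i => ?_
      rw [wnorm]
      congr 1
      ext x
      rw [mul_sub, ← mul_assoc _ _ (G x), hJ, one_mul]
    · have hψc : Continuous fun x => japanese x ^ (-e (∑ i, α i)) * φ x :=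
        (continuous_japanese_rpow _).mul hφ.smooth.continuous
      have hψ := hψc.memLp_of_hasCompactSupport (μ := volume)
        (p := ENNReal.ofReal p.conjExponent) hφ.compact.mul_left
      have h3 := tendsto_integral_mul (fun i => (hF i α hα).2) hG hψ hlim
      convert! h3 using 2
      · refine integral_congr_ae (.of_forall fun x => ?_)
        simp only
        linear_combination (-(weakDeriv α (F _) x * φ x)) * hJ (e (∑ i, α i)) x
      · congr 1
        ext x
        ring
  choose! g hg hlim hint using h1
  have hw : ∀ α : Fin d → ℕ, ∑ i, α i ≤ m → IsWeakDeriv α (g 0) (g α) := by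
    intro α hα
    refine ⟨(hg 0 (by simp)).locallyIntegrable hp.le, (hg α hα).locallyIntegrable hp.le,
      fun φ h2 h3 => ?_⟩
    have hφ : IsTest φ := ⟨h2, h3⟩
    have t1 := hint 0 (by simp) _ (hφ.multiDeriv α)
    have t2 := (hint α hα φ hφ).const_mul ((-1) ^ (∑ i, α i))
    refine tendsto_nhds_unique t1 (t2.congr fun i => ?_)
    obtain ⟨⟨gi, hgi⟩, -⟩ := hF i α hα
    rw [← (weakDeriv_spec hgi).2.2 φ h2 h3]
    refine integral_congr_ae ?_
    filter_upwards [weakDeriv_ae_eq (isWeakDeriv_zero_left hgi.1)] with x hx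
    rw [hx]
  refine ⟨g 0, fun α hα => ⟨⟨g α, hw α hα⟩, WMem.congr (hg α hα) (weakDeriv_ae_eq (hw α hα)).symm⟩, ?_⟩
  have h0 : (0 : ENNReal) = ∑ k ∈ Finset.range (m + 1),
      ∑ α ∈ Finset.piAntidiag (Finset.univ : Finset (Fin d)) k, 0 := by simp
  rw [h0]
  refine tendsto_finsetSum _ fun k hk => tendsto_finsetSum _ fun α hα => ?_
  have hαk : ∑ i, α i = k := (Finset.mem_piAntidiag.1 hα).1
  have hαm : ∑ i, α i ≤ m := hαk.le.trans (Nat.lt_succ_iff.1 (Finset.mem_range.1 hk))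
  have h4 := hlim α hαm
  rw [hαk] at h4
  refine h4.congr fun i => eLpNorm_congr_ae ?_
  obtain ⟨⟨gi, hgi⟩, -⟩ := hF i α hαm
  filter_upwards [weakDeriv_ae_eq ((weakDeriv_spec hgi).sub (hw α hαm))] with x hx
  rw [hx]

variable [NeZero d]

lemma IsWeakRot.sub {w : List (Plane d)} {a a' b b' : S d → ℝ} (h : IsWeakRot w a b)
    (h' : IsWeakRot w a' b') : IsWeakRot w (fun θ => a θ - a' θ) (fun θ => b θ - b' θ) := by
  simpa only [neg_one_mul, ← sub_eq_add_neg] using h.add (h'.const_mul (-1))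

lemma eLpNorm_weakRot_le {s k : ℕ} (hk : k ≤ s) (w : Fin k → Plane d) (a : S d → ℝ) :
    eLpNorm (weakRot (List.ofFn w) a) (ENNReal.ofReal p) (σ d) ≤ sphereSobolevNorm s p a := by
  refine le_trans ?_ (Finset.single_le_sum (f := fun k => ∑ w : Fin k → Plane d,
    eLpNorm (weakRot (List.ofFn w) a) (ENNReal.ofReal p) (σ d)) (fun _ _ => zero_le)
    (Finset.mem_range.2 (Nat.lt_succ_iff.2 hk)))
  exact Finset.single_le_sum (f := fun w : Fin k → Plane d =>
    eLpNorm (weakRot (List.ofFn w) a) (ENNReal.ofReal p) (σ d)) (fun _ _ => zero_le)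
    (Finset.mem_univ w)

/-- Completeness of the Sobolev spaces on the sphere. -/
theorem exists_tendsto_sphereSobolevNorm (hp : 1 < p) {s : ℕ} {A : ℕ → S d → ℝ}
    (hA : ∀ i, MemSphereSobolev s p (A i))
    (hC : IsCauchyDist fun i j => sphereSobolevNorm s p (fun θ => A i θ - A j θ)) :
    ∃ a, MemSphereSobolev s p a ∧
      Tendsto (fun i => sphereSobolevNorm s p (fun θ => A i θ - a θ)) atTop (𝓝 0) := by
  have hP : 1 ≤ ENNReal.ofReal p := by simpa using hp.le
  have hpq := Real.HolderConjugate.conjExponent hp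
  have := hpq.ennrealOfReal
  have h1 : ∀ (k : ℕ) (w : Fin k → Plane d), k ≤ s → ∃ b, MemLp b (ENNReal.ofReal p) (σ d) ∧
      Tendsto (fun i => eLpNorm (fun θ => weakRot (List.ofFn w) (A i) θ - b θ)
        (ENNReal.ofReal p) (σ d)) atTop (𝓝 0) ∧
      ∀ φ : E d → ℝ, ContDiff ℝ ∞ φ → Tendsto (fun i => ∫ θ, weakRot (List.ofFn w) (A i) θ * φ θ ∂σ d)
        atTop (𝓝 (∫ θ, b θ * φ θ ∂σ d)) := by
    intro k w hk
    obtain ⟨b, hb, hlim⟩ := exists_tendsto_eLpNorm hP (fun i => (hA i k hk w).2)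
      (hC.of_le fun i j => by
        obtain ⟨⟨gi, hgi⟩, -⟩ := hA i k hk w
        obtain ⟨⟨gj, hgj⟩, -⟩ := hA j k hk w
        have h2 := weakRot_ae_eq ((weakRot_spec hgi).sub (weakRot_spec hgj))
        exact le_trans (le_of_eq (eLpNorm_congr_ae h2.symm)) (eLpNorm_weakRot_le hk w _))
    refine ⟨b, hb, hlim, fun φ hφ => ?_⟩
    have hψc : Continuous fun θ : S d => φ θ := hφ.continuous.comp continuous_subtype_val
    have hψ := hψc.memLp_of_hasCompactSupport (μ := σ d)
      (p := ENNReal.ofReal p.conjExponent) (HasCompactSupport.of_compactSpace _)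
    exact tendsto_integral_mul (fun i => (hA i k hk w).2) hb hψ hlim
  choose! b hb hlim hint using h1
  have hw : ∀ (k : ℕ) (w : Fin k → Plane d), k ≤ s →
      IsWeakRot (List.ofFn w) (b 0 Fin.elim0) (b k w) := by
    intro k w hk
    refine ⟨memLp_sphere_integrable hp.le (hb 0 _ (Nat.zero_le s)),
      memLp_sphere_integrable hp.le (hb k w hk), fun φ hφ => ?_⟩
    have t1 := hint 0 Fin.elim0 (Nat.zero_le s) _ (contDiff_rotWord hφ (List.ofFn w))
    have t2 := (hint k w hk φ hφ).const_mul ((-1) ^ (List.ofFn w).length)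
    refine tendsto_nhds_unique t1 (t2.congr fun i => ?_)
    obtain ⟨⟨gi, hgi⟩, -⟩ := hA i k hk w
    rw [← (weakRot_spec hgi).2.2 φ hφ]
    refine integral_congr_ae ?_
    filter_upwards [weakRot_ae_eq (isWeakRot_nil hgi.1)] with θ hθ
    rw [List.ofFn_zero, hθ]
  refine ⟨b 0 Fin.elim0, fun k hk w => ⟨⟨b k w, hw k w hk⟩,
    (hb k w hk).ae_eq (weakRot_ae_eq (hw k w hk)).symm⟩, ?_⟩
  have h0 : (0 : ENNReal) = ∑ k ∈ Finset.range (s + 1), ∑ _w : Fin k → Plane d, 0 := by simp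
  rw [h0]
  refine tendsto_finsetSum _ fun k hk => tendsto_finsetSum _ fun w _ => ?_
  have hks := Nat.lt_succ_iff.1 (Finset.mem_range.1 hk)
  refine (hlim k w hks).congr fun i => eLpNorm_congr_ae ?_
  obtain ⟨⟨gi, hgi⟩, -⟩ := hA i k hks w
  exact (weakRot_ae_eq ((weakRot_spec hgi).sub (hw k w hks))).symm

end AsymptoticSpaces
end

/-! ### Completeness and Banach algebra structure of expansion spaces -/

noncomputable section
namespace AsymptoticSpaces
variable {d : ℕ} {p : ℝ} {m n K : ℕ} {e : ℕ → ℝ} {χ : ℝ → ℝ} {f : E d → ℝ}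

lemma ae_eq_zero_of_weightedSobolevNorm (hp : 1 ≤ p) (hf : MemWeightedSobolev m p e f)
    (h : weightedSobolevNorm m p e f = 0) : f =ᵐ[volume] 0 := by
  have h1 : wnorm p (e 0) f = 0 :=
    le_antisymm ((wnorm_le_weightedSobolevNorm hf.locallyIntegrable).trans h.le) zero_le
  rw [wnorm, eLpNorm_eq_zero_iff hf.wMem.1 (by simp; linarith)] at h1
  filter_upwards [h1] with x hx
  exact (mul_eq_zero.1 hx).resolve_left (Real.rpow_pos_of_pos (japanese_pos x) _).ne'

variable [NeZero d]

/-- By uniqueness the norm of a difference is the sum of the norms of the differences of components,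
so coefficients and remainders are separately Cauchy and their limits form an expansion. The
coefficients below `n` are kept equal to zero. -/
lemma expansionSpace_complete (hp : 1 < p) (hχ : IsCutoff χ) (hK : (K : ℝ) ≤ e 0 + d / p)
    {U : ℕ → (E d →ₘ[volume] ℝ)} (hU : ∀ i, U i ∈ expansionSpace χ m p n K e)
    (hC : IsCauchyDist fun i j => expansionNorm χ m p K e (U i - U j)) :
    ∃ u ∈ expansionSpace χ m p n K e,
      Tendsto (fun i => expansionNorm χ m p K e (U i - u)) atTop (𝓝 0) := by
  choose a f h ha _ using fun i => exists_isExpansion_of_mem (hU i)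
  have hD : ∀ i j, expansionNorm χ m p K e (U i - U j) =
      expansionSum m p K e (fun k θ => a i k θ - a j k θ) (fun x => f i x - f j x) :=
    fun i j => ((h i).sub (h j)).norm_eq hp.le hχ hK
  simp only [hD] at hC
  obtain ⟨g, hg, hgl⟩ := exists_tendsto_weightedSobolevNorm hp (fun i => (h i).2.1)
    (hC.of_le fun i j => weightedSobolevNorm_le_expansionSum)
  have h1 : ∀ k, k ≤ K → ∃ c, MemSphereSobolev (m + 1 + K - k) p c ∧
      Tendsto (fun i => sphereSobolevNorm (m + 1 + K - k) p (fun θ => a i k θ - c θ)) atTop (𝓝 0) ∧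
      (k < n → c = fun _ => 0) := by
    intro k hk
    by_cases hkn : k < n
    · refine ⟨fun _ => 0, memSphereSobolev_fun_zero, ?_, fun _ => rfl⟩
      simp [ha _ k hkn, sphereSobolevNorm_fun_zero]
    · obtain ⟨c, hc, hcl⟩ := exists_tendsto_sphereSobolevNorm hp (fun i => (h i).1 k hk)
        (hC.of_le fun i j => sphereSobolevNorm_le_expansionSum (a := fun k θ => a i k θ - a j k θ) hk)
      exact ⟨c, hc, hcl, fun h => absurd h hkn⟩
  choose! c hc hcl hc0 using h1
  -- Beyond `K` nothing constrains the chosen limits; setting them to zero secures the vanishing for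
  -- k < n also when n exceeds K.
  set c' : ℕ → S d → ℝ := fun k => if k ≤ K then c k else fun _ => 0 with hc'
  have hcc : ∀ k ≤ K, c' k = c k := fun k hk => if_pos hk
  have hm : AEStronglyMeasurable (fun x => asympFun χ K c' x + g x) volume :=
    (aestronglyMeasurable_asympFun hχ.smooth.continuous fun k hk => by
      rw [hcc k hk]; exact (hc k hk).integrable).add hg.locallyIntegrable.aestronglyMeasurable
  have hexp : IsExpansion χ m p K e c' g (AEEqFun.mk _ hm) :=
    ⟨fun k hk => by rw [hcc k hk]; exact hc k hk, hg, AEEqFun.coeFn_mk _ hm⟩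
  refine ⟨AEEqFun.mk _ hm, ⟨c', g, hexp, fun k hk => ?_⟩, ?_⟩
  · by_cases hkK : k ≤ K
    · rw [hcc k hkK, hc0 k hkK hk]; rfl
    · simp only [hc', if_neg hkK]; rfl
  · have h2 : ∀ i, expansionNorm χ m p K e (U i - AEEqFun.mk _ hm) =
        expansionSum m p K e (fun k θ => a i k θ - c' k θ) (fun x => f i x - g x) :=
      fun i => ((h i).sub hexp).norm_eq hp.le hχ hK
    simp only [h2, expansionSum]
    rw [show (0 : ENNReal) = ∑ k ∈ Finset.range (K + 1), 0 + 0 by simp]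
    refine (tendsto_finsetSum _ fun k hk => ?_).add hgl
    have hkK := Nat.lt_succ_iff.1 (Finset.mem_range.1 hk)
    rw [hcc k hkK]
    exact hcl k hkK

theorem isBanachAlgebra_expansionSpace (hp : 1 < p) (hχ : IsCutoff χ)
    (hK : (K : ℝ) ≤ e 0 + d / p)
    (hmul : ∃ C : NNReal, ∀ u ∈ expansionSpace (d := d) χ m p n K e,
      ∀ v ∈ expansionSpace χ m p n K e, u * v ∈ expansionSpace χ m p n K e ∧
      expansionNorm χ m p K e (u * v) ≤ C * expansionNorm χ m p K e u * expansionNorm χ m p K e v) :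
    IsBanachAlgebra (expansionSpace (d := d) χ m p n K e) (expansionNorm χ m p K e) where
  zero_mem := ⟨_, _, IsExpansion.zero, fun _ _ => .rfl⟩
  add_mem := by
    rintro u ⟨a, f, h, ha⟩ v ⟨b, g, h', hb⟩
    refine ⟨_, _, h.add h', fun k hk => ?_⟩
    filter_upwards [ha k hk, hb k hk] with θ h1 h2
    simp [h1, h2]
  smul_mem := by
    rintro c u ⟨a, f, h, ha⟩
    refine ⟨_, _, h.const_mul c, fun k hk => ?_⟩
    filter_upwards [ha k hk] with θ h1
    simp [h1]
  finite := by
    rintro u ⟨a, f, h, ha⟩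
    rw [h.norm_eq hp.le hχ hK]
    exact h.sum_lt_top
  eq_zero := by
    rintro u ⟨a, f, h, ha⟩ hu
    rw [h.norm_eq hp.le hχ hK, expansionSum, add_eq_zero, Finset.sum_eq_zero_iff] at hu
    have h1 : ∀ k ≤ K, a k =ᵐ[σ d] fun _ => 0 := fun k hk =>
      ae_eq_zero_of_sphereSobolevNorm hp.le (h.1 k hk)
        (hu.1 k (Finset.mem_range.2 (Nat.lt_succ_iff.2 hk)))
    have h2 := ae_eq_zero_of_weightedSobolevNorm hp.le h.2.1 hu.2
    have h3 := h.congr (b := fun _ _ => 0) (g := fun _ => 0) h1 h2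
    refine AEEqFun.ext ?_
    filter_upwards [h3.2.2, AEEqFun.coeFn_zero (α := E d) (β := ℝ) (μ := volume)] with x hx hx0
    rw [hx, hx0, asympFun_zero, add_zero, Pi.zero_apply]
  norm_add_le := by
    rintro u ⟨a, f, h, ha⟩ v ⟨b, g, h', hb⟩
    rw [h.norm_eq hp.le hχ hK, h'.norm_eq hp.le hχ hK, (h.add h').norm_eq hp.le hχ hK]
    exact expansionSum_add_le hp.le h h'
  norm_smul := by
    rintro c u ⟨a, f, h, ha⟩
    rw [h.norm_eq hp.le hχ hK, (h.const_mul c).norm_eq hp.le hχ hK, expansionSum_const_mul h]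
  complete := fun U hU hC => expansionSpace_complete hp hχ hK hU hC
  mul_mem u hu v hv := by
    obtain ⟨C, hC⟩ := hmul
    exact (hC u hu v hv).1
  norm_mul_le := by
    obtain ⟨C, hC⟩ := hmul
    exact ⟨C, fun u hu v hv => (hC u hu v hv).2⟩

end AsymptoticSpaces
end

/-! ### Uniform bounds over data; asymptotic functions times remainders -/

noncomputable section
namespace AsymptoticSpaces
variable {d : ℕ} {p : ℝ}

section Bounds
variable {X : Type*} {P : X → Prop} {B : X → ENNReal} {m s : ℕ} {e : ℕ → ℝ}

/-- The functions `F x`, for `x` with `P x`, lie in a weighted Sobolev space, with norm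
`O(B x)`. -/
def WeightedBound (P : X → Prop) (B : X → ENNReal) (m : ℕ) (p : ℝ) (e : ℕ → ℝ)
    (F : X → E d → ℝ) : Prop :=
  ∃ C : NNReal, ∀ x, P x → MemWeightedSobolev m p e (F x) ∧ weightedSobolevNorm m p e (F x) ≤ C * B x

/-- The functions `a x`, for `x` with `P x`, lie in a Sobolev space on the sphere, with norm
`O(B x)`. -/
def SphereBound (P : X → Prop) (B : X → ENNReal) (s : ℕ) (p : ℝ) (a : X → S d → ℝ) : Prop :=
  ∃ C : NNReal, ∀ x, P x → MemSphereSobolev s p (a x) ∧ sphereSobolevNorm s p (a x) ≤ C * B x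

lemma WeightedBound.congr {F G : X → E d → ℝ} (h : WeightedBound P B m p e F)
    (hFG : ∀ x, P x → F x = G x) : WeightedBound P B m p e G := by
  obtain ⟨C, hC⟩ := h
  exact ⟨C, fun x hx => hFG x hx ▸ hC x hx⟩

lemma weightedBound_zero : WeightedBound P B m p e fun _ (_ : E d) => 0 :=
  ⟨0, fun _ _ => ⟨memWeightedSobolev_zero, by simp [weightedSobolevNorm_fun_zero]⟩⟩

lemma WeightedBound.add (hp : 1 ≤ p) {F G : X → E d → ℝ} (hF : WeightedBound P B m p e F)
    (hG : WeightedBound P B m p e G) : WeightedBound P B m p e fun x y => F x y + G x y := by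
  obtain ⟨C, hC⟩ := hF
  obtain ⟨C', hC'⟩ := hG
  refine ⟨C + C', fun x hx => ⟨(hC x hx).1.add (hC' x hx).1,
    (weightedSobolevNorm_add_le hp (hC x hx).1 (hC' x hx).1).trans ?_⟩⟩
  rw [ENNReal.coe_add, add_mul]
  exact add_le_add (hC x hx).2 (hC' x hx).2

lemma WeightedBound.sum (hp : 1 ≤ p) {ι : Type*} {t : Finset ι} {F : ι → X → E d → ℝ}
    (h : ∀ i ∈ t, WeightedBound P B m p e (F i)) :
    WeightedBound P B m p e fun x y => ∑ i ∈ t, F i x y := by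
  classical
  induction t using Finset.induction_on with
  | empty => simpa using weightedBound_zero
  | insert i t hi ih =>
    simp only [Finset.sum_insert hi]
    exact (h i (Finset.mem_insert_self i t)).add hp
      (ih fun j hj => h j (Finset.mem_insert_of_mem hj))

lemma SphereBound.congr {F G : X → S d → ℝ} (h : SphereBound P B s p F)
    (hFG : ∀ x, P x → F x = G x) : SphereBound P B s p G := by
  obtain ⟨C, hC⟩ := h
  exact ⟨C, fun x hx => hFG x hx ▸ hC x hx⟩

variable [NeZero d]

lemma sphereBound_zero : SphereBound P B s p fun _ (_ : S d) => 0 :=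
  ⟨0, fun _ _ => ⟨memSphereSobolev_fun_zero, by simp [sphereSobolevNorm_fun_zero]⟩⟩

lemma SphereBound.sum (hp : 1 ≤ p) {ι : Type*} {t : Finset ι} {F : ι → X → S d → ℝ}
    (h : ∀ i ∈ t, SphereBound P B s p (F i)) :
    SphereBound P B s p fun x y => ∑ i ∈ t, F i x y := by
  classical
  induction t using Finset.induction_on with
  | empty => simpa using sphereBound_zero
  | insert i t hi ih =>
    simp only [Finset.sum_insert hi]
    obtain ⟨C, hC⟩ := h i (Finset.mem_insert_self i t)
    obtain ⟨C', hC'⟩ := ih fun j hj => h j (Finset.mem_insert_of_mem hj)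
    refine ⟨C + C', fun x hx => ⟨(hC x hx).1.add (hC' x hx).1,
      (sphereSobolevNorm_add_le hp (hC x hx).1 (hC' x hx).1).trans ?_⟩⟩
    rw [ENNReal.coe_add, add_mul]
    exact add_le_add (hC x hx).2 (hC' x hx).2

lemma SphereBound.sym_mul_angular (hp : 1 ≤ p) {a : X → S d → ℝ} (ha : SphereBound P B m p a)
    {k : ℤ} {h : E d → ℝ} (hh : IsSym k h) (he : ∀ j ≤ m, (e j + k - j) * p + d < 0) :
    WeightedBound P B m p e fun x y => h y * angular (a x) y := by
  obtain ⟨C, hC⟩ := ha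
  obtain ⟨C', hC'⟩ := hh.exists_recNorm_le hp m e he
  refine ⟨C' * C, fun x hx => ?_⟩
  obtain ⟨h1, h2⟩ := hC x hx
  obtain ⟨h3, h4⟩ := hC' _ h1
  refine ⟨h3, (weightedSobolevNorm_le_recNorm hp h3).trans (h4.trans ?_)⟩
  rw [ENNReal.coe_mul, mul_assoc]
  gcongr

end Bounds

/-- Coefficients and remainder of an expansion. -/
abbrev Data (d : ℕ) : Type := (ℕ → S d → ℝ) × (E d → ℝ)

/-- The coefficients have the required regularity and those with index less than `n` or greater
than `K` vanish; the remainder lies in the weighted Sobolev space. -/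
structure IsData (m : ℕ) (p : ℝ) (n K : ℕ) (e : ℕ → ℝ) (A : Data d) : Prop where
  coeff : ∀ k ≤ K, MemSphereSobolev (m + 1 + K - k) p (A.1 k)
  rem : MemWeightedSobolev m p e A.2
  eq_zero_of_lt : ∀ k < n, A.1 k = fun _ => 0
  eq_zero_of_gt : ∀ k, K < k → A.1 k = fun _ => 0

/-- The norm of an expansion. -/
abbrev dataNorm (m : ℕ) (p : ℝ) (K : ℕ) (e : ℕ → ℝ) (A : Data d) : ENNReal :=
  expansionSum m p K e A.1 A.2

variable [NeZero d] {m n K n₁ n₂ K₁ K₂ K₀ : ℕ} {e e₀ e₁ e₂ : ℕ → ℝ} {χ : ℝ → ℝ}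

lemma IsCutoff.isSym {χ : ℝ → ℝ} (hχ : IsCutoff χ) (k : ℕ) :
    IsSym (-k) fun x : E d => χ ‖x‖ * (‖x‖ ^ k)⁻¹ := .radial hχ.isRadial k

/-- Products of asymptotic functions and remainders. -/
lemma exists_asympFun_mul_le (hp : 1 < p) (hm : (d : ℝ) / p < m) (hχ : IsCutoff χ)
    (hc : ∀ i j β : ℕ, j + i ≤ m → β ≤ j → e₀ (j + i) - n - j + β ≤ e₁ (i + β)) :
    ∃ C : NNReal, ∀ (A : Data d) (f : E d → ℝ), IsData m p n K e A →
      MemWeightedSobolev m p e₁ f →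
      MemWeightedSobolev m p e₀ (fun x => asympFun χ K A.1 x * f x) ∧
      weightedSobolevNorm m p e₀ (fun x => asympFun χ K A.1 x * f x) ≤
        C * (dataNorm m p K e A * weightedSobolevNorm m p e₁ f) := by
  suffices h : WeightedBound (X := Data d × (E d → ℝ))
      (fun q => IsData m p n K e q.1 ∧ MemWeightedSobolev m p e₁ q.2)
      (fun q => dataNorm m p K e q.1 * weightedSobolevNorm m p e₁ q.2) m p e₀
      (fun q x => ∑ k ∈ Finset.range (K + 1),
        (χ ‖x‖ * (‖x‖ ^ k)⁻¹ * angular (q.1.1 k) x) * q.2 x) by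
    obtain ⟨C, hC⟩ := h.congr (G := fun q x => asympFun χ K q.1.1 x * q.2 x) fun q _ => by
      ext x
      rw [asympFun, Finset.mul_sum, Finset.sum_mul]
      exact Finset.sum_congr rfl fun k _ => by ring
    exact ⟨C, fun A f hA hf => hC (A, f) ⟨hA, hf⟩⟩
  refine WeightedBound.sum hp.le fun k hk => ?_
  have hkK := Nat.lt_succ_iff.1 (Finset.mem_range.1 hk)
  -- Terms below order n vanish, so every surviving term decays at least like r^{-n}; this explains
  -- the n in `hc`.
  by_cases hkn : k < n
  · refine weightedBound_zero.congr fun q hq => ?_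
    ext x
    rw [hq.1.eq_zero_of_lt k hkn, angular_fun_zero]
    simp
  obtain ⟨C, hC⟩ := (hχ.isSym (d := d) k).exists_unifNorm_le hp.le m
  -- The scale is τ = 1 whatever the weights of the remainder, because each derivative of r^{-k}
  -- a(θ) gains a full order. With a = m, the condition on β is β ≤ m - (m - j) = j.
  obtain ⟨C', hC'⟩ := exists_recNorm_mul_le hp hm zero_le_one le_rfl m m m le_rfl le_rfl le_rfl k
    e₀ e₁ fun j i β hji hβ => by
      have hnk : (n : ℝ) ≤ k := by exact_mod_cast not_lt.1 hkn
      have := hc i j β hji (by omega)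
      simp only [one_mul]
      linarith
  refine ⟨C' * C * (d + 1) ^ m, fun q hq => ?_⟩
  have hqk : MemSphereSobolev m p (q.1.1 k) := (hq.1.coeff k hkK).mono (by omega)
  obtain ⟨h1, h2⟩ := hC _ hqk
  rw [Int.cast_neg, neg_neg, Int.cast_natCast] at h2
  obtain ⟨h3, h4⟩ := hC' _ _ h1 (h2.trans_lt (ENNReal.mul_lt_top (by simp) hqk.norm_lt_top)) hq.2
  refine ⟨h3, (weightedSobolevNorm_le_recNorm hp.le h3).trans (h4.trans ?_)⟩
  have h5 : sphereSobolevNorm m p (q.1.1 k) ≤ dataNorm m p K e q.1 :=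
    (sphereSobolevNorm_mono (by omega)).trans (sphereSobolevNorm_le_expansionSum hkK)
  calc _ ≤ (C' : ENNReal) * ((C * dataNorm m p K e q.1) *
        ((d + 1) ^ m * weightedSobolevNorm m p e₁ q.2)) := by
        gcongr
        · exact h2.trans (by gcongr)
        · exact recNorm_le_weightedSobolevNorm hp.le hq.2
    _ = _ := by push_cast; ring

end AsymptoticSpaces
end

/-! ### Products of expansions -/

noncomputable section
namespace AsymptoticSpaces
variable {d : ℕ} {p : ℝ} {m : ℕ} {e₀ e₁ e₂ : ℕ → ℝ}

/-- Products of remainders. -/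
lemma exists_weightedSobolevNorm_mul_le (hp : 1 < p) (hm : (d : ℝ) / p < m) {τ s : ℝ} (h0 : 0 ≤ τ)
    (h1 : τ ≤ 1) (he₁ : ∀ β ≤ m, s + τ * β - τ * (d / p) ≤ e₁ β)
    (he₂ : ∀ i j β : ℕ, j + i ≤ m → β ≤ j → e₀ (j + i) - (s + τ * j) + τ * β ≤ e₂ (i + β)) :
    ∃ C : NNReal, ∀ f g : E d → ℝ, MemWeightedSobolev m p e₁ f → MemWeightedSobolev m p e₂ g →
      MemWeightedSobolev m p e₀ (fun x => f x * g x) ∧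
      weightedSobolevNorm m p e₀ (fun x => f x * g x) ≤
        C * (weightedSobolevNorm m p e₁ f * weightedSobolevNorm m p e₂ g) := by
  obtain ⟨C, hC⟩ := exists_unifNorm_le d hp.le h1 m s e₁ he₁
  obtain ⟨C', hC'⟩ := exists_recNorm_mul_le hp hm h0 h1 m m m le_rfl le_rfl le_rfl s e₀ e₂
    fun j i β hji hβ => he₂ i j β hji (by omega)
  refine ⟨C' * C * (d + 1) ^ m * (d + 1) ^ m, fun f g hf hg => ?_⟩
  have h2 := hC f hf
  obtain ⟨h3, h4⟩ := hC' f g (hf.locSobolev hp.le)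
    (h2.trans_lt (ENNReal.mul_lt_top (by simp) (hf.recNorm_lt_top hp.le))) hg
  refine ⟨h3, (weightedSobolevNorm_le_recNorm hp.le h3).trans (h4.trans ?_)⟩
  calc _ ≤ (C' : ENNReal) * ((C * ((d + 1) ^ m * weightedSobolevNorm m p e₁ f)) *
        ((d + 1) ^ m * weightedSobolevNorm m p e₂ g)) := by
        gcongr
        · refine h2.trans ?_
          gcongr
          exact recNorm_le_weightedSobolevNorm hp.le hf
        · exact recNorm_le_weightedSobolevNorm hp.le hg
    _ = _ := by push_cast; ring

/-- The vanishing beyond `K` and `L` lets the Cauchy product run over full antidiagonals. -/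
lemma sum_range_mul_sum_range {α β : ℕ → ℝ} {K L : ℕ} (hα : ∀ k, K < k → α k = 0)
    (hβ : ∀ l, L < l → β l = 0) :
    (∑ k ∈ Finset.range (K + 1), α k) * ∑ l ∈ Finset.range (L + 1), β l =
      ∑ s ∈ Finset.range (K + L + 1), ∑ q ∈ Finset.HasAntidiagonal.antidiagonal s, α q.1 * β q.2 := by
  rw [Finset.sum_mul_sum, ← Finset.sum_product',
    ← Finset.sum_fiberwise_of_maps_to (g := fun q : ℕ × ℕ => q.1 + q.2)
      (t := Finset.range (K + L + 1)) fun q hq => by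
        simp only [Finset.mem_product, Finset.mem_range] at hq ⊢; omega]
  refine Finset.sum_congr rfl fun s _ => Finset.sum_subset (fun q hq => ?_) fun q hq hq' => ?_
  · simp only [Finset.mem_filter] at hq
    exact Finset.HasAntidiagonal.mem_antidiagonal.2 hq.2
  · rw [Finset.HasAntidiagonal.mem_antidiagonal] at hq
    simp only [Finset.mem_filter, Finset.mem_product, Finset.mem_range, not_and] at hq'
    by_cases h1 : q.1 < K + 1
    · have h2 : L < q.2 := by
        by_contra h2
        exact hq' ⟨h1, by omega⟩ hq
      rw [hβ _ h2, mul_zero]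
    · rw [hα _ (by omega), zero_mul]

/-- The coefficients of a product of expansions. -/
def mulCoeff (a b : ℕ → S d → ℝ) (s : ℕ) (θ : S d) : ℝ :=
  ∑ q ∈ Finset.HasAntidiagonal.antidiagonal s, a q.1 θ * b q.2 θ

lemma angular_mulCoeff (a b : ℕ → S d → ℝ) (s : ℕ) (x : E d) :
    angular (mulCoeff a b s) x = ∑ q ∈ Finset.HasAntidiagonal.antidiagonal s, angular (a q.1) x * angular (b q.2) x := by
  simp only [← angular_mul]
  exact angular_sum _ _ _

/-- The terms of a product of asymptotic functions which do not belong to the asymptotic function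
of the product. -/
def mulTail (χ : ℝ → ℝ) (K₀ M : ℕ) (c : ℕ → S d → ℝ) (x : E d) : ℝ :=
  ∑ s ∈ Finset.range (K₀ + 1), (χ ‖x‖ * χ ‖x‖ - χ ‖x‖) * (‖x‖ ^ s)⁻¹ * angular (c s) x +
    ∑ s ∈ Finset.Ico (K₀ + 1) (M + 1), χ ‖x‖ * χ ‖x‖ * (‖x‖ ^ s)⁻¹ * angular (c s) x

lemma asympFun_mul_asympFun {χ : ℝ → ℝ} {a b : ℕ → S d → ℝ} {K₀ K₁ K₂ : ℕ} (hK : K₀ ≤ K₁ + K₂)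
    (ha : ∀ k, K₁ < k → a k = fun _ => 0) (hb : ∀ k, K₂ < k → b k = fun _ => 0) (x : E d) :
    asympFun χ K₁ a x * asympFun χ K₂ b x =
      asympFun χ K₀ (mulCoeff a b) x + mulTail χ K₀ (K₁ + K₂) (mulCoeff a b) x := by
  have h1 := sum_range_mul_sum_range (α := fun k => angular (a k) x / ‖x‖ ^ k)
    (β := fun k => angular (b k) x / ‖x‖ ^ k) (K := K₁) (L := K₂)
    (fun k hk => by simp [ha k hk, angular_fun_zero])
    (fun k hk => by simp [hb k hk, angular_fun_zero])
  have h2 : ∀ s, ∑ q ∈ Finset.HasAntidiagonal.antidiagonal s, angular (a q.1) x / ‖x‖ ^ q.1 *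
      (angular (b q.2) x / ‖x‖ ^ q.2) = angular (mulCoeff a b s) x / ‖x‖ ^ s := by
    intro s
    rw [angular_mulCoeff, Finset.sum_div]
    refine Finset.sum_congr rfl fun q hq => ?_
    rw [← Finset.HasAntidiagonal.mem_antidiagonal.1 hq, pow_add, div_mul_div_comm]
  simp only [h2] at h1
  rw [← Finset.sum_range_add_sum_Ico _ (show K₀ + 1 ≤ K₁ + K₂ + 1 by omega)] at h1
  have h3 : asympFun χ K₁ a x * asympFun χ K₂ b x = χ ‖x‖ * χ ‖x‖ *
      ((∑ k ∈ Finset.range (K₁ + 1), angular (a k) x / ‖x‖ ^ k) *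
        ∑ k ∈ Finset.range (K₂ + 1), angular (b k) x / ‖x‖ ^ k) := by
    rw [asympFun, asympFun]; ring
  rw [h3, h1, asympFun, mulTail, mul_add, ← add_assoc]
  congr 1
  · rw [Finset.mul_sum, Finset.mul_sum, ← Finset.sum_add_distrib]
    exact Finset.sum_congr rfl fun s _ => by ring
  · rw [Finset.mul_sum]
    exact Finset.sum_congr rfl fun s _ => by ring

variable [NeZero d]

/-- Outside the index ranges one of the coefficients is zero, so the regularity count `ht` is
demanded only inside them. -/
lemma sphereBound_mul (hp : 1 < p) (hm : (d : ℝ) / p < m) {n₁ n₂ K₁ K₂ t : ℕ} {k l : ℕ}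
    (ht : n₁ ≤ k → k ≤ K₁ → n₂ ≤ l → l ≤ K₂ →
      t ≤ m + 1 + K₁ - k ∧ t ≤ m + 1 + K₂ - l ∧ m + t ≤ (m + 1 + K₁ - k) + (m + 1 + K₂ - l)) :
    SphereBound (X := Data d × Data d)
      (fun q => IsData m p n₁ K₁ e₁ q.1 ∧ IsData m p n₂ K₂ e₂ q.2)
      (fun q => dataNorm m p K₁ e₁ q.1 * dataNorm m p K₂ e₂ q.2) t p
      (fun q θ => q.1.1 k θ * q.2.1 l θ) := by
  by_cases h : (n₁ ≤ k ∧ k ≤ K₁) ∧ n₂ ≤ l ∧ l ≤ K₂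
  · obtain ⟨⟨h1, h2⟩, h3, h4⟩ := h
    obtain ⟨ht1, ht2, ht3⟩ := ht h1 h2 h3 h4
    obtain ⟨C, hC⟩ := exists_sphereSobolevNorm_mul_le hp hm t _ _ ht1 ht2 ht3
    refine ⟨C, fun q hq => ?_⟩
    obtain ⟨h5, h6⟩ := hC _ _ (hq.1.coeff k h2) (hq.2.coeff l h4)
    refine ⟨h5, h6.trans ?_⟩
    exact mul_le_mul_right (mul_le_mul' (sphereSobolevNorm_le_expansionSum h2)
      (sphereSobolevNorm_le_expansionSum h4)) _
  · refine sphereBound_zero.congr fun q hq => ?_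
    ext θ
    by_cases h1 : n₁ ≤ k ∧ k ≤ K₁
    · have h2 : l < n₂ ∨ K₂ < l := by
        by_contra h3
        exact h ⟨h1, by omega⟩
      have h3 : q.2.1 l = fun _ => 0 :=
        h2.elim (hq.2.eq_zero_of_lt l) (hq.2.eq_zero_of_gt l)
      simp [h3]
    · have h3 : q.1.1 k = fun _ => 0 := by
        rcases lt_or_ge k n₁ with h4 | h4
        · exact hq.1.eq_zero_of_lt k h4
        · exact hq.1.eq_zero_of_gt k (by omega)
      simp [h3]

/-- The profile χ² - χ vanishes outside 1 < r < 2, so its terms may be written with any decay, here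
r^{-K₀-1}; the other terms start at that order anyway. By `hfar` this decay puts them in the
remainder space. -/
lemma weightedBound_mulTail (hp : 1 < p) {χ : ℝ → ℝ} (hχ : IsCutoff χ) {K₀ M : ℕ}
    (hfar : ∀ j ≤ m, e₀ j - j + d / p < K₀ + 1) {X : Type*} {P : X → Prop} {B : X → ENNReal}
    {c : X → ℕ → S d → ℝ} (hc : ∀ s, SphereBound P B m p fun x => c x s) :
    WeightedBound P B m p e₀ fun x => mulTail χ K₀ M (c x) := by
  have he : ∀ k : ℕ, K₀ + 1 ≤ k → ∀ j ≤ m, (e₀ j + ((-k : ℤ) : ℝ) - j) * p + d < 0 := by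
    intro k hk j hj
    have h1 := hfar j hj
    have hk' : (K₀ : ℝ) + 1 ≤ k := by exact_mod_cast hk
    have h2 : (e₀ j + ((-k : ℤ) : ℝ) - j) * p + d = (e₀ j - j + d / p - k) * p := by
      push_cast
      field_simp
      ring
    rw [h2]
    exact mul_neg_of_neg_of_pos (by linarith) (by linarith)
  refine WeightedBound.add hp.le (WeightedBound.sum hp.le fun s hs => ?_)
    (WeightedBound.sum hp.le fun s hs => ?_)
  · have hs' := Nat.lt_succ_iff.1 (Finset.mem_range.1 hs)
    have hr : IsRadial fun t => (χ t * χ t - χ t) * t ^ (K₀ + 1 - s) := by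
      refine ⟨((hχ.smooth.mul hχ.smooth).sub hχ.smooth).mul (contDiff_id.pow _), fun t ht => ?_,
        2, 0, fun t ht => ?_⟩
      · simp [hχ.eq_zero t ht]
      · simp [hχ.eq_one t ht]
    refine ((hc s).sym_mul_angular hp.le (IsSym.radial hr (K₀ + 1)) (he _ le_rfl)).congr
      fun x _ => ?_
    ext y
    congr 1
    by_cases hy : y = 0
    · simp [hy, hχ.eq_zero 0 zero_le_one]
    · have hy' : ‖y‖ ≠ 0 := norm_ne_zero_iff.2 hy
      have h3 : ‖y‖ ^ (K₀ + 1) = ‖y‖ ^ (K₀ + 1 - s) * ‖y‖ ^ s := by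
        rw [← pow_add]; congr 1; omega
      rw [h3]
      field_simp
  · exact (hc s).sym_mul_angular hp.le
      (IsSym.radial (hχ.isRadial.mul hχ.isRadial) s) (he _ (Finset.mem_Ico.1 hs).1)

/-- Products of expansions. -/
theorem exists_expansion_mul_le (hp : 1 < p) (hm : (d : ℝ) / p < m) {χ : ℝ → ℝ} (hχ : IsCutoff χ)
    {n₁ n₂ n K₀ K₁ K₂ : ℕ} (hn : n ≤ n₁ + n₂) (hK1 : K₀ ≤ K₁ + n₂) (hK2 : K₀ ≤ K₂ + n₁)
    (hn2 : n₂ ≤ K₂) (hU₁ : (K₁ : ℝ) ≤ e₁ 0 + d / p) (hU₂ : (K₂ : ℝ) ≤ e₂ 0 + d / p)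
    (hU₀ : (K₀ : ℝ) ≤ e₀ 0 + d / p)
    (hfar : ∀ j ≤ m, e₀ j - j + d / p < K₀ + 1)
    (hc₁ : ∀ i j β : ℕ, j + i ≤ m → β ≤ j → e₀ (j + i) - n₂ - j + β ≤ e₁ (i + β))
    (hc₂ : ∀ i j β : ℕ, j + i ≤ m → β ≤ j → e₀ (j + i) - n₁ - j + β ≤ e₂ (i + β))
    {τ s : ℝ} (h0 : 0 ≤ τ) (h1 : τ ≤ 1) (he₁ : ∀ β ≤ m, s + τ * β - τ * (d / p) ≤ e₁ β)
    (he₂ : ∀ i j β : ℕ, j + i ≤ m → β ≤ j → e₀ (j + i) - (s + τ * j) + τ * β ≤ e₂ (i + β)) :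
    ∃ C : NNReal, ∀ u ∈ expansionSpace (d := d) χ m p n₁ K₁ e₁,
      ∀ v ∈ expansionSpace χ m p n₂ K₂ e₂, u * v ∈ expansionSpace χ m p n K₀ e₀ ∧
      expansionNorm χ m p K₀ e₀ (u * v) ≤
        C * expansionNorm χ m p K₁ e₁ u * expansionNorm χ m p K₂ e₂ v := by
  set P : Data d × Data d → Prop := fun q => IsData m p n₁ K₁ e₁ q.1 ∧ IsData m p n₂ K₂ e₂ q.2
    with hP
  set B : Data d × Data d → ENNReal := fun q => dataNorm m p K₁ e₁ q.1 * dataNorm m p K₂ e₂ q.2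
    with hB
  -- For indices i + l = k with l ≥ n₂, the bound K₀ ≤ K₁ + n₂ gives K₀ - k ≤ K₁ - i, so the first
  -- factor is regular enough; the second is treated symmetrically. The surplus m in the sum of the
  -- regularities comes from the orders m + 1 of both factors.
  have hcoef : ∀ k, SphereBound P B (m + 1 + K₀ - k) p fun q => mulCoeff q.1.1 q.2.1 k :=
    fun k => SphereBound.sum hp.le fun q hq => sphereBound_mul hp hm fun _ _ _ _ => by
      have := Finset.HasAntidiagonal.mem_antidiagonal.1 hq
      omega
  -- For the tail, regularity m is available at every order, also beyond K₀.
  have hcoef' : ∀ k, SphereBound P B m p fun q => mulCoeff q.1.1 q.2.1 k :=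
    fun k => SphereBound.sum hp.le fun q hq => sphereBound_mul hp hm fun _ _ _ _ => by omega
  have hrem : WeightedBound P B m p e₀ fun q x =>
      mulTail χ K₀ (K₁ + K₂) (mulCoeff q.1.1 q.2.1) x + asympFun χ K₂ q.2.1 x * q.1.2 x +
        asympFun χ K₁ q.1.1 x * q.2.2 x + q.1.2 x * q.2.2 x := by
    refine (((weightedBound_mulTail hp hχ hfar hcoef').add hp.le ?_).add hp.le ?_).add hp.le ?_
    · obtain ⟨C, hC⟩ := exists_asympFun_mul_le (n := n₂) (K := K₂) (e := e₂) hp hm hχ hc₁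
      refine ⟨C, fun q hq => ?_⟩
      obtain ⟨h2, h3⟩ := hC q.2 q.1.2 hq.2 hq.1.rem
      refine ⟨h2, h3.trans (mul_le_mul_right ?_ _)⟩
      rw [hB, mul_comm]
      exact mul_le_mul_left weightedSobolevNorm_le_expansionSum _
    · obtain ⟨C, hC⟩ := exists_asympFun_mul_le (n := n₁) (K := K₁) (e := e₁) hp hm hχ hc₂
      refine ⟨C, fun q hq => ?_⟩
      obtain ⟨h2, h3⟩ := hC q.1 q.2.2 hq.1 hq.2.rem
      refine ⟨h2, h3.trans (mul_le_mul_right ?_ _)⟩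
      exact mul_le_mul_right weightedSobolevNorm_le_expansionSum _
    · obtain ⟨C, hC⟩ := exists_weightedSobolevNorm_mul_le hp hm h0 h1 he₁ he₂
      refine ⟨C, fun q hq => ?_⟩
      obtain ⟨h2, h3⟩ := hC q.1.2 q.2.2 hq.1.rem hq.2.rem
      refine ⟨h2, h3.trans (mul_le_mul_right ?_ _)⟩
      exact mul_le_mul' weightedSobolevNorm_le_expansionSum weightedSobolevNorm_le_expansionSum
  choose C hC using hcoef
  obtain ⟨C', hC'⟩ := hrem
  refine ⟨∑ k ∈ Finset.range (K₀ + 1), C k + C', fun u hu v hv => ?_⟩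
  obtain ⟨a, f, ha, ha1, ha2⟩ := exists_isExpansion_of_mem hu
  obtain ⟨b, g, hb, hb1, hb2⟩ := exists_isExpansion_of_mem hv
  have hq : P ((a, f), (b, g)) :=
    ⟨⟨ha.1, ha.2.1, ha1, ha2⟩, ⟨hb.1, hb.2.1, hb1, hb2⟩⟩
  obtain ⟨hr1, hr2⟩ := hC' _ hq
  have hexp : IsExpansion χ m p K₀ e₀ (mulCoeff a b) _ (u * v) :=
    ⟨fun k _ => (hC k _ hq).1, hr1, by
      filter_upwards [AEEqFun.coeFn_mul u v, ha.2.2, hb.2.2] with x hx hxu hxv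
      rw [hx, Pi.mul_apply, hxu, hxv]
      linear_combination asympFun_mul_asympFun (χ := χ) (show K₀ ≤ K₁ + K₂ by omega) ha2 hb2 x⟩
  refine ⟨⟨_, _, hexp, fun k hk => ?_⟩, ?_⟩
  · refine .of_forall fun θ => Finset.sum_eq_zero fun q hq => ?_
    have hqk := Finset.HasAntidiagonal.mem_antidiagonal.1 hq
    -- Since the two indices add up to less than n₁ + n₂, one of them lies below its threshold.
    by_cases h2 : q.1 < n₁
    · simp [ha1 _ h2]
    · simp [hb1 q.2 (by omega)]
  · rw [hexp.norm_eq hp.le hχ hU₀, ha.norm_eq hp.le hχ hU₁, hb.norm_eq hp.le hχ hU₂, expansionSum,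
      mul_assoc, ENNReal.coe_add, add_mul, ENNReal.ofNNReal_finsetSum, Finset.sum_mul]
    exact add_le_add (Finset.sum_le_sum fun k _ => (hC k _ hq).2) hr2

end AsymptoticSpaces
end

/-! ### Weights for the two families of spaces, and the theorem -/

noncomputable section
namespace AsymptoticSpaces
variable {d : ℕ} {p : ℝ}

lemma Nstar_le (hp : 0 < p) (N : ℕ) : (Nstar d p N : ℝ) ≤ N + d / p :=
  Nat.floor_le (by positivity)

lemma lt_Nstar_add_one (N : ℕ) : (N : ℝ) + d / p < Nstar d p N + 1 := Nat.lt_floor_add_one _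

/-- Together with `Nstar_mono` this carries the relation N ≤ N₁ + n₂ over to the numbers N*. -/
lemma Nstar_add (hp : 0 < p) (N n : ℕ) : Nstar d p (N + n) = Nstar d p N + n := by
  rw [Nstar, Nstar, ← Nat.floor_add_natCast (by positivity)]
  congr 1
  push_cast
  ring

lemma Nstar_mono {N M : ℕ} (h : N ≤ M) : Nstar d p N ≤ Nstar d p M :=
  Nat.floor_mono (by have : (N : ℝ) ≤ M := by exact_mod_cast h
                     linarith)

lemma le_Nstar (hp : 0 < p) (N : ℕ) : N ≤ Nstar d p N :=
  Nat.le_floor (by have : 0 ≤ (d : ℝ) / p := by positivity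
                   linarith)

variable [NeZero d] {m n n₁ n₂ N N₁ N₂ : ℕ} {χ : ℝ → ℝ}

/-- Products in the spaces `𝔸`. -/
theorem exists_bbANorm_mul_le (hp : 1 < p) (hm : (d : ℝ) / p < m) (hχ : IsCutoff χ)
    (hn : n ≤ n₁ + n₂) (hn₂ : n₂ ≤ N₂) (h₁ : N ≤ N₁ + n₂) (h₂ : N ≤ N₂ + n₁) :
    ∃ C : NNReal, ∀ u ∈ bbA d χ m p n₁ N₁, ∀ v ∈ bbA d χ m p n₂ N₂, u * v ∈ bbA d χ m p n N ∧
      bbANorm d χ m p N (u * v) ≤ C * bbANorm d χ m p N₁ u * bbANorm d χ m p N₂ v := by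
  have hp0 : 0 < p := by linarith
  have h₁' : (N : ℝ) ≤ N₁ + n₂ := by exact_mod_cast h₁
  have h₂' : (N : ℝ) ≤ N₂ + n₁ := by exact_mod_cast h₂
  have hn₂' : (n₂ : ℝ) ≤ N₂ := by exact_mod_cast hn₂
  refine exists_expansion_mul_le hp hm hχ hn
    ((Nstar_mono h₁).trans (Nstar_add hp0 _ _).le) ((Nstar_mono h₂).trans (Nstar_add hp0 _ _).le)
    (hn₂.trans (le_Nstar hp0 _)) (Nstar_le hp0 _) (Nstar_le hp0 _) (Nstar_le hp0 _)
    (fun j _ => ?_) (fun i j β _ hβ => ?_) (fun i j β _ hβ => ?_)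
    -- Balls of fixed size suit weights that ignore the order of the derivative: the first remainder
    -- has uniform decay N₁. The product of remainders then needs N ≤ N₁ + N₂, which follows from n₂
    -- ≤ N₂.
    (τ := 0) (s := N₁) le_rfl zero_le_one (fun β _ => ?_) (fun i j β _ hβ => ?_)
  · have := lt_Nstar_add_one (d := d) (p := p) N
    have hj : (0 : ℝ) ≤ j := Nat.cast_nonneg j
    simp only [expH]
    linarith
  · have hβ' : (β : ℝ) ≤ j := by exact_mod_cast hβ
    simp only [expH]
    linarith
  · have hβ' : (β : ℝ) ≤ j := by exact_mod_cast hβ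
    simp only [expH]
    linarith
  · simp [expH]
  · simp only [expH, zero_mul]
    linarith

/-- Products in the spaces `𝒜`. -/
theorem exists_calANorm_mul_le (hp : 1 < p) (hm : (d : ℝ) / p < m) (hχ : IsCutoff χ) {γ₀ : ℝ}
    (hγ₀ : 0 < γ₀ + d / p) (hγ₁ : γ₀ + d / p < 1)
    (hn : n ≤ n₁ + n₂) (hn₂ : n₂ ≤ N₂) (h₁ : N ≤ N₁ + n₂) (h₂ : N ≤ N₂ + n₁) :
    ∃ C : NNReal, ∀ u ∈ calA d χ γ₀ m p n₁ N₁, ∀ v ∈ calA d χ γ₀ m p n₂ N₂,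
      u * v ∈ calA d χ γ₀ m p n N ∧
      calANorm d χ γ₀ m p N (u * v) ≤ C * calANorm d χ γ₀ m p N₁ u * calANorm d χ γ₀ m p N₂ v := by
  have h₁' : (N : ℝ) ≤ N₁ + n₂ := by exact_mod_cast h₁
  have h₂' : (N : ℝ) ≤ N₂ + n₁ := by exact_mod_cast h₂
  have hn₂' : (n₂ : ℝ) ≤ N₂ := by exact_mod_cast hn₂
  have hU : ∀ M : ℕ, (M : ℝ) ≤ expW (M + γ₀) 0 + d / p := fun M => by
    simp only [expW, Nat.cast_zero]
    linarith
  refine exists_expansion_mul_le hp hm hχ hn h₁ h₂ hn₂ (hU _) (hU _) (hU _)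
    (fun j _ => ?_) (fun i j β _ hβ => ?_) (fun i j β _ hβ => ?_)
    -- At scale ⟨x⟩ the first remainder decays uniformly with exponent N₁ + γ₀ + d/p, the largest
    -- value that `exists_unifNorm_le` permits. The product of remainders then needs N ≤ N₁ + N₂ +
    -- γ₀ + d/p, where positivity of γ₀ + d/p enters; that it is below 1 is used for the tail.
    (τ := 1) (s := N₁ + γ₀ + d / p) zero_le_one le_rfl (fun β _ => ?_) (fun i j β _ hβ => ?_)
  all_goals
    simp only [expW]
    push_cast
    linarith

end AsymptoticSpaces
end

theorem proposition2p4 (d : ℕ) (hd : 1 ≤ d) (p : ℝ) (hp : 1 < p) (m : ℕ) (hm : (d : ℝ) / p < m)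
    (χ : ℝ → ℝ) (hχ : IsCutoff χ)
    (γ₀ : ℝ) (hγ₀ : 0 < γ₀ + d / p) (hγ₁ : γ₀ + d / p < 1) :
    (∀ n₁ N₁ n₂ N₂ : ℕ, n₁ ≤ N₁ → n₂ ≤ N₂ →
      (∃ C : NNReal, ∀ u ∈ bbA d χ m p n₁ N₁, ∀ v ∈ bbA d χ m p n₂ N₂,
        u * v ∈ bbA d χ m p (n₁ + n₂) (min (N₁ + n₂) (N₂ + n₁)) ∧
        bbANorm d χ m p (min (N₁ + n₂) (N₂ + n₁)) (u * v) ≤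
          C * bbANorm d χ m p N₁ u * bbANorm d χ m p N₂ v) ∧
      (∃ C : NNReal, ∀ u ∈ calA d χ γ₀ m p n₁ N₁, ∀ v ∈ calA d χ γ₀ m p n₂ N₂,
        u * v ∈ calA d χ γ₀ m p (n₁ + n₂) (min (N₁ + n₂) (N₂ + n₁)) ∧
        calANorm d χ γ₀ m p (min (N₁ + n₂) (N₂ + n₁)) (u * v) ≤
          C * calANorm d χ γ₀ m p N₁ u * calANorm d χ γ₀ m p N₂ v)) ∧
    (∀ n N : ℕ, n ≤ N →
      IsBanachAlgebra (bbA d χ m p n N) (bbANorm d χ m p N) ∧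
      IsBanachAlgebra (calA d χ γ₀ m p n N) (calANorm d χ γ₀ m p N)) := by
  have : NeZero d := ⟨by omega⟩
  have hp0 : 0 < p := by linarith
  refine ⟨fun n₁ N₁ n₂ N₂ h₁ h₂ => ⟨?_, ?_⟩, fun n N h => ⟨?_, ?_⟩⟩
  · exact exists_bbANorm_mul_le hp hm hχ le_rfl h₂ (min_le_left _ _) (min_le_right _ _)
  · exact exists_calANorm_mul_le hp hm hχ hγ₀ hγ₁ le_rfl h₂ (min_le_left _ _) (min_le_right _ _)
  -- Closure under products is the case of equal indices; the multiplication lemma allows any target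
  -- with n ≤ n₁ + n₂ and N at most the minimum, so the target can again be (n, N).
  · exact isBanachAlgebra_expansionSpace hp hχ (Nstar_le hp0 N) (exists_bbANorm_mul_le hp hm hχ
      (Nat.le_add_left n n) h (Nat.le_add_right N n) (Nat.le_add_right N n))
  · refine isBanachAlgebra_expansionSpace hp hχ ?_ (exists_calANorm_mul_le hp hm hχ hγ₀ hγ₁
      (Nat.le_add_left n n) h (Nat.le_add_right N n) (Nat.le_add_right N n))
    simp only [expW, Nat.cast_zero]
    linarith
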